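/- **Conventions.** A *local circle action* (effective, topological) on a space $X$ is a decomposition of $X$ into disjoint simple closed curves, possibly degenerated to points (the *fibers*), such that each fiber has a connected open neighborhood which is a union of fibers and carries a continuous effective action of $S^1$ whose orbits are exactly the fibers contained in it. Two such spaces are *equivalent* if there is a homeomorphism between them that maps fibers onto fibers. **Generalized solid tori and Klein bottles.** In $\mathbb R^3$ let $A(t)=\{x^2+y^2-z^2=t^2,\ |z|\le 1\}$ and $B(t)=\{x^2+y^2-z^2=-t^2,\ x^2+y^2\le 1\}$. Let $D(t)=A(t)/\{\pm1\}$ for $0<t\le 1$ (a Möbius band) and $D(t)=B(t)/\{\pm1\}$ for $-1\le t\le 0$ (a disk), with boundary circle $\partial D(t)$ (given by $|z|=1$, respectively $x^2+y^2=1$). The union $K=\bigcup_{t\in[-1,1]}D(t)$ (a subspace of $\mathbb R^3/\{\pm1\}$) is a closed cone over $\mathbb RP^2$. For $N\ge 1$ take $2N$ copies $K_0,\dots,K_{2N-1}$ of $K$ in cyclic order and glue each one to the next by an arbitrary homeomorphism of their ends $D(1)$ (from $K_j$ to $K_{j+1}$ with $j$ even) or of their ends $D(-1)$ ($j$ odd,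 indices mod $2N$). Let $Y$ be the resulting space and $\partial Y$ the union of all the circles $\partial D(t)$. A space homeomorphic to such a $Y$ is a *generalized solid torus of type $N$* if $\partial Y$ is a torus, and a *generalized solid Klein bottle of type $N$* if $\partial Y$ is a Klein bottle. The generalized solid tori of type $0$ are $D^2\times S^1$ and $\mathrm{Mo}\times S^1$; the generalized solid Klein bottles of type $0$ are the non-trivial bundles $D^2\tilde\times S^1$ and $\mathrm{Mo}\tilde\times S^1$, i.e. the mapping tori of complex conjugation on $D^2$ and of the reflection $[t,z]\mapsto[t,\bar z]$ on $\mathrm{Mo}=([-1,1]\times S^1)/(t,z)\sim(-t,-z)$. **SF-blocks.** Let $S^1$ act on $\mathbb RP^2=S^2/\{\pm1\}$ by rotations, $z[w,s]=[zw,s]$ ($S^2\subset\mathbb C\times\mathbb R$), and on $\mathrm{Susp}(\mathbb RP^2)$ by suspension. An *equivariant connected sum* of two spaces with (local) circle actions is formed by choosing in each an invariant open set that is equivalent to $\mathbb C\times\mathbb R$ with the rotations $z(w,s)=(zw,s)$, removing the open unit balls, and identifying the two boundary spheres; it carries the induced decomposition, respectively action. Let $R_k$, $k\ge1$, be an equivariant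 connected sum of $k$ copies of $\mathrm{Susp}(\mathbb RP^2)$. A *simple SF-block* is $R_k$ minus the interior of an invariant solid torus $D^2\times S^1$, on which $S^1$ acts freely by translations of the second factor, fibered by the orbits. The *twisted F-block* is the solid Klein bottle $D^2\tilde\times S^1$ fibered by the concentric circles in the disks (the centers being one-point fibers). A *twisted SF-block* is an equivariant connected sum of the twisted F-block and $R_k$. **Lemma 6.1.** Let $N\ge 0$ and let $Y$ be a generalized solid torus or a generalized solid Klein bottle of type $N$. Then $Y$ admits an effective topological local circle action such that the following hold. 1. If $Y$ is a generalized solid torus and $N>0$, then $Y$ with this local circle action is equivalent to a simple SF-block (one obtained from $R_N$). 2. If $Y$ is a generalized solid Klein bottle and $N>0$, then $Y$ with this local circle action is equivalent to a twisted SF-block (one obtained from $R_N$). -/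

import Mathlib

open Topology

noncomputable section

/-! ### Decompositions into fibers, local circle actions, equivalence -/

/-- Two decompositions (of `X` and of `Z`, recorded as setoids whose classes are the fibers) are
equivalent: there is a homeomorphism which maps fibers onto fibers. -/
def FiberEquivalent {X Z : Type*} [TopologicalSpace X] [TopologicalSpace Z]
    (r : Setoid X) (s : Setoid Z) : Prop :=
  ∃ h : X ≃ₜ Z, ∀ x y : X, r x y ↔ s (h x) (h y)

/-- `r` is the decomposition of `X` into the fibers of an effective topological local circle
action: each point (hence each fiber) lies in a connected open set `V` which is a union of fibers
and which carries a continuous effective circle action whose orbits are the fibers in `V`.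
(The fibers are then points or simple closed curves, and inside `V` each of them has a tube, by the
slice theorem for compact Lie groups.) -/
def IsLocalCircleAction {X : Type*} [TopologicalSpace X] (r : Setoid X) : Prop :=
  ∀ x : X, ∃ V : Set X, x ∈ V ∧ IsOpen V ∧ IsConnected V ∧ (∀ v ∈ V, ∀ y, r v y → y ∈ V) ∧
    ∃ _ : MulAction Circle V, ContinuousSMul Circle V ∧ FaithfulSMul Circle V ∧
      ∀ v w : V, r v w ↔ w ∈ MulAction.orbit Circle v

/-! ### Basic spaces

`ℝ³` is identified with `ℂ × ℝ`. -/

/-- Rotation of `ℂ × ℝ = ℝ³` about the axis `{0} × ℝ`. -/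
def rot (z : Circle) (p : ℂ × ℝ) : ℂ × ℝ := ((z : ℂ) * p.1, p.2)

lemma rot_one (p : ℂ × ℝ) : rot 1 p = p := by simp [rot]

lemma rot_mul (z w : Circle) (p : ℂ × ℝ) : rot (z * w) p = rot z (rot w p) := by
  simp [rot, mul_assoc]

lemma rot_neg (z : Circle) (p : ℂ × ℝ) : rot z (-p) = -rot z p := by simp [rot]

/-- The relation "equal or antipodal" on a subset of `ℝ³`. -/
def antipodal (S : Set (ℂ × ℝ)) : Setoid S where
  r p q := (q : ℂ × ℝ) = p ∨ (q : ℂ × ℝ) = -p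
  iseqv :=
    { refl := fun _ => Or.inl rfl
      symm := by
        rintro p q (h | h)
        · exact Or.inl h.symm
        · exact Or.inr (by rw [h, neg_neg])
      trans := by
        rintro p q s (h | h) (h' | h') <;> simp [h, h'] }

/-- The unit sphere of `ℝ³`. -/
def sphere2 : Set (ℂ × ℝ) := {p | ‖p.1‖ ^ 2 + p.2 ^ 2 = 1}

/-- The open unit ball of `ℝ³`. -/
def openBall3 : Set (ℂ × ℝ) := {p | ‖p.1‖ ^ 2 + p.2 ^ 2 < 1}

lemma rot_mem_sphere2 (z : Circle) {p : ℂ × ℝ} (hp : p ∈ sphere2) : rot z p ∈ sphere2 := by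
  simpa only [sphere2, rot, Set.mem_ofPred_eq, norm_mul, Circle.norm_coe, one_mul] using hp

/-- The real projective plane. -/
def RP2 : Type := Quotient (antipodal sphere2)

instance : TopologicalSpace RP2 := inferInstanceAs (TopologicalSpace (Quotient _))

/-- The standard circle action on the projective plane, `z • [w, s] = [z w, s]`. -/
instance : MulAction Circle RP2 where
  smul z := Quotient.map (fun p : sphere2 => (⟨rot z p, rot_mem_sphere2 z p.2⟩ : sphere2)) (by
    rintro p q (h | h)
    · exact Or.inl (by simp [h])
    · exact Or.inr (by simp [h, rot_neg]))
  one_smul x := by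
    induction x using Quotient.inductionOn with
    | h p => exact Quotient.sound (Or.inl (rot_one _).symm)
  mul_smul z w x := by
    induction x using Quotient.inductionOn with
    | h p => exact Quotient.sound (Or.inl (rot_mul z w _).symm)

/-- On `X × [-1,1]`, collapse `X × {1}` to a point and `X × {-1}` to a point. -/
def suspSetoid (X : Type) : Setoid (X × Set.Icc (-1 : ℝ) 1) where
  r a b := a = b ∨ (a.2 = b.2 ∧ ((a.2 : ℝ) = 1 ∨ (a.2 : ℝ) = -1))
  iseqv :=
    { refl := fun _ => Or.inl rfl
      symm := by
        rintro a b (h | ⟨h, h'⟩)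
        · exact Or.inl h.symm
        · exact Or.inr ⟨h.symm, h ▸ h'⟩
      trans := by
        rintro a b c (rfl | ⟨h, h'⟩) (rfl | ⟨k, k'⟩)
        · exact Or.inl rfl
        · exact Or.inr ⟨k, k'⟩
        · exact Or.inr ⟨h, h'⟩
        · exact Or.inr ⟨h.trans k, h'⟩ }

/-- The (unreduced) suspension. -/
def Susp (X : Type) : Type := Quotient (suspSetoid X)

instance (X : Type) [TopologicalSpace X] : TopologicalSpace (Susp X) :=
  inferInstanceAs (TopologicalSpace (Quotient _))

/-- The suspension of a circle action. -/
instance (X : Type) [MulAction Circle X] : MulAction Circle (Susp X) where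
  smul z := Quotient.map (fun a : X × Set.Icc (-1 : ℝ) 1 => (z • a.1, a.2)) (by
    rintro a b (rfl | ⟨h, h'⟩)
    · exact Or.inl rfl
    · exact Or.inr ⟨h, h'⟩)
  one_smul x := by
    induction x using Quotient.inductionOn with
    | h a => exact Quotient.sound (Or.inl (by simp))
  mul_smul z w x := by
    induction x using Quotient.inductionOn with
    | h a => exact Quotient.sound (Or.inl (by simp [mul_smul]))

/-- `(x, t) ∼ (fⁿ x, t + n)` on `X × ℝ`, for `n ∈ ℤ`. -/
def mappingTorusSetoid {X : Type} [TopologicalSpace X] (f : X ≃ₜ X) : Setoid (X × ℝ) where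
  r a b := ∃ n : ℤ, b = ((f ^ n) a.1, a.2 + n)
  iseqv :=
    { refl := fun a => ⟨0, by simp⟩
      symm := by
        rintro a b ⟨n, rfl⟩
        refine ⟨-n, ?_⟩
        have : (f ^ (-n)) ((f ^ n) a.1) = a.1 := by
          rw [← Homeomorph.mul_apply, ← zpow_add]; simp
        ext1
        · exact this.symm
        · simp
      trans := by
        rintro a b c ⟨n, rfl⟩ ⟨m, rfl⟩
        refine ⟨m + n, ?_⟩
        rw [zpow_add]
        ext1
        · rfl
        · push_cast; ring }

/-- The mapping torus of `f`, that is `X × [0,1]` with `(x, 0)` identified with `(f x, 1)`: the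
bundle over the circle with fiber `X` and monodromy `f`. -/
def MappingTorus {X : Type} [TopologicalSpace X] (f : X ≃ₜ X) : Type :=
  Quotient (mappingTorusSetoid f)

instance {X : Type} [TopologicalSpace X] (f : X ≃ₜ X) : TopologicalSpace (MappingTorus f) :=
  inferInstanceAs (TopologicalSpace (Quotient _))

/-- The closed unit disk. -/
abbrev Disk : Type := Metric.closedBall (0 : ℂ) 1

/-- Complex conjugation on the disk. -/
def diskConj : Disk ≃ₜ Disk where
  toFun w := ⟨(starRingEnd ℂ) w, by
    simpa only [Metric.mem_closedBall, dist_zero_right, RCLike.norm_conj] using w.2⟩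
  invFun w := ⟨(starRingEnd ℂ) w, by
    simpa only [Metric.mem_closedBall, dist_zero_right, RCLike.norm_conj] using w.2⟩
  left_inv w := by simp
  right_inv w := by simp
  continuous_toFun := by fun_prop
  continuous_invFun := by fun_prop

/-- The Klein bottle, as the non-orientable circle bundle over the circle. -/
abbrev KleinBottle : Type := MappingTorus (Homeomorph.inv Circle)

/-- The solid Klein bottle, as the non-orientable disk bundle over the circle. -/
abbrev SolidKleinBottle : Type := MappingTorus diskConj

/-- `(t, z) ∼ (-t, -z)` on `[-1,1] × S¹`. -/
def moebiusSetoid : Setoid (Set.Icc (-1 : ℝ) 1 × Circle) where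
  r a b := a = b ∨ ((b.1 : ℝ) = -a.1 ∧ b.2 = -a.2)
  iseqv :=
    { refl := fun _ => Or.inl rfl
      symm := by
        rintro a b (h | ⟨h, h'⟩)
        · exact Or.inl h.symm
        · exact Or.inr ⟨by rw [h, neg_neg], by rw [h', neg_neg]⟩
      trans := by
        rintro a b c (rfl | ⟨h, h'⟩) (rfl | ⟨k, k'⟩)
        · exact Or.inl rfl
        · exact Or.inr ⟨k, k'⟩
        · exact Or.inr ⟨h, h'⟩
        · refine Or.inl (Prod.ext (Subtype.ext ?_) ?_)
          · rw [k, h, neg_neg]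
          · rw [k', h', neg_neg] }

/-- The (compact) Möbius band `([-1,1] × S¹) / (t, z) ∼ (-t, -z)`. -/
def Moebius : Type := Quotient moebiusSetoid

instance : TopologicalSpace Moebius := inferInstanceAs (TopologicalSpace (Quotient _))

/-- The map `[t, z] ↦ [t, z⁻¹]` of the Möbius band. -/
def moebiusFlip : Moebius → Moebius :=
  Quotient.map (fun a => (a.1, a.2⁻¹)) (by
    rintro a b (rfl | ⟨h, h'⟩)
    · exact Or.inl rfl
    · refine Or.inr ⟨h, ?_⟩
      simp [h', inv_neg])

lemma moebiusFlip_flip (x : Moebius) : moebiusFlip (moebiusFlip x) = x := by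
  induction x using Quotient.inductionOn with
  | h a => exact Quotient.sound (Or.inl (by simp))

lemma continuous_moebiusFlip : Continuous moebiusFlip :=
  Continuous.quotient_map' (by fun_prop) _

/-- The reflection `[t, z] ↦ [t, z⁻¹]` of the Möbius band; it reverses the boundary circle. -/
def moebiusConj : Moebius ≃ₜ Moebius where
  toFun := moebiusFlip
  invFun := moebiusFlip
  left_inv := moebiusFlip_flip
  right_inv := moebiusFlip_flip
  continuous_toFun := continuous_moebiusFlip
  continuous_invFun := continuous_moebiusFlip

/-! ### Generalized solid tori and generalized solid Klein bottles -/

/-- The surfaces `x² + y² - z² = t²`, `|z| ≤ 1`. -/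
def surfA (t : ℝ) : Set (ℂ × ℝ) := {p | ‖p.1‖ ^ 2 - p.2 ^ 2 = t ^ 2 ∧ |p.2| ≤ 1}

/-- The surfaces `x² + y² - z² = -t²`, `x² + y² ≤ 1`. -/
def surfB (t : ℝ) : Set (ℂ × ℝ) := {p | ‖p.1‖ ^ 2 - p.2 ^ 2 = -t ^ 2 ∧ ‖p.1‖ ^ 2 ≤ 1}

open Classical in
/-- The surface whose antipodal quotient is `D(t)`. -/
def surf (t : ℝ) : Set (ℂ × ℝ) := if 0 < t then surfA t else surfB t

open Classical in
/-- The boundary curve (or curves) of that surface. -/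
def surfBd (t : ℝ) : Set (ℂ × ℝ) :=
  if 0 < t then {p | p ∈ surfA t ∧ |p.2| = 1} else {p | p ∈ surfB t ∧ ‖p.1‖ ^ 2 = 1}

/-- The union of the surfaces for `t ∈ [-1,1]`; it is a closed topological ball around `0`. -/
def solidRegion : Set (ℂ × ℝ) := {p | ∃ t ∈ Set.Icc (-1 : ℝ) 1, p ∈ surf t}

/-- The closed cone `K₁(ℝP²)`, as the antipodal quotient of `solidRegion`. -/
def ConeRP2 : Type := Quotient (antipodal solidRegion)

instance : TopologicalSpace ConeRP2 := inferInstanceAs (TopologicalSpace (Quotient _))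

/-- The surface `D(t)` in `K₁(ℝP²)`: a Möbius band for `t > 0`, a disk for `t ≤ 0`. It is the level
set over `t` of the projection `K₁(ℝP²) → [-1,1]`. -/
def levelD (t : ℝ) : Set ConeRP2 :=
  {c | ∃ p : solidRegion, (p : ℂ × ℝ) ∈ surf t ∧ Quotient.mk (antipodal solidRegion) p = c}

/-- The boundary circle of `D(t)`. -/
def levelDBd (t : ℝ) : Set ConeRP2 :=
  {c | ∃ p : solidRegion, (p : ℂ × ℝ) ∈ surfBd t ∧ Quotient.mk (antipodal solidRegion) p = c}

/-- The parameter of the end along which the `j`-th cone is glued to the next one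
(the cones are numbered from `0`): Möbius ends for even `j`, disk ends for odd `j`. Thus cones with
even number are traversed from `t = -1` to `t = 1` and the others from `t = 1` to `t = -1`. -/
def endParam (j : ℕ) : ℝ := if Even j then 1 else -1

/-- Gluing homeomorphisms for `2N` cones in cyclic order. -/
abbrev GluingData (N : ℕ) : Type :=
  ∀ j : Fin (2 * N), levelD (endParam j) ≃ₜ levelD (endParam j)

/-- The identifications: `x` in the appropriate end of the `j`-th cone is identified with `g j x` in
the cone which follows it cyclically. -/
def GlueRel {N : ℕ} (g : GluingData N) (a b : Fin (2 * N) × ConeRP2) : Prop :=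
  b.1 = finRotate (2 * N) a.1 ∧ ∃ h : a.2 ∈ levelD (endParam a.1), b.2 = (g a.1 ⟨a.2, h⟩ : ConeRP2)

/-- The space `Y` obtained from `2N` cones over `ℝP²` by the gluing. -/
def GluedSpace {N : ℕ} (g : GluingData N) : Type := Quot (GlueRel g)

instance {N : ℕ} (g : GluingData N) : TopologicalSpace (GluedSpace g) :=
  inferInstanceAs (TopologicalSpace (Quot _))

/-- The boundary `∂Y`, the union of the boundary circles of all the `D(t)`. -/
def gluedBoundary {N : ℕ} (g : GluingData N) : Set (GluedSpace g) :=
  {y | ∃ j : Fin (2 * N), ∃ t ∈ Set.Icc (-1 : ℝ) 1, ∃ c ∈ levelDBd t, Quot.mk (GlueRel g) (j, c) = y}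

/-- `Y` is (homeomorphic to) a generalized solid torus of type `N`. -/
def IsGeneralizedSolidTorus (N : ℕ) (Y : Type*) [TopologicalSpace Y] : Prop :=
  (N = 0 ∧ (Nonempty (Y ≃ₜ Disk × Circle) ∨ Nonempty (Y ≃ₜ Moebius × Circle))) ∨
  (0 < N ∧ ∃ g : GluingData N, Nonempty (gluedBoundary g ≃ₜ Circle × Circle) ∧
    Nonempty (Y ≃ₜ GluedSpace g))

/-- `Y` is (homeomorphic to) a generalized solid Klein bottle of type `N`. -/
def IsGeneralizedSolidKleinBottle (N : ℕ) (Y : Type*) [TopologicalSpace Y] : Prop :=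
  (N = 0 ∧ (Nonempty (Y ≃ₜ SolidKleinBottle) ∨ Nonempty (Y ≃ₜ MappingTorus moebiusConj))) ∨
  (0 < N ∧ ∃ g : GluingData N, Nonempty (gluedBoundary g ≃ₜ KleinBottle) ∧
    Nonempty (Y ≃ₜ GluedSpace g))

/-! ### Equivariant connected sums and SF-blocks -/

/-- `Z` is the space obtained from `X₁` and `X₂` by removing the open balls `e₁(B)` and `e₂(B)` (`B`
the open unit ball of `ℝ³`) and identifying `e₁ p` with `e₂ p` for `p` in the unit sphere. Here
`e₁`, `e₂` are open embeddings of `ℝ³`, and `i₁`, `i₂` are the inclusions of the two pieces. -/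
structure IsBallGluing {X₁ X₂ Z : Type} [TopologicalSpace X₁] [TopologicalSpace X₂]
    [TopologicalSpace Z] (e₁ : ℂ × ℝ → X₁) (e₂ : ℂ × ℝ → X₂)
    (i₁ : {x : X₁ // x ∉ e₁ '' openBall3} → Z) (i₂ : {x : X₂ // x ∉ e₂ '' openBall3} → Z) :
    Prop where
  isOpenEmbedding₁ : IsOpenEmbedding e₁
  isOpenEmbedding₂ : IsOpenEmbedding e₂
  isClosedEmbedding₁ : IsClosedEmbedding i₁
  isClosedEmbedding₂ : IsClosedEmbedding i₂
  cover : Set.range i₁ ∪ Set.range i₂ = Set.univ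
  glue : ∀ a b, i₁ a = i₂ b ↔ ∃ p ∈ sphere2, e₁ p = a ∧ e₂ p = b

/-- The circle space `Z` is an equivariant connected sum of the circle spaces `X₁` and `X₂`, along
invariant balls around regular fixed points `e₁ 0`, `e₂ 0` on which the circle acts by rotations. -/
def IsEquivariantConnectedSum (X₁ X₂ Z : Type) [TopologicalSpace X₁] [TopologicalSpace X₂]
    [TopologicalSpace Z] [MulAction Circle X₁] [MulAction Circle X₂] [MulAction Circle Z] : Prop :=
  ∃ (e₁ : ℂ × ℝ → X₁) (e₂ : ℂ × ℝ → X₂)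
    (i₁ : {x : X₁ // x ∉ e₁ '' openBall3} → Z) (i₂ : {x : X₂ // x ∉ e₂ '' openBall3} → Z),
    IsBallGluing e₁ e₂ i₁ i₂ ∧
    (∀ (z : Circle) p, e₁ (rot z p) = z • e₁ p) ∧ (∀ (z : Circle) p, e₂ (rot z p) = z • e₂ p) ∧
    (∀ (z : Circle) (a b : {x : X₁ // x ∉ e₁ '' openBall3}),
      (b : X₁) = z • (a : X₁) → i₁ b = z • i₁ a) ∧
    (∀ (z : Circle) (a b : {x : X₂ // x ∉ e₂ '' openBall3}),
      (b : X₂) = z • (a : X₂) → i₂ b = z • i₂ a)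

/-- `X` is, up to equivariant homeomorphism, the equivariant connected sum `R_k` of `k ≥ 1` copies
of `Susp(ℝP²)` with the suspension of the standard circle action. -/
def IsSuspSum : ℕ → (X : Type) → [TopologicalSpace X] → [MulAction Circle X] → Prop
  | 0, _, _, _ => False
  | 1, X, _, _ => ∃ h : X ≃ₜ Susp RP2, ∀ (z : Circle) x, h (z • x) = z • h x
  | k + 2, X, _, _ => ∃ (X' : Type) (_ : TopologicalSpace X') (_ : MulAction Circle X'),
      IsSuspSum (k + 1) X' ∧ IsEquivariantConnectedSum X' (Susp RP2) X

/-- `Z`, with fibers given by `r`, is a simple SF-block with `2k` singular points: up to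
equivalence, it is `R_k` minus the interior of an invariant solid torus `e(D² × S¹)`, fibered by the
orbits. The circle acts on the solid torus by translations of the second factor; in particular it
lies in the part of `R_k` with trivial isotropy. -/
def IsSimpleSFBlock (k : ℕ) (Z : Type) [TopologicalSpace Z] (r : Setoid Z) : Prop :=
  ∃ (R : Type) (_ : TopologicalSpace R) (_ : MulAction Circle R) (e : ℂ × Circle → R),
    IsSuspSum k R ∧ IsOpenEmbedding e ∧ (∀ (z u : Circle) d, e (d, z * u) = z • e (d, u)) ∧
    FiberEquivalent r
      (Setoid.comap (Subtype.val : {x : R // x ∉ e '' {p | ‖p.1‖ < 1}} → R)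
        (MulAction.orbitRel Circle R))

lemma norm_diskConj_zpow (n : ℤ) (w : Disk) : ‖(((diskConj ^ n) w : Disk) : ℂ)‖ = ‖(w : ℂ)‖ := by
  have h1 : ∀ w : Disk, ‖((diskConj w : Disk) : ℂ)‖ = ‖(w : ℂ)‖ := fun w => RCLike.norm_conj _
  have h2 : diskConj⁻¹ = diskConj := rfl
  induction n using Int.induction_on generalizing w with
  | zero => simp
  | succ i ih => rw [zpow_add, zpow_one, Homeomorph.mul_apply, ih, h1]
  | pred i ih => rw [zpow_sub, zpow_one, h2, Homeomorph.mul_apply, ih, h1]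

/-- The fibers of the twisted F-block, whose underlying space is the solid Klein bottle: concentric
circles in the disks of the disk bundle, those of radius `0` being points. -/
def twistedFBlock : Setoid SolidKleinBottle where
  r a b := ∃ (v w : Disk) (t : ℝ), ‖(v : ℂ)‖ = ‖(w : ℂ)‖ ∧
    Quotient.mk (mappingTorusSetoid diskConj) (v, t) = a ∧
    Quotient.mk (mappingTorusSetoid diskConj) (w, t) = b
  iseqv :=
    { refl := fun a => by
        induction a using Quotient.inductionOn with
        | h p => exact ⟨p.1, p.1, p.2, rfl, rfl, rfl⟩
      symm := fun ⟨v, w, t, h, ha, hb⟩ => ⟨w, v, t, h.symm, hb, ha⟩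
      trans := by
        rintro a b c ⟨v, w, t, h, ha, hb⟩ ⟨v', w', t', h', hb', hc⟩
        obtain ⟨n, hn⟩ := Quotient.exact (hb'.trans hb.symm)
        obtain ⟨hw, ht⟩ := Prod.ext_iff.1 hn
        simp only at hw ht
        refine ⟨v, (diskConj ^ n) w', t, ?_, ha, ?_⟩
        · rw [norm_diskConj_zpow, h, hw, norm_diskConj_zpow, h']
        · rw [← hc]
          have hr : mappingTorusSetoid diskConj (w', t') ((diskConj ^ n) w', t) := ⟨n, by rw [ht]⟩
          exact (Quotient.sound hr).symm }

/-- `Z`, with fibers given by `r`, is a twisted SF-block with `2k` singular points: the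
equivariant connected sum of the twisted F-block and `R_k` along invariant balls. Fibers in the two
pieces are those of the twisted F-block and the orbits of `R_k`. -/
def IsTwistedSFBlock (k : ℕ) (Z : Type) [TopologicalSpace Z] (r : Setoid Z) : Prop :=
  ∃ (R : Type) (_ : TopologicalSpace R) (_ : MulAction Circle R)
    (e₁ : ℂ × ℝ → SolidKleinBottle) (e₂ : ℂ × ℝ → R)
    (i₁ : {x : SolidKleinBottle // x ∉ e₁ '' openBall3} → Z)
    (i₂ : {x : R // x ∉ e₂ '' openBall3} → Z),
    IsSuspSum k R ∧ IsBallGluing e₁ e₂ i₁ i₂ ∧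
    (∀ p x, twistedFBlock (e₁ p) x ↔ ∃ z : Circle, x = e₁ (rot z p)) ∧
    (∀ (z : Circle) p, e₂ (rot z p) = z • e₂ p) ∧
    (∀ a b, r (i₁ a) (i₁ b) ↔ twistedFBlock a b) ∧
    (∀ a b, r (i₂ a) (i₂ b) ↔ MulAction.orbitRel Circle R a b) ∧
    (∀ a b, r (i₁ a) (i₂ b) ↔
      ∃ c : {x : SolidKleinBottle // x ∉ e₁ '' openBall3}, twistedFBlock a c ∧ i₁ c = i₂ b)

end

set_option linter.unusedSectionVars false

noncomputable section

/-! ### The no-retraction theorem for the ball, by volumes of perturbations of the identity. -/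

section NoRetraction

open MeasureTheory Metric Set

/-! Every space of the theorem is described over its orbit space. In `Lab S ℓ u` the orbit over a
base point `b` is free if the size `u b` is nonzero; over the zeros of `u` it is a fixed point where
`ℓ ≤ 0` and a circle with isotropy `±1` where `ℓ > 0`. Up to equivariant homeomorphism only the
base, the zero set of `u` and the sign of `ℓ` on it matter (`exists_homeomorph_lab`), so that the
geometry of the blocks reduces to plane geometry of the base.

The closed cone over the projective plane is such a space over a rectangle, with the parameter `t`
as label and the apex at label and size zero. The gluing maps of the ends are arbitrary, but they
can be absorbed: a homeomorphism of an end preserves the boundary circle, is isotopic there to the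
identity or the inversion, and by running this isotopy along the lateral annulus and coning off it
extends to the whole cone, with only the identity or the fiberwise reflection left on the other end
(`exists_cone_extension`). Carried around the cycle, this leaves a single bit `b`. Hence `Y` is
`WaveSpace b N`: the labelled space over an annulus with label `-cos (2πNx)`, closed up with or
without reflection of the orbits (`exists_gluedSpace_homeomorph`).

The bit is read off from the boundary, which is a torus or a Klein bottle. These two are not
homeomorphic because any two circle valued maps on the Klein bottle are multiplicatively dependent
up to exponentials of real functions (`klein_dependent`). Invariance of the boundary, needed for the
ends of the cones and again to see that `Y` is never of both kinds, rests on the notion of a labile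
point: boundary points can be pushed off themselves by small deformations, points with Euclidean
neighborhoods cannot, by the no-retraction theorem.

It remains to recognize the two standard spaces. A labelled space over a disk with one exceptional
boundary arc is the suspension of the projective plane, and cutting the disk along a chord with
regular end points is an equivariant connected sum; so `N` exceptional arcs give `R_N`
(`isSuspSum_diskLab`). The untwisted annulus is the disk minus a smaller concentric disk, over which
a free solid torus lies (`isSimpleSFBlock_wave`). In the twisted case a half disk in the base
containing all exceptional orbits is cut off: the outside is a punctured solid Klein bottle, the
inside a punctured `R_N` (`isTwistedSFBlock_wave`). For type zero explicit circle actions on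
products and on mapping tori of involutions suffice. -/

/-- The determinant is a polynomial in `t` of degree at most the size of `M`, hence equal to its
Lagrange interpolation at the integers `0, …, n`. In this form the coefficients are themselves
determinants, so that an integral over a family of matrices is visibly a polynomial in `t`. -/
lemma det_one_add_smul_interpolate {n : Type*} [Fintype n] [DecidableEq n] (M : Matrix n n ℝ)
    (t : ℝ) :
    (1 + t • M).det = ∑ k ∈ Finset.range (Fintype.card n + 1),
      (1 + (k : ℝ) • M).det *
        (Lagrange.basis (Finset.range (Fintype.card n + 1)) (fun k : ℕ => (k : ℝ)) k).eval t := by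
  set P : Polynomial ℝ :=
    ((Polynomial.X : Polynomial ℝ) • M.map Polynomial.C + (1 : Matrix n n ℝ).map Polynomial.C).det
    with hP
  have heval : ∀ s : ℝ, P.eval s = (1 + s • M).det := by
    intro s
    rw [hP, ← Polynomial.coe_evalRingHom, RingHom.map_det]
    congr 1
    ext i j
    by_cases hij : i = j
    · simp [hij]; ring
    · simp [hij]; ring
  have hdeg : P.degree < (Finset.range (Fintype.card n + 1)).card := by
    rw [Finset.card_range]
    exact lt_of_le_of_lt Polynomial.degree_le_natDegree
      (by exact_mod_cast Nat.lt_succ_of_le (Polynomial.natDegree_det_X_add_C_le M 1))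
  have hinj : Set.InjOn (fun k : ℕ => (k : ℝ)) (Finset.range (Fintype.card n + 1)) :=
    fun a _ b _ h => Nat.cast_injective h
  have h := Lagrange.eq_interpolate hinj hdeg
  rw [← heval t]
  conv_lhs => rw [h]
  rw [Lagrange.interpolate_apply, Polynomial.eval_finsetSum]
  refine Finset.sum_congr rfl fun k _ => ?_
  rw [Polynomial.eval_mul, Polynomial.eval_C, heval]

variable {E : Type*} [NormedAddCommGroup E] [InnerProductSpace ℝ E] [FiniteDimensional ℝ E]

lemma det_one_add_smul_interpolate' (A : E →L[ℝ] E) (t : ℝ) :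
    (1 + t • A).det = ∑ k ∈ Finset.range (Module.finrank ℝ E + 1),
      (1 + (k : ℝ) • A).det *
        (Lagrange.basis (Finset.range (Module.finrank ℝ E + 1))
          (fun k : ℕ => (k : ℝ)) k).eval t := by
  have key : ∀ s : ℝ, (1 + s • A).det =
      (1 + s • LinearMap.toMatrix (Module.finBasis ℝ E) (Module.finBasis ℝ E)
        (A : E →ₗ[ℝ] E)).det := by
    intro s
    rw [ContinuousLinearMap.det, ← LinearMap.det_toMatrix (Module.finBasis ℝ E)]
    congr 1
    simp [LinearMap.toMatrix_one]
  simp only [key]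
  simpa using det_one_add_smul_interpolate
    (LinearMap.toMatrix (Module.finBasis ℝ E) (Module.finBasis ℝ E) (A : E →ₗ[ℝ] E)) t

/-- All operators `1 + s • A` with `s` in `[0,1]` are invertible, so the determinant cannot change
sign on the way from the identity. -/
lemma det_pos_of_norm_lt {A : E →L[ℝ] E} (hA : ‖A‖ < 1) : 0 < (1 + A).det := by
  have hne : ∀ s ∈ Icc (0 : ℝ) 1, (1 + s • A).det ≠ 0 := by
    intro s hs h0
    rw [ContinuousLinearMap.det] at h0
    obtain ⟨v, hv, hv0⟩ := (LinearMap.bot_lt_ker_of_det_eq_zero h0).ne' |> (Submodule.ne_bot_iff _).1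
    have hv' : v + s • A v = 0 := by simpa using hv
    have h1 : ‖v‖ = ‖s • A v‖ := by
      conv_lhs => rw [eq_neg_of_add_eq_zero_left hv', norm_neg]
    have h2 : ‖s • A v‖ ≤ ‖A‖ * ‖v‖ := by
      rw [norm_smul, Real.norm_of_nonneg hs.1]
      calc s * ‖A v‖ ≤ 1 * ‖A v‖ := by gcongr; exact hs.2
        _ ≤ _ := by rw [one_mul]; exact A.le_opNorm v
    have h3 : 0 < ‖v‖ := norm_pos_iff.2 hv0
    nlinarith
  by_contra hneg
  have hc : ContinuousOn (fun s : ℝ => (1 + s • A).det) (Icc 0 1) :=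
    (ContinuousLinearMap.continuous_det.comp (by fun_prop)).continuousOn
  have : (0 : ℝ) ∈ (fun s : ℝ => (1 + s • A).det) '' Icc 0 1 := by
    refine intermediate_value_Icc' zero_le_one hc ⟨?_, ?_⟩
    · simpa using not_lt.1 hneg
    · simp [ContinuousLinearMap.det]
  obtain ⟨s, hs, h⟩ := this
  exact hne s hs h

/-- Being close to the identity in the Lipschitz sense makes the map injective and open. As a convex
combination of `x` and a unit vector it maps the open ball into itself; it fixes the sphere, so the
image of the open ball is also relatively closed in the ball, which is connected. -/
lemma image_ball_of_perturbation {f : E → E} {t : ℝ} {c : NNReal} (hc : c < 1)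
    (ht0 : 0 ≤ t) (ht1 : t < 1)
    (hf : ∀ x ∈ closedBall (0 : E) 1, ‖f x‖ = 1)
    (hs : ∀ x ∈ sphere (0 : E) 1, f x = x)
    (happ : ApproximatesLinearOn (fun x => x + t • (f x - x))
      ((ContinuousLinearEquiv.refl ℝ E : E ≃L[ℝ] E) : E →L[ℝ] E) (closedBall 0 1) c) :
    InjOn (fun x => x + t • (f x - x)) (ball 0 1) ∧
      (fun x => x + t • (f x - x)) '' ball 0 1 = ball 0 1 := by
  set F : E → E := fun x => x + t • (f x - x) with hF
  have hsymm : Subsingleton E ∨ c < ‖((ContinuousLinearEquiv.refl ℝ E).symm : E →L[ℝ] E)‖₊⁻¹ := by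
    rcases subsingleton_or_nontrivial E with h | h
    · exact Or.inl h
    · right
      have : ‖((ContinuousLinearEquiv.refl ℝ E).symm : E →L[ℝ] E)‖₊ = 1 :=
        NNReal.eq (by simp)
      rw [this]; simpa using hc
  have hinj : InjOn F (closedBall 0 1) := happ.injOn hsymm
  refine ⟨hinj.mono ball_subset_closedBall, ?_⟩
  have hnorm : ∀ x ∈ ball (0 : E) 1, F x ∈ ball (0 : E) 1 := by
    intro x hx
    have h1 : ‖f x‖ = 1 := hf x (ball_subset_closedBall hx)
    rw [mem_ball_zero_iff] at hx ⊢
    have : F x = (1 - t) • x + t • f x := by simp only [hF]; module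
    rw [this]
    calc ‖(1 - t) • x + t • f x‖ ≤ (1 - t) * ‖x‖ + t * ‖f x‖ := by
          refine (norm_add_le _ _).trans ?_
          rw [norm_smul, norm_smul, Real.norm_of_nonneg ht0, Real.norm_of_nonneg (by linarith)]
      _ < 1 := by rw [h1]; nlinarith
  have hopen : IsOpen (F '' ball 0 1) := by
    refine (happ.mono_set ball_subset_closedBall).open_image
      (ContinuousLinearEquiv.toNonlinearRightInverse (ContinuousLinearEquiv.refl ℝ E))
      isOpen_ball ?_
    exact hsymm
  have hcl : IsClosed (F '' closedBall 0 1) :=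
    ((isCompact_closedBall 0 1).image_of_continuousOn happ.continuousOn).isClosed
  have hcap : F '' closedBall 0 1 ∩ ball 0 1 ⊆ F '' ball 0 1 := by
    rintro _ ⟨⟨x, hx, rfl⟩, hy⟩
    by_cases hx1 : x ∈ sphere (0 : E) 1
    · have : F x = x := by simp [hF, hs x hx1]
      rw [this] at hy
      rw [mem_sphere_zero_iff_norm] at hx1
      rw [mem_ball_zero_iff] at hy
      linarith
    · refine ⟨x, ?_, rfl⟩
      rw [mem_closedBall_zero_iff] at hx
      rw [mem_sphere_zero_iff_norm] at hx1
      rw [mem_ball_zero_iff]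
      exact lt_of_le_of_ne hx hx1
  refine Subset.antisymm (by rintro _ ⟨x, hx, rfl⟩; exact hnorm x hx) ?_
  have hpre : IsPreconnected (ball (0 : E) 1) := (convex_ball 0 1).isPreconnected
  refine hpre.subset_left_of_subset_union (v := (F '' closedBall 0 1)ᶜ) hopen hcl.isOpen_compl ?_ ?_ ?_
  · exact disjoint_compl_right.mono_left (image_mono ball_subset_closedBall)
  · intro y hy
    by_cases h : y ∈ F '' closedBall 0 1
    · exact Or.inl (hcap ⟨h, hy⟩)
    · exact Or.inr h
  · exact ⟨F 0, hnorm 0 (by simp), 0, by simp, rfl⟩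

/-- The integral over the ball of the Jacobian of `x + t (f x - x)` is a polynomial in `t`. For
small positive `t` it is the volume of the ball, hence it is so for `t = 1` too; but there the map
is `f`, whose values lie on the sphere, so that its Jacobian vanishes. -/
lemma no_C1_retraction [MeasurableSpace E] [BorelSpace E] {f : E → E} (hC : ContDiff ℝ 1 f)
    (hf : ∀ x ∈ closedBall (0 : E) 1, ‖f x‖ = 1)
    (hs : ∀ x ∈ sphere (0 : E) 1, f x = x) : False := by
  have hg : ContDiff ℝ 1 (fun x => f x - x) := hC.sub contDiff_id
  set A : E → E →L[ℝ] E := fun x => fderiv ℝ f x - 1 with hA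
  have hAc : Continuous A := (hC.continuous_fderiv one_ne_zero).sub continuous_const
  have hder : ∀ x, HasFDerivAt (fun x => f x - x) (A x) x := fun x =>
    ((hC.differentiable one_ne_zero x).hasFDerivAt).sub (hasFDerivAt_id x)
  obtain ⟨C, hCb⟩ := (isCompact_closedBall (0 : E) 1).exists_bound_of_continuousOn hAc.continuousOn
  have hCpos : 0 ≤ C := (norm_nonneg _).trans (hCb 0 (by simp))
  have hlip : ∀ x ∈ closedBall (0 : E) 1, ∀ y ∈ closedBall (0 : E) 1,
      ‖(f x - x) - (f y - y)‖ ≤ C * ‖x - y‖ := fun x hx y hy =>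
    (convex_closedBall (0 : E) 1).norm_image_sub_le_of_norm_hasFDerivWithin_le
      (fun z _ => (hder z).hasFDerivWithinAt) hCb hy hx
  set p : ℝ → ℝ := fun t => ∫ x in ball (0 : E) 1, (1 + t • A x).det with hp
  have hdc : ∀ t : ℝ, Continuous fun x => (1 + t • A x).det := fun t =>
    ContinuousLinearMap.continuous_det.comp (by fun_prop)
  have hint : ∀ t : ℝ, IntegrableOn (fun x => (1 + t • A x).det) (ball (0 : E) 1) := fun t =>
    ((hdc t).continuousOn.integrableOn_compact (isCompact_closedBall 0 1)).mono_set
      ball_subset_closedBall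
  set V : ℝ := (volume (ball (0 : E) 1)).toReal with hV
  have hVpos : 0 < V :=
    ENNReal.toReal_pos (measure_ball_pos _ _ one_pos).ne' measure_ball_lt_top.ne
  -- for small `t` the perturbation of the identity is a bijection of the ball
  have hsmall : ∀ t ∈ Ioo (0 : ℝ) (1 / (C + 1)), p t = V := by
    rintro t ⟨ht0, ht1⟩
    have htC : t * C < 1 := by
      rw [lt_div_iff₀ (by linarith)] at ht1; nlinarith
    have ht1' : t < 1 := by
      rw [lt_div_iff₀ (by linarith)] at ht1; nlinarith
    have hd : ∀ x ∈ ball (0 : E) 1,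
        HasFDerivWithinAt (fun x => x + t • (f x - x)) (1 + t • A x) (ball 0 1) x := fun x _ =>
      ((hasFDerivAt_id x).add ((hder x).const_smul t)).hasFDerivWithinAt
    have hdet : ∀ x ∈ ball (0 : E) 1, 0 < (1 + t • A x).det := by
      intro x hx
      refine det_pos_of_norm_lt ?_
      rw [norm_smul, Real.norm_of_nonneg ht0.le]
      have := hCb x (ball_subset_closedBall hx)
      nlinarith
    obtain ⟨hinj, himg⟩ := image_ball_of_perturbation (f := f) (t := t)
      (c := Real.toNNReal (t * C)) (by simpa using htC) ht0.le ht1' hf hs (by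
        intro x hx y hy
        have := hlip x hx y hy
        simp only [ContinuousLinearEquiv.coe_coe, ContinuousLinearEquiv.refl_apply]
        rw [Real.coe_toNNReal _ (by positivity)]
        have e : x + t • (f x - x) - (y + t • (f y - y)) - (x - y)
          = t • ((f x - x) - (f y - y)) := by module
        rw [e, norm_smul, Real.norm_of_nonneg ht0.le, mul_assoc]
        gcongr)
    have := integral_image_eq_integral_abs_det_fderiv_smul volume measurableSet_ball hd hinj
      (fun _ => (1 : ℝ))
    rw [himg] at this
    simp only [smul_eq_mul, mul_one, integral_const, MeasurableSet.univ, measureReal_restrict_apply,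
      univ_inter] at this
    rw [hp, hV, ← measureReal_def, this]
    refine setIntegral_congr_fun measurableSet_ball fun x hx => ?_
    exact (abs_of_pos (hdet x hx)).symm
  -- `p` is polynomial
  obtain ⟨P, hP⟩ : ∃ P : Polynomial ℝ, ∀ t, P.eval t = p t := by
    refine ⟨∑ k ∈ Finset.range (Module.finrank ℝ E + 1), Polynomial.C (p k) *
        (Lagrange.basis (Finset.range (Module.finrank ℝ E + 1)) (fun k : ℕ => (k : ℝ)) k), ?_⟩
    intro t
    simp only [hp, Polynomial.eval_finsetSum, Polynomial.eval_mul, Polynomial.eval_C]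
    simp_rw [fun x => det_one_add_smul_interpolate' (A x) t]
    refine Eq.trans ?_ (integral_finsetSum _ fun (k : ℕ) _ => (hint (k : ℝ)).mul_const _).symm
    simp_rw [integral_mul_const]
  have hconst : P = Polynomial.C V := by
    refine Polynomial.eq_of_infinite_eval_eq _ _ ?_
    refine (Ioo_infinite (show (0 : ℝ) < 1 / (C + 1) by positivity)).mono fun t ht => ?_
    simp [hP, hsmall t ht]
  have h1 : p 1 = V := by rw [← hP, hconst, Polynomial.eval_C]
  have h0 : p 1 = 0 := by
    rw [hp]
    refine setIntegral_eq_zero_of_forall_eq_zero fun x hx => ?_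
    by_contra hne
    have hdetf : (fderiv ℝ f x).det ≠ 0 := by simpa [hA] using hne
    have hu : IsUnit ((fderiv ℝ f x : E →ₗ[ℝ] E)) :=
      (LinearMap.isUnit_iff_isUnit_det _).2 (isUnit_iff_ne_zero.2 hdetf)
    -- An invertible derivative would reach the normal vector `f x`, contradicting the derivative of
    -- the constant function `⟨f, f⟩ = 1`.
    obtain ⟨v, hv⟩ := ((Module.End.isUnit_iff _).1 hu).2 (f x)
    have hin : HasFDerivAt (fun y => inner ℝ (f y) (f y)) _ x :=
      ((hC.differentiable one_ne_zero x).hasFDerivAt).inner ℝ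
        ((hC.differentiable one_ne_zero x).hasFDerivAt)
    have hz : HasFDerivAt (fun y => inner ℝ (f y) (f y)) (0 : E →L[ℝ] ℝ) x := by
      refine (hasFDerivAt_const (1 : ℝ) x).congr_of_eventuallyEq ?_
      filter_upwards [isOpen_ball.mem_nhds hx] with y hy
      rw [real_inner_self_eq_norm_sq, hf y (ball_subset_closedBall hy)]; norm_num
    have := congrArg (fun L : E →L[ℝ] ℝ => L v) (hin.unique hz)
    have hv' : fderiv ℝ f x v = f x := hv
    simp [fderivInnerCLM_apply, hv', hf x (ball_subset_closedBall hx)] at this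
  linarith

/-- Reduction to the `C¹` case: extended by the identity, `f` is bounded away from zero, so a `C¹`
approximation with smaller error has no zeros either. The approximation is exact from radius two on;
rescaling by two and normalizing gives a `C¹` retraction. -/
lemma no_retraction {f : E → E} (hC : ContinuousOn f (closedBall 0 1))
    (hf : ∀ x ∈ closedBall (0 : E) 1, f x ≠ 0)
    (hs : ∀ x ∈ sphere (0 : E) 1, f x = x) : False := by
  classical
  borelize E
  obtain ⟨m, hm0, hm⟩ : ∃ m > 0, ∀ x ∈ closedBall (0 : E) 1, m ≤ ‖f x‖ := by
    obtain ⟨x₀, hx₀, hmin⟩ := (isCompact_closedBall (0 : E) 1).exists_isMinOn ⟨0, by simp⟩ hC.norm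
    exact ⟨‖f x₀‖, norm_pos_iff.2 (hf x₀ hx₀), fun x hx => hmin hx⟩
  set F : E → E := fun x => if ‖x‖ ≤ 1 then f x else x with hF
  have hFc : Continuous F := by
    refine continuous_if_le continuous_norm continuous_const ?_ continuousOn_id ?_
    · convert hC using 1
      ext x; simp
    · intro x hx
      exact hs x (by simpa using hx)
  have hF1 : ∀ x, 1 < ‖x‖ → F x = x := fun x hx => by simp [hF, not_le.2 hx]
  have hFm : ∀ x, min m 1 ≤ ‖F x‖ := by
    intro x
    by_cases hx : ‖x‖ ≤ 1
    · simp only [hF, hx, if_true]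
      exact (min_le_left _ _).trans (hm x (by simpa using hx))
    · rw [hF1 x (not_le.1 hx)]
      exact (min_le_right _ _).trans (not_le.1 hx).le
  have hm1 : 0 < min m 1 := lt_min hm0 one_pos
  obtain ⟨g, hg, hgF, hgS, -⟩ := hFc.exists_contDiff_approx_and_eqOn (ε := fun _ => min m 1) 1
    continuous_const (fun _ => hm1) (S := {x | 2 ≤ ‖x‖}) (U := {x | 1 < ‖x‖})
    (isClosed_le continuous_const continuous_norm)
    ((isOpen_lt continuous_const continuous_norm).mem_nhdsSet.2 fun x (hx : 2 ≤ ‖x‖) =>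
      show 1 < ‖x‖ from lt_of_lt_of_le one_lt_two hx)
    (contDiffOn_id.congr fun x hx => hF1 x hx)
  have hg0 : ∀ x, g x ≠ 0 := by
    intro x h0
    have h1 := hgF x
    rw [h0, dist_zero_left] at h1
    exact absurd (hFm x) (not_le.2 h1)
  have hg2 : ContDiff ℝ 1 fun x : E => g ((2 : ℝ) • x) := hg.comp (contDiff_const_smul 2)
  refine no_C1_retraction (f := fun x => ‖g ((2 : ℝ) • x)‖⁻¹ • g ((2 : ℝ) • x)) ?_ ?_ ?_
  · exact ((hg2.norm ℝ fun x => hg0 _).inv fun x => norm_ne_zero_iff.2 (hg0 _)).smul hg2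
  · intro x _
    rw [norm_smul, norm_inv, norm_norm, inv_mul_cancel₀ (norm_ne_zero_iff.2 (hg0 _))]
  · intro x hx
    have hx1 : ‖x‖ = 1 := by simpa using hx
    have h2 : ‖(2 : ℝ) • x‖ = 2 := by rw [norm_smul, hx1]; norm_num
    have : g ((2 : ℝ) • x) = (2 : ℝ) • x := by
      rw [hgS (show (2 : ℝ) ≤ ‖(2 : ℝ) • x‖ by rw [h2]), hF1 _ (by rw [h2]; norm_num)]
    simp only [this, h2, smul_smul]
    norm_num

end NoRetraction

/-! ### Labile points: a topological test for boundary points. -/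

section Labile

open Set Metric

/-- A point off which arbitrarily small parts of the space can be pushed. -/
def Labile {X : Type*} [TopologicalSpace X] (p : X) : Prop :=
  ∀ W ∈ 𝓝 p, ∃ (K : Set X) (f : X → X), IsCompact K ∧ K ⊆ W ∧ Continuous f ∧
    (∀ x ∉ K, f x = x) ∧ MapsTo f K K ∧ p ∉ range f

variable {X Y : Type*} [TopologicalSpace X] [TopologicalSpace Y]

/-- The deformation is supported in a compact set, which is closed in a Hausdorff space; so it
extends by the identity. -/
lemma Labile.of_isOpenEmbedding [T2Space Y] {e : X → Y} (he : IsOpenEmbedding e) {p : X}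
    (hp : Labile p) : Labile (e p) := by
  classical
  intro W hW
  obtain ⟨K, f, hK, hKW, hf, hid, hm, hpf⟩ := hp (e ⁻¹' W) (he.continuous.continuousAt hW)
  have hcl : IsClosed (e '' K) := (hK.image he.continuous).isClosed
  let F : Y → Y := fun y => if h : y ∈ range e then e (f h.choose) else y
  have hFe : ∀ x, F (e x) = e (f x) := by
    intro x
    have h : e x ∈ range e := ⟨x, rfl⟩
    simp only [F, dif_pos h]
    rw [he.injective h.choose_spec]
  have hFid : ∀ y ∉ e '' K, F y = y := by
    intro y hy
    by_cases h : y ∈ range e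
    · obtain ⟨x, rfl⟩ := h
      rw [hFe, hid x fun hx => hy ⟨x, hx, rfl⟩]
    · simp only [F, dif_neg h]
  refine ⟨e '' K, F, hK.image he.continuous, image_subset_iff.2 hKW, ?_, hFid, ?_, ?_⟩
  · rw [continuous_iff_continuousAt]
    intro y
    by_cases h : y ∈ range e
    · obtain ⟨x, rfl⟩ := h
      rw [← he.continuousAt_iff]
      have : F ∘ e = e ∘ f := funext hFe
      rw [this]
      exact (he.continuous.comp hf).continuousAt
    · have hy : (e '' K)ᶜ ∈ 𝓝 y :=
        hcl.isOpen_compl.mem_nhds fun hy => h (image_subset_range _ _ hy)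
      exact continuousAt_id.congr (Filter.mem_of_superset hy fun z hz => (hFid z hz).symm)
  · rintro _ ⟨x, hx, rfl⟩
    rw [hFe]
    exact ⟨_, hm hx, rfl⟩
  · rintro ⟨y, hy⟩
    by_cases h : y ∈ range e
    · obtain ⟨x, rfl⟩ := h
      rw [hFe] at hy
      exact hpf ⟨x, he.injective hy⟩
    · rw [hFid y fun hy => h (image_subset_range _ _ hy)] at hy
      exact h (hy ▸ ⟨p, rfl⟩)

lemma Labile.homeomorph (h : X ≃ₜ Y) {p : X} (hp : Labile p) : Labile (h p) := by
  intro W hW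
  obtain ⟨K, f, hK, hKW, hf, hid, hm, hpf⟩ := hp (h ⁻¹' W) (h.continuous.continuousAt hW)
  refine ⟨h '' K, h ∘ f ∘ h.symm, hK.image h.continuous, image_subset_iff.2 hKW, by fun_prop,
    ?_, ?_, ?_⟩
  · intro y hy
    have : h.symm y ∉ K := fun hk => hy ⟨_, hk, by simp⟩
    simp [hid _ this]
  · rintro _ ⟨x, hx, rfl⟩
    exact ⟨f x, hm hx, by simp⟩
  · rintro ⟨y, hy⟩
    exact hpf ⟨h.symm y, h.injective hy⟩

lemma labile_homeomorph_iff (h : X ≃ₜ Y) {p : X} : Labile (h p) ↔ Labile p :=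
  ⟨fun hp => by simpa using hp.homeomorph h.symm, fun hp => hp.homeomorph h⟩

/-- Points of the boundary of a half space are labile. -/
lemma labile_halfSpace {E : Type*} [NormedAddCommGroup E] [NormedSpace ℝ E]
    [FiniteDimensional ℝ E] (x₀ : E) : Labile ((x₀, ⟨0, mem_Ici.2 le_rfl⟩) : E × Ici (0 : ℝ)) := by
  intro W hW
  have : ProperSpace E := FiniteDimensional.proper ℝ E
  obtain ⟨δ, hδ, hball⟩ := Metric.mem_nhds_iff.1 hW
  -- The support is a pyramid of height `δ / 2` over a ball in the boundary, and each of its points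
  -- is lifted vertically to the upper face.
  refine ⟨{q | ‖q.1 - x₀‖ + (q.2 : ℝ) ≤ δ / 2},
    fun q => (q.1, ⟨max (q.2 : ℝ) (δ / 2 - ‖q.1 - x₀‖), mem_Ici.2 (le_max_of_le_left q.2.2)⟩), ?_, ?_, ?_, ?_,
    ?_, ?_⟩
  · have hc : IsCompact (closedBall x₀ (δ / 2) ×ˢ
        ((Subtype.val : Ici (0 : ℝ) → ℝ) ⁻¹' (Icc 0 (δ / 2)))) := by
      refine (isCompact_closedBall _ _).prod ?_
      exact isClosed_Ici.isClosedEmbedding_subtypeVal.isCompact_preimage isCompact_Icc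
    refine hc.of_isClosed_subset (isClosed_le (by fun_prop) continuous_const) ?_
    rintro ⟨x, h, hh⟩ hq
    simp only [mem_ofPred_eq] at hq
    rw [mem_Ici] at hh
    refine ⟨?_, hh, ?_⟩
    · rw [mem_closedBall, dist_eq_norm]; linarith
    · have := norm_nonneg (x - x₀)
      simp only
      linarith
  · rintro ⟨x, h, hh⟩ hq
    simp only [mem_ofPred_eq] at hq
    rw [mem_Ici] at hh
    apply hball
    rw [mem_ball, Prod.dist_eq, max_lt_iff]
    have := norm_nonneg (x - x₀)
    refine ⟨by rw [dist_eq_norm]; linarith, ?_⟩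
    rw [Subtype.dist_eq, Real.dist_eq, sub_zero, abs_of_nonneg hh]
    linarith
  · fun_prop
  · rintro ⟨x, h, hh⟩ hq
    simp only [mem_ofPred_eq, not_le] at hq
    ext1
    · rfl
    · ext1
      exact max_eq_left (by linarith)
  · rintro ⟨x, h, hh⟩ hq
    simp only [mem_ofPred_eq] at hq ⊢
    rcases max_cases h (δ / 2 - ‖x - x₀‖) with ⟨h1, -⟩ | ⟨h1, -⟩ <;> rw [h1] <;> linarith
  · rintro ⟨⟨x, h⟩, hq⟩
    simp only [Prod.mk.injEq, Subtype.mk.injEq] at hq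
    obtain ⟨rfl, hq⟩ := hq
    have := le_max_right (h : ℝ) (δ / 2 - ‖x - x‖)
    rw [hq] at this
    simp at this
    linarith

/-- Points with a Euclidean neighborhood are not labile. -/
lemma not_labile_of_chart {E : Type*} [NormedAddCommGroup E] [NormedSpace ℝ E]
    [FiniteDimensional ℝ E] {Ω : Set E} (hΩ : IsOpen Ω) {e : Ω → X} (he : IsOpenEmbedding e)
    (a : Ω) : ¬ Labile (e a) := by
  classical
  intro hl
  set T := toEuclidean (E := E) with hT
  obtain ⟨r, hr, hrΩ⟩ : ∃ r > 0, ∀ v : EuclideanSpace ℝ (Fin (Module.finrank ℝ E)),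
      ‖v‖ ≤ r → (a : E) + T.symm v ∈ Ω := by
    have hc : Continuous fun v => (a : E) + T.symm v := by fun_prop
    have : (fun v => (a : E) + T.symm v) ⁻¹' Ω ∈ 𝓝 0 :=
      hc.continuousAt.preimage_mem_nhds (by simpa using hΩ.mem_nhds a.2)
    obtain ⟨r, hr, h⟩ := Metric.nhds_basis_closedBall.mem_iff.1 this
    exact ⟨r, hr, fun v hv => h (by simpa using hv)⟩
  -- the chart on the closed unit ball
  let c : closedBall (0 : EuclideanSpace ℝ (Fin (Module.finrank ℝ E))) 1 → Ω := fun v =>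
    ⟨a + T.symm (r • (v : EuclideanSpace ℝ (Fin (Module.finrank ℝ E)))), hrΩ _ (by
      have := v.2
      rw [mem_closedBall_zero_iff] at this
      rw [norm_smul, Real.norm_of_nonneg hr.le]; nlinarith)⟩
  have hcc : Continuous c := by
    apply Continuous.subtype_mk
    fun_prop
  let d : Ω → EuclideanSpace ℝ (Fin (Module.finrank ℝ E)) := fun x => r⁻¹ • T ((x : E) - a)
  have hd : Continuous d := by
    simp only [d]
    fun_prop
  have hdc : ∀ v, d (c v) = v := by
    intro v
    simp [c, d, smul_smul, hr.ne']
  have hW : e '' {x | ‖d x‖ < 1} ∈ 𝓝 (e a) := by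
    refine (he.isOpenMap _ (isOpen_lt hd.norm continuous_const)).mem_nhds ⟨a, ?_, rfl⟩
    simp [d]
  obtain ⟨K, f, -, hKW, hf, hid, hm, hpf⟩ := hl _ hW
  -- The support `K` lies in the open unit ball of the chart and is mapped to itself, so the
  -- deformation restricts to a self-map of the closed unit ball.
  have hrange : ∀ v, ∃ w, f (e (c v)) = e (c w) := by
    intro v
    by_cases hv : e (c v) ∈ K
    · obtain ⟨x, hx, hxe⟩ := hKW (hm hv)
      simp only [mem_ofPred_eq] at hx
      refine ⟨⟨d x, by simpa using hx.le⟩, ?_⟩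
      rw [← hxe]
      congr 1
      ext1
      simp [c, d, smul_smul, hr.ne']
    · exact ⟨v, hid _ hv⟩
  choose w hw using hrange
  have hwc : Continuous w := by
    have h1 : Continuous fun v => e (c (w v)) := by
      simp_rw [← hw]
      exact hf.comp (he.continuous.comp hcc)
    have h2 : Continuous fun v => c (w v) := he.isEmbedding.continuous_iff.2 h1
    have h3 := hd.comp h2
    exact Continuous.subtype_mk h3 (fun v => by
      show d (c (w v)) ∈ _
      rw [hdc]; exact (w v).2) |>.congr fun v => Subtype.ext (hdc (w v))
  -- The self-map avoids the center and fixes the sphere, which is excluded by `no_retraction`. The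
  -- value outside the ball plays no role.
  let G : EuclideanSpace ℝ (Fin (Module.finrank ℝ E)) →
      EuclideanSpace ℝ (Fin (Module.finrank ℝ E)) := fun v =>
    if h : v ∈ closedBall (0 : EuclideanSpace ℝ (Fin (Module.finrank ℝ E))) 1 then w ⟨v, h⟩ else 0
  have hG : ∀ v : closedBall (0 : EuclideanSpace ℝ (Fin (Module.finrank ℝ E))) 1, G v = w v :=
    fun v => by simp only [G, dif_pos v.2]
  refine no_retraction (f := G) ?_ ?_ ?_
  · rw [continuousOn_iff_continuous_domRestrict]
    exact (continuous_subtype_val.comp hwc).congr fun v => (hG v).symm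
  · intro v hv h0
    have h1 := hG ⟨v, hv⟩
    simp only at h1
    rw [h0] at h1
    apply hpf
    refine ⟨e (c ⟨v, hv⟩), ?_⟩
    rw [hw]
    congr 1
    ext1
    simp [c, ← h1]
  · intro v hv
    have hv' : v ∈ closedBall (0 : EuclideanSpace ℝ (Fin (Module.finrank ℝ E))) 1 :=
      sphere_subset_closedBall hv
    have hnk : e (c ⟨v, hv'⟩) ∉ K := by
      intro hk
      obtain ⟨x, hx, hxe⟩ := hKW hk
      have hx' := he.injective hxe
      simp only [mem_ofPred_eq, hx', hdc] at hx
      rw [mem_sphere_zero_iff_norm] at hv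
      linarith
    have h1 := hid _ hnk
    rw [hw] at h1
    have h2 := congrArg d (he.injective h1)
    rw [hdc, hdc] at h2
    exact (hG ⟨v, hv'⟩).trans h2

end Labile

/-! ### Circle valued maps on the Klein bottle; the torus is not a Klein bottle. -/

section CircleMaps

open Set

lemma exp_eq_exp_iff {a b : ℝ} : Circle.exp a = Circle.exp b ↔ ∃ n : ℤ, a = b + n * (2 * Real.pi) := by
  rw [Circle.exp_eq_exp]

lemma exp_two_pi_int (n : ℤ) (a : ℝ) : Circle.exp (a + n * (2 * Real.pi)) = Circle.exp a :=
  exp_eq_exp_iff.2 ⟨n, rfl⟩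

lemma exists_lift {A : Type*} [TopologicalSpace A] [SimplyConnectedSpace A]
    [LocallyPathConnectedSpace A] {f : A → Circle} (hf : Continuous f) :
    ∃ φ : A → ℝ, Continuous φ ∧ ∀ a, Circle.exp (φ a) = f a := by
  obtain ⟨a₀⟩ := (inferInstance : Nonempty A)
  obtain ⟨e₀, he₀⟩ := Circle.exp_surjective (f a₀)
  obtain ⟨F, ⟨-, hF⟩, -⟩ := Circle.isCoveringMap_exp.existsUnique_continuousMap_lifts
    ⟨f, hf⟩ a₀ e₀ he₀
  exact ⟨F, F.continuous, fun a => congrFun hF a⟩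

/-- A continuous function with values in the integer multiples of `2π` is constant. -/
lemma constant_of_exp_eq_one {A : Type*} [TopologicalSpace A] [PreconnectedSpace A] {φ : A → ℝ}
    (hφ : Continuous φ) (h : ∀ a, Circle.exp (φ a) = 1) (a b : A) : φ a = φ b := by
  have h1 : ∀ a, ∃ n : ℤ, φ a = n * (2 * Real.pi) := by
    intro a
    have := h a
    rw [← Circle.exp_zero, exp_eq_exp_iff] at this
    simpa using this
  choose n hn using h1
  have hpi : (0 : ℝ) < 2 * Real.pi := by positivity
  have hnc : Continuous n := by
    have : Continuous fun a => ((n a : ℤ) : ℝ) := by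
      have h2 : (fun a => ((n a : ℤ) : ℝ)) = fun a => φ a / (2 * Real.pi) := by
        funext a
        rw [hn, mul_div_assoc, div_self hpi.ne', mul_one]
      rw [h2]
      fun_prop
    exact (Int.isClosedEmbedding_coe_real.isEmbedding.continuous_iff).2 this
  rw [hn a, hn b, PreconnectedSpace.constant inferInstance hnc (x := a) (y := b)]

/-- A power of the circle which is the exponential of a real function is trivial. -/
lemma zpow_eq_zero_of_lift {θ : Circle → ℝ} (hθ : Continuous θ) {n : ℤ}
    (h : ∀ z : Circle, Circle.exp (θ z) = z ^ n) : n = 0 := by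
  have h1 := constant_of_exp_eq_one (A := ℝ) (φ := fun s => θ (Circle.exp s) - n * s)
    (by fun_prop) (fun s => by
      rw [Circle.exp_sub, h, Circle.exp_intCast_mul, div_self']) (0 + (1 : ℤ) * (2 * Real.pi)) 0
  simp only [exp_two_pi_int] at h1
  have hpi := Real.pi_pos
  have : (n : ℝ) * (2 * Real.pi) = 0 := by
    simp at h1 ⊢
    tauto
  rcases mul_eq_zero.1 this with h | h
  · exact_mod_cast h
  · linarith

/-- The universal covering of the Klein bottle. -/
def kleinMap (p : ℝ × ℝ) : KleinBottle :=
  Quotient.mk (mappingTorusSetoid (Homeomorph.inv Circle)) (Circle.exp p.1, p.2)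

lemma continuous_kleinMap : Continuous kleinMap := by
  have : Continuous (Quotient.mk (mappingTorusSetoid (Homeomorph.inv Circle))) :=
    continuous_quotient_mk'
  exact this.comp (by fun_prop)

lemma kleinMap_shift (s x : ℝ) : kleinMap (s, x + 1) = kleinMap (-s, x) := by
  have : mappingTorusSetoid (Homeomorph.inv Circle) (Circle.exp (-s), x) (Circle.exp s, x + 1) :=
    ⟨1, by simp [Circle.exp_neg]⟩
  exact (Quotient.sound this).symm

lemma kleinMap_period (s x : ℝ) : kleinMap (s + 2 * Real.pi, x) = kleinMap (s, x) := by
  have := exp_two_pi_int 1 s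
  rw [Int.cast_one, one_mul] at this
  exact congrArg (fun z => Quotient.mk (mappingTorusSetoid (Homeomorph.inv Circle)) (z, x)) this

lemma kleinMap_surjective : Function.Surjective kleinMap := by
  intro q
  induction q using Quotient.inductionOn with
  | h p =>
    obtain ⟨s, hs⟩ := Circle.exp_surjective p.1
    exact ⟨(s, p.2), congrArg
      (fun z => Quotient.mk (mappingTorusSetoid (Homeomorph.inv Circle)) (z, p.2)) hs⟩

lemma isOpenQuotientMap_kleinMap : IsOpenQuotientMap kleinMap := by
  have h1 : IsOpenQuotientMap (fun p : ℝ × ℝ => (Circle.exp p.1, p.2)) :=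
    (IsOpenQuotientMap.prodMap
      ⟨Circle.exp_surjective, Circle.exp.continuous, isLocalHomeomorph_circleExp.isOpenMap⟩
      IsOpenQuotientMap.id)
  refine IsOpenQuotientMap.comp (g := Quotient.mk (mappingTorusSetoid (Homeomorph.inv Circle)))
    ⟨Quotient.mk_surjective, continuous_quotient_mk', ?_⟩ h1
  intro U hU
  have : Quotient.mk (mappingTorusSetoid (Homeomorph.inv Circle)) ⁻¹'
      (Quotient.mk (mappingTorusSetoid (Homeomorph.inv Circle)) '' U) =
      ⋃ n : ℤ, (fun a : Circle × ℝ => ((Homeomorph.inv Circle ^ n) a.1, a.2 + (n : ℝ))) ⁻¹' U := by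
    ext a
    simp only [mem_preimage, mem_image, mem_iUnion]
    constructor
    · rintro ⟨b, hb, hba⟩
      obtain ⟨n, hn⟩ := Quotient.exact hba.symm
      exact ⟨n, hn ▸ hb⟩
    · rintro ⟨n, hn⟩
      have hr : mappingTorusSetoid (Homeomorph.inv Circle) a
        ((Homeomorph.inv Circle ^ n) a.1, a.2 + (n : ℝ)) := ⟨n, rfl⟩
      exact ⟨_, hn, (Quotient.sound hr).symm⟩
  rw [← isQuotientMap_quotient_mk'.isOpen_preimage]
  refine this ▸ isOpen_iUnion fun n => hU.preimage ?_
  have := (Homeomorph.inv Circle ^ n).continuous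
  fun_prop

/-- A circle valued map on the Klein bottle is, up to homotopy, determined by one integer: the map
lifts to the universal covering, with trivial degree along the fibers. -/
lemma klein_lift {f : KleinBottle → Circle} (hf : Continuous f) :
    ∃ (φ : ℝ × ℝ → ℝ) (k : ℤ), Continuous φ ∧ (∀ p, Circle.exp (φ p) = f (kleinMap p)) ∧
      (∀ s x, φ (s + 2 * Real.pi, x) = φ (s, x)) ∧
      (∀ s x, φ (s, x + 1) = φ (-s, x) + k * (2 * Real.pi)) := by
  obtain ⟨φ, hφ, hφf⟩ := exists_lift (hf.comp continuous_kleinMap)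
  have hd := constant_of_exp_eq_one (A := ℝ × ℝ)
    (φ := fun p => φ (p.1 + 2 * Real.pi, p.2) - φ p) (by fun_prop) (fun p => by
      rw [Circle.exp_sub, hφf, hφf]
      simp [kleinMap_period])
  have hk := constant_of_exp_eq_one (A := ℝ × ℝ)
    (φ := fun p => φ (p.1, p.2 + 1) - φ (-p.1, p.2)) (by fun_prop) (fun p => by
      rw [Circle.exp_sub, hφf, hφf]
      simp [kleinMap_shift])
  obtain ⟨k, hk0⟩ : ∃ k : ℤ, φ (0, 0 + 1) - φ (-0, 0) = k * (2 * Real.pi) := by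
    have : Circle.exp (φ (0, 0 + 1)) = Circle.exp (φ (-0, 0)) := by
      rw [hφf, hφf]; simp only [Function.comp_apply, kleinMap_shift]
    obtain ⟨k, hk⟩ := exp_eq_exp_iff.1 this
    exact ⟨k, by rw [hk]; ring⟩
  refine ⟨φ, k, hφ, hφf, ?_, ?_⟩
  · intro s x
    -- The degree along a fiber is the constant increment over a period in `s`. Going once around
    -- the base reverses the fiber, so this increment equals its own negative.
    have h1 := hk (s + 2 * Real.pi, x) (s, x)
    have h2 := hd (s, x + 1) (s, x)
    have h3 := hd (-(s + 2 * Real.pi), x) (s, x)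
    simp only at h1 h2 h3
    rw [show -(s + 2 * Real.pi) + 2 * Real.pi = -s by ring] at h3
    linarith
  · intro s x
    have := hk (s, x) (0, 0)
    simp only at this
    linarith

/-- The degrees along the fibers vanish, so each map has a single winding number, the one along the
base. Some nontrivial integer combination of the two winding numbers is zero, and the corresponding
combination of the lifts is invariant under the deck transformations, hence descends. -/
lemma klein_dependent {f g : KleinBottle → Circle} (hf : Continuous f) (hg : Continuous g) :
    ∃ (m n : ℤ) (θ : KleinBottle → ℝ), (m ≠ 0 ∨ n ≠ 0) ∧ Continuous θ ∧
      ∀ q, Circle.exp (θ q) = f q ^ m * g q ^ n := by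
  obtain ⟨φ, k, hφ, hφf, hφp, hφs⟩ := klein_lift hf
  obtain ⟨ψ, l, hψ, hψg, hψp, hψs⟩ := klein_lift hg
  obtain ⟨m, n, hmn, hkl⟩ : ∃ m n : ℤ, (m ≠ 0 ∨ n ≠ 0) ∧ m * k + n * l = 0 := by
    by_cases hk : k = 0
    · exact ⟨1, 0, Or.inl one_ne_zero, by simp [hk]⟩
    · exact ⟨-l, k, Or.inr hk, by ring⟩
  set χ : ℝ × ℝ → ℝ := fun p => m * φ p + n * ψ p with hχ
  have hχp : ∀ s x, χ (s + 2 * Real.pi, x) = χ (s, x) := fun s x => by simp only [hχ, hφp, hψp]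
  have hχs : ∀ s x, χ (s, x + 1) = χ (-s, x) := fun s x => by
    simp only [hχ, hφs, hψs]
    have : ((m * k + n * l : ℤ) : ℝ) = 0 := by rw [hkl]; simp
    push_cast at this
    linear_combination (2 * Real.pi) * this
  have hper : ∀ (s x : ℝ) (j : ℤ), χ (s + j * (2 * Real.pi), x) = χ (s, x) := by
    intro s x j
    induction j using Int.induction_on with
    | zero => simp
    | succ i ih =>
      rw [← ih, ← hχp (s + ((i : ℤ) : ℝ) * (2 * Real.pi))]
      congr 2; push_cast; ring
    | pred i ih =>
      rw [← ih, ← hχp (s + ((-(i : ℤ) - 1 : ℤ) : ℝ) * (2 * Real.pi))]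
      congr 2; push_cast; ring
  have hzp : ∀ (z w : Circle) (s s' x x' : ℝ) (j : ℤ), Circle.exp s = z → Circle.exp s' = w →
      (w, x') = ((Homeomorph.inv Circle ^ j) z, x + j) → χ (s, x) = χ (s', x') := by
    intro z w s s' x x' j
    induction j using Int.induction_on generalizing z s x with
    | zero =>
      rintro rfl rfl h
      simp only [zpow_zero, Homeomorph.one_apply, Int.cast_zero, add_zero, Prod.mk.injEq] at h
      obtain ⟨j, rfl⟩ := exp_eq_exp_iff.1 h.1
      rw [h.2, hper]
    | succ i ih =>
      rintro rfl hw h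
      rw [show χ (s, x) = χ (-s, x + 1) by rw [hχs, neg_neg]]
      refine ih _ _ _ rfl hw ?_
      rw [h, zpow_add, zpow_one, Homeomorph.mul_apply]
      simp [Circle.exp_neg]
      ring
    | pred i ih =>
      rintro rfl hw h
      rw [show χ (s, x) = χ (-s, x - 1) by
        have := hχs s (x - 1)
        rw [sub_add_cancel] at this
        exact this]
      refine ih _ _ _ rfl hw ?_
      have hi : (Homeomorph.inv Circle)⁻¹ = Homeomorph.inv Circle := rfl
      rw [h, zpow_sub, zpow_one, hi, Homeomorph.mul_apply]
      simp [Circle.exp_neg]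
      ring
  have hq := isOpenQuotientMap_kleinMap.isQuotientMap
  have hcomp : ∀ p p', kleinMap p = kleinMap p' → χ p = χ p' := by
    intro p p' h
    obtain ⟨j, hj⟩ := Quotient.exact h
    exact hzp _ _ _ _ _ _ j rfl rfl hj
  choose sec hsec using kleinMap_surjective
  have hθ : (fun q => χ (sec q)) ∘ kleinMap = χ := by
    funext p
    exact hcomp _ _ (hsec _)
  refine ⟨m, n, fun q => χ (sec q), hmn, ?_, ?_⟩
  · rw [hq.continuous_iff, hθ]
    fun_prop
  · intro q
    simp only [hχ]
    rw [Circle.exp_add, Circle.exp_intCast_mul, Circle.exp_intCast_mul, hφf, hψg, hsec]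

/-- A dependence between the two projections of the torus, restricted to a coordinate circle, would
make a nontrivial power of the circle the exponential of a real function. -/
lemma not_homeomorph_torus_klein (h : Circle × Circle ≃ₜ KleinBottle) : False := by
  obtain ⟨m, n, θ, hmn, hθ, hθe⟩ := klein_dependent
    (f := fun q => (h.symm q).1) (g := fun q => (h.symm q).2) (by fun_prop) (by fun_prop)
  rcases hmn with hm | hn
  · refine hm (zpow_eq_zero_of_lift (θ := fun z => θ (h (z, 1))) (by fun_prop) fun z => ?_)
    rw [hθe]; simp
  · refine hn (zpow_eq_zero_of_lift (θ := fun z => θ (h (1, z))) (by fun_prop) fun z => ?_)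
    rw [hθe]; simp

end CircleMaps

/-! ### Isotopies of homeomorphisms of the circle. -/

section CircleIsotopy

open Set

/-- Inversion of the circle, or the identity. -/
def flipIf (b : Bool) (z : Circle) : Circle := if b then z⁻¹ else z

lemma quasiperiodic_int (G : ℝ → ℝ) (e : ℤ)
    (hG : ∀ s, G (s + 2 * Real.pi) = G s + e * (2 * Real.pi)) (s : ℝ) (j : ℤ) :
    G (s + j * (2 * Real.pi)) = G s + j * e * (2 * Real.pi) := by
  induction j using Int.induction_on with
  | zero => simp
  | succ i ih =>
    have := hG (s + ((i : ℤ) : ℝ) * (2 * Real.pi))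
    rw [ih] at this
    push_cast at this ⊢
    rw [show s + ((i : ℝ) + 1) * (2 * Real.pi) = s + i * (2 * Real.pi) + 2 * Real.pi by ring, this]
    ring
  | pred i ih =>
    have := hG (s + ((-(i : ℤ) - 1 : ℤ) : ℝ) * (2 * Real.pi))
    push_cast at this ih ⊢
    rw [show s + (-(i : ℝ) - 1) * (2 * Real.pi) + 2 * Real.pi = s + -i * (2 * Real.pi) by ring,
      ih] at this
    linarith

/-- The straight line from the lift `F` to the identity runs through increasing functions commuting
with translation by `2π`, so it descends to an isotopy of the circle. -/
lemma isotopy_of_lift {f : Circle → Circle} {F : ℝ → ℝ} (hF : Continuous F) (hm : StrictMono F)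
    (hper : ∀ s, F (s + 2 * Real.pi) = F s + 2 * Real.pi)
    (hlift : ∀ s, Circle.exp (F s) = f (Circle.exp s)) :
    ∃ H : (Icc (0 : ℝ) 1 × Circle) ≃ₜ (Icc (0 : ℝ) 1 × Circle), (∀ p, (H p).1 = p.1) ∧
      ∀ (p : Icc (0 : ℝ) 1 × Circle), ((p.1 : ℝ) = 0 → (H p).2 = f p.2) ∧
        ((p.1 : ℝ) = 1 → (H p).2 = p.2) := by
  set G : Icc (0 : ℝ) 1 → ℝ → ℝ := fun τ s => (1 - (τ : ℝ)) * F s + τ * s with hG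
  have hGm : ∀ τ, StrictMono (G τ) := by
    intro τ s s' hs
    have h1 := hm hs
    have h2 := τ.2.1
    have h3 := τ.2.2
    simp only [hG]
    rcases h2.eq_or_lt with h | h
    · rw [← h]; linarith
    · nlinarith
  have hGp : ∀ τ s (j : ℤ), G τ (s + j * (2 * Real.pi)) = G τ s + j * (2 * Real.pi) := by
    intro τ s j
    have := quasiperiodic_int (G τ) 1 (fun s => by simp only [hG, hper]; push_cast; ring) s j
    rw [this]; simp
  have hGc : Continuous fun p : Icc (0 : ℝ) 1 × ℝ => G p.1 p.2 := by
    simp only [hG]; fun_prop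
  set h : Icc (0 : ℝ) 1 × Circle → Icc (0 : ℝ) 1 × Circle :=
    fun p => (p.1, Circle.exp (G p.1 (Complex.arg p.2))) with hh
  -- The map was defined by the discontinuous choice of the principal argument; equivariance of `G`
  -- makes the choice immaterial.
  have hexp : ∀ τ s, h (τ, Circle.exp s) = (τ, Circle.exp (G τ s)) := by
    intro τ s
    obtain ⟨n, hn⟩ := exp_eq_exp_iff.1 (Circle.exp_arg (Circle.exp s))
    simp only [hh]
    rw [hn, hGp, exp_two_pi_int]
  have hq : IsOpenQuotientMap (fun p : Icc (0 : ℝ) 1 × ℝ => (p.1, Circle.exp p.2)) :=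
    IsOpenQuotientMap.prodMap IsOpenQuotientMap.id
      ⟨Circle.exp_surjective, Circle.exp.continuous, isLocalHomeomorph_circleExp.isOpenMap⟩
  have hc : Continuous h := by
    rw [hq.isQuotientMap.continuous_iff]
    have : h ∘ (fun p : Icc (0 : ℝ) 1 × ℝ => (p.1, Circle.exp p.2)) =
        fun p => (p.1, Circle.exp (G p.1 p.2)) := funext fun p => hexp _ _
    rw [this]
    fun_prop
  have hbij : Function.Bijective h := by
    constructor
    · rintro ⟨τ, z⟩ ⟨τ', z'⟩ hzz
      obtain ⟨s, rfl⟩ := Circle.exp_surjective z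
      obtain ⟨s', rfl⟩ := Circle.exp_surjective z'
      rw [hexp, hexp, Prod.mk.injEq] at hzz
      obtain ⟨rfl, h2⟩ := hzz
      obtain ⟨n, hn⟩ := exp_eq_exp_iff.1 h2
      rw [← hGp] at hn
      rw [(hGm τ).injective hn, exp_two_pi_int]
    · rintro ⟨τ, z⟩
      obtain ⟨y, rfl⟩ := Circle.exp_surjective z
      have : y ∈ range (G τ) := by
        obtain ⟨n, hn⟩ := exists_nat_gt (|y - G τ 0|)
        have hpi : (1 : ℝ) ≤ 2 * Real.pi := by linarith [Real.pi_gt_three]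
        have hn' : |y - G τ 0| ≤ n * (2 * Real.pi) :=
          hn.le.trans (le_mul_of_one_le_right (Nat.cast_nonneg n) hpi)
        obtain ⟨h1, h2⟩ := abs_le.1 hn'
        have e1 := hGp τ 0 (n : ℤ)
        have e2 := hGp τ 0 (-(n : ℤ))
        push_cast at e1 e2
        refine mem_range_of_exists_le_of_exists_ge (hGc.comp (Continuous.prodMk_right τ))
          ⟨0 + -(n : ℝ) * (2 * Real.pi), ?_⟩ ⟨0 + (n : ℝ) * (2 * Real.pi), ?_⟩
        · rw [e2]; linarith
        · rw [e1]; linarith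
      obtain ⟨s, rfl⟩ := this
      exact ⟨(τ, Circle.exp s), hexp _ _⟩
  refine ⟨Continuous.homeoOfEquivCompactToT2 (f := Equiv.ofBijective h hbij) hc, fun p => rfl, ?_⟩
  rintro ⟨τ, z⟩
  obtain ⟨s, rfl⟩ := Circle.exp_surjective z
  have : (Continuous.homeoOfEquivCompactToT2 (f := Equiv.ofBijective h hbij) hc)
      (τ, Circle.exp s) = (τ, Circle.exp (G τ s)) := hexp _ _
  rw [this]
  constructor
  · intro h0
    simp only at h0
    simp [hG, h0, hlift]
  · intro h1
    simp only at h1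
    simp [hG, h1]

/-- Every homeomorphism of the circle is isotopic to the identity or to the inversion. -/
lemma circle_isotopy (f : Circle ≃ₜ Circle) :
    ∃ (b : Bool) (H : (Icc (0 : ℝ) 1 × Circle) ≃ₜ (Icc (0 : ℝ) 1 × Circle)),
      (∀ p, (H p).1 = p.1) ∧
      ∀ (p : Icc (0 : ℝ) 1 × Circle), ((p.1 : ℝ) = 0 → (H p).2 = f p.2) ∧
        ((p.1 : ℝ) = 1 → (H p).2 = flipIf b p.2) := by
  have key : ∀ f : Circle ≃ₜ Circle, ∃ (F : ℝ → ℝ) (d : ℤ), Continuous F ∧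
      (∀ s, Circle.exp (F s) = f (Circle.exp s)) ∧
      ∀ s, F (s + 2 * Real.pi) = F s + d * (2 * Real.pi) := by
    intro f
    obtain ⟨F, hF, hl⟩ := exists_lift (A := ℝ) (f := fun s => f (Circle.exp s)) (by fun_prop)
    have h1 : Circle.exp (F (0 + 2 * Real.pi)) = Circle.exp (F 0) := by
      rw [hl, hl]; simp
    obtain ⟨d, hd⟩ := exp_eq_exp_iff.1 h1
    refine ⟨F, d, hF, hl, fun s => ?_⟩
    have := constant_of_exp_eq_one (A := ℝ) (φ := fun s => F (s + 2 * Real.pi) - F s)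
      (by fun_prop) (fun s => by rw [Circle.exp_sub, hl, hl]; simp) s 0
    linarith
  obtain ⟨F, d, hF, hFl, hFp⟩ := key f
  obtain ⟨G, e, hG, hGl, hGp1⟩ := key f.symm
  have hGp := quasiperiodic_int G e hGp1
  have hGF : ∀ s, G (F s) - s = G (F 0) - 0 := fun s =>
    constant_of_exp_eq_one (A := ℝ) (φ := fun s => G (F s) - s) (by fun_prop)
      (fun s => by rw [Circle.exp_sub, hGl, hFl]; simp) s 0
  -- Degrees multiply, so the degree of a homeomorphism is `±1`.
  have hde : d * e = 1 := by
    have h1 := hGF (0 + 2 * Real.pi)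
    rw [hFp, hGp] at h1
    have : ((d : ℝ) * e - 1) * (2 * Real.pi) = 0 := by linarith
    rcases mul_eq_zero.1 this with h | h
    · have : (d : ℝ) * e = 1 := by linarith
      exact_mod_cast this
    · linarith [Real.pi_pos]
  have hinj : Function.Injective F := by
    intro s s' h
    have h1 := hGF s
    have h2 := hGF s'
    rw [h] at h1
    linarith
  have hpi := Real.pi_pos
  have hd0 := hFp 0
  rcases Int.eq_one_or_neg_one_of_mul_eq_one hde with hd | hd
  · subst hd
    have hm : StrictMono F := by
      rcases hF.strictMono_of_inj hinj with h | h
      · exact h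
      · have := h (show (0 : ℝ) < 0 + 2 * Real.pi by linarith)
        push_cast at hd0
        linarith
    obtain ⟨H, hH⟩ := isotopy_of_lift hF hm (fun s => by rw [hFp]; simp) hFl
    exact ⟨false, H, hH⟩
  · subst hd
    have hm : StrictAnti F := by
      rcases hF.strictMono_of_inj hinj with h | h
      · have := h (show (0 : ℝ) < 0 + 2 * Real.pi by linarith)
        push_cast at hd0
        linarith
      · exact h
    -- In degree `-1` precomposition with the inversion gives an increasing lift; the inversion is
    -- then put back in front of the isotopy.
    obtain ⟨H, hH1, hH2⟩ := isotopy_of_lift (f := fun z => f z⁻¹) (F := fun s => F (-s))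
      (by fun_prop) (fun s s' hs => hm (neg_lt_neg hs)) (fun s => by
        have := hFp (-(s + 2 * Real.pi))
        push_cast at this
        rw [show -(s + 2 * Real.pi) + 2 * Real.pi = -s by ring] at this
        linarith) (fun s => by rw [hFl, Circle.exp_neg])
    refine ⟨true, ((Homeomorph.refl _).prodCongr (Homeomorph.inv Circle)).trans H, ?_, ?_⟩
    · intro p
      exact hH1 _
    · intro p
      have := hH2 (p.1, p.2⁻¹)
      simp only [inv_inv] at this
      exact this

end CircleIsotopy

/-! ### Maps between quotient spaces. -/

section QuotientEmbeddings

open Set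

variable {A X B Z : Type*} [TopologicalSpace A] [TopologicalSpace X] [TopologicalSpace B]
  [TopologicalSpace Z] {q₀ : A → X} {q : B → Z} {ι : A → B} {f : X → Z}

lemma continuous_of_quotient (hq₀ : IsQuotientMap q₀) (hq : Continuous q) (hι : Continuous ι)
    (hf : ∀ a, f (q₀ a) = q (ι a)) : Continuous f := by
  rw [hq₀.continuous_iff, show f ∘ q₀ = q ∘ ι from funext hf]
  exact hq.comp hι

lemma injective_of_quotient (hq₀ : Function.Surjective q₀) (hf : ∀ a, f (q₀ a) = q (ι a))
    (hker : ∀ a a', q (ι a) = q (ι a') → q₀ a = q₀ a') : Function.Injective f := by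
  intro x x' h
  obtain ⟨a, rfl⟩ := hq₀ x
  obtain ⟨a', rfl⟩ := hq₀ x'
  rw [hf, hf] at h
  exact hker _ _ h

lemma preimage_image_of_quotient (hq₀ : Function.Surjective q₀) (hf : ∀ a, f (q₀ a) = q (ι a))
    (hsat : ∀ a b, q (ι a) = q b → ∃ a', ι a' = b ∧ q₀ a' = q₀ a) (U : Set X) :
    q ⁻¹' (f '' U) = ι '' (q₀ ⁻¹' U) := by
  ext b
  constructor
  · rintro ⟨x, hx, hxb⟩
    obtain ⟨a, rfl⟩ := hq₀ x
    rw [hf] at hxb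
    obtain ⟨a', rfl, ha'⟩ := hsat _ _ hxb
    exact ⟨a', by rwa [mem_preimage, ha'], rfl⟩
  · rintro ⟨a, ha, rfl⟩
    exact ⟨q₀ a, ha, hf a⟩

/-- A map of quotients induced by an open embedding with saturated image is an open embedding. -/
lemma isOpenEmbedding_of_quotient (hq₀ : IsQuotientMap q₀) (hq : IsQuotientMap q)
    (hι : IsOpenEmbedding ι) (hf : ∀ a, f (q₀ a) = q (ι a))
    (hsat : ∀ a b, q (ι a) = q b → ∃ a', ι a' = b ∧ q₀ a' = q₀ a) : IsOpenEmbedding f := by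
  refine IsOpenEmbedding.of_continuous_injective_isOpenMap
    (continuous_of_quotient hq₀ hq.continuous hι.continuous hf)
    (injective_of_quotient hq₀.surjective hf ?_) ?_
  · intro a a' h
    obtain ⟨a'', h1, h2⟩ := hsat _ _ h
    rw [hι.injective h1] at h2
    exact h2.symm
  · intro U hU
    rw [← hq.isOpen_preimage, preimage_image_of_quotient hq₀.surjective hf hsat]
    exact hι.isOpenMap _ (hU.preimage hq₀.continuous)

lemma isClosedEmbedding_of_injective [CompactSpace X] [T2Space Z] (hf : Continuous f)
    (hi : Function.Injective f) : IsClosedEmbedding f :=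
  hf.isClosedEmbedding hi

lemma isQuotientMap_of_compact [CompactSpace A] [T2Space X] (hf : Continuous q₀)
    (hs : Function.Surjective q₀) : IsQuotientMap q₀ :=
  hf.isClosedMap.isQuotientMap hf hs

/-- Two quotients of a space with the same kernel are homeomorphic. -/
lemma exists_homeomorph_of_quotient {q' : A → Z} (h : IsQuotientMap q₀) (h' : IsQuotientMap q')
    (hk : ∀ a b, q₀ a = q₀ b ↔ q' a = q' b) : ∃ e : X ≃ₜ Z, ∀ a, e (q₀ a) = q' a := by
  choose s hs using h.surjective
  have hf : ∀ a, q' (s (q₀ a)) = q' (id a) := fun a => (hk _ _).1 (hs _)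
  have hf' := isOpenEmbedding_of_quotient (f := fun x => q' (s x)) h h' IsOpenEmbedding.id hf
    (fun a b hab => ⟨b, rfl, (hk _ _).2 hab.symm⟩)
  refine ⟨hf'.isEmbedding.toHomeomorphOfSurjective ?_, hf⟩
  intro z
  obtain ⟨a, rfl⟩ := h'.surjective z
  exact ⟨q₀ a, hf a⟩

end QuotientEmbeddings

/-! ### Labelled spaces: circle spaces given by label and size functions on a base. -/

section LabelledSpaces

open Set

/-- The point with phase `z` of the orbit with label `ℓ` and size `u`: the orbit is free when
`u ≠ 0`; when `u = 0` it is a fixed point if `ℓ ≤ 0`, and has isotropy `±1` if `0 < ℓ`. -/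
def lab (ℓ u : ℝ) (z : Circle) : ℂ × ℂ := ((u : ℂ) * z, ((max ℓ 0 : ℝ) : ℂ) * (z : ℂ) ^ 2)

lemma lab_eq_iff {ℓ u : ℝ} {z z' : Circle} :
    lab ℓ u z = lab ℓ u z' ↔ z = z' ∨ (u = 0 ∧ (ℓ ≤ 0 ∨ z' = -z)) := by
  constructor
  · intro h
    simp only [lab, Prod.mk.injEq, mul_eq_mul_left_iff, Complex.ofReal_eq_zero] at h
    obtain ⟨h1, h2⟩ := h
    rcases h1 with h1 | h1
    · exact Or.inl (Circle.ext h1)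
    rcases h2 with h2 | h2
    · rcases sq_eq_sq_iff_eq_or_eq_neg.1 h2 with h3 | h3
      · exact Or.inl (Circle.ext h3)
      · exact Or.inr ⟨h1, Or.inr (Circle.ext (by simp [h3]))⟩
    · exact Or.inr ⟨h1, Or.inl (max_eq_right_iff.1 h2)⟩
  · rintro (rfl | ⟨rfl, h | rfl⟩)
    · rfl
    · simp [lab, max_eq_right h]
    · simp [lab]

lemma norm_lab_fst {ℓ u : ℝ} (hu : 0 ≤ u) (z : Circle) : ‖(lab ℓ u z).1‖ = u := by
  simp only [lab, norm_mul, Circle.norm_coe, mul_one, Complex.norm_real]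
  exact abs_of_nonneg hu

variable {β γ : Type*} [TopologicalSpace β] [TopologicalSpace γ]

/-- The space fibered over `S` by the orbits with labels `ℓ` and sizes `u`. -/
def Lab (S : Set β) (ℓ u : β → ℝ) : Set (β × ℂ × ℂ) :=
  {p | p.1 ∈ S ∧ ∃ z : Circle, p.2 = lab (ℓ p.1) (u p.1) z}

variable {S : Set β} {ℓ u : β → ℝ} {S' : Set γ} {ℓ' u' : γ → ℝ}

/-- The point of `Lab S ℓ u` over `b` with phase `z`. -/
def labMk (S : Set β) (ℓ u : β → ℝ) (p : S × Circle) : Lab S ℓ u :=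
  ⟨(p.1, lab (ℓ p.1) (u p.1) p.2), p.1.2, p.2, rfl⟩

lemma labMk_surjective : Function.Surjective (labMk S ℓ u) := by
  rintro ⟨⟨b, v⟩, hb, z, hz⟩
  exact ⟨(⟨b, hb⟩, z), Subtype.ext (Prod.ext rfl hz.symm)⟩

lemma labMk_eq_iff {p q : S × Circle} :
    labMk S ℓ u p = labMk S ℓ u q ↔
      p.1 = q.1 ∧ (p.2 = q.2 ∨ (u p.1 = 0 ∧ (ℓ p.1 ≤ 0 ∨ q.2 = -p.2))) := by
  obtain ⟨b, z⟩ := p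
  obtain ⟨b', z'⟩ := q
  constructor
  · intro h
    have h1 : b = b' := Subtype.ext (congrArg (fun x : Lab S ℓ u => (x : β × ℂ × ℂ).1) h)
    subst h1
    have h2 := congrArg (fun x : Lab S ℓ u => (x : β × ℂ × ℂ).2) h
    exact ⟨rfl, lab_eq_iff.1 h2⟩
  · rintro ⟨h1, h2⟩
    simp only at h1
    subst h1
    exact Subtype.ext (Prod.ext rfl (lab_eq_iff.2 h2))

lemma continuous_labMk (hℓ : ContinuousOn ℓ S) (hu : ContinuousOn u S) :
    Continuous (labMk S ℓ u) := by
  rw [continuousOn_iff_continuous_domRestrict] at hℓ hu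
  have h1 : Continuous fun p : S × Circle => ((max (ℓ p.1) 0 : ℝ) : ℂ) :=
    Complex.continuous_ofReal.comp ((hℓ.comp continuous_fst).max continuous_const)
  have h2 : Continuous fun p : S × Circle => (u p.1 : ℂ) :=
    Complex.continuous_ofReal.comp (hu.comp continuous_fst)
  refine Continuous.subtype_mk ?_ _
  simp only [lab]
  exact Continuous.prodMk (by fun_prop) ((h2.mul (by fun_prop)).prodMk (h1.mul (by fun_prop)))

/-- Followed by the projection to the base this is the projection of `S × Circle` along a compact
factor. Properness makes `labMk` a quotient map also over noncompact bases. -/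
lemma isProperMap_labMk [T2Space β] (hℓ : ContinuousOn ℓ S) (hu : ContinuousOn u S) :
    IsProperMap (labMk S ℓ u) := by
  refine isProperMap_of_comp_of_t2 (g := fun p : Lab S ℓ u => (⟨(p : β × ℂ × ℂ).1, p.2.1⟩ : S))
    (continuous_labMk hℓ hu) (by fun_prop) ?_
  exact isProperMap_fst_of_compactSpace

lemma isQuotientMap_labMk [T2Space β] (hℓ : ContinuousOn ℓ S) (hu : ContinuousOn u S) :
    IsQuotientMap (labMk S ℓ u) :=
  (isProperMap_labMk hℓ hu).isClosedMap.isQuotientMap (continuous_labMk hℓ hu) labMk_surjective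

lemma compactSpace_lab (hS : IsCompact S) (hℓ : ContinuousOn ℓ S) (hu : ContinuousOn u S) :
    CompactSpace (Lab S ℓ u) := by
  have : CompactSpace S := isCompact_iff_compactSpace.1 hS
  exact labMk_surjective.compactSpace (continuous_labMk hℓ hu)

/-- Rotation of the orbits. -/
instance : MulAction Circle (Lab S ℓ u) where
  smul z p := ⟨((p : β × ℂ × ℂ).1, (z : ℂ) * (p : β × ℂ × ℂ).2.1, (z : ℂ) ^ 2 * (p : β × ℂ × ℂ).2.2),
    p.2.1, by
      obtain ⟨ζ, hζ⟩ := p.2.2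
      refine ⟨z * ζ, ?_⟩
      rw [hζ]
      simp only [lab, Circle.coe_mul]
      exact Prod.ext (by ring) (by ring)⟩
  one_smul p := Subtype.ext (by
    show ((p : β × ℂ × ℂ).1, _, _) = _
    simp)
  mul_smul z w p := Subtype.ext (by
    show ((p : β × ℂ × ℂ).1, ((z * w : Circle) : ℂ) * (p : β × ℂ × ℂ).2.1,
        ((z * w : Circle) : ℂ) ^ 2 * (p : β × ℂ × ℂ).2.2) =
      ((p : β × ℂ × ℂ).1, (z : ℂ) * ((w : ℂ) * (p : β × ℂ × ℂ).2.1),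
        (z : ℂ) ^ 2 * ((w : ℂ) ^ 2 * (p : β × ℂ × ℂ).2.2))
    rw [Circle.coe_mul, mul_assoc, mul_pow, mul_assoc])

lemma coe_smul_lab (z : Circle) (p : Lab S ℓ u) : ((z • p : Lab S ℓ u) : β × ℂ × ℂ) =
    ((p : β × ℂ × ℂ).1, (z : ℂ) * (p : β × ℂ × ℂ).2.1, (z : ℂ) ^ 2 * (p : β × ℂ × ℂ).2.2) := rfl

lemma smul_labMk (z : Circle) (p : S × Circle) :
    z • labMk S ℓ u p = labMk S ℓ u (p.1, z * p.2) := by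
  refine Subtype.ext ?_
  rw [coe_smul_lab]
  simp only [labMk, lab, Circle.coe_mul]
  exact Prod.ext rfl (Prod.ext (by ring) (by ring))

instance : ContinuousSMul Circle (Lab S ℓ u) where
  continuous_smul := by
    refine Continuous.subtype_mk (f := fun p : Circle × Lab S ℓ u =>
      ((p.2 : β × ℂ × ℂ).1, (p.1 : ℂ) * (p.2 : β × ℂ × ℂ).2.1,
        (p.1 : ℂ) ^ 2 * (p.2 : β × ℂ × ℂ).2.2)) ?_ _
    fun_prop

lemma mem_orbit_lab_iff {p q : Lab S ℓ u} :
    q ∈ MulAction.orbit Circle p ↔ (p : β × ℂ × ℂ).1 = (q : β × ℂ × ℂ).1 := by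
  constructor
  · rintro ⟨z, rfl⟩
    rfl
  · intro h
    obtain ⟨⟨b, z⟩, rfl⟩ := labMk_surjective p
    obtain ⟨⟨b', z'⟩, rfl⟩ := labMk_surjective q
    have : b = b' := Subtype.ext h
    subst this
    refine ⟨z' * z⁻¹, ?_⟩
    simp only [smul_labMk, inv_mul_cancel_right]

lemma faithfulSMul_lab {b : β} (hb : b ∈ S) (h0 : u b ≠ 0) : FaithfulSMul Circle (Lab S ℓ u) where
  eq_of_smul_eq_smul := by
    intro z w h
    have h1 := h (labMk S ℓ u (⟨b, hb⟩, 1))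
    rw [smul_labMk, smul_labMk, labMk_eq_iff] at h1
    simpa [h0] using h1.2

/-- The map of labelled spaces over a map of the bases. -/
def labMap (φ : S → S') (p : Lab S ℓ u) : Lab S' ℓ' u' :=
  labMk S' ℓ' u' (φ ⟨(p : β × ℂ × ℂ).1, p.2.1⟩, p.2.2.choose)

variable {φ : S → S'}

/-- The phase in `labMap` is a choice, determined only up to the isotropy of the orbit; the
hypothesis says that isotropy does not shrink under `φ`, so the choice does not matter. -/
lemma labMap_labMk (h : ∀ b : S, u b = 0 → u' (φ b) = 0 ∧ (ℓ b ≤ 0 → ℓ' (φ b) ≤ 0)) (b : S)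
    (z : Circle) : (labMap φ (labMk S ℓ u (b, z)) : Lab S' ℓ' u') = labMk S' ℓ' u' (φ b, z) := by
  have hc := (labMk S ℓ u (b, z)).2.2.choose_spec
  have : lab (ℓ b) (u b) z = lab (ℓ b) (u b) (labMk S ℓ u (b, z)).2.2.choose := hc
  unfold labMap
  symm
  rw [labMk_eq_iff]
  refine ⟨rfl, ?_⟩
  rcases lab_eq_iff.1 this with h1 | ⟨h1, h2⟩
  · exact Or.inl h1
  · exact Or.inr ⟨(h b h1).1, h2.imp (h b h1).2 id⟩

lemma smul_labMap (h : ∀ b : S, u b = 0 → u' (φ b) = 0 ∧ (ℓ b ≤ 0 → ℓ' (φ b) ≤ 0)) (z : Circle)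
    (p : Lab S ℓ u) : (labMap φ (z • p) : Lab S' ℓ' u') = z • labMap φ p := by
  obtain ⟨⟨b, ζ⟩, rfl⟩ := labMk_surjective p
  rw [smul_labMk, labMap_labMk h, labMap_labMk h, smul_labMk]

/-- The conditions `h` and `h'` together say that `φ` preserves the isotropy exactly. Then the image
of the parameter space is saturated for the identifications in the target, and
`isOpenEmbedding_of_quotient` applies. -/
lemma isOpenEmbedding_labMap [T2Space β] [T2Space γ] (hℓ : ContinuousOn ℓ S)
    (hu : ContinuousOn u S)
    (hℓ' : ContinuousOn ℓ' S') (hu' : ContinuousOn u' S') (hφ : IsOpenEmbedding φ)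
    (h : ∀ b : S, u b = 0 → u' (φ b) = 0 ∧ (ℓ b ≤ 0 → ℓ' (φ b) ≤ 0))
    (h' : ∀ b : S, u' (φ b) = 0 → u b = 0 ∧ (ℓ' (φ b) ≤ 0 → ℓ b ≤ 0)) :
    IsOpenEmbedding (labMap φ : Lab S ℓ u → Lab S' ℓ' u') := by
  refine isOpenEmbedding_of_quotient (ι := fun p : S × Circle => (φ p.1, p.2))
    (isQuotientMap_labMk hℓ hu) (isQuotientMap_labMk hℓ' hu') (hφ.prodMap IsOpenEmbedding.id)
    (fun p => labMap_labMk h p.1 p.2) ?_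
  rintro ⟨b, z⟩ ⟨b', z'⟩ hb
  refine ⟨(b, z'), ?_, ?_⟩
  · rw [labMk_eq_iff] at hb
    exact Prod.ext hb.1 rfl
  · rw [labMk_eq_iff] at hb ⊢
    refine ⟨rfl, hb.2.elim (fun h1 => Or.inl h1.symm) fun hb2 =>
      Or.inr ⟨(h' b hb2.1).1, hb2.2.imp (h' b hb2.1).2 fun h1 => ?_⟩⟩
    simp only at h1 ⊢
    rw [h1, neg_neg]

/-- A homeomorphism of the bases compatible with the labels gives one of the labelled spaces. -/
lemma exists_homeomorph_lab [T2Space β] [T2Space γ] (hℓ : ContinuousOn ℓ S)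
    (hu : ContinuousOn u S) (hℓ' : ContinuousOn ℓ' S') (hu' : ContinuousOn u' S') (φ : S ≃ₜ S')
    (h : ∀ b : S, u b = 0 ↔ u' (φ b) = 0) (h' : ∀ b : S, u b = 0 → (ℓ b ≤ 0 ↔ ℓ' (φ b) ≤ 0)) :
    ∃ e : Lab S ℓ u ≃ₜ Lab S' ℓ' u', (∀ (z : Circle) p, e (z • p) = z • e p) ∧
      ∀ b z, e (labMk S ℓ u (b, z)) = labMk S' ℓ' u' (φ b, z) := by
  have h1 : ∀ b : S, u b = 0 → u' (φ b) = 0 ∧ (ℓ b ≤ 0 → ℓ' (φ b) ≤ 0) :=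
    fun b hb => ⟨(h b).1 hb, (h' b hb).1⟩
  have h2 : ∀ b : S, u' (φ b) = 0 → u b = 0 ∧ (ℓ' (φ b) ≤ 0 → ℓ b ≤ 0) :=
    fun b hb => ⟨(h b).2 hb, (h' b ((h b).2 hb)).2⟩
  have he : IsOpenEmbedding (labMap φ : Lab S ℓ u → Lab S' ℓ' u') :=
    isOpenEmbedding_labMap hℓ hu hℓ' hu' φ.isOpenEmbedding h1 h2
  refine ⟨he.isEmbedding.toHomeomorphOfSurjective ?_, fun z p => smul_labMap h1 z p,
    fun b z => labMap_labMk h1 b z⟩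
  intro p
  obtain ⟨⟨b, z⟩, rfl⟩ := labMk_surjective p
  exact ⟨labMk S ℓ u (φ.symm b, z), by rw [labMap_labMk h1, φ.apply_symm_apply]⟩

end LabelledSpaces

/-! ### Charts of labelled spaces over strips, and their labile points. -/

section LabelledCharts

open Set

lemma isOpenEmbedding_arctan : IsOpenEmbedding Real.arctan :=
  (isOpen_Ioo.isOpenEmbedding_subtypeVal).comp
    Real.tanOrderIso.symm.toHomeomorph.isOpenEmbedding

/-- The parametrization of an open half circle by the real line. -/
def arcMap (c : Circle) (t : ℝ) : Circle := c * Circle.exp (Real.arctan t)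

lemma isOpenEmbedding_arcMap (c : Circle) : IsOpenEmbedding (arcMap c) := by
  have h : IsOpenEmbedding fun t => Circle.exp (Real.arctan t) := by
    refine IsOpenEmbedding.of_continuous_injective_isOpenMap (by fun_prop) ?_
      (isLocalHomeomorph_circleExp.isOpenMap.comp isOpenEmbedding_arctan.isOpenMap)
    intro s t hst
    apply Real.arctan_injective
    have hpi := Real.pi_pos
    refine Circle.exp_injOn_Ioc (a := -Real.pi) (b := Real.pi) (by linarith) ?_ ?_ hst
    · exact ⟨by linarith [Real.neg_pi_div_two_lt_arctan s], by linarith [Real.arctan_lt_pi_div_two s]⟩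
    · exact ⟨by linarith [Real.neg_pi_div_two_lt_arctan t], by linarith [Real.arctan_lt_pi_div_two t]⟩
  exact (Homeomorph.mulLeft c).isOpenEmbedding.comp h

lemma arcMap_zero (c : Circle) : arcMap c 0 = c := by simp [arcMap]

variable {E : Type*} [NormedAddCommGroup E] [NormedSpace ℝ E] [FiniteDimensional ℝ E]

/-- Base of the standard labelled space with boundary: sizes range over `[0,1]`. -/
def unitStrip (E : Type*) : Set (E × ℝ) := {b | b.2 ∈ Icc (0 : ℝ) 1}

variable {ℓ : E × ℝ → ℝ}

/-- Near size one the orbits are free, so a product of a collar of the strip with an arc of phases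
is a half space chart. -/
lemma labile_unitStrip (hℓ : Continuous ℓ) (x : E) (z : Circle) :
    Labile (labMk (unitStrip E) ℓ Prod.snd (⟨(x, 1), by simp [unitStrip]⟩, z)) := by
  let j : ℝ → ℝ := fun t => 1 - Real.arctan t / 2
  have hj : IsOpenEmbedding j := by
    have h2 : (2 : ℝ)⁻¹ ≠ 0 := by norm_num
    have := ((Homeomorph.subLeft (1 : ℝ)).isOpenEmbedding.comp
      (Homeomorph.mulRight₀ (2 : ℝ)⁻¹ h2).isOpenEmbedding).comp isOpenEmbedding_arctan
    exact this
  -- Since `π < 4`, the values of `j` stay positive, so the chart never meets the orbits of size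
  -- zero.
  have hjm : ∀ t, j t ∈ Icc (0 : ℝ) 1 ↔ 0 ≤ t := by
    intro t
    have h1 := Real.arctan_lt_pi_div_two t
    have h2 := Real.pi_lt_four
    simp only [j, mem_Icc]
    constructor
    · rintro ⟨-, h⟩
      rw [← Real.arctan_nonneg]
      linarith
    · intro h
      have := Real.arctan_nonneg.2 h
      constructor <;> linarith
  let Φ : (E × ℝ) × ℝ → (E × ℝ) × Circle := fun q => ((q.1.1, j q.2), arcMap z q.1.2)
  have hΦ : IsOpenEmbedding Φ := by
    have h1 := (IsOpenEmbedding.id (X := E)).prodMap (hj.prodMap (isOpenEmbedding_arcMap z))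
    let e₁ : (E × ℝ) × ℝ ≃ₜ E × ℝ × ℝ :=
      (Homeomorph.prodAssoc E ℝ ℝ).trans ((Homeomorph.refl E).prodCongr (Homeomorph.prodComm ℝ ℝ))
    exact (Homeomorph.prodAssoc E ℝ Circle).symm.isOpenEmbedding.comp
      (h1.comp e₁.isOpenEmbedding)
  let T : Set ((E × ℝ) × Circle) := {q | q.1 ∈ unitStrip E}
  let e₂ : (E × ℝ) × Ici (0 : ℝ) ≃ₜ Φ ⁻¹' T :=
    { toFun := fun q => ⟨(q.1, q.2), (hjm _).2 q.2.2⟩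
      invFun := fun q => (q.1.1, ⟨q.1.2, (hjm _).1 q.2⟩)
      left_inv := fun _ => rfl
      right_inv := fun _ => rfl
      continuous_toFun := by fun_prop
      continuous_invFun := by fun_prop }
  let e₃ : T ≃ₜ unitStrip E × Circle :=
    { toFun := fun q => (⟨q.1.1, q.2⟩, q.1.2)
      invFun := fun q => ⟨(q.1, q.2), q.1.2⟩
      left_inv := fun _ => rfl
      right_inv := fun _ => rfl
      continuous_toFun := by fun_prop
      continuous_invFun := by fun_prop }
  have hι : IsOpenEmbedding (fun q => e₃ (T.restrictPreimage Φ (e₂ q))) :=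
    e₃.isOpenEmbedding.comp ((hΦ.restrictPreimage T).comp e₂.isOpenEmbedding)
  have hf : IsOpenEmbedding (fun q => labMk (unitStrip E) ℓ Prod.snd
      (e₃ (T.restrictPreimage Φ (e₂ q)))) := by
    refine isOpenEmbedding_of_quotient IsQuotientMap.id
      (isQuotientMap_labMk hℓ.continuousOn continuous_snd.continuousOn) hι (fun _ => rfl) ?_
    intro a b hab
    refine ⟨a, ?_, rfl⟩
    rw [labMk_eq_iff] at hab
    refine Prod.ext hab.1 (hab.2.resolve_right fun h => ?_)
    have h1 : j a.2 = 0 := h.1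
    have h2 := Real.arctan_lt_pi_div_two a.2
    have h3 := Real.pi_lt_four
    simp only [j] at h1
    linarith
  have h := (labile_halfSpace ((x, 0) : E × ℝ)).of_isOpenEmbedding hf
  convert h using 3
  · exact Subtype.ext (Prod.ext rfl (by simp [e₃, e₂, Φ, j]))
  · simp [e₃, e₂, Φ, arcMap_zero]

/-- Size and phase are the polar coordinates of a complex number `w`, which gives a chart in `ℂ ×
E`. The value `w = 0` is admitted only where the label is negative: there the last coordinate
vanishes nearby, so its dependence on the undefined phase is harmless. -/
lemma not_labile_unitStrip_of_free_or_fixed (hℓ : Continuous ℓ) {x : E} {s : ℝ}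
    (hs : (x, s) ∈ unitStrip E) (hs1 : s < 1) (h0 : s ≠ 0 ∨ ℓ (x, 0) < 0) (z : Circle) :
    ¬ Labile (labMk (unitStrip E) ℓ Prod.snd (⟨(x, s), hs⟩, z)) := by
  let Ω : Set (ℂ × E) := {q | ‖q.1‖ < 1 ∧ (q.1 ≠ 0 ∨ ℓ (q.2, 0) < 0)}
  have hΩ : IsOpen Ω := by
    have h1 : IsOpen {q : ℂ × E | ‖q.1‖ < 1} := isOpen_lt (by fun_prop) continuous_const
    have h2 : IsOpen {q : ℂ × E | q.1 ≠ 0} := isOpen_ne_fun (by fun_prop) (by fun_prop)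
    have h3 : IsOpen {q : ℂ × E | ℓ (q.2, 0) < 0} := isOpen_lt (by fun_prop) continuous_const
    exact h1.inter (h2.union h3)
  let raw : ℂ × E → (E × ℝ) × ℂ × ℂ := fun q =>
    ((q.2, ‖q.1‖), q.1, ((max (ℓ (q.2, ‖q.1‖)) 0 : ℝ) : ℂ) * (q.1 / ‖q.1‖) ^ 2)
  have hraw : ∀ q ∈ Ω, raw q ∈ Lab (unitStrip E) ℓ Prod.snd := by
    rintro ⟨w, y⟩ ⟨hw, hq⟩
    refine ⟨⟨norm_nonneg _, hw.le⟩, ?_⟩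
    by_cases hw0 : w = 0
    · subst hw0
      have : ℓ (y, 0) < 0 := hq.resolve_left (by simp)
      refine ⟨1, ?_⟩
      simp only [raw, lab, norm_zero, max_eq_right this.le]
      simp
    · have hn : (‖w‖ : ℂ) ≠ 0 := by simpa using hw0
      refine ⟨⟨w / ‖w‖, mem_sphere_zero_iff_norm.2 (by
          rw [norm_div, Complex.norm_real, norm_norm, div_self (by simpa using hw0)])⟩, ?_⟩
      refine Prod.ext ?_ rfl
      simp only [raw, lab]
      exact (mul_div_cancel₀ w hn).symm
  have hrawc : ContinuousOn raw Ω := by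
    rintro ⟨w, y⟩ ⟨hw, hq⟩
    apply ContinuousAt.continuousWithinAt
    have h12 : ContinuousAt (fun q : ℂ × E => ((q.2, ‖q.1‖) : E × ℝ)) (w, y) := by fun_prop
    refine h12.prodMk (continuousAt_fst.prodMk ?_)
    by_cases hw0 : w = 0
    · subst hw0
      have hneg : ℓ (y, 0) < 0 := hq.resolve_left (by simp)
      have hev : ∀ᶠ q : ℂ × E in 𝓝 (0, y), ℓ (q.2, ‖q.1‖) < 0 := by
        have hc : Continuous fun q : ℂ × E => ℓ (q.2, ‖q.1‖) := by fun_prop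
        exact hc.continuousAt.eventually_lt continuousAt_const (by simpa using hneg)
      refine (continuousAt_const (y := (0 : ℂ))).congr ?_
      filter_upwards [hev] with q hq
      rw [max_eq_right hq.le]; simp
    · have hn : (‖w‖ : ℂ) ≠ 0 := by simpa using hw0
      have h1 : ContinuousAt (fun q : ℂ × E => q.1 / (‖q.1‖ : ℂ)) (w, y) :=
        ContinuousAt.div (by fun_prop) (by fun_prop) hn
      refine ContinuousAt.mul ?_ (h1.pow 2)
      have : Continuous fun q : ℂ × E => ((max (ℓ (q.2, ‖q.1‖)) 0 : ℝ) : ℂ) :=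
        Complex.continuous_ofReal.comp (by fun_prop)
      exact this.continuousAt
  let e : Ω → Lab (unitStrip E) ℓ Prod.snd := fun q => ⟨raw q, hraw _ q.2⟩
  have hec : Continuous e := Continuous.subtype_mk (continuousOn_iff_continuous_domRestrict.1 hrawc) _
  let g : Lab (unitStrip E) ℓ Prod.snd → ℂ × E := fun p => (p.1.2.1, p.1.1.1)
  have hgc : Continuous g := by fun_prop
  have hemb : IsEmbedding e := IsEmbedding.of_comp hec hgc (by
    have : g ∘ e = Subtype.val := rfl
    rw [this]
    exact IsEmbedding.subtypeVal)
  have hbase : ∀ (b : unitStrip E) (ζ : Circle), b.1.2 < 1 → (b.1.2 ≠ 0 ∨ ℓ (b.1.1, 0) < 0) →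
      labMk (unitStrip E) ℓ Prod.snd (b, ζ) ∈ range e := by
    rintro ⟨⟨y, t⟩, ht0, ht1⟩ ζ h1 h2
    simp only at ht0 h1 h2
    have hnorm : ‖(t : ℂ) * (ζ : ℂ)‖ = t := by
      rw [norm_mul, Circle.norm_coe, mul_one, Complex.norm_real, Real.norm_of_nonneg ht0]
    have hm : ((t : ℂ) * (ζ : ℂ), y) ∈ Ω := by
      refine ⟨by simp only [hnorm]; exact h1, ?_⟩
      exact h2.imp (fun h => mul_ne_zero (by exact_mod_cast h) (Circle.coe_ne_zero ζ)) id
    refine ⟨⟨_, hm⟩, Subtype.ext ?_⟩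
    simp only [e, raw, labMk, lab, hnorm]
    refine Prod.ext rfl (Prod.ext rfl ?_)
    simp only
    by_cases ht : t = 0
    · subst ht
      have : ℓ (y, 0) < 0 := h2.resolve_left (by simp)
      rw [max_eq_right this.le]; simp
    · have : (t : ℂ) ≠ 0 := by exact_mod_cast ht
      rw [mul_div_cancel_left₀ _ this]
  have hopen : IsOpenEmbedding e := by
    refine ⟨hemb, ?_⟩
    have : range e = g ⁻¹' Ω := by
      apply Subset.antisymm
      · rintro _ ⟨q, rfl⟩
        exact q.2
      · intro p hp
        obtain ⟨⟨b, ζ⟩, rfl⟩ := labMk_surjective p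
        have hnorm : ‖(labMk (unitStrip E) ℓ Prod.snd (b, ζ)).1.2.1‖ = b.1.2 :=
          norm_lab_fst b.2.1 ζ
        obtain ⟨h1, h2⟩ := hp
        simp only [g] at h1 h2
        rw [hnorm] at h1
        refine hbase b ζ h1 (h2.imp (fun h hb => h ?_) id)
        rw [← norm_eq_zero, hnorm, hb]
    rw [this]
    exact hΩ.preimage hgc
  obtain ⟨a, ha⟩ := hbase ⟨(x, s), hs⟩ z hs1 h0
  rw [← ha]
  exact not_labile_of_chart hΩ hopen a

/-- Around an exceptional orbit the phase is determined only up to sign at size zero. Letting the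
size take both signs, with `(s, z)` and `(-s, -z)` the same point, resolves this: a signed size and
an angle in an open half circle form a Euclidean chart. -/
lemma not_labile_unitStrip_of_exceptional (hℓ : Continuous ℓ) {x : E} (h0 : 0 < ℓ (x, 0))
    (z : Circle) :
    ¬ Labile (labMk (unitStrip E) ℓ Prod.snd (⟨(x, 0), by simp [unitStrip]⟩, z)) := by
  let Ω : Set ((E × ℝ) × ℝ) :=
    {q | (|q.1.2| < 1 ∧ 0 < ℓ (q.1.1, |q.1.2|)) ∧ -(Real.pi / 2) < q.2 ∧ q.2 < Real.pi / 2}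
  have hΩ : IsOpen Ω := by
    have h1 : IsOpen {q : (E × ℝ) × ℝ | |q.1.2| < 1} := isOpen_lt (by fun_prop) (by fun_prop)
    have h2 : IsOpen {q : (E × ℝ) × ℝ | 0 < ℓ (q.1.1, |q.1.2|)} :=
      isOpen_lt (by fun_prop) (by fun_prop)
    have h3 : IsOpen {q : (E × ℝ) × ℝ | -(Real.pi / 2) < q.2} :=
      isOpen_lt (by fun_prop) (by fun_prop)
    have h4 : IsOpen {q : (E × ℝ) × ℝ | q.2 < Real.pi / 2} :=
      isOpen_lt (by fun_prop) (by fun_prop)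
    exact (h1.inter h2).inter (h3.inter h4)
  let rot' : (E × ℝ) × ℝ → Circle := fun q => z * Circle.exp q.2
  let raw : (E × ℝ) × ℝ → (E × ℝ) × ℂ × ℂ := fun q =>
    ((q.1.1, |q.1.2|), (q.1.2 : ℂ) * (rot' q : ℂ),
      ((max (ℓ (q.1.1, |q.1.2|)) 0 : ℝ) : ℂ) * (rot' q : ℂ) ^ 2)
  have hrawc : Continuous raw := by
    have h1 : Continuous fun q : (E × ℝ) × ℝ => ((max (ℓ (q.1.1, |q.1.2|)) 0 : ℝ) : ℂ) :=
      Complex.continuous_ofReal.comp (by fun_prop)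
    simp only [raw, rot']
    fun_prop
  let V : Set (Lab (unitStrip E) ℓ Prod.snd) :=
    {p | (p.1.1.2 < 1 ∧ 0 < ℓ p.1.1) ∧ p.1.2.2 / (z : ℂ) ^ 2 ∈ Complex.slitPlane}
  have hV : IsOpen V := by
    have h1 : IsOpen {p : Lab (unitStrip E) ℓ Prod.snd | p.1.1.2 < 1} :=
      isOpen_lt (by fun_prop) (by fun_prop)
    have h2 : IsOpen {p : Lab (unitStrip E) ℓ Prod.snd | 0 < ℓ p.1.1} :=
      isOpen_lt (by fun_prop) (by fun_prop)
    have h3 : Continuous fun p : Lab (unitStrip E) ℓ Prod.snd => p.1.2.2 / (z : ℂ) ^ 2 := by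
      fun_prop
    exact (h1.inter h2).inter (Complex.isOpen_slitPlane.preimage h3)
  have hmem : ∀ q ∈ Ω, raw q ∈ Lab (unitStrip E) ℓ Prod.snd := by
    rintro ⟨⟨y, s⟩, θ⟩ ⟨⟨h1, h2⟩, h3, h4⟩
    refine ⟨⟨abs_nonneg _, h1.le⟩, ?_⟩
    rcases le_total 0 s with hs | hs
    · refine ⟨z * Circle.exp θ, ?_⟩
      simp only [raw, rot', lab, abs_of_nonneg hs]
    · refine ⟨-(z * Circle.exp θ), ?_⟩
      simp only [raw, rot', lab, abs_of_nonpos hs]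
      simp
  have hratio : ∀ q : (E × ℝ) × ℝ, (raw q).2.2 / (z : ℂ) ^ 2 =
      ((max (ℓ (q.1.1, |q.1.2|)) 0 : ℝ) : ℂ) * Complex.exp ((2 * q.2 : ℝ) * Complex.I) := by
    intro q
    simp only [raw, rot', Circle.coe_mul, Circle.coe_exp]
    have hz := Circle.coe_ne_zero z
    rw [mul_pow, ← Complex.exp_nat_mul]
    field_simp
    congr 2
    push_cast
    ring
  have harg : ∀ q ∈ Ω, Complex.arg ((raw q).2.2 / (z : ℂ) ^ 2) = 2 * q.2 := by
    rintro q ⟨⟨h1, h2⟩, h3, h4⟩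
    rw [hratio, max_eq_left h2.le, Complex.arg_real_mul _ h2, Complex.arg_exp_mul_I,
      toIocMod_eq_self]
    constructor <;> linarith
  have hslit : ∀ q ∈ Ω, (raw q).2.2 / (z : ℂ) ^ 2 ∈ Complex.slitPlane := by
    intro q hq
    rw [Complex.mem_slitPlane_iff_arg, harg q hq]
    obtain ⟨⟨h1, h2⟩, h3, h4⟩ := hq
    refine ⟨by linarith, ?_⟩
    rw [hratio, max_eq_left h2.le]
    exact mul_ne_zero (by exact_mod_cast h2.ne') (Complex.exp_ne_zero _)
  let e : Ω → V := fun q => ⟨⟨raw q, hmem _ q.2⟩, ⟨q.2.1, hslit _ q.2⟩⟩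
  have hec : Continuous e :=
    Continuous.subtype_mk (Continuous.subtype_mk (hrawc.comp continuous_subtype_val) _) _
  -- The last coordinate is a positive multiple of the squared phase, so half its argument is the
  -- phase up to sign, normalized to the half circle around `z`.
  let ang : V → ℝ := fun p => Complex.arg (p.1.1.2.2 / (z : ℂ) ^ 2) / 2
  have hang : Continuous ang := by
    rw [continuous_iff_continuousAt]
    intro p
    have h1 : Continuous fun p : V => p.1.1.2.2 / (z : ℂ) ^ 2 := by fun_prop
    exact (ContinuousAt.comp (f := fun p : V => p.1.1.2.2 / (z : ℂ) ^ 2) (g := Complex.arg)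
      (Complex.continuousAt_arg p.2.2) h1.continuousAt).div_const 2
  let g : V → (E × ℝ) × ℝ := fun p =>
    ((p.1.1.1.1, (p.1.1.2.1 / ((z * Circle.exp (ang p) : Circle) : ℂ)).re), ang p)
  have hgc : Continuous g := by
    have h1 : Continuous fun p : V => ((z * Circle.exp (ang p) : Circle) : ℂ) := by fun_prop
    have h2 : Continuous fun p : V => p.1.1.2.1 / ((z * Circle.exp (ang p) : Circle) : ℂ) :=
      Continuous.div (by fun_prop) h1 fun p => Circle.coe_ne_zero _
    exact ((by fun_prop : Continuous fun p : V => p.1.1.1.1).prodMk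
      (Complex.continuous_re.comp h2)).prodMk hang
  have hge : ∀ q, g (e q) = q := by
    intro q
    have h1 : ang (e q) = q.1.2 := by
      simp only [ang, e]
      rw [harg q q.2]; ring
    refine Prod.ext (Prod.ext rfl ?_) h1
    simp only [g, h1]
    simp only [e, raw, rot']
    rw [mul_div_cancel_right₀ _ (Circle.coe_ne_zero _), Complex.ofReal_re]
  have hemb : IsEmbedding e := IsEmbedding.of_comp hec hgc (by
    have : g ∘ e = Subtype.val := funext hge
    rw [this]
    exact IsEmbedding.subtypeVal)
  have hsurj : Function.Surjective e := by
    rintro ⟨p, ⟨hp1, hp2⟩, hp3⟩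
    obtain ⟨⟨⟨⟨y, t⟩, ht⟩, ζ⟩, rfl⟩ := labMk_surjective p
    simp only [labMk] at hp1 hp2 hp3
    have ht0 : 0 ≤ t := ht.1
    -- choose the angle of `ζ / z` up to sign
    obtain ⟨θ, hθ⟩ := Circle.exp_surjective (ζ / z)
    have hy : (lab (ℓ (y, t)) t ζ).2 / (z : ℂ) ^ 2 =
        (ℓ (y, t) : ℂ) * ((ζ / z : Circle) : ℂ) ^ 2 := by
      simp only [lab, max_eq_left hp2.le, Circle.coe_div]
      ring
    rw [hy, Complex.mem_slitPlane_iff_arg, Complex.arg_real_mul _ hp2] at hp3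
    set α := Complex.arg (((ζ / z : Circle) : ℂ) ^ 2) with hα
    have hα1 : -(Real.pi / 2) < α / 2 ∧ α / 2 < Real.pi / 2 := by
      have h1 := Complex.neg_pi_lt_arg (((ζ / z : Circle) : ℂ) ^ 2)
      have h2 := lt_of_le_of_ne (Complex.arg_le_pi (((ζ / z : Circle) : ℂ) ^ 2)) hp3.1
      constructor <;> linarith
    have hsq : (Circle.exp (α / 2) : ℂ) ^ 2 = ((ζ / z : Circle) : ℂ) ^ 2 := by
      have h1 : ((Circle.exp (α / 2) ^ 2 : Circle)) = (ζ / z) ^ 2 := by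
        rw [← Circle.exp_natCast_mul]
        have : Circle.exp α = (ζ / z) ^ 2 := by
          have := Circle.exp_arg ((ζ / z) ^ 2)
          rw [Circle.coe_pow] at this
          exact this
        rw [← this]
        congr 1
        push_cast
        ring
      have h2 := congrArg (fun c : Circle => (c : ℂ)) h1
      simpa using h2
    have hzc := Circle.coe_ne_zero z
    have hp1' : |t| < 1 := by rw [abs_of_nonneg ht0]; exact hp1
    have hp2' : 0 < ℓ (y, |t|) := by rw [abs_of_nonneg ht0]; exact hp2
    have hsq' : ((z * Circle.exp (α / 2) : Circle) : ℂ) ^ 2 = (ζ : ℂ) ^ 2 := by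
      rw [Circle.coe_mul, mul_pow, hsq, Circle.coe_div]
      field_simp
    -- If the normalized angle gives `-ζ` instead of `ζ`, the signed size is `-t`.
    rcases sq_eq_sq_iff_eq_or_eq_neg.1 hsq' with h | h
    · refine ⟨⟨((y, t), α / 2), ⟨⟨hp1', hp2'⟩, hα1⟩⟩, Subtype.ext (Subtype.ext ?_)⟩
      simp only [e, raw, rot', labMk, lab, h, abs_of_nonneg ht0]
    · refine ⟨⟨((y, -t), α / 2), ⟨⟨by simpa using hp1', by simpa using hp2'⟩, hα1⟩⟩,
        Subtype.ext (Subtype.ext ?_)⟩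
      simp only [e, raw, rot', labMk, lab, h, abs_neg, abs_of_nonneg ht0]
      simp
  have hopen : IsOpenEmbedding (fun q => (e q : Lab (unitStrip E) ℓ Prod.snd)) :=
    hV.isOpenEmbedding_subtypeVal.comp ⟨hemb, by rw [hsurj.range_eq]; exact isOpen_univ⟩
  have hpV : labMk (unitStrip E) ℓ Prod.snd (⟨(x, 0), by simp [unitStrip]⟩, z) ∈ V := by
    refine ⟨⟨?_, h0⟩, ?_⟩
    · simp [labMk]
    · have hz := Circle.coe_ne_zero z
      simp only [labMk, lab, max_eq_left h0.le]
      rw [mul_div_cancel_right₀ _ (pow_ne_zero 2 hz)]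
      exact Complex.ofReal_mem_slitPlane.2 h0
  obtain ⟨a, ha⟩ := hsurj ⟨_, hpV⟩
  have ha' := congrArg Subtype.val ha
  simp only at ha'
  rw [← ha']
  exact not_labile_of_chart hΩ hopen a

/-- The labile points of a labelled space over a strip, apart from the singular fixed points, are
the boundary points. -/
lemma labile_unitStrip_iff (hℓ : Continuous ℓ) (p : Lab (unitStrip E) ℓ Prod.snd)
    (hp : ¬ (p.1.1.2 = 0 ∧ ℓ p.1.1 = 0)) : Labile p ↔ p.1.1.2 = 1 := by
  obtain ⟨⟨⟨⟨x, s⟩, hs⟩, z⟩, rfl⟩ := labMk_surjective p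
  simp only [labMk] at hp ⊢
  constructor
  · intro h
    by_contra h1
    have hs1 : s < 1 := lt_of_le_of_ne hs.2 h1
    by_cases hs0 : s = 0
    · subst hs0
      rcases lt_trichotomy (ℓ (x, 0)) 0 with h2 | h2 | h2
      · exact not_labile_unitStrip_of_free_or_fixed hℓ hs hs1 (Or.inr h2) z h
      · exact hp ⟨rfl, h2⟩
      · exact not_labile_unitStrip_of_exceptional hℓ h2 z h
    · exact not_labile_unitStrip_of_free_or_fixed hℓ hs hs1 (Or.inl hs0) z h
  · rintro rfl
    exact labile_unitStrip hℓ x z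

end LabelledCharts

/-! ### Antipodal quotients are Hausdorff. -/

section Antipodal

open Set

variable {S : Set (ℂ × ℝ)}

/-- The squares determine each coordinate up to sign, and the mixed product couples the two signs.
These quadratic functions therefore separate antipodal pairs. -/
lemma eq_or_eq_neg_of_invariants (a b : ℂ × ℝ)
    (h : (a.1 ^ 2, a.1 * a.2, a.2 ^ 2) = ((b.1 ^ 2, b.1 * b.2, b.2 ^ 2) : ℂ × ℂ × ℝ)) :
    b = a ∨ b = -a := by
  obtain ⟨w, s⟩ := a
  obtain ⟨w', s'⟩ := b
  simp only [Prod.mk.injEq] at h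
  obtain ⟨h1, h2, h3⟩ := h
  have key : ∀ {s : ℝ}, s ≠ 0 → w * s = w' * s → w' = w := fun hs h =>
    (mul_right_cancel₀ (by exact_mod_cast hs) h).symm
  rcases sq_eq_sq_iff_eq_or_eq_neg.1 h1 with rfl | hw
  · rcases sq_eq_sq_iff_eq_or_eq_neg.1 h3 with rfl | hs
    · exact Or.inl rfl
    · by_cases hs' : s' = 0
      · left; simp [hs, hs']
      · right
        have h4 : w * (2 * (s' : ℂ)) = 0 := by
          rw [hs] at h2
          push_cast at h2
          linear_combination -h2
        have h5 : w = 0 := by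
          rcases mul_eq_zero.1 h4 with h | h
          · exact h
          · exact absurd h (by simpa using hs')
        simp [hs, h5]
  · rcases sq_eq_sq_iff_eq_or_eq_neg.1 h3 with rfl | hs
    · by_cases hs' : s = 0
      · right; simp [hw, hs']
      · left
        rw [key hs' h2]
    · right; simp [hw, hs]

/-- Coordinates of a point up to sign. -/
def antipodalInvariant : Quotient (antipodal S) → ℂ × ℂ × ℝ := Quotient.lift
  (fun p : S => ((p : ℂ × ℝ).1 ^ 2, (p : ℂ × ℝ).1 * (p : ℂ × ℝ).2, (p : ℂ × ℝ).2 ^ 2)) (by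
    rintro p q (h | h) <;> simp [h])

lemma continuous_antipodalInvariant :
    Continuous (antipodalInvariant : Quotient (antipodal S) → ℂ × ℂ × ℝ) := by
  apply Continuous.quotient_lift
  fun_prop

lemma antipodalInvariant_injective :
    Function.Injective (antipodalInvariant : Quotient (antipodal S) → ℂ × ℂ × ℝ) := by
  intro x y
  induction x using Quotient.inductionOn with
  | h p =>
    induction y using Quotient.inductionOn with
    | h q => exact fun h => Quotient.sound (eq_or_eq_neg_of_invariants _ _ h)

lemma t2Space_antipodal : T2Space (Quotient (antipodal S)) :=
  T2Space.of_injective_continuous antipodalInvariant_injective continuous_antipodalInvariant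

instance : T2Space ConeRP2 := t2Space_antipodal

end Antipodal

/-! ### The closed cone over the projective plane as a labelled space. -/

section ConeModel

open Set

/-- The base of the labelled model of the closed cone over the projective plane. -/
def coneBase : Set (ℝ × ℝ) := Icc (-1) 1 ×ˢ Icc 0 1

/-- Model of the closed cone over the projective plane. -/
abbrev ConeModel : Set ((ℝ × ℝ) × ℂ × ℂ) := Lab coneBase Prod.fst Prod.snd

lemma isCompact_coneBase : IsCompact coneBase := isCompact_Icc.prod isCompact_Icc

instance : CompactSpace ConeModel :=
  compactSpace_lab isCompact_coneBase continuous_fst.continuousOn continuous_snd.continuousOn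

lemma isQuotientMap_coneModel : IsQuotientMap (labMk coneBase Prod.fst Prod.snd) :=
  isQuotientMap_labMk continuous_fst.continuousOn continuous_snd.continuousOn

/-- The point of `ℝ³` with parameters `(t, u)` and phase `z`. -/
def conePoint (t u : ℝ) (z : Circle) : ℂ × ℝ :=
  ((z : ℂ) * (√((max t 0) ^ 2 + u ^ 2) : ℝ), √((max (-t) 0) ^ 2 + u ^ 2))

lemma norm_conePoint_fst_sq (t u : ℝ) (z : Circle) :
    ‖(conePoint t u z).1‖ ^ 2 = (max t 0) ^ 2 + u ^ 2 := by
  rw [conePoint, norm_mul, Circle.norm_coe, one_mul, Complex.norm_real, Real.norm_eq_abs, sq_abs,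
    Real.sq_sqrt (by positivity)]

lemma conePoint_snd_sq (t u : ℝ) (z : Circle) :
    (conePoint t u z).2 ^ 2 = (max (-t) 0) ^ 2 + u ^ 2 := by
  rw [conePoint, Real.sq_sqrt (by positivity)]

/-- The squared radius minus the squared height is `t ^ 2` or `-t ^ 2` according to the sign of `t`,
because `u ^ 2` cancels; so the quadratic form recovers `t`. -/
lemma conePoint_mem_surf_iff {t t' u : ℝ} (hu : u ∈ Icc (0 : ℝ) 1) (z : Circle) :
    conePoint t u z ∈ surf t' ↔ t = t' := by
  have h1 := norm_conePoint_fst_sq t u z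
  have h2 := conePoint_snd_sq t u z
  have h3 : (conePoint t u z).2 ^ 2 ≤ 1 ↔ |(conePoint t u z).2| ≤ 1 := by
    rw [sq_le_one_iff_abs_le_one]
  obtain ⟨hu0, hu1⟩ := hu
  have hu2 : u ^ 2 ≤ 1 := by nlinarith
  unfold surf surfA surfB
  rcases le_or_gt t 0 with ht | ht
  · rw [max_eq_right ht] at h1
    rw [max_eq_left (by linarith)] at h2
    split_ifs with ht'
    · simp only [mem_ofPred_eq]
      constructor
      · rintro ⟨h, -⟩
        nlinarith
      · intro h; linarith
    · simp only [mem_ofPred_eq, h1, h2]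
      constructor
      · rintro ⟨h, -⟩
        nlinarith
      · rintro rfl
        constructor <;> nlinarith
  · rw [max_eq_left ht.le] at h1
    rw [max_eq_right (by linarith)] at h2
    split_ifs with ht'
    · simp only [mem_ofPred_eq, ← h3, h1, h2]
      constructor
      · rintro ⟨h, -⟩
        nlinarith
      · rintro rfl
        constructor <;> nlinarith
    · simp only [mem_ofPred_eq, h1, h2]
      constructor
      · rintro ⟨h, -⟩
        nlinarith
      · rintro rfl
        exact absurd ht ht'

lemma conePoint_mem_surfBd_iff {t u : ℝ} (hu : u ∈ Icc (0 : ℝ) 1) (z : Circle) :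
    conePoint t u z ∈ surfBd t ↔ u = 1 := by
  have h1 := norm_conePoint_fst_sq t u z
  have h2 := conePoint_snd_sq t u z
  have h3 : (conePoint t u z).2 ^ 2 = 1 ↔ |(conePoint t u z).2| = 1 := by
    rw [← sq_abs, pow_eq_one_iff_of_nonneg (abs_nonneg _) two_ne_zero]
  have h4 := (conePoint_mem_surf_iff (t' := t) hu z).2 rfl
  have h5 : u ^ 2 = 1 ↔ u = 1 := by
    have := hu.1
    constructor
    · intro h; nlinarith
    · rintro rfl; norm_num
  unfold surf at h4
  unfold surfBd
  split_ifs at h4 ⊢ with ht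
  · rw [max_eq_right (by linarith)] at h2
    simp only [mem_ofPred_eq, h4, true_and, ← h3, h2, ← h5]
    norm_num
  · rw [max_eq_right (by linarith)] at h1
    simp only [mem_ofPred_eq, h4, true_and, h1, ← h5]
    norm_num

lemma conePoint_mem_solidRegion (b : coneBase) (z : Circle) :
    conePoint b.1.1 b.1.2 z ∈ solidRegion :=
  ⟨b.1.1, b.2.1, (conePoint_mem_surf_iff b.2.2 z).2 rfl⟩

/-- Parametrization of the closed cone over the projective plane. -/
def coneMk (p : coneBase × Circle) : ConeRP2 :=
  Quotient.mk (antipodal solidRegion) ⟨_, conePoint_mem_solidRegion p.1 p.2⟩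

lemma continuous_coneMk : Continuous coneMk := by
  have h : Continuous fun p : coneBase × Circle => conePoint p.1.1.1 p.1.1.2 p.2 := by
    unfold conePoint
    fun_prop
  exact continuous_quotient_mk'.comp (h.subtype_mk _)

/-- The size `u` is the smaller of radius and height: the height on the Möbius levels `t > 0`, the
radius on the disk levels `t ≤ 0`. -/
lemma exists_conePoint {p : ℂ × ℝ} (hp : p ∈ solidRegion) (h0 : 0 ≤ p.2) :
    ∃ (b : coneBase) (z : Circle), conePoint b.1.1 b.1.2 z = p := by
  obtain ⟨w, s⟩ := p
  obtain ⟨t, ht, hp⟩ := hp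
  have hz : ∃ z : Circle, (z : ℂ) * (‖w‖ : ℝ) = w :=
    ⟨Circle.exp (Complex.arg w), by rw [Circle.coe_exp, mul_comm, Complex.norm_mul_exp_arg_mul_I]⟩
  obtain ⟨z, hz⟩ := hz
  have hn := norm_nonneg w
  simp only at h0
  unfold surf surfA surfB at hp
  split_ifs at hp with h
  · obtain ⟨h1, h2⟩ := hp
    simp only at h1 h2
    rw [abs_of_nonneg h0] at h2
    refine ⟨⟨(t, s), ht, h0, h2⟩, z, ?_⟩
    simp only [conePoint]
    rw [max_eq_left h.le, max_eq_right (by linarith), show t ^ 2 + s ^ 2 = ‖w‖ ^ 2 by linarith,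
      Real.sqrt_sq hn, hz, show (0 : ℝ) ^ 2 + s ^ 2 = s ^ 2 by ring, Real.sqrt_sq h0]
  · obtain ⟨h1, h2⟩ := hp
    simp only at h1 h2
    refine ⟨⟨(t, ‖w‖), ht, hn, by nlinarith⟩, z, ?_⟩
    simp only [conePoint]
    rw [max_eq_right (not_lt.1 h), max_eq_left (by linarith [not_lt.1 h]),
      show (-t) ^ 2 + ‖w‖ ^ 2 = s ^ 2 by linarith, Real.sqrt_sq h0,
      show (0 : ℝ) ^ 2 + ‖w‖ ^ 2 = ‖w‖ ^ 2 by ring, Real.sqrt_sq hn, hz]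

lemma neg_mem_surf_iff {p : ℂ × ℝ} {t : ℝ} : -p ∈ surf t ↔ p ∈ surf t := by
  unfold surf surfA surfB
  split_ifs <;> simp

lemma neg_mem_surfBd_iff {p : ℂ × ℝ} {t : ℝ} : -p ∈ surfBd t ↔ p ∈ surfBd t := by
  unfold surfBd surfA surfB
  split_ifs <;> simp

lemma coneMk_surjective : Function.Surjective coneMk := by
  intro c
  induction c using Quotient.inductionOn with
  | h p =>
    obtain ⟨p, hp⟩ := p
    rcases le_total 0 p.2 with h | h
    · obtain ⟨b, z, hz⟩ := exists_conePoint hp h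
      exact ⟨(b, z), Quotient.sound (Or.inl hz.symm)⟩
    · have hp' : -p ∈ solidRegion := by
        obtain ⟨t, ht, h⟩ := hp
        exact ⟨t, ht, neg_mem_surf_iff.2 h⟩
      obtain ⟨b, z, hz⟩ := exists_conePoint hp' (by simpa using h)
      exact ⟨(b, z), Quotient.sound (Or.inr (by simp [hz]))⟩

instance : CompactSpace coneBase := isCompact_iff_compactSpace.1 isCompact_coneBase

lemma isQuotientMap_coneMk : IsQuotientMap coneMk :=
  isQuotientMap_of_compact continuous_coneMk coneMk_surjective

/-- All representatives have nonnegative height, so two can be antipodal only at height zero, that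
is for `u = 0` and `t ≥ 0`. Different phases give the same representative only on the axis, for `u =
0` and `t ≤ 0`. These are the identifications of a labelled space with label `t` and size `u`. -/
lemma coneMk_eq_iff {p q : coneBase × Circle} : coneMk p = coneMk q ↔
    p.1 = q.1 ∧ (p.2 = q.2 ∨ (p.1.1.2 = 0 ∧ (p.1.1.1 ≤ 0 ∨ q.2 = -p.2))) := by
  obtain ⟨⟨⟨t, u⟩, ht, hu⟩, z⟩ := p
  obtain ⟨⟨⟨t', u'⟩, ht', hu'⟩, z'⟩ := q
  simp only at ht hu ht' hu'
  constructor
  · intro h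
    have h0 := Quotient.exact h
    have h0' : conePoint t' u' z' = conePoint t u z ∨ conePoint t' u' z' = -conePoint t u z := h0
    have hmem : conePoint t' u' z' ∈ surf t := by
      rcases h0' with h | h <;> rw [h]
      · exact (conePoint_mem_surf_iff hu z).2 rfl
      · exact neg_mem_surf_iff.2 ((conePoint_mem_surf_iff hu z).2 rfl)
    have ht1 := (conePoint_mem_surf_iff hu' z').1 hmem
    subst ht1
    have hu1 : u' ^ 2 = u ^ 2 := by
      have h1 := norm_conePoint_fst_sq t' u z
      have h2 := norm_conePoint_fst_sq t' u' z'
      have : ‖(conePoint t' u' z').1‖ = ‖(conePoint t' u z).1‖ := by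
        rcases h0' with h | h <;> simp [h]
      rw [this] at h2
      linarith
    have hu2 : u' = u := by
      rcases sq_eq_sq_iff_eq_or_eq_neg.1 hu1 with h | h
      · exact h
      · linarith [hu.1, hu'.1]
    subst hu2
    refine ⟨rfl, ?_⟩
    simp only
    by_cases hz : z = z'
    · exact Or.inl hz
    right
    rcases h0' with h | h
    · have h1 := (Prod.ext_iff.1 h).1
      simp only [conePoint, mul_eq_mul_right_iff, Complex.ofReal_eq_zero] at h1
      have h2 := h1.resolve_left fun h => hz (Circle.ext h.symm)
      rw [Real.sqrt_eq_zero (by positivity)] at h2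
      constructor
      · nlinarith [sq_nonneg (max t' 0)]
      · left
        have : max t' 0 = 0 := by nlinarith [sq_nonneg (max t' 0), sq_nonneg u']
        exact max_eq_right_iff.1 this
    · have h1 := (Prod.ext_iff.1 h).2
      simp only [conePoint, Prod.snd_neg] at h1
      have h3 := Real.sqrt_nonneg (max (-t') 0 ^ 2 + u' ^ 2)
      have h2 : √(max (-t') 0 ^ 2 + u' ^ 2) = 0 := by linarith
      rw [Real.sqrt_eq_zero (by positivity)] at h2
      have hu0 : u' = 0 := by nlinarith [sq_nonneg (max (-t') 0)]
      refine ⟨hu0, ?_⟩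
      by_cases ht0 : t' ≤ 0
      · exact Or.inl ht0
      · right
        have h1 := (Prod.ext_iff.1 h).1
        simp only [conePoint, Prod.fst_neg, hu0] at h1
        have h4 : (√(max t' 0 ^ 2 + 0 ^ 2) : ℝ) ≠ 0 := by
          rw [max_eq_left (by linarith)]
          have : 0 < t' := by linarith
          positivity
        have h5 : (z' : ℂ) = -z := by
          apply mul_right_cancel₀ (b := ((√(max t' 0 ^ 2 + 0 ^ 2) : ℝ) : ℂ)) (by exact_mod_cast h4)
          linear_combination h1
        exact Circle.ext (by simpa using h5)
  · rintro ⟨h1, h2⟩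
    simp only at h1 h2
    cases h1
    rcases h2 with rfl | ⟨rfl, h2⟩
    · rfl
    by_cases ht0 : t ≤ 0
    · refine Quotient.sound (Or.inl ?_)
      simp [conePoint, max_eq_right ht0]
    · have h3 := h2.resolve_left ht0
      subst h3
      refine Quotient.sound (Or.inr ?_)
      simp only [conePoint]
      rw [max_eq_right (show -t ≤ 0 by linarith)]
      simp

lemma exists_homeomorph_cone :
    ∃ Θ : ConeModel ≃ₜ ConeRP2, ∀ p, Θ (labMk coneBase Prod.fst Prod.snd p) = coneMk p :=
  exists_homeomorph_of_quotient isQuotientMap_coneModel isQuotientMap_coneMk fun p q => by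
    rw [coneMk_eq_iff, labMk_eq_iff]

/-- The closed cone over the projective plane is homeomorphic to its labelled model. -/
def coneHomeo : ConeModel ≃ₜ ConeRP2 := exists_homeomorph_cone.choose

lemma coneHomeo_mk (p : coneBase × Circle) :
    coneHomeo (labMk coneBase Prod.fst Prod.snd p) = coneMk p := exists_homeomorph_cone.choose_spec p

lemma coneHomeo_mem_levelD_iff (p : ConeModel) (t : ℝ) :
    coneHomeo p ∈ levelD t ↔ p.1.1.1 = t := by
  obtain ⟨⟨b, z⟩, rfl⟩ := labMk_surjective p
  rw [coneHomeo_mk]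
  have h1 := conePoint_mem_surf_iff (t := b.1.1) (t' := t) b.2.2 z
  refine Iff.trans ?_ h1
  constructor
  · rintro ⟨p, hp, h⟩
    rcases Quotient.exact h with h | h <;> simp only at h <;> rw [h]
    · exact hp
    · exact neg_mem_surf_iff.2 hp
  · intro h
    exact ⟨_, h, rfl⟩

lemma coneHomeo_mem_levelDBd_iff (p : ConeModel) (t : ℝ) :
    coneHomeo p ∈ levelDBd t ↔ p.1.1.1 = t ∧ p.1.1.2 = 1 := by
  obtain ⟨⟨b, z⟩, rfl⟩ := labMk_surjective p
  constructor
  · rintro ⟨p, hp, h⟩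
    rw [coneHomeo_mk] at h
    have h2 : conePoint b.1.1 b.1.2 z ∈ surfBd t := by
      rcases Quotient.exact h with h | h <;> simp only at h <;> rw [h]
      · exact hp
      · exact neg_mem_surfBd_iff.2 hp
    have h3 : conePoint b.1.1 b.1.2 z ∈ surf t := by
      unfold surfBd at h2
      unfold surf
      split_ifs at h2 ⊢
      · exact h2.1
      · exact h2.1
    have h4 := (conePoint_mem_surf_iff b.2.2 z).1 h3
    subst h4
    exact ⟨rfl, (conePoint_mem_surfBd_iff b.2.2 z).1 h2⟩
  · rintro ⟨rfl, h⟩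
    rw [coneHomeo_mk]
    exact ⟨_, (conePoint_mem_surfBd_iff b.2.2 z).2 h, rfl⟩

end ConeModel

/-! ### Fiberwise reflection of labelled spaces. -/

section LabelledConjugation

open Set

variable {β : Type*} [TopologicalSpace β] {S : Set β} {ℓ u : β → ℝ}

/-- Complex conjugation, or the identity. -/
def conjIf (b : Bool) (w : ℂ) : ℂ := if b then (starRingEnd ℂ) w else w

lemma continuous_conjIf (b : Bool) : Continuous (conjIf b) := by
  cases b
  · exact continuous_id
  · exact Complex.continuous_conj

lemma conjIf_conjIf (b : Bool) (w : ℂ) : conjIf b (conjIf b w) = w := by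
  cases b <;> simp [conjIf]

lemma lab_flipIf (b : Bool) (l s : ℝ) (z : Circle) :
    lab l s (flipIf b z) = (conjIf b (lab l s z).1, conjIf b (lab l s z).2) := by
  cases b
  · simp [lab, conjIf, flipIf]
  · simp only [lab, conjIf, flipIf, if_true, Circle.coe_inv_eq_conj, map_mul, map_pow,
      Complex.conj_ofReal]

lemma flipIf_flipIf (b : Bool) (z : Circle) : flipIf b (flipIf b z) = z := by
  cases b <;> simp [flipIf]

/-- Fiberwise reflection of a labelled space, or the identity. -/
def labConj (b : Bool) : Lab S ℓ u ≃ₜ Lab S ℓ u :=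
  have hmem : ∀ p : Lab S ℓ u,
      ((p.1.1, conjIf b p.1.2.1, conjIf b p.1.2.2) : β × ℂ × ℂ) ∈ Lab S ℓ u := fun p => by
    obtain ⟨z, hz⟩ := p.2.2
    refine ⟨p.2.1, flipIf b z, ?_⟩
    rw [lab_flipIf, hz]
  have hinv : ∀ p : Lab S ℓ u, (⟨_, hmem ⟨_, hmem p⟩⟩ : Lab S ℓ u) = p := fun p =>
    Subtype.ext (by simp only [conjIf_conjIf])
  have hc : Continuous fun p : Lab S ℓ u => (⟨_, hmem p⟩ : Lab S ℓ u) := by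
    have := continuous_conjIf b
    fun_prop
  { toFun := fun p => ⟨_, hmem p⟩
    invFun := fun p => ⟨_, hmem p⟩
    left_inv := hinv
    right_inv := hinv
    continuous_toFun := hc
    continuous_invFun := hc }

lemma coe_labConj (b : Bool) (p : Lab S ℓ u) : ((labConj b p : Lab S ℓ u) : β × ℂ × ℂ) =
    (p.1.1, conjIf b p.1.2.1, conjIf b p.1.2.2) := rfl

lemma labConj_labMk (b : Bool) (x : S) (z : Circle) :
    labConj b (labMk S ℓ u (x, z)) = labMk S ℓ u (x, flipIf b z) :=
  Subtype.ext (Prod.ext rfl (lab_flipIf b _ _ z).symm)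

lemma labConj_labConj (b : Bool) (p : Lab S ℓ u) : labConj b (labConj b p) = p :=
  (labConj b).left_inv p

end LabelledConjugation

/-! ### Extending homeomorphisms of an end over the cone. -/

section ConeExtension

open Set

/-- The end of the cone model at the parameter `t`. -/
def coneFace (t : ℝ) : Set ConeModel := {p | p.1.1.1 = t}

instance (t : ℝ) : CompactSpace (coneFace t) :=
  isCompact_iff_compactSpace.1 (isClosed_eq (by fun_prop) continuous_const).isCompact

/-- The parametrization of the model of the cone. -/
abbrev cMk (p : coneBase × Circle) : ConeModel := labMk coneBase Prod.fst Prod.snd p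

/-- The end is a labelled space over a strip with zero-dimensional `E` and constant nonzero label,
so it has no singular point and its labile points are precisely the boundary points. -/
lemma coneFace_boundary_iff {t : ℝ} (ht : t ∈ Icc (-1 : ℝ) 1) (h0 : t ≠ 0)
    (φ : coneFace t ≃ₜ coneFace t) (x : coneFace t) :
    (φ x).1.1.1.2 = 1 ↔ x.1.1.1.2 = 1 := by
  let j : coneFace t ≃ₜ Lab (unitStrip (Fin 0 → ℝ)) (fun _ => t) Prod.snd :=
    { toFun := fun x => ⟨((0, x.1.1.1.2), x.1.1.2), x.1.2.1.2, by
        obtain ⟨z, hz⟩ := x.1.2.2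
        have h : x.1.1.1.1 = t := x.2
        exact ⟨z, by rw [hz, h]⟩⟩
      invFun := fun x => ⟨⟨((t, x.1.1.2), x.1.2), ⟨ht, x.2.1⟩, x.2.2⟩, rfl⟩
      left_inv := fun x => Subtype.ext (Subtype.ext (Prod.ext (Prod.ext x.2.symm rfl) rfl))
      right_inv := fun x => Subtype.ext (Prod.ext (Prod.ext (Subsingleton.elim _ _) rfl) rfl)
      continuous_toFun := by fun_prop
      continuous_invFun := by fun_prop }
  have h : ∀ x : coneFace t, Labile x ↔ x.1.1.1.2 = 1 := fun x => by
    rw [← labile_homeomorph_iff j]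
    exact labile_unitStrip_iff continuous_const (j x) fun h => h0 h.2
  rw [← h, ← h]
  exact labile_homeomorph_iff φ

lemma mem_Icc_of_sign {e : ℝ} (he : e = 1 ∨ e = -1) : e ∈ Icc (-1 : ℝ) 1 := by
  rcases he with rfl | rfl <;> norm_num

/-- The boundary circle of the end of the cone model at the parameter `t`. -/
def faceCircle {t : ℝ} (ht : t ∈ Icc (-1 : ℝ) 1) (z : Circle) : coneFace t :=
  ⟨cMk (⟨(t, 1), ht, by norm_num⟩, z), rfl⟩

lemma continuous_cMk : Continuous cMk :=
  continuous_labMk continuous_fst.continuousOn continuous_snd.continuousOn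

lemma continuous_faceCircle {t : ℝ} (ht : t ∈ Icc (-1 : ℝ) 1) : Continuous (faceCircle ht) :=
  (continuous_cMk.comp (by fun_prop)).subtype_mk _

lemma faceCircle_injective {t : ℝ} (ht : t ∈ Icc (-1 : ℝ) 1) :
    Function.Injective (faceCircle ht) := by
  intro z z' h
  have h1 : cMk _ = cMk _ := congrArg Subtype.val h
  rw [labMk_eq_iff] at h1
  simpa using h1.2

lemma exists_faceCircle {t : ℝ} (ht : t ∈ Icc (-1 : ℝ) 1) {x : coneFace t}
    (hx : x.1.1.1.2 = 1) : ∃ z, faceCircle ht z = x := by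
  obtain ⟨x, hxt⟩ := x
  obtain ⟨⟨⟨⟨s, r⟩, hb⟩, z⟩, rfl⟩ := labMk_surjective x
  have h1 : s = t := hxt
  have h2 : r = 1 := hx
  subst h1 h2
  exact ⟨z, rfl⟩

lemma exists_circle_homeomorph {t : ℝ} (ht : t ∈ Icc (-1 : ℝ) 1) (h0 : t ≠ 0)
    (φ : coneFace t ≃ₜ coneFace t) :
    ∃ f : Circle ≃ₜ Circle, ∀ z, φ (faceCircle ht z) = faceCircle ht (f z) := by
  have h : ∀ (φ : coneFace t ≃ₜ coneFace t) z, ∃ z', faceCircle ht z' = φ (faceCircle ht z) :=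
    fun φ z => exists_faceCircle ht ((coneFace_boundary_iff ht h0 φ _).2 rfl)
  choose F hF using h
  have hFc : ∀ φ, Continuous (F φ) := by
    intro φ
    have he : IsEmbedding (faceCircle ht) :=
      ((continuous_faceCircle ht).isClosedEmbedding (faceCircle_injective ht)).isEmbedding
    rw [he.continuous_iff, show faceCircle ht ∘ F φ = φ ∘ faceCircle ht from funext (hF φ)]
    exact φ.continuous.comp (continuous_faceCircle ht)
  refine ⟨{ toFun := F φ, invFun := F φ.symm, left_inv := ?_, right_inv := ?_,
            continuous_toFun := hFc _, continuous_invFun := hFc _ }, fun z => (hF φ z).symm⟩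
  · intro z
    apply faceCircle_injective ht
    rw [hF, hF, φ.symm_apply_apply]
  · intro z
    apply faceCircle_injective ht
    rw [hF, hF, φ.apply_symm_apply]

/-- Contraction of the cone model towards its apex. -/
def coneScale (r : Icc (0 : ℝ) 1) (p : ConeModel) : ConeModel :=
  ⟨((r * p.1.1.1, r * p.1.1.2), (r : ℂ) * p.1.2.1, (r : ℂ) * p.1.2.2), by
    obtain ⟨⟨⟨⟨t, s⟩, ⟨ht1, ht2⟩, hs1, hs2⟩, z⟩, rfl⟩ := labMk_surjective p
    obtain ⟨r, hr0, hr1⟩ := r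
    simp only at ht1 ht2 hs1 hs2
    refine ⟨⟨⟨?_, ?_⟩, ⟨?_, ?_⟩⟩, z, ?_⟩
    · simp only [labMk]; nlinarith
    · simp only [labMk]; nlinarith
    · simp only [labMk]; positivity
    · simp only [labMk]; nlinarith
    · simp only [labMk, lab]
      have : max (r * t) 0 = r * max t 0 := by
        rw [mul_max_of_nonneg _ _ hr0, mul_zero]
      rw [this]
      push_cast
      exact Prod.ext (by ring) (by ring)⟩

lemma continuous_coneScale : Continuous fun p : ConeModel × Icc (0 : ℝ) 1 => coneScale p.2 p.1 := by
  refine Continuous.subtype_mk ?_ _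
  fun_prop

lemma coneScale_one (p : ConeModel) : coneScale 1 p = p := by
  apply Subtype.ext
  simp [coneScale]

/-- The size of a point of the cone model. -/
def coneNorm (p : ConeModel) : ℝ := max |p.1.1.1| p.1.1.2

lemma coneNorm_scale (r : Icc (0 : ℝ) 1) (p : ConeModel) :
    coneNorm (coneScale r p) = r * coneNorm p := by
  simp only [coneNorm, coneScale]
  rw [abs_mul, abs_of_nonneg r.2.1, mul_max_of_nonneg _ _ r.2.1]

lemma coneScale_eq_iff {r r' : Icc (0 : ℝ) 1} {p p' : ConeModel} (hp : coneNorm p = 1)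
    (hp' : coneNorm p' = 1) :
    coneScale r p = coneScale r' p' ↔ r = r' ∧ (r = 0 ∨ p = p') := by
  constructor
  · intro h
    have h1 : r = r' := by
      have h2 := congrArg coneNorm h
      rw [coneNorm_scale, coneNorm_scale, hp, hp', mul_one, mul_one] at h2
      exact Subtype.ext h2
    subst h1
    refine ⟨rfl, ?_⟩
    by_cases h0 : r = 0
    · exact Or.inl h0
    right
    have h0' : (r : ℝ) ≠ 0 := fun h => h0 (Subtype.ext h)
    have h0'' : (r : ℂ) ≠ 0 := by exact_mod_cast h0'
    simp only [coneScale, Subtype.mk.injEq, Prod.mk.injEq, mul_eq_mul_left_iff, h0', or_false,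
      h0''] at h
    exact Subtype.ext (Prod.ext (Prod.ext h.1.1 h.1.2) (Prod.ext h.2.1 h.2.2))
  · rintro ⟨rfl, rfl | rfl⟩
    · apply Subtype.ext
      simp [coneScale]
    · rfl

/-- The pieces of the link of the apex of the cone model: two ends and the lateral annulus. -/
abbrev ConeLink (e : ℝ) : Type := coneFace e ⊕ (Icc (0 : ℝ) 1 × Circle) ⊕ coneFace (-e)

variable {e : ℝ}

lemma annulus_mem (he : e = 1 ∨ e = -1) (s : Icc (0 : ℝ) 1) :
    ((e * (1 - 2 * s), 1) : ℝ × ℝ) ∈ coneBase := by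
  obtain ⟨s, hs0, hs1⟩ := s
  rcases he with rfl | rfl
  · exact ⟨⟨by simp only; linarith, by simp only; linarith⟩, by norm_num⟩
  · exact ⟨⟨by simp only; linarith, by simp only; linarith⟩, by norm_num⟩

/-- The map from the pieces of the link to the cone model. -/
def linkMap (he : e = 1 ∨ e = -1) : ConeLink e → ConeModel
  | Sum.inl x => x
  | Sum.inr (Sum.inl (s, z)) => cMk (⟨_, annulus_mem he s⟩, z)
  | Sum.inr (Sum.inr x) => x

lemma continuous_linkMap (he : e = 1 ∨ e = -1) : Continuous (linkMap he) := by
  rw [continuous_sum_dom, continuous_sum_dom]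
  refine ⟨continuous_subtype_val, ?_, continuous_subtype_val⟩
  exact continuous_cMk.comp (f := fun p : Icc (0 : ℝ) 1 × Circle =>
    ((⟨_, annulus_mem he p.1⟩ : coneBase), p.2)) (by fun_prop)

lemma coneNorm_linkMap (he : e = 1 ∨ e = -1) (x : ConeLink e) : coneNorm (linkMap he x) = 1 := by
  have habs : |e| = 1 := by rcases he with rfl | rfl <;> simp
  rcases x with ⟨x, hx⟩ | ⟨s, z⟩ | ⟨x, hx⟩
  · have h1 : x.1.1.1 = e := hx
    simp only [linkMap, coneNorm, h1, habs]
    exact max_eq_left x.2.1.2.2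
  · have h1 := (annulus_mem he s).1
    simp only [linkMap, coneNorm, labMk]
    exact max_eq_right (abs_le.2 h1)
  · have h1 : x.1.1.1 = -e := hx
    simp only [linkMap, coneNorm, h1, abs_neg, habs]
    exact max_eq_left x.2.1.2.2

/-- The cone model as a cone. -/
def conePolar (he : e = 1 ∨ e = -1) (p : ConeLink e × Icc (0 : ℝ) 1) : ConeModel :=
  coneScale p.2 (linkMap he p.1)

lemma conePolar_surjective (he : e = 1 ∨ e = -1) : Function.Surjective (conePolar he) := by
  intro p
  have habs : |e| = 1 := by rcases he with rfl | rfl <;> simp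
  have hee : e * e = 1 := by rcases he with rfl | rfl <;> norm_num
  have key : ∀ p : ConeModel, coneNorm p = 1 → ∃ x, linkMap he x = p := by
    intro p hp
    obtain ⟨⟨⟨⟨t, s⟩, ht, hs⟩, z⟩, rfl⟩ := labMk_surjective p
    simp only [coneNorm, labMk] at hp
    by_cases h1 : s = 1
    · subst h1
      have h2 : e * t ≤ 1 := by
        have := abs_le.2 ht
        have h3 := le_abs_self (e * t)
        rw [abs_mul, habs] at h3
        linarith
      have h3 : -1 ≤ e * t := by
        have := abs_le.2 ht
        have h3 := neg_abs_le (e * t)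
        rw [abs_mul, habs] at h3
        linarith
      refine ⟨Sum.inr (Sum.inl (⟨(1 - e * t) / 2, by linarith, by linarith⟩, z)), ?_⟩
      simp only [linkMap]
      congr 4
      linear_combination t * hee
    · have h2 : |t| = 1 := by
        rcases max_choice |t| s with h | h
        · rw [← h, hp]
        · exact absurd (h.symm.trans hp) h1
      have h3 : t = e ∨ t = -e := by
        rw [← habs] at h2
        exact abs_eq_abs.1 h2
      rcases h3 with h3 | h3
      · exact ⟨Sum.inl ⟨_, h3⟩, rfl⟩
      · exact ⟨Sum.inr (Sum.inr ⟨_, h3⟩), rfl⟩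
  obtain ⟨⟨⟨⟨t, s⟩, ht, hs⟩, z⟩, rfl⟩ := labMk_surjective p
  simp only at ht hs
  set r := max |t| s with hr
  have hrt : |t| ≤ r := le_max_left _ _
  have hrs : s ≤ r := le_max_right _ _
  have hr0 : 0 ≤ r := le_trans (abs_nonneg t) hrt
  have hr1 : r ≤ 1 := max_le (abs_le.2 ht) hs.2
  rcases hr0.eq_or_lt with h | h
  · have h1 : t = 0 := abs_eq_zero.1 (le_antisymm (h ▸ hrt) (abs_nonneg t))
    have h2 : s = 0 := le_antisymm (h ▸ hrs) hs.1
    subst h1 h2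
    refine ⟨(Sum.inr (Sum.inl (0, 1)), 0), Subtype.ext ?_⟩
    simp [conePolar, coneScale, labMk, lab]
  · have hb : ((t / r, s / r) : ℝ × ℝ) ∈ coneBase := by
      have h1 := abs_le.1 hrt
      refine ⟨⟨?_, ?_⟩, ?_, ?_⟩
      · simp only; rw [le_div_iff₀ h]; linarith
      · simp only; rw [div_le_one h]; linarith
      · exact div_nonneg hs.1 hr0
      · simp only; rwa [div_le_one h]
    obtain ⟨x, hx⟩ := key (cMk (⟨_, hb⟩, z)) (by
      simp only [coneNorm, labMk, abs_div, abs_of_pos h]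
      rw [max_div_div_right hr0, ← hr, div_self h.ne'])
    refine ⟨(x, ⟨r, hr0, hr1⟩), Subtype.ext ?_⟩
    have hrc : (r : ℂ) ≠ 0 := by exact_mod_cast h.ne'
    simp only [conePolar, hx, coneScale, labMk, lab]
    refine Prod.ext (Prod.ext (mul_div_cancel₀ t h.ne') (mul_div_cancel₀ s h.ne')) (Prod.ext ?_ ?_)
    · simp only
      push_cast
      field_simp
    · have : max (t / r) 0 = max t 0 / r := by
        rw [← zero_div r, max_div_div_right hr0, zero_div]
      simp only [this]
      push_cast
      field_simp

lemma isQuotientMap_conePolar (he : e = 1 ∨ e = -1) : IsQuotientMap (conePolar he) := by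
  refine isQuotientMap_of_compact ?_ (conePolar_surjective he)
  have h : Continuous fun p : ConeLink e × Icc (0 : ℝ) 1 => (linkMap he p.1, p.2) :=
    ((continuous_linkMap he).comp continuous_fst).prodMk continuous_snd
  exact continuous_coneScale.comp h

/-- Data on the pieces of the link that fit together. -/
structure LinkData (he : e = 1 ∨ e = -1) (b : Bool) (f : Circle → Circle)
    (φ : coneFace e ≃ₜ coneFace e)
    (H : (Icc (0 : ℝ) 1 × Circle) ≃ₜ (Icc (0 : ℝ) 1 × Circle)) : Prop where
  face : ∀ z, φ (faceCircle (mem_Icc_of_sign he) z) = faceCircle (mem_Icc_of_sign he) (f z)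
  fst : ∀ p, (H p).1 = p.1
  zero : ∀ z, (H (0, z)).2 = f z
  one : ∀ z, (H (1, z)).2 = flipIf b z

/-- The homeomorphism of an end induced by conjugation. -/
def faceConj (t : ℝ) (b : Bool) : coneFace t ≃ₜ coneFace t :=
  (labConj b).subtype fun _ => Iff.rfl

/-- The induced homeomorphism of the pieces of the link. -/
def linkHomeo (b : Bool) (φ : coneFace e ≃ₜ coneFace e)
    (H : (Icc (0 : ℝ) 1 × Circle) ≃ₜ (Icc (0 : ℝ) 1 × Circle)) : ConeLink e ≃ₜ ConeLink e :=
  φ.sumCongr (H.sumCongr (faceConj (-e) b))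

/-- The pieces of the link meet only in the two boundary circles of the annulus. At `s = 0` the
isotopy agrees with the given homeomorphism of the end, at `s = 1` with the reflection of the
opposite end. -/
lemma linkMap_linkHomeo {he : e = 1 ∨ e = -1} {b : Bool} {f : Circle → Circle}
    {φ : coneFace e ≃ₜ coneFace e} {H : (Icc (0 : ℝ) 1 × Circle) ≃ₜ (Icc (0 : ℝ) 1 × Circle)}
    (hD : LinkData he b f φ H) {x y : ConeLink e} (h : linkMap he x = linkMap he y) :
    linkMap he (linkHomeo b φ H x) = linkMap he (linkHomeo b φ H y) := by
  have he0 : e ≠ 0 := by rcases he with rfl | rfl <;> norm_num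
  have h1 : ∀ (x : coneFace e) (s : Icc (0 : ℝ) 1) (z : Circle),
      linkMap he (Sum.inl x) = linkMap he (Sum.inr (Sum.inl (s, z))) →
      linkMap he (linkHomeo b φ H (Sum.inl x)) =
        linkMap he (linkHomeo b φ H (Sum.inr (Sum.inl (s, z)))) := by
    intro x s z h
    simp only [linkMap] at h
    have hs : s = 0 := by
      have h2 : x.1.1.1.1 = e := x.2
      rw [h] at h2
      simp only [labMk] at h2
      have : e * s = 0 := by linarith
      exact Subtype.ext ((mul_eq_zero.1 this).resolve_left he0)
    subst hs
    have hx : x = faceCircle (mem_Icc_of_sign he) z := by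
      apply Subtype.ext
      rw [h]
      simp only [faceCircle]
      congr 3
      simp
    show (φ x : ConeModel) = linkMap he (Sum.inr (Sum.inl (H (0, z))))
    rw [hx, hD.face, show H (0, z) = (0, f z) from Prod.ext (hD.fst _) (hD.zero _)]
    simp only [faceCircle, linkMap]
    congr 3
    simp
  have h2 : ∀ (x : coneFace (-e)) (s : Icc (0 : ℝ) 1) (z : Circle),
      linkMap he (Sum.inr (Sum.inr x)) = linkMap he (Sum.inr (Sum.inl (s, z))) →
      linkMap he (linkHomeo b φ H (Sum.inr (Sum.inr x))) =
        linkMap he (linkHomeo b φ H (Sum.inr (Sum.inl (s, z)))) := by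
    intro x s z h
    simp only [linkMap] at h
    have hs : s = 1 := by
      have h2 : x.1.1.1.1 = -e := x.2
      rw [h] at h2
      simp only [labMk] at h2
      have : e * (1 - s) = 0 := by linarith
      have := (mul_eq_zero.1 this).resolve_left he0
      exact Subtype.ext (by simp only [Icc.coe_one]; linarith)
    subst hs
    show (labConj b x.1 : ConeModel) = linkMap he (Sum.inr (Sum.inl (H (1, z))))
    rw [h, labConj_labMk, show H (1, z) = (1, flipIf b z) from Prod.ext (hD.fst _) (hD.one _)]
    rfl
  rcases x with x | ⟨s, z⟩ | x <;> rcases y with y | ⟨s', z'⟩ | y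
  · rw [show x = y from Subtype.ext h]
  · exact h1 _ _ _ h
  · have h3 : x.1.1.1.1 = e := x.2
    have h4 : y.1.1.1.1 = -e := y.2
    simp only [linkMap] at h
    rw [h, h4] at h3
    exact absurd (by linarith) he0
  · exact (h1 _ _ _ h.symm).symm
  · simp only [linkMap] at h
    rw [labMk_eq_iff] at h
    simp only [Subtype.mk.injEq, Prod.mk.injEq, and_true, one_ne_zero, false_and, or_false] at h
    obtain ⟨h3, rfl⟩ := h
    have h4 : s = s' := by
      have := mul_left_cancel₀ he0 h3
      exact Subtype.ext (by linarith)
    rw [h4]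
  · exact (h2 _ _ _ h.symm).symm
  · have h3 : x.1.1.1.1 = -e := x.2
    have h4 : y.1.1.1.1 = e := y.2
    simp only [linkMap] at h
    rw [h, h4] at h3
    exact absurd (by linarith) he0
  · exact h2 _ _ _ h
  · rw [show x = y from Subtype.ext h]

/-- A homeomorphism of an end of the cone model extends to the whole cone, so that it is the
identity or the reflection on the other end. -/
lemma exists_cone_extension (he : e = 1 ∨ e = -1) (φ : coneFace e ≃ₜ coneFace e) :
    ∃ (b : Bool) (Φ : ConeModel ≃ₜ ConeModel), (∀ x : coneFace e, Φ x = φ x) ∧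
      (∀ x ∈ coneFace (-e), Φ x = labConj b x) ∧ ∀ p, (Φ p).1.1.2 = 1 ↔ p.1.1.2 = 1 := by
  have he0 : e ≠ 0 := by rcases he with rfl | rfl <;> norm_num
  obtain ⟨f, hf⟩ := exists_circle_homeomorph (mem_Icc_of_sign he) he0 φ
  obtain ⟨b, H, hH, hH'⟩ := circle_isotopy f
  have hD : LinkData he b f φ H := ⟨hf, hH, fun z => (hH' _).1 rfl, fun z => (hH' _).2 rfl⟩
  have hH1 : ∀ p, (H.symm p).1 = p.1 := fun p => by
    rw [← hH (H.symm p), H.apply_symm_apply]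
  have hD' : LinkData he b f.symm φ.symm H.symm := by
    refine ⟨fun z => ?_, hH1, fun z => ?_, fun z => ?_⟩
    · rw [φ.symm_apply_eq, hf, f.apply_symm_apply]
    · apply f.injective
      rw [f.apply_symm_apply, ← hD.zero]
      have : (0, (H.symm (0, z)).2) = H.symm (0, z) := Prod.ext (hH1 (0, z)).symm rfl
      rw [this, H.apply_symm_apply]
    · have h1 := hD.one (H.symm (1, z)).2
      have : (1, (H.symm (1, z)).2) = H.symm (1, z) := Prod.ext (hH1 (1, z)).symm rfl
      rw [this, H.apply_symm_apply] at h1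
      rw [show z = _ from h1, flipIf_flipIf, ← h1]
  let F := linkHomeo b φ H
  have hF : ∀ x y, linkMap he x = linkMap he y ↔ linkMap he (F x) = linkMap he (F y) := by
    intro x y
    refine ⟨linkMap_linkHomeo hD, fun h => ?_⟩
    have h1 := linkMap_linkHomeo hD' h
    have h2 : ∀ x, linkHomeo b φ.symm H.symm (F x) = x := by
      intro x
      rcases x with x | x | x
      · exact congrArg Sum.inl (φ.symm_apply_apply x)
      · exact congrArg (fun t => Sum.inr (Sum.inl t)) (H.symm_apply_apply x)
      · exact congrArg (fun t => Sum.inr (Sum.inr t)) (Subtype.ext (labConj_labConj b x.1))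
    rwa [h2, h2] at h1
  have hq := isQuotientMap_conePolar he
  have hq' : IsQuotientMap fun p : ConeLink e × Icc (0 : ℝ) 1 => conePolar he (F p.1, p.2) :=
    hq.comp (F.prodCongr (Homeomorph.refl _)).isQuotientMap
  -- Coning off: in polar coordinates the homeomorphism of the link acts with fixed radius, and by
  -- `hF` it respects the identifications in both directions.
  obtain ⟨Φ, hΦ⟩ := exists_homeomorph_of_quotient hq hq' fun x y => by
    unfold conePolar
    rw [coneScale_eq_iff (coneNorm_linkMap he _) (coneNorm_linkMap he _),
      coneScale_eq_iff (coneNorm_linkMap he _) (coneNorm_linkMap he _), hF]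
  have h1 : ∀ x, Φ (linkMap he x) = linkMap he (F x) := fun x => by
    have := hΦ (x, 1)
    simpa only [conePolar, coneScale_one] using this
  refine ⟨b, Φ, fun x => h1 (Sum.inl x), fun x hx => h1 (Sum.inr (Sum.inr ⟨x, hx⟩)), ?_⟩
  intro p
  obtain ⟨⟨x, r⟩, rfl⟩ := conePolar_surjective he p
  rw [hΦ]
  have hle : ∀ p : ConeModel, p.1.1.2 ∈ Icc (0 : ℝ) 1 := fun p => p.2.1.2
  have hmul : ∀ p : ConeModel, (coneScale r p).1.1.2 = 1 ↔ (r : ℝ) = 1 ∧ p.1.1.2 = 1 := by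
    intro p
    have h2 := hle p
    have h3 := r.2
    simp only [coneScale]
    constructor
    · intro h
      have : (r : ℝ) = 1 := by nlinarith [h2.1, h2.2, h3.1, h3.2]
      exact ⟨this, by rwa [this, one_mul] at h⟩
    · rintro ⟨h, h'⟩
      rw [h, h', one_mul]
  simp only [conePolar, hmul]
  refine and_congr_right fun _ => ?_
  rcases x with x | ⟨s, z⟩ | x
  · exact coneFace_boundary_iff (mem_Icc_of_sign he) he0 φ x
  · exact Iff.rfl
  · exact Iff.rfl

end ConeExtension

/-! ### The standard labelled spaces over the annulus. -/

section WaveSpaces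

open Set

/-- The label function with `N` exceptional intervals per period. -/
def waveLabel (N : ℕ) (b : ℝ × ℝ) : ℝ := -Real.cos (2 * Real.pi * N * b.1)

lemma continuous_waveLabel (N : ℕ) : Continuous (waveLabel N) := by
  unfold waveLabel; fun_prop

lemma waveLabel_add_int (N : ℕ) (x s s' : ℝ) (n : ℤ) :
    waveLabel N (x + n, s) = waveLabel N (x, s') := by
  simp only [waveLabel]
  rw [show 2 * Real.pi * N * (x + n) = 2 * Real.pi * N * x + ((N * n : ℤ) : ℝ) * (2 * Real.pi) by
    push_cast; ring, Real.cos_add_int_mul_two_pi]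

/-- The periodic labelled space over the strip `ℝ × [0,1]`. -/
abbrev WaveCover (N : ℕ) : Set ((ℝ × ℝ) × ℂ × ℂ) := Lab (unitStrip ℝ) (waveLabel N) Prod.snd

/-- Whether translation by `n` reflects the orbits. -/
def twist (b : Bool) (n : ℤ) : Bool := b && decide (Odd n)

lemma conjIf_twist_add (b : Bool) (m n : ℤ) (w : ℂ) :
    conjIf (twist b (m + n)) w = conjIf (twist b m) (conjIf (twist b n) w) := by
  cases b
  · simp [twist, conjIf]
  · by_cases hm : Odd m <;> by_cases hn : Odd n <;>
      simp [twist, conjIf, Int.odd_add, hm, hn, ← Int.not_odd_iff_even]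

variable {N : ℕ} {b : Bool}

/-- Translation by `n` on the periodic labelled space. -/
def waveShift (b : Bool) (n : ℤ) (p : WaveCover N) : WaveCover N :=
  ⟨((p.1.1.1 + n, p.1.1.2), conjIf (twist b n) p.1.2.1, conjIf (twist b n) p.1.2.2), p.2.1, by
    obtain ⟨z, hz⟩ := p.2.2
    refine ⟨flipIf (twist b n) z, ?_⟩
    rw [lab_flipIf]
    simp only
    rw [waveLabel_add_int N p.1.1.1 p.1.1.2 p.1.1.2 n, hz]⟩

lemma waveShift_zero (p : WaveCover N) : waveShift b 0 p = p := by
  apply Subtype.ext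
  simp [waveShift, twist, conjIf]

lemma waveShift_add (m n : ℤ) (p : WaveCover N) :
    waveShift b (m + n) p = waveShift b m (waveShift b n p) := by
  apply Subtype.ext
  simp only [waveShift, conjIf_twist_add]
  push_cast
  rw [add_comm (m : ℝ), add_assoc]

lemma continuous_waveShift (n : ℤ) : Continuous (waveShift b n : WaveCover N → WaveCover N) := by
  have := continuous_conjIf (twist b n)
  refine Continuous.subtype_mk ?_ _
  fun_prop

/-- Points that differ by a translation. -/
def waveSetoid (b : Bool) (N : ℕ) : Setoid (WaveCover N) where
  r p q := ∃ n : ℤ, q = waveShift b n p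
  iseqv :=
    { refl := fun p => ⟨0, (waveShift_zero p).symm⟩
      symm := by
        rintro p q ⟨n, rfl⟩
        exact ⟨-n, by rw [← waveShift_add, neg_add_cancel, waveShift_zero]⟩
      trans := by
        rintro p q s ⟨n, rfl⟩ ⟨m, rfl⟩
        exact ⟨m + n, by rw [waveShift_add]⟩ }

/-- The labelled space over the annulus with `N` exceptional intervals, whose orbits are reflected
along the core if `b` is true. -/
def WaveSpace (b : Bool) (N : ℕ) : Type := Quotient (waveSetoid b N)

instance : TopologicalSpace (WaveSpace b N) := inferInstanceAs (TopologicalSpace (Quotient _))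

/-- The quotient map to `WaveSpace b N`. -/
def waveMk (b : Bool) (N : ℕ) (p : WaveCover N) : WaveSpace b N := Quotient.mk _ p

lemma waveMk_eq_iff {p q : WaveCover N} : waveMk b N p = waveMk b N q ↔ ∃ n, q = waveShift b n p :=
  Quotient.eq (r := waveSetoid b N)

lemma waveMk_surjective : Function.Surjective (waveMk b N) := Quotient.mk_surjective

lemma continuous_waveMk : Continuous (waveMk b N) := continuous_quotient_mk'

lemma isOpenMap_waveMk : IsOpenMap (waveMk b N) := by
  intro U hU
  have h : waveMk b N ⁻¹' (waveMk b N '' U) = ⋃ n : ℤ, waveShift b n ⁻¹' U := by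
    ext p
    simp only [mem_preimage, mem_image, mem_iUnion]
    constructor
    · rintro ⟨q, hq, h⟩
      obtain ⟨n, rfl⟩ := waveMk_eq_iff.1 h.symm
      exact ⟨n, hq⟩
    · rintro ⟨n, hn⟩
      exact ⟨_, hn, (waveMk_eq_iff.2 ⟨n, rfl⟩).symm⟩
  have h2 : IsOpen (waveMk b N ⁻¹' (waveMk b N '' U)) := by
    rw [h]
    exact isOpen_iUnion fun n => hU.preimage (continuous_waveShift n)
  exact h2

lemma isQuotientMap_waveMk : IsQuotientMap (waveMk b N) := isQuotientMap_quotient_mk'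

/-- The size of a point. -/
def waveSize : WaveSpace b N → ℝ :=
  Quotient.lift (fun p => p.1.1.2) (by rintro p _ ⟨n, rfl⟩; rfl)

lemma waveSize_mk (p : WaveCover N) : waveSize (waveMk b N p) = p.1.1.2 := rfl

/-- A square root of the coordinate along the core when orbits are reflected. -/
def waveSign (b : Bool) (x : ℝ) : ℂ := if b then (Circle.exp (Real.pi * x) : ℂ) else 1

lemma waveSign_ne_zero (x : ℝ) : waveSign b x ≠ 0 := by
  unfold waveSign
  split_ifs
  · exact Circle.coe_ne_zero _
  · exact one_ne_zero

/-- In the twisted case an odd translation changes the sign of the imaginary part; the half-angle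
factor `exp (iπx)` changes sign as well, so the product descends to the quotient. -/
lemma waveSign_mul_im (x : ℝ) (n : ℤ) (w : ℂ) :
    waveSign b (x + n) * ((conjIf (twist b n) w).im : ℂ) = waveSign b x * (w.im : ℂ) := by
  cases b
  · simp [waveSign, twist, conjIf]
  · rcases Int.even_or_odd n with hn | hn
    · have hn' : ¬ Odd n := Int.not_odd_iff_even.2 hn
      obtain ⟨k, rfl⟩ := hn
      have : Real.pi * (x + ((k + k : ℤ) : ℝ)) = Real.pi * x + k * (2 * Real.pi) := by
        push_cast; ring
      simp only [waveSign, twist, conjIf, hn', this, exp_two_pi_int]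
      simp
    · have hn' := hn
      obtain ⟨k, rfl⟩ := hn
      have : Real.pi * (x + ((2 * k + 1 : ℤ) : ℝ)) =
          (Real.pi * x + Real.pi) + k * (2 * Real.pi) := by
        push_cast; ring
      simp only [waveSign, twist, conjIf, hn', this, Circle.exp_add]
      simp

lemma conjIf_re (a : Bool) (w : ℂ) : (conjIf a w).re = w.re := by
  cases a <;> simp [conjIf]

/-- Coordinates of a point that are invariant under translation. -/
def waveInvariant (b : Bool) (p : WaveCover N) : Circle × ℝ × (ℝ × ℝ) × (ℂ × ℂ) :=
  (Circle.exp (2 * Real.pi * p.1.1.1), p.1.1.2, (p.1.2.1.re, p.1.2.2.re),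
    (waveSign b p.1.1.1 * (p.1.2.1.im : ℂ), waveSign b p.1.1.1 * (p.1.2.2.im : ℂ)))

lemma waveInvariant_shift (n : ℤ) (p : WaveCover N) :
    waveInvariant b (waveShift b n p) = waveInvariant b p := by
  have h : 2 * Real.pi * (p.1.1.1 + n) = 2 * Real.pi * p.1.1.1 + n * (2 * Real.pi) := by ring
  simp only [waveInvariant, waveShift, waveSign_mul_im, conjIf_re, h, exp_two_pi_int]

lemma exists_waveShift_of_invariant {p q : WaveCover N}
    (h : waveInvariant b p = waveInvariant b q) : ∃ n, q = waveShift b n p := by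
  have hpi := Real.pi_pos
  have h1 := congrArg (fun t => t.1) h
  simp only [waveInvariant] at h1
  obtain ⟨n, hn⟩ := exp_eq_exp_iff.1 h1.symm
  have hx : q.1.1.1 = p.1.1.1 + n := by
    have : 2 * Real.pi * (q.1.1.1 - (p.1.1.1 + n)) = 0 := by linear_combination hn
    have := (mul_eq_zero.1 this).resolve_left (by positivity)
    linarith
  refine ⟨n, ?_⟩
  rw [← waveInvariant_shift n p] at h
  have hx' : (waveShift b n p).1.1.1 = q.1.1.1 := hx.symm
  generalize waveShift b n p = p' at h hx'
  simp only [waveInvariant, Prod.mk.injEq, hx'] at h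
  obtain ⟨-, h2, ⟨h3, h4⟩, h5, h6⟩ := h
  have h5' := mul_left_cancel₀ (waveSign_ne_zero _) h5
  have h6' := mul_left_cancel₀ (waveSign_ne_zero _) h6
  refine Subtype.ext (Prod.ext (Prod.ext hx'.symm h2.symm) (Prod.ext ?_ ?_))
  · exact Complex.ext h3.symm (by exact_mod_cast h5'.symm)
  · exact Complex.ext h4.symm (by exact_mod_cast h6'.symm)

/-- The translation invariants form a continuous injection into a Hausdorff space: the first one
fixes the translation, the others the remaining coordinates. -/
instance : T2Space (WaveSpace b N) := by
  let F : WaveSpace b N → Circle × ℝ × (ℝ × ℝ) × (ℂ × ℂ) :=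
    Quotient.lift (waveInvariant b) (by
      rintro p _ ⟨n, rfl⟩
      exact (waveInvariant_shift n p).symm)
  have hF : Continuous F := by
    apply Continuous.quotient_lift
    have h : Continuous (waveSign b) := by
      unfold waveSign
      split_ifs <;> fun_prop
    unfold waveInvariant
    fun_prop
  refine T2Space.of_injective_continuous (f := F) ?_ hF
  intro x y
  obtain ⟨p, rfl⟩ := waveMk_surjective x
  obtain ⟨q, rfl⟩ := waveMk_surjective y
  exact fun h => waveMk_eq_iff.2 (exists_waveShift_of_invariant h)

end WaveSpaces

/-! ### Decomposition of the wave spaces into cones. -/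

section Cells

open Set

variable {N : ℕ} {b : Bool}

/-- The position in the `j`-th cell of the level with parameter `t`, between `0` and `1`. -/
def cellPhase (j : ℕ) (t : ℝ) : ℝ := Real.arccos (if Even j then -t else t) / Real.pi

lemma continuous_cellPhase (j : ℕ) : Continuous (cellPhase j) := by
  unfold cellPhase
  split_ifs <;> fun_prop

lemma cellPhase_mem (j : ℕ) (t : ℝ) : cellPhase j t ∈ Icc (0 : ℝ) 1 := by
  have hpi := Real.pi_pos
  unfold cellPhase
  exact ⟨div_nonneg (Real.arccos_nonneg _) hpi.le, (div_le_one hpi).2 (Real.arccos_le_pi _)⟩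

/-- On each half period the wave label runs monotonically through `[-1,1]`, in a direction given by
the parity of `j`, as do the parameters of consecutive cones. So each half period carries a copy of
the cone model. -/
lemma cos_cellPhase (j : ℕ) {t : ℝ} (ht : t ∈ Icc (-1 : ℝ) 1) :
    -Real.cos (Real.pi * (j + cellPhase j t)) = t := by
  have hpi := Real.pi_pos
  have h1 : Real.pi * (j + cellPhase j t) =
      Real.arccos (if Even j then -t else t) + j * Real.pi := by
    unfold cellPhase
    rw [mul_add, mul_div_cancel₀ _ hpi.ne']
    ring
  rw [h1, Real.cos_add_nat_mul_pi]
  split_ifs with h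
  · rw [h.neg_one_pow, Real.cos_arccos (by linarith [ht.2]) (by linarith [ht.1])]
    ring
  · rw [(Nat.not_even_iff_odd.1 h).neg_one_pow, Real.cos_arccos ht.1 ht.2]
    ring

lemma cellPhase_eq_one_iff (j : ℕ) {t : ℝ} (ht : t ∈ Icc (-1 : ℝ) 1) :
    cellPhase j t = 1 ↔ t = endParam j := by
  have hpi := Real.pi_pos
  unfold cellPhase endParam
  rw [div_eq_one_iff_eq hpi.ne', Real.arccos_eq_pi]
  have h1 := ht.1
  have h2 := ht.2
  split_ifs
  · constructor <;> intro h <;> linarith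
  · constructor <;> intro h <;> linarith

lemma endParam_succ (j : ℕ) : endParam (j + 1) = -endParam j := by
  unfold endParam
  by_cases h : Even j <;> simp [Nat.even_add_one, h]

lemma endParam_sign (j : ℕ) : endParam j = 1 ∨ endParam j = -1 := by
  unfold endParam
  split_ifs <;> simp

lemma cellPhase_eq_zero_iff (j : ℕ) {t : ℝ} (ht : t ∈ Icc (-1 : ℝ) 1) :
    cellPhase j t = 0 ↔ t = -endParam j := by
  have hpi := Real.pi_pos
  unfold cellPhase endParam
  rw [div_eq_zero_iff, or_iff_left hpi.ne', Real.arccos_eq_zero]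
  have h1 := ht.1
  have h2 := ht.2
  split_ifs
  · constructor <;> intro h <;> linarith
  · constructor <;> intro h <;> linarith

/-- The inclusion of the `j`-th cell. -/
def cellMap (N : ℕ) (hN : 0 < N) (a : ℕ × ConeModel) : WaveCover N :=
  ⟨(((a.1 + cellPhase a.1 a.2.1.1.1) / (2 * N), a.2.1.1.2), a.2.1.2), a.2.2.1.2, by
    obtain ⟨z, hz⟩ := a.2.2.2
    refine ⟨z, ?_⟩
    have hN' : (N : ℝ) ≠ 0 := by positivity
    have : waveLabel N ((a.1 + cellPhase a.1 a.2.1.1.1) / (2 * N), a.2.1.1.2) = a.2.1.1.1 := by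
      rw [← cos_cellPhase a.1 (t := a.2.1.1.1) a.2.2.1.1]
      simp only [waveLabel]
      congr 2
      rw [cos_cellPhase a.1 (t := a.2.1.1.1) a.2.2.1.1]
      field_simp
    simp only
    rw [this, hz]⟩

/-- Points of cells which are identified with points of the next cell. -/
def CellAdj (b : Bool) (N : ℕ) (a a' : ℕ × ConeModel) : Prop :=
  (a'.1 = a.1 + 1 ∧ a.2.1.1.1 = endParam a.1 ∧ a'.2 = a.2) ∨
  (a.1 + 1 = 2 * N ∧ a'.1 = 0 ∧ a.2.1.1.1 = endParam a.1 ∧ a'.2 = labConj b a.2)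

lemma cellMap_eq_of_adj {hN : 0 < N} {a a' : ℕ × ConeModel} (h : CellAdj b N a a') :
    waveMk b N (cellMap N hN a) = waveMk b N (cellMap N hN a') := by
  have hN' : (N : ℝ) ≠ 0 := by positivity
  have ht := a.2.2.1.1
  have ht' := a'.2.2.1.1
  rw [waveMk_eq_iff]
  rcases h with ⟨h1, h2, h3⟩ | ⟨h1, h2, h3, h4⟩
  · refine ⟨0, ?_⟩
    rw [waveShift_zero]
    apply Subtype.ext
    have h4 := (cellPhase_eq_one_iff a.1 ht).2 h2
    have h5 : cellPhase a'.1 a'.2.1.1.1 = 0 := by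
      rw [cellPhase_eq_zero_iff _ ht', h1, h3, h2, endParam_succ, neg_neg]
    rw [h1, h3] at h5
    simp only [cellMap, h4, h1, h3, h5]
    push_cast
    rw [add_zero]
  · refine ⟨-1, ?_⟩
    apply Subtype.ext
    have h5 := (cellPhase_eq_one_iff a.1 ht).2 h3
    have h6 : cellPhase a'.1 a'.2.1.1.1 = 0 := by
      rw [cellPhase_eq_zero_iff _ ht', h2, h4, coe_labConj, h3]
      have h7 := endParam_succ a.1
      rw [h1] at h7
      have h8 : endParam (2 * N) = 1 := by simp [endParam]
      have h9 : endParam 0 = 1 := by simp [endParam]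
      rw [h9]; linarith
    have h7 : (a.1 : ℝ) + 1 = 2 * N := by exact_mod_cast h1
    have h8 : twist b (-1) = b := by simp [twist]
    rw [h2, h4, coe_labConj] at h6
    simp only [cellMap, waveShift, h5, h6, h2, h4, h8, coe_labConj, h7]
    rw [div_self (by positivity)]
    simp

/-- Measured in half periods, the position `j + cellPhase j t` of a point is determined modulo `2N`.
Two distinct points of cells with the same image therefore lie at the common end of neighboring
cells, or at the two ends of the whole period. -/
lemma cellMap_eq_cases {hN : 0 < N} {a a' : ℕ × ConeModel} (ha : a.1 < 2 * N) (ha' : a'.1 < 2 * N)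
    (h : waveMk b N (cellMap N hN a) = waveMk b N (cellMap N hN a')) :
    a = a' ∨ CellAdj b N a a' ∨ CellAdj b N a' a := by
  have hN' : (0 : ℝ) < N := by positivity
  -- it suffices to treat the case of a nonnegative translation
  have key : ∀ (a a' : ℕ × ConeModel) (n : ℤ), a.1 < 2 * N → a'.1 < 2 * N → 0 ≤ n →
      cellMap N hN a' = waveShift b n (cellMap N hN a) →
      a = a' ∨ CellAdj b N a a' ∨ CellAdj b N a' a := by
    rintro ⟨j, p⟩ ⟨j', p'⟩ n hj hj' hn h
    simp only at hj hj'
    have ht := p.2.1.1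
    have ht' := p'.2.1.1
    have h1 := congrArg (fun t : WaveCover N => t.1) h
    simp only [cellMap, waveShift, Prod.mk.injEq] at h1
    obtain ⟨⟨hx, hu⟩, hw, hy⟩ : (_ ∧ p'.1.1.2 = p.1.1.2) ∧ p'.1.2.1 = _ ∧ p'.1.2.2 = _ := by
      refine ⟨⟨h1.1.1, h1.1.2⟩, ?_, ?_⟩
      · exact congrArg Prod.fst h1.2
      · exact congrArg Prod.snd h1.2
    have hα := cellPhase_mem j p.1.1.1
    have hα' := cellPhase_mem j' p'.1.1.1
    have hX : (j' : ℝ) + cellPhase j' p'.1.1.1 = j + cellPhase j p.1.1.1 + 2 * N * n := by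
      have h2 : (2 * (N : ℝ)) ≠ 0 := by positivity
      field_simp at hx
      linarith
    obtain ⟨hα0, hα1⟩ := hα
    obtain ⟨hα0', hα1'⟩ := hα'
    have hext : p'.1.1.1 = p.1.1.1 → n = 0 → p' = p := by
      intro h2 h3
      subst h3
      have h4 : twist b 0 = false := by simp [twist]
      rw [h4] at hw hy
      exact Subtype.ext (Prod.ext (Prod.ext h2 hu) (Prod.ext hw hy))
    rcases hn.eq_or_lt with h0 | h0
    · subst h0
      simp only [Int.cast_zero, mul_zero, add_zero] at hX
      rcases lt_trichotomy j j' with hlt | rfl | hlt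
      · have h2 : (j : ℝ) + 1 ≤ j' := by exact_mod_cast hlt
        have h3 : cellPhase j p.1.1.1 = 1 := by linarith
        have h4 : cellPhase j' p'.1.1.1 = 0 := by linarith
        have h5 : j' = j + 1 := by
          have : (j' : ℝ) = j + 1 := by linarith
          exact_mod_cast this
        subst h5
        rw [cellPhase_eq_one_iff _ ht] at h3
        rw [cellPhase_eq_zero_iff _ ht', endParam_succ, neg_neg] at h4
        exact Or.inr (Or.inl (Or.inl ⟨rfl, h3, hext (h4.trans h3.symm) rfl⟩))
      · left
        have h2 : cellPhase j p'.1.1.1 = cellPhase j p.1.1.1 := by linarith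
        have h3 : p'.1.1.1 = p.1.1.1 := by
          rw [← cos_cellPhase j ht, ← cos_cellPhase j ht', h2]
        rw [hext h3 rfl]
      · have h2 : (j' : ℝ) + 1 ≤ j := by exact_mod_cast hlt
        have h3 : cellPhase j' p'.1.1.1 = 1 := by linarith
        have h4 : cellPhase j p.1.1.1 = 0 := by linarith
        have h5 : j = j' + 1 := by
          have : (j : ℝ) = j' + 1 := by linarith
          exact_mod_cast this
        subst h5
        rw [cellPhase_eq_one_iff _ ht'] at h3
        rw [cellPhase_eq_zero_iff _ ht, endParam_succ, neg_neg] at h4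
        exact Or.inr (Or.inr (Or.inl ⟨rfl, h3, (hext (h3.trans h4.symm) rfl).symm⟩))
    -- The positions lie between `0` and `2N` and differ by `2Nn`; so they are the two extremes and
    -- `n = 1`, which is where the reflection enters.
    · have h2 : (1 : ℝ) ≤ n := by exact_mod_cast h0
      have h3 : (j' : ℝ) + 1 ≤ 2 * N := by exact_mod_cast hj'
      have h4 : (0 : ℝ) ≤ j := by positivity
      have h5 : 2 * (N : ℝ) ≤ 2 * N * n := by nlinarith
      have h6 : cellPhase j' p'.1.1.1 = 1 := by linarith
      have h7 : cellPhase j p.1.1.1 = 0 := by linarith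
      have h8 : j = 0 := by
        have : (j : ℝ) = 0 := by linarith
        exact_mod_cast this
      have h9 : j' + 1 = 2 * N := by
        have : (j' : ℝ) + 1 = 2 * N := by linarith
        exact_mod_cast this
      have h10 : n = 1 := by
        have h11 : 2 * (N : ℝ) * (n - 1) = 0 := by linarith
        have h12 := (mul_eq_zero.1 h11).resolve_left (by positivity)
        have : (n : ℝ) = 1 := by linarith
        exact_mod_cast this
      subst h8 h10
      rw [cellPhase_eq_one_iff _ ht'] at h6
      rw [cellPhase_eq_zero_iff _ ht] at h7
      have h13 : twist b 1 = b := by simp [twist]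
      rw [h13] at hw hy
      refine Or.inr (Or.inr (Or.inr ⟨h9, rfl, h6, ?_⟩))
      have h14 : p.1.1.1 = p'.1.1.1 := by
        rw [h6, h7]
        have h15 := endParam_succ j'
        rw [h9] at h15
        have h16 : endParam (2 * N) = 1 := by simp [endParam]
        have h17 : endParam 0 = 1 := by simp [endParam]
        rw [h17]; linarith
      apply Subtype.ext
      rw [coe_labConj]
      simp only
      rw [hw, hy, conjIf_conjIf, conjIf_conjIf]
      exact Prod.ext (Prod.ext h14 hu.symm) rfl
  obtain ⟨n, hn⟩ := waveMk_eq_iff.1 h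
  rcases le_total 0 n with h0 | h0
  · exact key a a' n ha ha' h0 hn
  · have h1 : cellMap N hN a = waveShift b (-n) (cellMap N hN a') := by
      rw [hn, ← waveShift_add, neg_add_cancel, waveShift_zero]
    rcases key a' a (-n) ha' ha (by linarith) h1 with h2 | h2 | h2
    · exact Or.inl h2.symm
    · exact Or.inr (Or.inr h2)
    · exact Or.inr (Or.inl h2)

/-- A representative is translated to `x` in `[0,1)`. The integral part of `2Nx` is the number of
the cell, and its fractional part is the phase, from which the label recovers `t`. -/
lemma exists_cellMap {hN : 0 < N} (y : WaveSpace b N) :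
    ∃ a : ℕ × ConeModel, a.1 < 2 * N ∧ waveMk b N (cellMap N hN a) = y := by
  have hN' : (0 : ℝ) < N := by positivity
  have hpi := Real.pi_pos
  obtain ⟨p, rfl⟩ := waveMk_surjective y
  have hq : ∃ q : WaveCover N, waveMk b N q = waveMk b N p ∧ 0 ≤ q.1.1.1 ∧ q.1.1.1 < 1 := by
    refine ⟨waveShift b (-⌊p.1.1.1⌋) p, (waveMk_eq_iff.2 ⟨_, rfl⟩).symm, ?_, ?_⟩
    · have := Int.floor_le p.1.1.1
      simp only [waveShift]
      push_cast
      linarith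
    · have := Int.lt_floor_add_one p.1.1.1
      simp only [waveShift]
      push_cast
      linarith
  obtain ⟨⟨⟨⟨x, s⟩, v⟩, hs, z, hz⟩, hqp, hx0, hx1⟩ := hq
  rw [← hqp]
  simp only at hx0 hx1 hz hs
  set j := ⌊2 * N * x⌋₊ with hj
  have hj1 : (j : ℝ) ≤ 2 * N * x := Nat.floor_le (by positivity)
  have hj2 : 2 * N * x < j + 1 := Nat.lt_floor_add_one _
  set t := waveLabel N (x, s) with ht
  have ht' : t = -Real.cos (2 * Real.pi * N * x) := rfl
  have htm : t ∈ Icc (-1 : ℝ) 1 := by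
    have h1 := Real.neg_one_le_cos (2 * Real.pi * N * x)
    have h2 := Real.cos_le_one (2 * Real.pi * N * x)
    exact ⟨by rw [ht']; linarith, by rw [ht']; linarith⟩
  have hphase : cellPhase j t = 2 * N * x - j := by
    have h1 : Real.cos (Real.pi * (2 * N * x - j)) = if Even j then -t else t := by
      have : Real.pi * (2 * N * x - j) = 2 * Real.pi * N * x - j * Real.pi := by ring
      rw [this, Real.cos_sub_nat_mul_pi, ht']
      split_ifs with h
      · rw [h.neg_one_pow]; ring
      · rw [(Nat.not_even_iff_odd.1 h).neg_one_pow]; ring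
    unfold cellPhase
    rw [← h1, Real.arccos_cos (mul_nonneg hpi.le (by linarith)) (by nlinarith)]
    field_simp
  refine ⟨(j, ⟨((t, s), v), ⟨htm, hs⟩, z, hz⟩), ?_, ?_⟩
  · have : (j : ℝ) < 2 * N := by nlinarith
    exact_mod_cast this
  · congr 1
    apply Subtype.ext
    simp only [cellMap, hphase]
    refine Prod.ext (Prod.ext ?_ rfl) rfl
    simp only
    field_simp
    ring

end Cells

/-! ### Normalizing the gluing maps. -/

section Gluing

open Set

/-- A homeomorphism of the cone model that preserves both ends and the boundary. -/
structure ConeAut where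
  /-- The underlying homeomorphism. -/
  map : ConeModel ≃ₜ ConeModel
  face_iff : ∀ e : ℝ, e = 1 ∨ e = -1 → ∀ p, map p ∈ coneFace e ↔ p ∈ coneFace e
  size_iff : ∀ p, (map p).1.1.2 = 1 ↔ p.1.1.2 = 1

/-- The identity automorphism. -/
def ConeAut.refl : ConeAut := ⟨Homeomorph.refl _, fun _ _ _ => Iff.rfl, fun _ => Iff.rfl⟩

lemma mem_coneFace_labConj_iff (b : Bool) (e : ℝ) (p : ConeModel) :
    labConj b p ∈ coneFace e ↔ p ∈ coneFace e := Iff.rfl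

/-- Composition with the reflection. -/
def ConeAut.conj (b : Bool) (Φ : ConeAut) : ConeAut :=
  ⟨Φ.map.trans (labConj b), fun e he p => (mem_coneFace_labConj_iff b e _).trans (Φ.face_iff e he p),
    Φ.size_iff⟩

lemma exists_coneAut {e : ℝ} (he : e = 1 ∨ e = -1) (φ : coneFace e ≃ₜ coneFace e) :
    ∃ (b : Bool) (Φ : ConeAut), (∀ x : coneFace e, Φ.map x = φ x) ∧
      ∀ x ∈ coneFace (-e), Φ.map x = labConj b x := by
  obtain ⟨b, Φ, h1, h2, h3⟩ := exists_cone_extension he φ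
  have h4 : ∀ p, Φ p ∈ coneFace e ↔ p ∈ coneFace e := by
    intro p
    constructor
    · intro hp
      have h5 : Φ (φ.symm ⟨_, hp⟩ : coneFace e) = Φ p := by
        rw [h1, φ.apply_symm_apply]
      rw [← Φ.injective h5]
      exact (φ.symm ⟨_, hp⟩ : coneFace e).2
    · intro hp
      rw [h1 ⟨p, hp⟩]
      exact (φ ⟨p, hp⟩).2
  have h5 : ∀ p, Φ p ∈ coneFace (-e) ↔ p ∈ coneFace (-e) := by
    intro p
    constructor
    · intro hp
      have h6 : Φ (labConj b (Φ p)) = Φ p := by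
        rw [h2 _ ((mem_coneFace_labConj_iff b _ _).2 hp), labConj_labConj]
      rw [← Φ.injective h6]
      exact (mem_coneFace_labConj_iff b _ _).2 hp
    · intro hp
      rw [h2 p hp]
      exact (mem_coneFace_labConj_iff b _ _).2 hp
  refine ⟨b, ⟨Φ, fun e' he' p => ?_, h3⟩, h1, h2⟩
  have h6 : e' = e ∨ e' = -e := by
    rcases he with rfl | rfl <;> rcases he' with rfl | rfl <;> norm_num
  rcases h6 with rfl | rfl
  · exact h4 p
  · exact h5 p

/-- Restriction of an automorphism to an end. -/
def ConeAut.restrict (Φ : ConeAut) {e : ℝ} (he : e = 1 ∨ e = -1) : coneFace e ≃ₜ coneFace e :=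
  Φ.map.subtype fun p => (Φ.face_iff e he p).symm

/-- Inductive step of the normalization: given the automorphism `Φ` of one cone, extending `Φ ∘ g⁻¹`
from the common end gives an automorphism of the next cone for which the gluing becomes the
identity. -/
lemma exists_coneAut_comp (Φ : ConeAut) {e : ℝ} (he : e = 1 ∨ e = -1)
    (g : coneFace e ≃ₜ coneFace e) :
    ∃ (b : Bool) (Ψ : ConeAut), (∀ x : coneFace e, Ψ.map (g x) = Φ.map x) ∧
      ∀ x ∈ coneFace (-e), Ψ.map x = labConj b x := by
  obtain ⟨b, Ψ, h1, h2⟩ := exists_coneAut he (g.symm.trans (Φ.restrict he))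
  refine ⟨b, Ψ, fun x => ?_, h2⟩
  rw [h1]
  show Φ.map (g.symm (g x)) = Φ.map x
  rw [g.symm_apply_apply]

/-- Automorphisms of the cells that turn given gluings along the ends into the standard ones. -/
lemma exists_coneAut_family {N : ℕ} (hN : 0 < N)
    (g : ∀ j : Fin (2 * N), coneFace (endParam j) ≃ₜ coneFace (endParam j)) :
    ∃ (b : Bool) (G : ℕ → ConeAut),
      (∀ (j : Fin (2 * N)) (x : coneFace (endParam j)), (j : ℕ) + 1 < 2 * N →
        (G (j + 1)).map (g j x) = (G j).map x) ∧
      ∀ (j : Fin (2 * N)) (x : coneFace (endParam j)), (j : ℕ) + 1 = 2 * N →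
        (G 0).map (g j x) = labConj b ((G j).map x) := by
  have step : ∀ (j : ℕ) (Φ : ConeAut), ∃ Ψ : ConeAut, ∀ (h : j < 2 * N)
      (x : coneFace (endParam j)), Ψ.map (g ⟨j, h⟩ x) = Φ.map x := by
    intro j Φ
    by_cases h : j < 2 * N
    · obtain ⟨b, Ψ, h1, -⟩ := exists_coneAut_comp Φ (endParam_sign j) (g ⟨j, h⟩)
      exact ⟨Ψ, fun _ => h1⟩
    · exact ⟨Φ, fun h' => absurd h' h⟩
  choose S hS using step
  -- Starting from the identity, the gluings are straightened one after the other; only the one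
  -- closing the cycle is not yet under control.
  let G' : ℕ → ConeAut := fun n => Nat.rec ConeAut.refl S n
  have hG0 : G' 0 = ConeAut.refl := rfl
  have hG : ∀ (j : ℕ) (h : j < 2 * N) (x : coneFace (endParam j)),
      (G' (j + 1)).map (g ⟨j, h⟩ x) = (G' j).map x := fun j h x => hS j (G' j) h x
  have hlast : 2 * N - 1 < 2 * N := by omega
  obtain ⟨b, Ψ, h1, h2⟩ := exists_coneAut_comp (G' (2 * N - 1)) (endParam_sign (2 * N - 1))
    (g ⟨2 * N - 1, hlast⟩)
  -- Cone `0` receives `Ψ`, which straightens the last gluing and is the reflection `labConj b` on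
  -- its other end. Reflecting all other cones by `b` keeps the intermediate gluings standard,
  -- including the one from cone `0` to cone `1`, and moves the reflection to the closing gluing.
  -- The last cone is different from cone `0` because `2N ≥ 2`.
  refine ⟨b, fun j => if j = 0 then Ψ else (G' j).conj b, ?_, ?_⟩
  · rintro ⟨j, hj⟩ x hj1
    simp only at hj1 x ⊢
    rw [if_neg (Nat.succ_ne_zero j)]
    show labConj b ((G' (j + 1)).map _) = _
    rw [hG]
    rcases Nat.eq_zero_or_pos j with rfl | hj0
    · rw [if_pos rfl, hG0, h2]
      · rfl
      · have h3 := endParam_succ (2 * N - 1)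
        rw [show 2 * N - 1 + 1 = 2 * N by omega] at h3
        have h4 : endParam (2 * N) = endParam 0 := by simp [endParam]
        rw [← h3, h4]
        exact x.2
    · rw [if_neg hj0.ne']
      rfl
  · rintro ⟨j, hj⟩ x hj1
    simp only at hj1 x ⊢
    obtain rfl : j = 2 * N - 1 := by omega
    rw [if_pos trivial, if_neg (by omega), h1]
    show _ = labConj b (labConj b _)
    rw [labConj_labConj]
    rfl

/-- The gluing of the cones is one of two standard labelled spaces. -/
lemma exists_gluedSpace_homeomorph {N : ℕ} (hN : 0 < N) (g : GluingData N) :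
    ∃ (b : Bool) (h : GluedSpace g ≃ₜ WaveSpace b N),
      ∀ y, y ∈ gluedBoundary g ↔ waveSize (h y) = 1 := by
  let c : ∀ t, coneFace t ≃ₜ levelD t := fun t =>
    coneHomeo.subtype fun p => (coneHomeo_mem_levelD_iff p t).symm
  obtain ⟨b, G, hG1, hG2⟩ := exists_coneAut_family hN
    fun j => ((c (endParam j)).trans (g j)).trans (c (endParam j)).symm
  let F : Fin (2 * N) × ConeRP2 → ℕ × ConeModel := fun a => (a.1, (G a.1).map (coneHomeo.symm a.2))
  have hface : ∀ a : Fin (2 * N) × ConeRP2, a.2 ∈ levelD (endParam a.1) ↔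
      (F a).2.1.1.1 = endParam a.1 := by
    intro a
    have h1 := (G a.1).face_iff _ (endParam_sign a.1) (coneHomeo.symm a.2)
    have h2 := coneHomeo_mem_levelD_iff (coneHomeo.symm a.2) (endParam a.1)
    rw [coneHomeo.apply_symm_apply] at h2
    exact h2.trans h1.symm
  have hrot1 : ∀ j : Fin (2 * N), (j : ℕ) + 1 < 2 * N → (finRotate (2 * N) j : ℕ) = j + 1 := by
    intro j hj
    obtain ⟨n, hn⟩ : ∃ n, 2 * N = n + 1 := ⟨2 * N - 1, by omega⟩
    revert j
    rw [hn]
    intro j hj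
    rw [coe_finRotate_of_ne_last]
    intro h
    rw [h] at hj
    simp at hj
  have hrot2 : ∀ j : Fin (2 * N), (j : ℕ) + 1 = 2 * N → (finRotate (2 * N) j : ℕ) = 0 := by
    intro j hj
    obtain ⟨n, hn⟩ : ∃ n, 2 * N = n + 1 := ⟨2 * N - 1, by omega⟩
    revert j
    rw [hn]
    intro j hj
    have : j = Fin.last n := Fin.ext (by simp; omega)
    rw [this, finRotate_last]
    rfl
  -- After the automorphisms `G` the gluing relation is the standard adjacency of cells; the cyclic
  -- step is an increment except for the last cone.
  have hrel : ∀ a a' : Fin (2 * N) × ConeRP2, GlueRel g a a' ↔ CellAdj b N (F a) (F a') := by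
    rintro ⟨j, x⟩ ⟨j', x'⟩
    have hg : ∀ h : x ∈ levelD (endParam j), ∀ y : ConeModel,
        ((((c (endParam j)).trans (g j)).trans (c (endParam j)).symm)
          ((c (endParam j)).symm ⟨x, h⟩) : ConeModel) = y ↔
        ((g j ⟨x, h⟩ : levelD (endParam j)) : ConeRP2) = coneHomeo y := by
      intro h y
      rw [Homeomorph.trans_apply, Homeomorph.trans_apply, Homeomorph.apply_symm_apply]
      show coneHomeo.symm _ = y ↔ _
      rw [Homeomorph.symm_apply_eq]
    have hF := hface (j, x)
    simp only at hF
    have hx : ∀ h : x ∈ levelD (endParam j),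
        (((c (endParam j)).symm ⟨x, h⟩ : coneFace _) : ConeModel) = coneHomeo.symm x := fun h => rfl
    rcases lt_or_eq_of_le (show (j : ℕ) + 1 ≤ 2 * N from j.2) with hj | hj
    · constructor
      · rintro ⟨h1, h2, h3⟩
        simp only at h1 h2 h3
        refine Or.inl ⟨?_, hF.1 h2, ?_⟩
        · simp only [F, h1, hrot1 j hj]
        · simp only [F, h1, hrot1 j hj, h3]
          rw [← hx h2, ← hG1 j ((c (endParam j)).symm ⟨x, h2⟩) hj]
          congr 1
          symm
          rw [hg, coneHomeo.apply_symm_apply]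
      · rintro (⟨h1, h2, h3⟩ | ⟨h1, h2, h3, h4⟩)
        · have h4 : j' = finRotate (2 * N) j := Fin.ext (by rw [hrot1 j hj]; exact h1)
          refine ⟨h4, hF.2 h2, ?_⟩
          simp only [F, h4, hrot1 j hj] at h3
          rw [← hx (hF.2 h2), ← hG1 j ((c (endParam j)).symm ⟨x, hF.2 h2⟩) hj] at h3
          have h5 := ((G (j + 1)).map.injective h3).symm
          rw [hg, coneHomeo.apply_symm_apply] at h5
          exact h5.symm
        · exact absurd h1 hj.ne
    · constructor
      · rintro ⟨h1, h2, h3⟩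
        simp only at h1 h2 h3
        refine Or.inr ⟨hj, ?_, hF.1 h2, ?_⟩
        · simp only [F, h1, hrot2 j hj]
        · simp only [F, h1, hrot2 j hj, h3]
          rw [← hx h2, ← hG2 j ((c (endParam j)).symm ⟨x, h2⟩) hj]
          congr 1
          symm
          rw [hg, coneHomeo.apply_symm_apply]
      · rintro (⟨h1, h2, h3⟩ | ⟨h1, h2, h3, h4⟩)
        · have h4 : (j' : ℕ) = j + 1 := h1
          exact absurd j'.2 (by omega)
        · have h5 : j' = finRotate (2 * N) j := Fin.ext (by rw [hrot2 j hj]; exact h2)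
          refine ⟨h5, hF.2 h3, ?_⟩
          simp only [F, h5, hrot2 j hj] at h4
          rw [← hx (hF.2 h3), ← hG2 j ((c (endParam j)).symm ⟨x, hF.2 h3⟩) hj] at h4
          have h5 := ((G 0).map.injective h4).symm
          rw [hg, coneHomeo.apply_symm_apply] at h5
          exact h5.symm
  have hFinj : Function.Injective F := by
    rintro ⟨j, x⟩ ⟨j', x'⟩ h
    simp only [F, Prod.mk.injEq] at h
    obtain ⟨h1, h2⟩ := h
    have h3 : j = j' := Fin.ext h1
    subst h3
    rw [coneHomeo.symm.injective ((G j).map.injective h2)]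
  let Q : GluedSpace g → WaveSpace b N := Quot.lift (fun a => waveMk b N (cellMap N hN (F a)))
    fun a a' h => cellMap_eq_of_adj ((hrel a a').1 h)
  have hcell : ∀ j : ℕ, Continuous fun p : ConeModel => cellMap N hN (j, p) := by
    intro j
    have h1 := continuous_cellPhase j
    refine Continuous.subtype_mk ?_ _
    have h2 : Continuous fun p : ConeModel =>
        ((((j : ℝ) + cellPhase j p.1.1.1) / (2 * N), p.1.1.2), p.1.2) := by fun_prop
    exact h2
  have hQc : Continuous Q := by
    refine (isQuotientMap_quot_mk (r := GlueRel g)).continuous_iff.2 ?_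
    show Continuous fun a => waveMk b N (cellMap N hN (F a))
    rw [continuous_prod_of_discrete_left]
    intro j
    exact continuous_waveMk.comp ((hcell j).comp ((G j).map.continuous.comp
      coneHomeo.symm.continuous))
  have hQi : Function.Injective Q := by
    intro y y'
    induction y using Quot.inductionOn with
    | h a =>
      induction y' using Quot.inductionOn with
      | h a' =>
        intro h
        rcases cellMap_eq_cases a.1.2 a'.1.2 h with h | h | h
        · rw [hFinj h]
        · exact Quot.sound ((hrel _ _).2 h)
        · exact (Quot.sound ((hrel _ _).2 h)).symm
  have hQs : Function.Surjective Q := by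
    intro y
    obtain ⟨⟨j, p⟩, hj, rfl⟩ := exists_cellMap (hN := hN) y
    refine ⟨Quot.mk _ (⟨j, hj⟩, coneHomeo ((G j).map.symm p)), ?_⟩
    show waveMk b N (cellMap N hN (F _)) = _
    simp [F]
  have hcomp : CompactSpace ConeRP2 := coneHomeo.compactSpace
  have hcomp' : CompactSpace (GluedSpace g) := Quot.compactSpace
  let h : GluedSpace g ≃ₜ WaveSpace b N :=
    (hQc.isClosedEmbedding hQi).isEmbedding.toHomeomorphOfSurjective hQs
  refine ⟨b, h, ?_⟩
  have hsize : ∀ a : Fin (2 * N) × ConeRP2, waveSize (h (Quot.mk _ a)) = 1 ↔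
      (coneHomeo.symm a.2).1.1.2 = 1 := fun a => (G a.1).size_iff _
  intro y
  constructor
  · rintro ⟨j, t, ht, x, hx, rfl⟩
    rw [hsize]
    have h1 := coneHomeo_mem_levelDBd_iff (coneHomeo.symm x) t
    rw [coneHomeo.apply_symm_apply] at h1
    exact (h1.1 hx).2
  · induction y using Quot.inductionOn with
    | h a =>
      intro h1
      rw [hsize] at h1
      refine ⟨a.1, _, (coneHomeo.symm a.2).2.1.1, a.2, ?_, rfl⟩
      have h2 := coneHomeo_mem_levelDBd_iff (coneHomeo.symm a.2) (coneHomeo.symm a.2).1.1.1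
      rw [coneHomeo.apply_symm_apply] at h2
      exact h2.2 ⟨rfl, h1⟩

end Gluing

/-! ### Lability is a local property. -/

section LabileLocal

open Set

variable {X Y : Type*} [TopologicalSpace X] [TopologicalSpace Y]

/-- A deformation supported inside the image of `e` maps that image to itself, hence pulls back. -/
lemma Labile.restrict {e : X → Y} (he : IsOpenEmbedding e) {p : X} (hp : Labile (e p)) :
    Labile p := by
  intro W hW
  obtain ⟨K, f, hK, hKW, hf, hid, hm, hpf⟩ := hp (e '' W) (he.image_mem_nhds.2 hW)
  have hKr : K ⊆ range e := hKW.trans (image_subset_range _ _)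
  have hmaps : ∀ x, f (e x) ∈ range e := by
    intro x
    by_cases hx : e x ∈ K
    · exact hKr (hm hx)
    · rw [hid _ hx]
      exact ⟨x, rfl⟩
  choose F hF using hmaps
  refine ⟨e ⁻¹' K, F, he.isInducing.isCompact_preimage_iff hKr |>.2 hK, ?_, ?_, ?_, ?_, ?_⟩
  · intro x hx
    obtain ⟨w, hw, hwx⟩ := hKW hx
    rwa [← he.injective hwx]
  · rw [he.isEmbedding.continuous_iff, show e ∘ F = f ∘ e from funext hF]
    exact hf.comp he.continuous
  · intro x hx
    apply he.injective
    rw [hF, hid _ hx]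
  · intro x hx
    show e (F x) ∈ K
    rw [hF]
    exact hm hx
  · rintro ⟨x, hx⟩
    exact hpf ⟨e x, by rw [← hF, hx]⟩

lemma labile_iff_of_isOpenEmbedding [T2Space Y] {e : X → Y} (he : IsOpenEmbedding e) {p : X} :
    Labile (e p) ↔ Labile p :=
  ⟨fun h => h.restrict he, fun h => h.of_isOpenEmbedding he⟩

end LabileLocal

/-! ### The boundary of the wave spaces determines the twist. -/

section WaveBoundary

open Set

variable {N : ℕ} {b : Bool}

/-- The part of the periodic space over the interval of length one around `x`. -/
def waveChart (N : ℕ) (x : ℝ) : Set (WaveCover N) := {p | |p.1.1.1 - x| < 1 / 2}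

lemma isOpen_waveChart (x : ℝ) : IsOpen (waveChart N x) :=
  isOpen_lt (by fun_prop) continuous_const

/-- An open window of length one contains no two points differing by a nonzero integer translation.
-/
lemma isOpenEmbedding_waveMk (x : ℝ) :
    IsOpenEmbedding (fun p : waveChart N x => waveMk b N p) := by
  refine IsOpenEmbedding.of_continuous_injective_isOpenMap
    (continuous_waveMk.comp continuous_subtype_val) ?_
    (isOpenMap_waveMk.comp (isOpen_waveChart x).isOpenMap_subtype_val)
  rintro ⟨p, hp⟩ ⟨q, hq⟩ h
  obtain ⟨n, rfl⟩ := waveMk_eq_iff.1 h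
  have h1 := abs_lt.1 (show |p.1.1.1 - x| < 1 / 2 from hp)
  have h2 := abs_lt.1 (show |p.1.1.1 + n - x| < 1 / 2 from hq)
  have h3 : (n : ℝ) < 1 := by linarith
  have h4 : (-1 : ℝ) < n := by linarith
  have h5 : n = 0 := by
    have h6 : n < 1 := by exact_mod_cast h3
    have h7 : -1 < n := by exact_mod_cast h4
    omega
  subst h5
  exact Subtype.ext (waveShift_zero p).symm

lemma labile_waveMk_iff (p : WaveCover N) : Labile (waveMk b N p) ↔ Labile p := by
  have hp : p ∈ waveChart N p.1.1.1 := by simp [waveChart]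
  have h1 : Labile (waveMk b N p) ↔ Labile (⟨p, hp⟩ : waveChart N p.1.1.1) :=
    labile_iff_of_isOpenEmbedding (p := (⟨p, hp⟩ : waveChart N p.1.1.1))
      (isOpenEmbedding_waveMk (b := b) p.1.1.1)
  rw [h1]
  exact (labile_iff_of_isOpenEmbedding
    (isOpen_waveChart p.1.1.1).isOpenEmbedding_subtypeVal (p := ⟨p, hp⟩)).symm

/-- Whether the cone points over the projective plane are labile is left open; but they are isolated
from the other labile points, whereas every boundary point is a limit of boundary points on its own
orbit. This gives a purely topological description of the boundary. -/
lemma waveSize_eq_one_iff (hN : 0 < N) (y : WaveSpace b N) :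
    waveSize y = 1 ↔ Labile y ∧ y ∈ closure ({y' | Labile y'} \ {y}) := by
  have hpi := Real.pi_pos
  have hN' : (0 : ℝ) < N := by positivity
  have hbd : ∀ y : WaveSpace b N, waveSize y = 1 → Labile y := by
    intro y hy
    obtain ⟨p, rfl⟩ := waveMk_surjective y
    rw [waveSize_mk] at hy
    rw [labile_waveMk_iff, labile_unitStrip_iff (continuous_waveLabel N)]
    · exact hy
    · rintro ⟨h, -⟩
      rw [hy] at h
      exact one_ne_zero h
  have hsing : ∀ p : WaveCover N, Labile (waveMk b N p) → p.1.1.2 ≠ 1 →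
      p.1.1.2 = 0 ∧ Real.cos (2 * Real.pi * N * p.1.1.1) = 0 := by
    intro p hp h1
    by_contra hc
    rw [labile_waveMk_iff, labile_unitStrip_iff (continuous_waveLabel N)] at hp
    · exact h1 hp
    · rintro ⟨h, h'⟩
      exact hc ⟨h, neg_eq_zero.1 h'⟩
  constructor
  · intro hy
    refine ⟨hbd y hy, ?_⟩
    obtain ⟨p, rfl⟩ := waveMk_surjective y
    rw [waveSize_mk] at hy
    obtain ⟨⟨⟨⟨x, s⟩, hs⟩, z⟩, rfl⟩ := labMk_surjective p
    simp only [labMk] at hy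
    subst hy
    -- A path along the orbit, which consists of boundary points and is injective for small times
    -- because the orbit is free.
    let γ : ℝ → WaveSpace b N := fun t =>
      waveMk b N (labMk (unitStrip ℝ) (waveLabel N) Prod.snd (⟨(x, 1), hs⟩, z * Circle.exp t))
    have hγ : Continuous γ := by
      refine continuous_waveMk.comp
        ((continuous_labMk (continuous_waveLabel N).continuousOn continuous_snd.continuousOn).comp ?_)
      fun_prop
    have h0 : γ 0 = waveMk b N (labMk (unitStrip ℝ) (waveLabel N) Prod.snd (⟨(x, 1), hs⟩, z)) := by
      simp [γ]
    rw [← h0]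
    have hlim : Filter.Tendsto γ (𝓝[>] 0) (𝓝 (γ 0)) :=
      hγ.continuousAt.tendsto.mono_left nhdsWithin_le_nhds
    refine mem_closure_of_tendsto hlim ?_
    filter_upwards [Ioo_mem_nhdsGT hpi] with t ht
    refine ⟨hbd _ rfl, ?_⟩
    intro h
    obtain ⟨n, hn⟩ := waveMk_eq_iff.1 (show γ 0 = γ t from h.symm)
    have h1 := congrArg (fun q : WaveCover N => q.1.1.1) hn
    simp only [waveShift, labMk] at h1
    have h2 : n = 0 := by
      have : (n : ℝ) = 0 := by linarith
      exact_mod_cast this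
    subst h2
    rw [waveShift_zero, labMk_eq_iff] at hn
    simp only [one_ne_zero, false_and, or_false, mul_right_inj, true_and] at hn
    have h3 := Circle.exp_injOn_Ioc (a := -Real.pi) (b := Real.pi) (by linarith)
      ⟨by linarith [ht.1], ht.2.le⟩ ⟨by linarith, hpi.le⟩ hn
    exact ht.1.ne' h3
  · rintro ⟨hy, hcl⟩
    by_contra h1
    obtain ⟨p, rfl⟩ := waveMk_surjective y
    rw [waveSize_mk] at h1
    obtain ⟨h2, h3⟩ := hsing p hy h1
    -- The zeros of the label are spaced by `1 / (2 * N)`, so this neighborhood contains no other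
    -- cone point, and it avoids the boundary.
    let V : Set (WaveCover N) := {q | |q.1.1.1 - p.1.1.1| < 1 / (2 * N) ∧ q.1.1.2 < 1}
    have hV : IsOpen V := by
      have h4 : IsOpen {q : WaveCover N | |q.1.1.1 - p.1.1.1| < 1 / (2 * N)} :=
        isOpen_lt (by fun_prop) continuous_const
      have h5 : IsOpen {q : WaveCover N | q.1.1.2 < 1} := isOpen_lt (by fun_prop) continuous_const
      exact h4.inter h5
    have hpV : p ∈ V := by
      refine ⟨?_, ?_⟩
      · rw [sub_self, abs_zero]; positivity
      · rw [h2]; exact one_pos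
    obtain ⟨_, ⟨q, hq, rfl⟩, hql, hqp⟩ := mem_closure_iff.1 hcl _ (isOpenMap_waveMk V hV) ⟨p, hpV, rfl⟩
    obtain ⟨h4, h5⟩ := hsing q hql hq.2.ne
    apply hqp
    have h6 : q.1.1.1 = p.1.1.1 := by
      have h7 : Real.sin (2 * Real.pi * N * q.1.1.1 - 2 * Real.pi * N * p.1.1.1) = 0 := by
        rw [Real.sin_sub, h5, h3]; ring
      have h8 := abs_lt.1 hq.1
      have h9 : 2 * Real.pi * N * q.1.1.1 - 2 * Real.pi * N * p.1.1.1 =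
          (2 * N * (q.1.1.1 - p.1.1.1)) * Real.pi := by ring
      have h10 : 2 * N * (q.1.1.1 - p.1.1.1) < 1 := by
        have := mul_lt_mul_of_pos_left h8.2 (show (0 : ℝ) < 2 * N by positivity)
        rwa [mul_one_div_cancel (by positivity)] at this
      have h11 : -1 < 2 * N * (q.1.1.1 - p.1.1.1) := by
        have := mul_lt_mul_of_pos_left h8.1 (show (0 : ℝ) < 2 * N by positivity)
        rwa [mul_neg, mul_one_div_cancel (by positivity)] at this
      rw [h9] at h7
      have h12 := (Real.sin_eq_zero_iff_of_lt_of_lt (by nlinarith) (by nlinarith)).1 h7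
      have h13 := (mul_eq_zero.1 h12).resolve_right hpi.ne'
      have h14 := (mul_eq_zero.1 h13).resolve_left (by positivity)
      linarith
    congr 1
    obtain ⟨⟨bq, zq⟩, rfl⟩ := labMk_surjective q
    obtain ⟨⟨bp, zp⟩, rfl⟩ := labMk_surjective p
    rw [labMk_eq_iff]
    have h15 : bq = bp := Subtype.ext (Prod.ext h6 (h4.trans h2.symm))
    refine ⟨h15, Or.inr ⟨h4, Or.inl ?_⟩⟩
    exact (neg_eq_zero.2 h5).le

/-- The boundary of the wave space. -/
def waveBoundary (b : Bool) (N : ℕ) : Set (WaveSpace b N) := {y | waveSize y = 1}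

/-- Homeomorphisms preserve boundaries. -/
def waveBoundaryHomeo (hN : 0 < N) {b' : Bool} (h : WaveSpace b N ≃ₜ WaveSpace b' N) :
    waveBoundary b N ≃ₜ waveBoundary b' N :=
  h.subtype fun y => by
    show waveSize y = 1 ↔ waveSize (h y) = 1
    rw [waveSize_eq_one_iff hN, waveSize_eq_one_iff hN, labile_homeomorph_iff]
    have h1 : ({y' : WaveSpace b' N | Labile y'} \ {h y}) = h '' ({y' | Labile y'} \ {y}) := by
      rw [image_sdiff h.injective, image_singleton]
      congr 1
      ext w
      constructor
      · intro hw
        exact ⟨h.symm w, (labile_homeomorph_iff h).1 (by simpa using hw), by simp⟩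
      · rintro ⟨v, hv, rfl⟩
        exact (labile_homeomorph_iff h).2 hv
    rw [h1, ← h.image_closure, h.injective.mem_set_image]

/-- Parametrization of the boundary of the wave space. -/
def waveBoundaryMk (b : Bool) (N : ℕ) (a : Circle × ℝ) : waveBoundary b N :=
  ⟨waveMk b N (labMk (unitStrip ℝ) (waveLabel N) Prod.snd
    (⟨(a.2, 1), by simp [unitStrip]⟩, a.1)), rfl⟩

lemma isQuotientMap_waveBoundaryMk : IsQuotientMap (waveBoundaryMk b N) := by
  have h1 : IsQuotientMap ((waveBoundary b N).restrictPreimage (waveMk b N)) := by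
    refine IsOpenMap.isQuotientMap (isOpenMap_waveMk.restrictPreimage _)
      (continuous_waveMk.restrictPreimage) ?_
    exact waveMk_surjective.restrictPreimage _
  let e : Circle × ℝ ≃ₜ waveMk b N ⁻¹' waveBoundary b N :=
    { toFun := fun a => ⟨labMk (unitStrip ℝ) (waveLabel N) Prod.snd
        (⟨(a.2, 1), by simp [unitStrip]⟩, a.1), rfl⟩
      invFun := fun p => (⟨p.1.1.2.1, by
        obtain ⟨z, hz⟩ := p.1.2.2
        refine mem_sphere_zero_iff_norm.2 ?_
        rw [hz, norm_lab_fst p.1.2.1.1]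
        exact p.2⟩, p.1.1.1.1)
      left_inv := fun a => by
        refine Prod.ext (Circle.ext ?_) rfl
        simp [labMk, lab]
      right_inv := by
        rintro ⟨p, hp⟩
        obtain ⟨⟨⟨⟨x, s⟩, hs⟩, z⟩, rfl⟩ := labMk_surjective p
        have h2 : s = 1 := hp
        subst h2
        apply Subtype.ext
        simp only
        congr 2
        apply Circle.ext
        simp [labMk, lab]
      continuous_toFun := by
        refine Continuous.subtype_mk ((continuous_labMk (continuous_waveLabel N).continuousOn
          continuous_snd.continuousOn).comp ?_) _
        fun_prop
      continuous_invFun := by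
        refine Continuous.prodMk (Continuous.subtype_mk ?_ _) ?_ <;> fun_prop }
  exact h1.comp e.isQuotientMap

lemma waveBoundaryMk_eq_iff (a a' : Circle × ℝ) :
    waveBoundaryMk b N a = waveBoundaryMk b N a' ↔
      ∃ n : ℤ, a'.2 = a.2 + n ∧ a'.1 = flipIf (twist b n) a.1 := by
  rw [Subtype.ext_iff]
  simp only [waveBoundaryMk]
  rw [waveMk_eq_iff]
  refine exists_congr fun n => ?_
  have h1 : waveShift b n (labMk (unitStrip ℝ) (waveLabel N) Prod.snd
      (⟨(a.2, 1), by simp [unitStrip]⟩, a.1)) = labMk (unitStrip ℝ) (waveLabel N) Prod.snd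
      (⟨(a.2 + n, 1), by simp [unitStrip]⟩, flipIf (twist b n) a.1) := by
    apply Subtype.ext
    simp only [waveShift, labMk]
    rw [lab_flipIf, waveLabel_add_int N a.2 1 1 n]
  rw [h1, labMk_eq_iff]
  simp

lemma exists_waveBoundary_torus : Nonempty (waveBoundary false N ≃ₜ Circle × Circle) := by
  have hpi := Real.pi_pos
  have h1 : IsQuotientMap fun a : Circle × ℝ => (a.1, Circle.exp (2 * Real.pi * a.2)) := by
    have h2 : IsOpenMap fun x : ℝ => Circle.exp (2 * Real.pi * x) :=
      isLocalHomeomorph_circleExp.isOpenMap.comp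
        (Homeomorph.mulLeft₀ (2 * Real.pi) (by positivity)).isOpenMap
    refine IsOpenMap.isQuotientMap (IsOpenMap.id.prodMap h2) (by fun_prop) ?_
    rintro ⟨z, w⟩
    obtain ⟨x, rfl⟩ := Circle.exp_surjective w
    exact ⟨(z, x / (2 * Real.pi)), by simp only; rw [mul_div_cancel₀ _ (by positivity)]⟩
  obtain ⟨e, -⟩ := exists_homeomorph_of_quotient
    (isQuotientMap_waveBoundaryMk (b := false) (N := N)) h1 fun a a' => by
      rw [waveBoundaryMk_eq_iff, Prod.mk.injEq, eq_comm (a := Circle.exp _), exp_eq_exp_iff]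
      constructor
      · rintro ⟨n, h2, h3⟩
        refine ⟨by simp [h3, twist, flipIf], n, ?_⟩
        rw [h2]; ring
      · rintro ⟨h2, n, h3⟩
        refine ⟨n, ?_, by simp [h2, twist, flipIf]⟩
        have h4 : 2 * Real.pi * (a'.2 - (a.2 + n)) = 0 := by linear_combination h3
        have := (mul_eq_zero.1 h4).resolve_left (by positivity)
        linarith
  exact ⟨e⟩

lemma inv_zpow_apply (n : ℤ) (z : Circle) :
    ((Homeomorph.inv Circle) ^ n) z = flipIf (twist true n) z := by
  have h1 : ∀ z, (Homeomorph.inv Circle) z = z⁻¹ := fun _ => rfl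
  have h2 : (Homeomorph.inv Circle)⁻¹ = Homeomorph.inv Circle := rfl
  induction n using Int.induction_on generalizing z with
  | zero => simp [flipIf, twist]
  | succ i ih =>
    rw [zpow_add, zpow_one, Homeomorph.mul_apply, ih, h1]
    by_cases h : Odd (i : ℤ)
    · simp [flipIf, twist, h, ← Int.not_odd_iff_even]
    · simp [flipIf, twist, h, ← Int.not_odd_iff_even]
  | pred i ih =>
    rw [zpow_sub, zpow_one, h2, Homeomorph.mul_apply, ih, h1]
    have h3 : Odd (-(i : ℤ) - 1) ↔ ¬ Odd (-(i : ℤ)) := by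
      rw [Int.odd_sub]
      simp
    by_cases h : Odd (-(i : ℤ))
    · simp [flipIf, twist, h, h3]
    · simp [flipIf, twist, h, h3]

lemma exists_waveBoundary_klein : Nonempty (waveBoundary true N ≃ₜ KleinBottle) := by
  obtain ⟨e, -⟩ := exists_homeomorph_of_quotient
    (isQuotientMap_waveBoundaryMk (b := true) (N := N))
    (isQuotientMap_quotient_mk' (s := mappingTorusSetoid (Homeomorph.inv Circle))) fun a a' => by
      rw [waveBoundaryMk_eq_iff]
      refine Iff.trans ?_ (Quotient.eq (r := mappingTorusSetoid (Homeomorph.inv Circle))).symm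
      refine exists_congr fun n => ?_
      rw [inv_zpow_apply, Prod.ext_iff, and_comm]
  exact ⟨e⟩

/-- A homeomorphism restricts to the boundaries, which are a torus for `false` and a Klein bottle
for `true`. -/
lemma wave_twist_eq_of_homeomorph (hN : 0 < N) {b' : Bool} (h : WaveSpace b N ≃ₜ WaveSpace b' N) :
    b = b' := by
  obtain ⟨e⟩ := exists_waveBoundary_torus (N := N)
  obtain ⟨e'⟩ := exists_waveBoundary_klein (N := N)
  cases b <;> cases b'
  · rfl
  · exact (not_homeomorph_torus_klein (e.symm.trans ((waveBoundaryHomeo hN h).trans e'))).elim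
  · exact (not_homeomorph_torus_klein
      (e.symm.trans ((waveBoundaryHomeo hN h).symm.trans e'))).elim
  · rfl

/-- The boundary decides which of the two standard labelled spaces a gluing is. -/
lemma exists_wave_homeomorph (hN : 0 < N) {Y : Type*} [TopologicalSpace Y] :
    (IsGeneralizedSolidTorus N Y → Nonempty (Y ≃ₜ WaveSpace false N)) ∧
      (IsGeneralizedSolidKleinBottle N Y → Nonempty (Y ≃ₜ WaveSpace true N)) := by
  obtain ⟨et⟩ := exists_waveBoundary_torus (N := N)
  obtain ⟨ek⟩ := exists_waveBoundary_klein (N := N)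
  have key : ∀ g : GluingData N, ∃ (b : Bool) (_ : GluedSpace g ≃ₜ WaveSpace b N),
      Nonempty (gluedBoundary g ≃ₜ waveBoundary b N) := by
    intro g
    obtain ⟨b, h, hb⟩ := exists_gluedSpace_homeomorph hN g
    exact ⟨b, h, ⟨h.subtype hb⟩⟩
  constructor
  · rintro (⟨rfl, -⟩ | ⟨-, g, ⟨e⟩, ⟨e'⟩⟩)
    · exact absurd hN (lt_irrefl 0)
    obtain ⟨b, h, ⟨hb⟩⟩ := key g
    cases b
    · exact ⟨e'.trans h⟩
    · exact (not_homeomorph_torus_klein (e.symm.trans (hb.trans ek))).elim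
  · rintro (⟨rfl, -⟩ | ⟨-, g, ⟨e⟩, ⟨e'⟩⟩)
    · exact absurd hN (lt_irrefl 0)
    obtain ⟨b, h, ⟨hb⟩⟩ := key g
    cases b
    · exact (not_homeomorph_torus_klein (et.symm.trans (hb.symm.trans e))).elim
    · exact ⟨e'.trans h⟩

end WaveBoundary

/-! ### Coordinates on the suspension of the projective plane. -/

section SuspensionModel

open Set

/-- Parametrization of the projective plane by height and phase. -/
def rpMk (p : Icc (0 : ℝ) 1 × Circle) : RP2 :=
  Quotient.mk (antipodal sphere2) ⟨((p.2 : ℂ) * (√(1 - (p.1 : ℝ) ^ 2) : ℝ), p.1), by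
    obtain ⟨⟨h, h0, h1⟩, z⟩ := p
    simp only [sphere2, mem_ofPred_eq, norm_mul, Circle.norm_coe, one_mul, Complex.norm_real,
      Real.norm_eq_abs, sq_abs]
    rw [Real.sq_sqrt (by nlinarith)]
    ring⟩

lemma continuous_rpMk : Continuous rpMk := by
  refine continuous_quotient_mk'.comp (Continuous.subtype_mk ?_ _)
  fun_prop

lemma rpMk_surjective : Function.Surjective rpMk := by
  have key : ∀ (p : ℂ × ℝ) (hp : p ∈ sphere2), 0 ≤ p.2 →
      ∃ a, rpMk a = Quotient.mk (antipodal sphere2) ⟨p, hp⟩ := by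
    rintro ⟨w, s⟩ hp hs
    have hp' : ‖w‖ ^ 2 + s ^ 2 = 1 := hp
    have hn := norm_nonneg w
    simp only at hs
    refine ⟨(⟨s, hs, by nlinarith⟩, Circle.exp (Complex.arg w)), Quotient.sound (Or.inl ?_)⟩
    simp only
    rw [show 1 - s ^ 2 = ‖w‖ ^ 2 by linarith, Real.sqrt_sq hn, Circle.coe_exp, mul_comm,
      Complex.norm_mul_exp_arg_mul_I]
  intro x
  induction x using Quotient.inductionOn with
  | h p =>
    obtain ⟨p, hp⟩ := p
    rcases le_total 0 p.2 with h | h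
    · exact key p hp h
    · have hp' : -p ∈ sphere2 := by
        have h1 : ‖p.1‖ ^ 2 + p.2 ^ 2 = 1 := hp
        simpa [sphere2] using h1
      obtain ⟨a, ha⟩ := key (-p) hp' (by simpa using h)
      exact ⟨a, ha.trans (Quotient.sound (Or.inr (by simp)))⟩

/-- On the closed upper hemisphere the antipodal relation acts only on the equator, which becomes an
orbit with isotropy `±1`; the pole is the fixed point, and all other orbits are free. -/
lemma rpMk_eq_iff {p q : Icc (0 : ℝ) 1 × Circle} : rpMk p = rpMk q ↔
    p.1 = q.1 ∧ (p.2 = q.2 ∨ (p.1 : ℝ) = 1 ∨ ((p.1 : ℝ) = 0 ∧ q.2 = -p.2)) := by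
  obtain ⟨⟨h, h0, h1⟩, z⟩ := p
  obtain ⟨⟨h', h0', h1'⟩, z'⟩ := q
  have hrad : ∀ {x : ℝ}, 0 ≤ x → x ≤ 1 → x ≠ 1 → ((√(1 - x ^ 2) : ℝ) : ℂ) ≠ 0 := by
    intro x hx0 hx1 hx
    have : 0 < 1 - x ^ 2 := by
      have : x < 1 := lt_of_le_of_ne hx1 hx
      nlinarith
    have := Real.sqrt_pos.2 this
    exact_mod_cast this.ne'
  constructor
  · intro hpq
    rcases Quotient.exact hpq with h2 | h2 <;> simp only [Prod.mk.injEq, Prod.neg_mk] at h2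
    · obtain ⟨h3, rfl⟩ := h2
      refine ⟨rfl, ?_⟩
      by_cases hh : h' = 1
      · exact Or.inr (Or.inl hh)
      · exact Or.inl (Circle.ext (mul_right_cancel₀ (hrad h0 h1 hh) h3).symm)
    · obtain ⟨h3, h4⟩ := h2
      have h5 : h = 0 := by linarith
      have h6 : h' = 0 := by linarith
      subst h5 h6
      refine ⟨rfl, Or.inr (Or.inr ⟨rfl, ?_⟩)⟩
      rw [← neg_mul] at h3
      have := mul_right_cancel₀ (hrad le_rfl zero_le_one zero_ne_one) h3
      exact Circle.ext (by simpa using this)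
  · rintro ⟨h2, h3⟩
    simp only at h2 h3
    cases h2
    rcases h3 with rfl | rfl | ⟨rfl, rfl⟩
    · rfl
    · exact Quotient.sound (Or.inl (by simp))
    · exact Quotient.sound (Or.inr (by simp))

lemma smul_rpMk (z : Circle) (p : Icc (0 : ℝ) 1 × Circle) : z • rpMk p = rpMk (p.1, z * p.2) := by
  refine Quotient.sound (Or.inl ?_)
  simp [rot, mul_assoc]

/-- Parametrization of the suspension of the projective plane. -/
def suspMk (p : (Icc (-1 : ℝ) 1 × Icc (0 : ℝ) 1) × Circle) : Susp RP2 :=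
  Quotient.mk (suspSetoid RP2) (rpMk (p.1.2, p.2), p.1.1)

lemma continuous_suspMk : Continuous suspMk := by
  have h := continuous_rpMk
  refine continuous_quotient_mk'.comp ?_
  fun_prop

lemma suspMk_surjective : Function.Surjective suspMk := by
  intro x
  induction x using Quotient.inductionOn with
  | h a =>
    obtain ⟨y, t⟩ := a
    obtain ⟨p, rfl⟩ := rpMk_surjective y
    exact ⟨((t, p.1), p.2), rfl⟩

lemma smul_suspMk (z : Circle) (p : (Icc (-1 : ℝ) 1 × Icc (0 : ℝ) 1) × Circle) :
    z • suspMk p = suspMk (p.1, z * p.2) := by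
  show Quotient.mk (suspSetoid RP2) (z • rpMk (p.1.2, p.2), p.1.1) = _
  rw [smul_rpMk]
  rfl

lemma suspMk_eq_iff {p q : (Icc (-1 : ℝ) 1 × Icc (0 : ℝ) 1) × Circle} : suspMk p = suspMk q ↔
    p.1.1 = q.1.1 ∧ (((p.1.1 : ℝ) = 1 ∨ (p.1.1 : ℝ) = -1) ∨ (p.1.2 = q.1.2 ∧
      (p.2 = q.2 ∨ (p.1.2 : ℝ) = 1 ∨ ((p.1.2 : ℝ) = 0 ∧ q.2 = -p.2)))) := by
  have h1 : suspMk p = suspMk q ↔ suspSetoid RP2 (rpMk (p.1.2, p.2), p.1.1)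
    (rpMk (q.1.2, q.2), q.1.1) := Quotient.eq
  have h2 : suspSetoid RP2 (rpMk (p.1.2, p.2), p.1.1) (rpMk (q.1.2, q.2), q.1.1) ↔
    ((rpMk (p.1.2, p.2), p.1.1) = (rpMk (q.1.2, q.2), q.1.1) ∨
      (p.1.1 = q.1.1 ∧ ((p.1.1 : ℝ) = 1 ∨ (p.1.1 : ℝ) = -1))) := Iff.rfl
  rw [h1, h2, Prod.mk.injEq, rpMk_eq_iff]
  tauto

/-- The quadratic invariants of the projective plane, multiplied by `1 - t ^ 2` so that they vanish
at the suspension points, separate points together with `t`. -/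
instance : T2Space (Susp RP2) := by
  let F : Susp RP2 → ℝ × ℂ × ℂ × ℝ := Quotient.lift
    (fun a : RP2 × Icc (-1 : ℝ) 1 => ((a.2 : ℝ),
      (1 - (a.2 : ℝ) ^ 2) • (antipodalInvariant a.1 : ℂ × ℂ × ℝ))) (by
      rintro a b (rfl | ⟨h, h' | h'⟩)
      · rfl
      · simp only [← h, h']; simp
      · simp only [← h, h']; simp)
  have hF : Continuous F := by
    apply Continuous.quotient_lift
    have h1 : Continuous fun a : RP2 × Icc (-1 : ℝ) 1 => (antipodalInvariant a.1 : ℂ × ℂ × ℝ) :=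
      continuous_antipodalInvariant.comp continuous_fst
    have h2 : Continuous fun a : RP2 × Icc (-1 : ℝ) 1 => 1 - (a.2 : ℝ) ^ 2 := by fun_prop
    exact (continuous_subtype_val.comp continuous_snd).prodMk (h2.smul h1)
  refine T2Space.of_injective_continuous (f := F) ?_ hF
  intro x y
  induction x using Quotient.inductionOn with
  | h a =>
    induction y using Quotient.inductionOn with
    | h a' =>
      intro h
      obtain ⟨x, t⟩ := a
      obtain ⟨x', t'⟩ := a'
      have h1 : (t : ℝ) = t' := congrArg Prod.fst h
      have h2 : (1 - (t : ℝ) ^ 2) • (antipodalInvariant x : ℂ × ℂ × ℝ) =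
        (1 - (t' : ℝ) ^ 2) • antipodalInvariant x' := congrArg Prod.snd h
      have h1' : t = t' := Subtype.ext h1
      subst h1'
      by_cases h3 : 1 - (t : ℝ) ^ 2 = 0
      · refine Quotient.sound (Or.inr ⟨rfl, ?_⟩)
        exact mul_self_eq_one_iff.1 (show (t : ℝ) * t = 1 by linarith)
      · have h4 := smul_right_injective _ h3 h2
        rw [antipodalInvariant_injective h4]

end SuspensionModel

/-! ### The suspension of the projective plane as a labelled space over the disk. -/

section DiskModel

open Set Metric

/-- The labelled space over the disk whose labels are given by `ℓ`; the orbits over boundary points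
are not free. -/
abbrev DiskLab (ℓ : ℂ → ℝ) : Set (ℂ × ℂ × ℂ) := Lab (closedBall (0 : ℂ) 1) ℓ fun v => 1 - ‖v‖

lemma continuousOn_diskSize : ContinuousOn (fun v : ℂ => 1 - ‖v‖) (closedBall (0 : ℂ) 1) := by
  fun_prop

lemma exists_diskLab_homeomorph {ℓ ℓ' : ℂ → ℝ} (hℓ : ContinuousOn ℓ (closedBall 0 1))
    (hℓ' : ContinuousOn ℓ' (closedBall 0 1)) (φ : closedBall (0 : ℂ) 1 ≃ₜ closedBall (0 : ℂ) 1)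
    (h : ∀ v, ‖(φ v : ℂ)‖ = 1 ↔ ‖(v : ℂ)‖ = 1)
    (h' : ∀ v : closedBall (0 : ℂ) 1, ‖(v : ℂ)‖ = 1 → (ℓ v ≤ 0 ↔ ℓ' (φ v) ≤ 0)) :
    ∃ e : DiskLab ℓ ≃ₜ DiskLab ℓ', ∀ (z : Circle) p, e (z • p) = z • e p := by
  obtain ⟨e, he, -⟩ := exists_homeomorph_lab hℓ continuousOn_diskSize hℓ' continuousOn_diskSize φ
    (fun v => by rw [sub_eq_zero, sub_eq_zero, eq_comm, ← h, eq_comm])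
    (fun v hv => h' v (by linarith))
  exact ⟨e, he⟩

/-- The point of the disk on the chord at height `p.1` at relative position `p.2`. -/
def chordPoint (p : Icc (-1 : ℝ) 1 × Icc (0 : ℝ) 1) : ℂ :=
  ⟨√(1 - (p.1 : ℝ) ^ 2) * (1 - 2 * p.2), p.1⟩

lemma normSq_chordPoint (p : Icc (-1 : ℝ) 1 × Icc (0 : ℝ) 1) :
    1 - ‖chordPoint p‖ ^ 2 = 4 * (1 - (p.1 : ℝ) ^ 2) * (p.2 * (1 - p.2)) := by
  obtain ⟨⟨t, ht⟩, s⟩ := p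
  have h : √(1 - t ^ 2) ^ 2 = 1 - t ^ 2 := Real.sq_sqrt (by nlinarith [ht.1, ht.2])
  rw [← Complex.normSq_eq_norm_sq, Complex.normSq_apply]
  simp only [chordPoint]
  linear_combination (-(1 - 2 * (s : ℝ)) ^ 2) * h

lemma chordPoint_mem (p : Icc (-1 : ℝ) 1 × Icc (0 : ℝ) 1) : chordPoint p ∈ closedBall (0 : ℂ) 1 := by
  have h := normSq_chordPoint p
  obtain ⟨⟨t, ht⟩, ⟨s, hs⟩⟩ := p
  rw [mem_closedBall_zero_iff]
  have h1 : 0 ≤ 4 * (1 - t ^ 2) * (s * (1 - s)) :=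
    mul_nonneg (by nlinarith [ht.1, ht.2]) (mul_nonneg hs.1 (by linarith [hs.2]))
  simp only at h
  rw [← h] at h1
  exact (sq_le_one_iff₀ (norm_nonneg _)).1 (by linarith)

lemma exists_chordPoint {v : ℂ} (hv : v ∈ closedBall (0 : ℂ) 1) : ∃ p, chordPoint p = v := by
  rw [mem_closedBall_zero_iff] at hv
  have h1 : v.re ^ 2 + v.im ^ 2 ≤ 1 := by
    have h := Complex.normSq_eq_norm_sq v
    rw [Complex.normSq_apply] at h
    nlinarith [norm_nonneg v]
  have ht : v.im ∈ Icc (-1 : ℝ) 1 := abs_le.1 (abs_le_one_iff_mul_self_le_one.2 (by nlinarith))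
  set r := √(1 - v.im ^ 2) with hr
  have hr2 : r ^ 2 = 1 - v.im ^ 2 := Real.sq_sqrt (by nlinarith)
  have hr0 : 0 ≤ r := Real.sqrt_nonneg _
  have h2 := abs_le.1 (abs_le_of_sq_le_sq (show v.re ^ 2 ≤ r ^ 2 by linarith) hr0)
  rcases hr0.eq_or_lt with h0 | h0
  · refine ⟨(⟨v.im, ht⟩, ⟨0, by norm_num, by norm_num⟩), Complex.ext ?_ rfl⟩
    simp only [chordPoint]
    rw [← hr, ← h0]
    linarith [h2.1, h2.2]
  · refine ⟨(⟨v.im, ht⟩, ⟨(1 - v.re / r) / 2, ?_, ?_⟩), Complex.ext ?_ rfl⟩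
    · have : v.re / r ≤ 1 := (div_le_one h0).2 h2.2
      linarith
    · have : -1 ≤ v.re / r := (le_div_iff₀ h0).2 (by linarith)
      linarith
    · simp only [chordPoint]
      rw [← hr]
      field_simp
      ring

lemma chordPoint_eq_iff {p q : Icc (-1 : ℝ) 1 × Icc (0 : ℝ) 1} : chordPoint p = chordPoint q ↔
    p.1 = q.1 ∧ (((p.1 : ℝ) = 1 ∨ (p.1 : ℝ) = -1) ∨ p.2 = q.2) := by
  obtain ⟨⟨t, ht⟩, ⟨s, hs⟩⟩ := p
  obtain ⟨⟨t', ht'⟩, ⟨s', hs'⟩⟩ := q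
  simp only [chordPoint, Complex.mk.injEq, Subtype.mk.injEq]
  constructor
  · rintro ⟨h1, rfl⟩
    refine ⟨rfl, ?_⟩
    rcases mul_eq_mul_left_iff.1 h1 with h2 | h2
    · right; linarith
    · left
      rw [Real.sqrt_eq_zero (by nlinarith [ht.1, ht.2])] at h2
      exact mul_self_eq_one_iff.1 (by linarith)
  · rintro ⟨rfl, (rfl | rfl) | rfl⟩ <;> simp

lemma norm_chordPoint_eq_one_iff (p : Icc (-1 : ℝ) 1 × Icc (0 : ℝ) 1) :
    1 - ‖chordPoint p‖ = 0 ↔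
      ((p.1 : ℝ) = 1 ∨ (p.1 : ℝ) = -1) ∨ (p.2 : ℝ) = 0 ∨ (p.2 : ℝ) = 1 := by
  have h2 : 1 - ‖chordPoint p‖ = 0 ↔ 1 - ‖chordPoint p‖ ^ 2 = 0 := by
    have := norm_nonneg (chordPoint p)
    constructor <;> intro h <;> nlinarith
  rw [h2, normSq_chordPoint, mul_eq_zero, mul_eq_zero, mul_eq_zero, ← mul_self_eq_one_iff]
  constructor
  · rintro ((h | h) | h | h)
    · norm_num at h
    · left; linarith
    · exact Or.inr (Or.inl h)
    · right; right; linarith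
  · rintro (h | h | h)
    · left; right; linarith
    · exact Or.inr (Or.inl h)
    · right; right; linarith

lemma chordPoint_re_nonpos_iff (p : Icc (-1 : ℝ) 1 × Icc (0 : ℝ) 1)
    (hp : ¬ ((p.1 : ℝ) = 1 ∨ (p.1 : ℝ) = -1)) (hs : (p.2 : ℝ) = 0 ∨ (p.2 : ℝ) = 1) :
    (chordPoint p).re ≤ 0 ↔ (p.2 : ℝ) = 1 := by
  have h1 : 0 < √(1 - (p.1 : ℝ) ^ 2) := by
    apply Real.sqrt_pos.2
    rw [← mul_self_eq_one_iff] at hp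
    have h2 := p.1.2.1
    have h3 := p.1.2.2
    refine lt_of_le_of_ne (by nlinarith) fun h => hp (by linarith)
  simp only [chordPoint]
  rcases hs with hs | hs
  · rw [hs]
    constructor
    · intro h; linarith
    · intro h; linarith
  · rw [hs]
    constructor
    · intro; rfl
    · intro; linarith

/-- The orbit space of the suspension is a rectangle with two opposite sides collapsed, that is a
disk swept out by horizontal chords. Equators end on the right half circle, where the label is
positive, poles on the left half circle; the suspension points are `±i`, with label zero. -/
lemma exists_diskLab_susp : ∃ e : DiskLab Complex.re ≃ₜ Susp RP2,
    ∀ (z : Circle) p, e (z • p) = z • e p := by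
  let q : (Icc (-1 : ℝ) 1 × Icc (0 : ℝ) 1) × Circle → DiskLab Complex.re := fun p =>
    labMk _ _ _ (⟨chordPoint p.1, chordPoint_mem p.1⟩, p.2)
  have hcp : Continuous chordPoint := by
    have : chordPoint = fun p => ((√(1 - (p.1 : ℝ) ^ 2) * (1 - 2 * p.2) : ℝ) : ℂ) +
        ((p.1 : ℝ) : ℂ) * Complex.I := by
      funext p
      apply Complex.ext <;> simp [chordPoint]
    rw [this]
    fun_prop
  have hq : Continuous q := by
    refine (continuous_labMk Complex.continuous_re.continuousOn continuousOn_diskSize).comp ?_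
    fun_prop
  have hqs : Function.Surjective q := by
    intro p
    obtain ⟨⟨⟨v, hv⟩, z⟩, rfl⟩ := labMk_surjective p
    obtain ⟨a, rfl⟩ := exists_chordPoint hv
    exact ⟨(a, z), rfl⟩
  obtain ⟨e, he⟩ := exists_homeomorph_of_quotient (isQuotientMap_of_compact hq hqs)
    (isQuotientMap_of_compact continuous_suspMk suspMk_surjective) (by
      rintro ⟨⟨t, s⟩, z⟩ ⟨⟨t', s'⟩, z'⟩
      rw [suspMk_eq_iff, labMk_eq_iff]
      simp only [Subtype.mk.injEq, chordPoint_eq_iff]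
      have h1 := norm_chordPoint_eq_one_iff (t, s)
      have h2 := chordPoint_re_nonpos_iff (t, s)
      simp only at h1 h2
      rw [h1]
      by_cases ht : (t : ℝ) = 1 ∨ (t : ℝ) = -1
      · have h3 : (chordPoint (t, s)).re ≤ 0 := by
          simp only [chordPoint]
          rcases ht with ht | ht <;> simp [ht]
        simp only [ht, h3, true_or, or_true, and_true]
      · simp only [ht, false_or]
        by_cases h0 : (s : ℝ) = 0
        · have h4 := h2 ht (Or.inl h0)

          simp only [h0, h4, true_or, true_and, false_or, and_assoc, zero_ne_one]
        · by_cases h5 : (s : ℝ) = 1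
          · have h4 := h2 ht (Or.inr h5)
            simp only [h4, h5, or_true, true_or, and_true]
          · simp only [h0, h5, or_false, false_and, and_assoc])
  refine ⟨e, fun z p => ?_⟩
  obtain ⟨a, rfl⟩ := hqs p
  have h1 : z • q a = q (a.1, z * a.2) := smul_labMk z _
  rw [h1, he, he, smul_suspMk]

end DiskModel

/-! ### Plane geometry: moving chords, the Cayley transform, radial contractions. -/

section DiskGeometry

open Set Metric

lemma isOpenEmbedding_of_inverse {X Y : Type*} [TopologicalSpace X] [TopologicalSpace Y]
    {f : X → Y} {g : Y → X} {V : Set Y} (hf : Continuous f) (hV : IsOpen V) (hfV : ∀ x, f x ∈ V)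
    (hg : ContinuousOn g V) (hgf : ∀ x, g (f x) = x) (hfg : ∀ y ∈ V, f (g y) = y) :
    IsOpenEmbedding f := by
  let e : X ≃ₜ V :=
    { toFun := fun x => ⟨f x, hfV x⟩
      invFun := fun y => g y
      left_inv := hgf
      right_inv := fun y => Subtype.ext (hfg y y.2)
      continuous_toFun := hf.subtype_mk _
      continuous_invFun := continuousOn_iff_continuous_domRestrict.1 hg }
  exact hV.isOpenEmbedding_subtypeVal.comp e.isOpenEmbedding

/-- Translation by `γ` along the real axis, in the projective model of the hyperbolic plane. -/
def diskShift (γ : ℝ) (v : ℂ) : ℂ :=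
  ⟨(v.re - γ) / (1 - γ * v.re), √(1 - γ ^ 2) * v.im / (1 - γ * v.re)⟩

variable {γ : ℝ}

lemma diskShift_den_pos (hγ : |γ| < 1) {v : ℂ} (hv : ‖v‖ ≤ 1) : 0 < 1 - γ * v.re := by
  have h1 := (Complex.abs_re_le_norm v).trans hv
  have h2 : |γ * v.re| < 1 := by
    rw [abs_mul]
    exact mul_lt_one_of_nonneg_of_lt_one_left (abs_nonneg _) hγ h1
  linarith [(abs_lt.1 h2).2]

/-- The two sides differ by a positive factor, so the translation preserves the disk and its
boundary circle. -/
lemma one_sub_norm_sq_diskShift (hγ : |γ| < 1) {v : ℂ} (hv : ‖v‖ ≤ 1) :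
    1 - ‖diskShift γ v‖ ^ 2 = (1 - γ ^ 2) * (1 - ‖v‖ ^ 2) / (1 - γ * v.re) ^ 2 := by
  have h1 := (diskShift_den_pos hγ hv).ne'
  have h2 : √(1 - γ ^ 2) ^ 2 = 1 - γ ^ 2 := Real.sq_sqrt (by
    have := (sq_lt_one_iff_abs_lt_one γ).2 hγ
    linarith)
  rw [← Complex.normSq_eq_norm_sq, ← Complex.normSq_eq_norm_sq, Complex.normSq_apply,
    Complex.normSq_apply]
  simp only [diskShift]
  obtain ⟨D, hD⟩ : ∃ D, D = 1 - γ * v.re := ⟨_, rfl⟩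
  rw [← hD] at h1 ⊢
  field_simp
  rw [h2, hD]
  ring

lemma norm_diskShift_le (hγ : |γ| < 1) {v : ℂ} (hv : ‖v‖ ≤ 1) : ‖diskShift γ v‖ ≤ 1 := by
  have h1 := one_sub_norm_sq_diskShift hγ hv
  have h2 : 0 ≤ (1 - γ ^ 2) * (1 - ‖v‖ ^ 2) / (1 - γ * v.re) ^ 2 := by
    have := (sq_lt_one_iff_abs_lt_one γ).2 hγ
    have h3 : ‖v‖ ^ 2 ≤ 1 := by nlinarith [norm_nonneg v]
    exact div_nonneg (mul_nonneg (by linarith) (by linarith)) (sq_nonneg _)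
  exact (sq_le_one_iff₀ (norm_nonneg _)).1 (by linarith)

lemma norm_diskShift_eq_one_iff (hγ : |γ| < 1) {v : ℂ} (hv : ‖v‖ ≤ 1) :
    ‖diskShift γ v‖ = 1 ↔ ‖v‖ = 1 := by
  have h1 := one_sub_norm_sq_diskShift hγ hv
  have h2 := (diskShift_den_pos hγ hv).ne'
  have h3 : 1 - γ ^ 2 ≠ 0 := by
    have := (sq_lt_one_iff_abs_lt_one γ).2 hγ
    linarith
  rw [← pow_eq_one_iff_of_nonneg (norm_nonneg _) two_ne_zero,
    ← pow_eq_one_iff_of_nonneg (norm_nonneg v) two_ne_zero]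
  constructor
  · intro h
    rw [h, sub_self, eq_comm, div_eq_zero_iff, mul_eq_zero] at h1
    rcases h1 with (h1 | h1) | h1
    · exact absurd h1 h3
    · linarith
    · exact absurd h1 (pow_ne_zero 2 h2)
  · intro h
    rw [h, sub_self, mul_zero, zero_div] at h1
    linarith

lemma diskShift_diskShift (hγ : |γ| < 1) {v : ℂ} (hv : ‖v‖ ≤ 1) :
    diskShift (-γ) (diskShift γ v) = v := by
  have h1 := (diskShift_den_pos hγ hv).ne'
  have h4 := (sq_lt_one_iff_abs_lt_one γ).2 hγ
  have h2 : √(1 - γ ^ 2) ^ 2 = 1 - γ ^ 2 := Real.sq_sqrt (by linarith)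
  have h3 : 1 - -γ * ((v.re - γ) / (1 - γ * v.re)) = (1 - γ ^ 2) / (1 - γ * v.re) := by
    field_simp
    ring
  have h5 : 1 - γ ^ 2 ≠ 0 := by linarith
  apply Complex.ext
  · simp only [diskShift]
    rw [h3]
    obtain ⟨D, hD⟩ : ∃ D, D = 1 - γ * v.re := ⟨_, rfl⟩
    rw [← hD] at h1 ⊢
    field_simp
    rw [hD]
    ring
  · simp only [diskShift]
    rw [h3, neg_sq]
    field_simp
    rw [h2]

lemma continuousOn_diskShift (hγ : |γ| < 1) : ContinuousOn (diskShift γ) (closedBall 0 1) := by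
  have h : diskShift γ = fun v : ℂ => (((v.re - γ) / (1 - γ * v.re) : ℝ) : ℂ) +
      ((√(1 - γ ^ 2) * v.im / (1 - γ * v.re) : ℝ) : ℂ) * Complex.I := by
    funext v
    exact Complex.mk_eq_add_mul_I _ _
  have h1 : ∀ v ∈ closedBall (0 : ℂ) 1, 1 - γ * v.re ≠ 0 := fun v hv =>
    (diskShift_den_pos hγ (mem_closedBall_zero_iff.1 hv)).ne'
  rw [h]
  refine ContinuousOn.add ?_ (ContinuousOn.mul ?_ continuousOn_const)
  · refine Complex.continuous_ofReal.comp_continuousOn (ContinuousOn.div ?_ ?_ h1) <;> fun_prop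
  · refine Complex.continuous_ofReal.comp_continuousOn (ContinuousOn.div ?_ ?_ h1) <;> fun_prop

/-- Translations as homeomorphisms of the disk. -/
def diskShiftHomeo (hγ : |γ| < 1) : closedBall (0 : ℂ) 1 ≃ₜ closedBall (0 : ℂ) 1 where
  toFun v := ⟨diskShift γ v, mem_closedBall_zero_iff.2
    (norm_diskShift_le hγ (mem_closedBall_zero_iff.1 v.2))⟩
  invFun v := ⟨diskShift (-γ) v, mem_closedBall_zero_iff.2
    (norm_diskShift_le (by rwa [abs_neg]) (mem_closedBall_zero_iff.1 v.2))⟩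
  left_inv v := Subtype.ext (diskShift_diskShift hγ (mem_closedBall_zero_iff.1 v.2))
  right_inv v := Subtype.ext (by
    have := diskShift_diskShift (γ := -γ) (by rwa [abs_neg]) (mem_closedBall_zero_iff.1 v.2)
    rwa [neg_neg] at this)
  continuous_toFun :=
    (continuousOn_iff_continuous_domRestrict.1 (continuousOn_diskShift hγ)).subtype_mk _
  continuous_invFun := (continuousOn_iff_continuous_domRestrict.1
    (continuousOn_diskShift (by rwa [abs_neg]))).subtype_mk _

/-- Rotations as homeomorphisms of the disk. -/
def diskRotate (d : Circle) : closedBall (0 : ℂ) 1 ≃ₜ closedBall (0 : ℂ) 1 :=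
  (rotation d).toHomeomorph.subtype fun v => by
    simp only [mem_closedBall_zero_iff]
    show _ ↔ ‖rotation d v‖ ≤ 1
    rw [LinearIsometryEquiv.norm_map]

/-- A half disk can be moved to the standard half disk. -/
lemma exists_disk_normalization (d : Circle) (hγ : |γ| < 1) :
    ∃ φ : closedBall (0 : ℂ) 1 ≃ₜ closedBall (0 : ℂ) 1, (∀ v, ‖(φ v : ℂ)‖ = 1 ↔ ‖(v : ℂ)‖ = 1) ∧
      (∀ v, 0 < (φ v : ℂ).re ↔ γ < ((d : ℂ) * v).re) ∧
      ∀ v, (φ v : ℂ).re < 0 ↔ ((d : ℂ) * v).re < γ := by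
  have hd : ∀ v, ((diskRotate d v : closedBall (0 : ℂ) 1) : ℂ) = (d : ℂ) * v := fun _ => rfl
  have hre : ∀ v, ((((diskRotate d).trans (diskShiftHomeo hγ)) v : closedBall (0 : ℂ) 1) : ℂ).re =
    ((diskRotate d v : ℂ).re - γ) / (1 - γ * (diskRotate d v : ℂ).re) := fun _ => rfl
  -- The rotation makes the chord vertical, at abscissa `γ`; the projective translation then moves
  -- it to the vertical diameter. Its denominator is positive, so the sides are kept.
  refine ⟨(diskRotate d).trans (diskShiftHomeo hγ), fun v => ?_, fun v => ?_, fun v => ?_⟩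
  · refine (norm_diskShift_eq_one_iff hγ (mem_closedBall_zero_iff.1 (diskRotate d v).2)).trans ?_
    rw [hd, norm_mul, Circle.norm_coe, one_mul]
  · have h := diskShift_den_pos hγ (mem_closedBall_zero_iff.1 (diskRotate d v).2)
    rw [hre, lt_div_iff₀ h, zero_mul, sub_pos, hd]
  · have h := diskShift_den_pos hγ (mem_closedBall_zero_iff.1 (diskRotate d v).2)
    rw [hre, div_lt_iff₀ h, zero_mul, sub_neg, hd]

/-- The closed upper half plane. -/
abbrev UpperHalf : Set ℂ := {b | 0 ≤ b.im}

/-- The Cayley transform from the upper half plane to the disk. -/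
def cayley (b : ℂ) : ℂ := (b - Complex.I) / (b + Complex.I)

lemma add_I_ne_zero {b : ℂ} (hb : b ∈ UpperHalf) : b + Complex.I ≠ 0 := by
  intro h
  have h1 := congrArg Complex.im h
  have h2 : 0 ≤ b.im := hb
  simp at h1
  linarith

lemma normSq_add_I (b : ℂ) : Complex.normSq (b + Complex.I) = ‖b‖ ^ 2 + 2 * b.im + 1 := by
  rw [← Complex.normSq_eq_norm_sq, Complex.normSq_apply, Complex.normSq_apply]
  simp
  ring

lemma re_cayley (b : ℂ) :
    (cayley b).re = (‖b‖ ^ 2 - 1) / (‖b‖ ^ 2 + 2 * b.im + 1) := by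
  rw [← normSq_add_I, cayley, Complex.div_re, ← add_div, ← Complex.normSq_eq_norm_sq,
    Complex.normSq_apply b]
  congr 1
  simp
  ring

lemma one_sub_norm_sq_cayley {b : ℂ} (hb : b ∈ UpperHalf) :
    1 - ‖cayley b‖ ^ 2 = 4 * b.im / (‖b‖ ^ 2 + 2 * b.im + 1) := by
  have h1 := add_I_ne_zero hb
  have h2 : Complex.normSq (b + Complex.I) ≠ 0 := by rwa [ne_eq, Complex.normSq_eq_zero]
  have h3 : Complex.normSq (b - Complex.I) = ‖b‖ ^ 2 - 2 * b.im + 1 := by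
    rw [← Complex.normSq_eq_norm_sq, Complex.normSq_apply, Complex.normSq_apply]
    simp
    ring
  rw [cayley, ← Complex.normSq_eq_norm_sq, Complex.normSq_div, h3, ← normSq_add_I]
  field_simp
  rw [normSq_add_I]
  ring

lemma cayley_den_pos {b : ℂ} (hb : b ∈ UpperHalf) : 0 < ‖b‖ ^ 2 + 2 * b.im + 1 := by
  have : 0 ≤ b.im := hb
  positivity

lemma cayley_mem {b : ℂ} (hb : b ∈ UpperHalf) : cayley b ∈ closedBall (0 : ℂ) 1 := by
  rw [mem_closedBall_zero_iff]
  have h1 := one_sub_norm_sq_cayley hb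
  have h2 : 0 ≤ 4 * b.im / (‖b‖ ^ 2 + 2 * b.im + 1) :=
    div_nonneg (by linarith [show 0 ≤ b.im from hb]) (cayley_den_pos hb).le
  exact (sq_le_one_iff₀ (norm_nonneg _)).1 (by linarith)

lemma norm_cayley_eq_one_iff {b : ℂ} (hb : b ∈ UpperHalf) : ‖cayley b‖ = 1 ↔ b.im = 0 := by
  have h1 := one_sub_norm_sq_cayley hb
  have h2 := (cayley_den_pos hb).ne'
  rw [← pow_eq_one_iff_of_nonneg (norm_nonneg _) two_ne_zero]
  constructor
  · intro h
    rw [h, sub_self, eq_comm, div_eq_zero_iff] at h1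
    rcases h1 with h1 | h1
    · linarith
    · exact absurd h1 h2
  · intro h
    rw [h, mul_zero, zero_div] at h1
    linarith

/-- The inverse of the Cayley transform. -/
def cayleyInv (v : ℂ) : ℂ := Complex.I * (1 + v) / (1 - v)

lemma cayleyInv_mem {v : ℂ} (hv : v ∈ closedBall (0 : ℂ) 1) : cayleyInv v ∈ UpperHalf := by
  rw [mem_closedBall_zero_iff] at hv
  show 0 ≤ (cayleyInv v).im
  have h1 : (cayleyInv v).im = (1 - ‖v‖ ^ 2) / Complex.normSq (1 - v) := by
    rw [cayleyInv, Complex.div_im, ← sub_div, ← Complex.normSq_eq_norm_sq, Complex.normSq_apply v]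
    congr 1
    simp
    ring
  rw [h1]
  exact div_nonneg (by nlinarith [norm_nonneg v]) (Complex.normSq_nonneg _)

lemma cayleyInv_cayley {b : ℂ} (hb : b ∈ UpperHalf) : cayleyInv (cayley b) = b := by
  have h1 := add_I_ne_zero hb
  have h2 : 1 - (b - Complex.I) / (b + Complex.I) = 2 * Complex.I / (b + Complex.I) := by
    field_simp
    ring
  rw [cayleyInv, cayley, h2]
  field_simp
  ring

lemma cayley_cayleyInv {v : ℂ} (hv : v ≠ 1) : cayley (cayleyInv v) = v := by
  have h1 : 1 - v ≠ 0 := sub_ne_zero.2 hv.symm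
  have h2 : Complex.I * (1 + v) / (1 - v) + Complex.I = 2 * Complex.I / (1 - v) := by
    field_simp
    ring
  rw [cayley, cayleyInv, h2]
  field_simp
  ring

lemma cayley_ne_one {b : ℂ} (hb : b ∈ UpperHalf) : cayley b ≠ 1 := by
  intro h
  rw [cayley, div_eq_one_iff_eq (add_I_ne_zero hb)] at h
  have h2 := congrArg Complex.im h
  simp at h2
  linarith

lemma isOpenEmbedding_cayley :
    IsOpenEmbedding fun b : UpperHalf => (⟨cayley b, cayley_mem b.2⟩ : closedBall (0 : ℂ) 1) := by
  refine isOpenEmbedding_of_inverse (V := {v | (v : ℂ) ≠ 1})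
    (g := fun v => ⟨cayleyInv v, cayleyInv_mem v.2⟩) (Continuous.subtype_mk ?_ _)
    (isOpen_ne_fun (by fun_prop) (by fun_prop)) (fun b => cayley_ne_one b.2) ?_
    (fun b => Subtype.ext (cayleyInv_cayley b.2)) (fun v hv => Subtype.ext (cayley_cayleyInv hv))
  · unfold cayley
    exact Continuous.div (by fun_prop) (by fun_prop) fun b => add_I_ne_zero b.2
  · rw [Topology.IsInducing.subtypeVal.continuousOn_iff]
    unfold cayleyInv Function.comp
    exact ContinuousOn.div (by fun_prop) (by fun_prop) fun v hv => sub_ne_zero.2 (Ne.symm hv)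

/-- A radial contraction of the plane to the disk of radius `1 + δ` fixing the unit circle. -/
def squeeze (δ : ℝ) (b : ℂ) : ℂ := (((1 + δ) / (δ + ‖b‖) : ℝ) : ℂ) * b

/-- The inverse of the radial contraction. -/
def unsqueeze (δ : ℝ) (b : ℂ) : ℂ := ((δ / |1 + δ - ‖b‖| : ℝ) : ℂ) * b

variable {δ : ℝ}

lemma norm_squeeze (hδ : 0 < δ) (b : ℂ) : ‖squeeze δ b‖ = (1 + δ) / (δ + ‖b‖) * ‖b‖ := by
  have : 0 ≤ (1 + δ) / (δ + ‖b‖) := by positivity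
  rw [squeeze, norm_mul, Complex.norm_real, Real.norm_of_nonneg this]

lemma norm_squeeze_lt (hδ : 0 < δ) (b : ℂ) : ‖squeeze δ b‖ < 1 + δ := by
  have h := norm_nonneg b
  rw [norm_squeeze hδ, div_mul_eq_mul_div, div_lt_iff₀ (by positivity)]
  nlinarith

lemma norm_squeeze_lt_one_iff (hδ : 0 < δ) (b : ℂ) : ‖squeeze δ b‖ < 1 ↔ ‖b‖ < 1 := by
  have h := norm_nonneg b
  rw [norm_squeeze hδ, div_mul_eq_mul_div, div_lt_iff₀ (by positivity)]
  constructor <;> intro h <;> nlinarith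

lemma norm_squeeze_eq_one_iff (hδ : 0 < δ) (b : ℂ) : ‖squeeze δ b‖ = 1 ↔ ‖b‖ = 1 := by
  have h := norm_nonneg b
  rw [norm_squeeze hδ, div_mul_eq_mul_div, div_eq_one_iff_eq (by positivity)]
  constructor
  · intro h
    have : δ * (‖b‖ - 1) = 0 := by linarith
    linarith [(mul_eq_zero.1 this).resolve_left hδ.ne']
  · intro h
    rw [h]; ring

lemma squeeze_eq_self (hδ : 0 < δ) {b : ℂ} (hb : ‖b‖ = 1) : squeeze δ b = b := by
  rw [squeeze, hb, add_comm, div_self (by positivity)]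
  simp

lemma im_squeeze_eq (b : ℂ) : (squeeze δ b).im = (1 + δ) / (δ + ‖b‖) * b.im := by
  rw [squeeze, Complex.im_ofReal_mul]

lemma unsqueeze_squeeze (hδ : 0 < δ) (b : ℂ) : unsqueeze δ (squeeze δ b) = b := by
  have h := norm_nonneg b
  have h1 : 1 + δ - ‖squeeze δ b‖ = (1 + δ) * δ / (δ + ‖b‖) := by
    rw [norm_squeeze hδ]
    field_simp
    ring
  rw [unsqueeze, h1, abs_of_nonneg (by positivity), squeeze, ← mul_assoc, ← Complex.ofReal_mul]
  have : δ / ((1 + δ) * δ / (δ + ‖b‖)) * ((1 + δ) / (δ + ‖b‖)) = 1 := by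
    field_simp
  rw [this]
  simp

lemma squeeze_unsqueeze (hδ : 0 < δ) {b : ℂ} (hb : ‖b‖ < 1 + δ) :
    squeeze δ (unsqueeze δ b) = b := by
  have h1 : 0 < 1 + δ - ‖b‖ := by linarith
  have h := norm_nonneg b
  have h2 : ‖unsqueeze δ b‖ = δ / (1 + δ - ‖b‖) * ‖b‖ := by
    rw [unsqueeze, abs_of_pos h1, norm_mul, Complex.norm_real, Real.norm_of_nonneg (by positivity)]
  have h3 : δ + δ / (1 + δ - ‖b‖) * ‖b‖ = δ * (1 + δ) / (1 + δ - ‖b‖) := by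
    field_simp
    ring
  rw [squeeze, h2, h3, unsqueeze, abs_of_pos h1, ← mul_assoc, ← Complex.ofReal_mul]
  have : (1 + δ) / (δ * (1 + δ) / (1 + δ - ‖b‖)) * (δ / (1 + δ - ‖b‖)) = 1 := by
    field_simp
  rw [this]
  simp

lemma squeeze_mem (hδ : 0 < δ) {b : ℂ} (hb : b ∈ UpperHalf) : squeeze δ b ∈ UpperHalf := by
  show 0 ≤ (squeeze δ b).im
  rw [im_squeeze_eq]
  have : 0 ≤ b.im := hb
  positivity

lemma unsqueeze_mem (hδ : 0 < δ) {b : ℂ} (hb : b ∈ UpperHalf) : unsqueeze δ b ∈ UpperHalf := by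
  show 0 ≤ (unsqueeze δ b).im
  rw [unsqueeze, Complex.im_ofReal_mul]
  have : 0 ≤ b.im := hb
  positivity

lemma continuous_squeeze (hδ : 0 < δ) : Continuous (squeeze δ) := by
  unfold squeeze
  refine Continuous.mul (Complex.continuous_ofReal.comp ?_) continuous_id
  exact Continuous.div (by fun_prop) (by fun_prop) fun b => by positivity

lemma continuousOn_unsqueeze : ContinuousOn (unsqueeze δ) {b | ‖b‖ < 1 + δ} := by
  unfold unsqueeze
  refine ContinuousOn.mul (Complex.continuous_ofReal.comp_continuousOn ?_) continuousOn_id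
  refine ContinuousOn.div (by fun_prop) (by fun_prop) fun b hb => ?_
  have : ‖b‖ < 1 + δ := hb
  exact abs_ne_zero.2 (by linarith)

lemma isOpenEmbedding_squeeze (hδ : 0 < δ) :
    IsOpenEmbedding fun b : UpperHalf => (⟨squeeze δ b, squeeze_mem hδ b.2⟩ : UpperHalf) := by
  refine isOpenEmbedding_of_inverse (V := {b | ‖(b : ℂ)‖ < 1 + δ})
    (g := fun b => ⟨unsqueeze δ b, unsqueeze_mem hδ b.2⟩)
    (((continuous_squeeze hδ).comp continuous_subtype_val).subtype_mk _)
    (isOpen_lt (by fun_prop) (by fun_prop)) (fun b => norm_squeeze_lt hδ _) ?_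
    (fun b => Subtype.ext (unsqueeze_squeeze hδ _)) (fun b hb => Subtype.ext (squeeze_unsqueeze hδ hb))
  rw [Topology.IsInducing.subtypeVal.continuousOn_iff]
  exact continuousOn_unsqueeze.comp (g := unsqueeze δ) (f := Subtype.val) (by fun_prop) fun b hb => hb

/-- An open embedding of the half plane in the disk which maps the unit half disk to a half disk. -/
lemma exists_halfDisk_chart {δ₀ : ℝ} (hδ₀ : 0 < δ₀) :
    ∃ ψ : UpperHalf → closedBall (0 : ℂ) 1, IsOpenEmbedding ψ ∧
      (∀ b, ‖(ψ b : ℂ)‖ = 1 ↔ (b : ℂ).im = 0) ∧ (∀ b, (ψ b : ℂ).re < δ₀) ∧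
      (∀ b, (ψ b : ℂ).re < 0 ↔ ‖(b : ℂ)‖ < 1) ∧ (∀ b, (ψ b : ℂ).re = 0 ↔ ‖(b : ℂ)‖ = 1) ∧
      ∀ v : closedBall (0 : ℂ) 1, (v : ℂ).re ≤ 0 → v ∈ range ψ := by
  -- The contracted half plane has radius less than `1 + δ`, so the real part of its Cayley image is
  -- less than `(1 + δ) ^ 2 - 1 ≤ 3 * δ ≤ δ₀`.
  set δ := min 1 (δ₀ / 3) with hδdef
  have hδ : 0 < δ := lt_min one_pos (by positivity)
  have hδ1 : δ ≤ 1 := min_le_left _ _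
  have hδ2 : δ ≤ δ₀ / 3 := min_le_right _ _
  refine ⟨_, (isOpenEmbedding_cayley).comp (isOpenEmbedding_squeeze hδ), ?_, ?_, ?_, ?_, ?_⟩
  · rintro ⟨b, hb⟩
    show ‖cayley (squeeze δ b)‖ = 1 ↔ b.im = 0
    rw [norm_cayley_eq_one_iff (squeeze_mem hδ hb), im_squeeze_eq, mul_eq_zero, or_iff_right]
    positivity
  · rintro ⟨b, hb⟩
    show (cayley (squeeze δ b)).re < δ₀
    have h1 := norm_squeeze_lt hδ b
    have h2 : 0 ≤ (squeeze δ b).im := squeeze_mem hδ hb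
    rw [re_cayley, div_lt_iff₀ (cayley_den_pos (squeeze_mem hδ hb))]
    have h3 := norm_nonneg (squeeze δ b)
    have h4 : ‖squeeze δ b‖ ^ 2 < (1 + δ) ^ 2 := by nlinarith
    have h5 : δ₀ * 1 ≤ δ₀ * (‖squeeze δ b‖ ^ 2 + 2 * (squeeze δ b).im + 1) :=
      mul_le_mul_of_nonneg_left (by nlinarith) hδ₀.le
    nlinarith
  · rintro ⟨b, hb⟩
    show (cayley (squeeze δ b)).re < 0 ↔ ‖b‖ < 1
    rw [re_cayley, div_lt_iff₀ (cayley_den_pos (squeeze_mem hδ hb)), zero_mul,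
      ← norm_squeeze_lt_one_iff hδ, sub_neg, sq_lt_one_iff₀ (norm_nonneg _)]
  · rintro ⟨b, hb⟩
    show (cayley (squeeze δ b)).re = 0 ↔ ‖b‖ = 1
    rw [re_cayley, div_eq_zero_iff, or_iff_left (cayley_den_pos (squeeze_mem hδ hb)).ne',
      ← norm_squeeze_eq_one_iff hδ, sub_eq_zero, pow_eq_one_iff_of_nonneg (norm_nonneg _) two_ne_zero]
  · rintro ⟨v, hv⟩ hre
    simp only at hre
    have hv1 : v ≠ 1 := by
      rintro rfl
      norm_num at hre
    have h1 : ‖cayleyInv v‖ < 1 + δ := by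
      have h2 := re_cayley (cayleyInv v)
      have h3 := cayley_den_pos (cayleyInv_mem hv)
      rw [cayley_cayleyInv hv1, eq_div_iff h3.ne'] at h2
      have h4 : ‖cayleyInv v‖ ^ 2 ≤ 1 := by nlinarith
      have h5 := (sq_le_one_iff₀ (norm_nonneg _)).1 h4
      linarith
    refine ⟨⟨unsqueeze δ (cayleyInv v), unsqueeze_mem hδ (cayleyInv_mem hv)⟩, Subtype.ext ?_⟩
    show cayley (squeeze δ (unsqueeze δ (cayleyInv v))) = v
    rw [squeeze_unsqueeze hδ h1, cayley_cayleyInv hv1]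

end DiskGeometry

/-! ### Cutting a disk along a chord is an equivariant connected sum. -/

section ConnectedSums

open Set Metric

/-- Euclidean space as a labelled space over the half plane. -/
def rotHomeo : ℂ × ℝ ≃ₜ Lab UpperHalf (fun _ => (-1 : ℝ)) Complex.im where
  toFun p := ⟨(⟨p.2, ‖p.1‖⟩, p.1, 0), norm_nonneg _, Circle.exp (Complex.arg p.1), by
    rw [lab, max_eq_right (by norm_num), Circle.coe_exp, Complex.norm_mul_exp_arg_mul_I]
    simp⟩
  invFun p := (p.1.2.1, p.1.1.re)
  left_inv p := rfl
  right_inv p := by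
    obtain ⟨⟨⟨b, hb⟩, z⟩, rfl⟩ := labMk_surjective p
    have h1 : ‖(lab (-1) b.im z).1‖ = b.im := norm_lab_fst hb z
    apply Subtype.ext
    refine Prod.ext (Complex.ext rfl h1) (Prod.ext rfl ?_)
    simp [labMk, lab]
  continuous_toFun := by
    have h : Continuous fun p : ℂ × ℝ => (⟨p.2, ‖p.1‖⟩ : ℂ) := by
      have : (fun p : ℂ × ℝ => (⟨p.2, ‖p.1‖⟩ : ℂ)) =
          fun p => (p.2 : ℂ) + ((‖p.1‖ : ℝ) : ℂ) * Complex.I :=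
        funext fun p => Complex.mk_eq_add_mul_I _ _
      rw [this]
      fun_prop
    refine Continuous.subtype_mk ?_ _
    fun_prop
  continuous_invFun := by fun_prop

lemma rotHomeo_rot (z : Circle) (p : ℂ × ℝ) : rotHomeo (rot z p) = z • rotHomeo p := by
  apply Subtype.ext
  rw [coe_smul_lab]
  simp only [rotHomeo, rot, Homeomorph.homeomorph_mk_coe, Equiv.coe_fn_mk, norm_mul,
    Circle.norm_coe, one_mul, mul_zero]

lemma rotHomeo_polar (b : UpperHalf) (z : Circle) :
    rotHomeo ((b : ℂ).im * z, (b : ℂ).re) = labMk UpperHalf (fun _ => (-1 : ℝ)) Complex.im (b, z) := by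
  obtain ⟨b, hb⟩ := b
  have hb' : 0 ≤ b.im := hb
  apply Subtype.ext
  simp only [rotHomeo, labMk, lab, Homeomorph.homeomorph_mk_coe, Equiv.coe_fn_mk]
  refine Prod.ext (Complex.ext rfl ?_) (Prod.ext rfl ?_)
  · simp only [norm_mul, Circle.norm_coe, mul_one, Complex.norm_real, Real.norm_of_nonneg hb']
  · simp

lemma exists_polar (p : ℂ × ℝ) : ∃ (b : UpperHalf) (z : Circle),
    p = (((b : ℂ).im * z : ℂ), (b : ℂ).re) ∧ ‖(b : ℂ)‖ ^ 2 = ‖p.1‖ ^ 2 + p.2 ^ 2 := by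
  refine ⟨⟨⟨p.2, ‖p.1‖⟩, norm_nonneg _⟩, Circle.exp (Complex.arg p.1), ?_, ?_⟩
  · rw [Circle.coe_exp, Complex.norm_mul_exp_arg_mul_I]
  · rw [← Complex.normSq_eq_norm_sq, Complex.normSq_apply]
    ring

lemma norm_polar (b : UpperHalf) (z : Circle) :
    ‖(((b : ℂ).im * z : ℂ), (b : ℂ).re).1‖ ^ 2 + (((b : ℂ).im * z : ℂ), (b : ℂ).re).2 ^ 2 =
      ‖(b : ℂ)‖ ^ 2 := by
  have hb : 0 ≤ (b : ℂ).im := b.2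
  rw [← Complex.normSq_eq_norm_sq (b : ℂ), Complex.normSq_apply]
  simp only [norm_mul, Circle.norm_coe, mul_one, Complex.norm_real, Real.norm_of_nonneg hb]
  ring

variable {ℓ : ℂ → ℝ}

/-- Invariant balls around regular fixed points of labelled spaces. -/
lemma exists_ball_chart {β : Type*} [TopologicalSpace β] [T2Space β] {S : Set β} {ℓ u : β → ℝ}
    (hℓ : ContinuousOn ℓ S) (hu : ContinuousOn u S)
    {ψ : UpperHalf → S} (hψ : IsOpenEmbedding ψ)
    (h1 : ∀ b : UpperHalf, u (ψ b) = 0 ↔ (b : ℂ).im = 0)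
    (h2 : ∀ b : UpperHalf, (b : ℂ).im = 0 → ℓ (ψ b) ≤ 0) :
    ∃ e : ℂ × ℝ → Lab S ℓ u, IsOpenEmbedding e ∧ (∀ (z : Circle) p, e (rot z p) = z • e p) ∧
      ∀ (b : UpperHalf) (z : Circle), e ((b : ℂ).im * z, (b : ℂ).re) = labMk _ _ _ (ψ b, z) := by
  have h3 : ∀ b : UpperHalf, (b : ℂ).im = 0 → u (ψ b) = 0 ∧
      ((-1 : ℝ) ≤ 0 → ℓ (ψ b) ≤ 0) := fun b hb => ⟨(h1 b).2 hb, fun _ => h2 b hb⟩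
  have h4 : ∀ b : UpperHalf, u (ψ b) = 0 → (b : ℂ).im = 0 ∧
      (ℓ (ψ b) ≤ 0 → (-1 : ℝ) ≤ 0) := fun b hb => ⟨(h1 b).1 hb, fun _ => by norm_num⟩
  have he := isOpenEmbedding_labMap (ℓ := fun _ : ℂ => (-1 : ℝ)) (u := Complex.im)
    continuousOn_const Complex.continuous_im.continuousOn hℓ hu hψ h3 h4
  refine ⟨_, he.comp rotHomeo.isOpenEmbedding, fun z p => ?_, fun b z => ?_⟩
  · show labMap ψ (rotHomeo (rot z p)) = _
    rw [rotHomeo_rot, smul_labMap h3]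
    rfl
  · show labMap ψ (rotHomeo _) = _
    rw [rotHomeo_polar, labMap_labMk h3]

/-- The image of the unit ball under a chart as above. -/
lemma mem_image_openBall_iff {β : Type*} [TopologicalSpace β] {S : Set β} {ℓ u : β → ℝ}
    {ψ : UpperHalf → S} {e : ℂ × ℝ → Lab S ℓ u}
    (he : ∀ (b : UpperHalf) (z : Circle), e ((b : ℂ).im * z, (b : ℂ).re) = labMk _ _ _ (ψ b, z))
    (x : Lab S ℓ u) :
    x ∈ e '' openBall3 ↔ ∃ b : UpperHalf, ‖(b : ℂ)‖ < 1 ∧ (ψ b : β) = x.1.1 := by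
  constructor
  · rintro ⟨p, hp, rfl⟩
    obtain ⟨b, z, rfl, hb⟩ := exists_polar p
    refine ⟨b, ?_, ?_⟩
    · have h1 : ‖(((b : ℂ).im * z : ℂ), (b : ℂ).re).1‖ ^ 2 +
        (((b : ℂ).im * z : ℂ), (b : ℂ).re).2 ^ 2 < 1 := hp
      rw [← hb] at h1
      exact (sq_lt_one_iff₀ (norm_nonneg _)).1 h1
    · rw [he]
      rfl
  · rintro ⟨b, hb, hx⟩
    obtain ⟨⟨v, z⟩, rfl⟩ := labMk_surjective x
    refine ⟨((b : ℂ).im * z, (b : ℂ).re), ?_, ?_⟩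
    · show ‖(((b : ℂ).im * z : ℂ), (b : ℂ).re).1‖ ^ 2 +
        (((b : ℂ).im * z : ℂ), (b : ℂ).re).2 ^ 2 < 1
      rw [norm_polar]
      exact (sq_lt_one_iff₀ (norm_nonneg _)).2 hb
    · rw [he]
      congr 2
      exact Subtype.ext hx

lemma polar_mem_sphere2_iff (b : UpperHalf) (z : Circle) :
    (((b : ℂ).im * z : ℂ), (b : ℂ).re) ∈ sphere2 ↔ ‖(b : ℂ)‖ = 1 := by
  rw [← pow_eq_one_iff_of_nonneg (norm_nonneg _) two_ne_zero, ← norm_polar b z]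
  rfl

/-- Reflection of the disk in the imaginary axis. -/
def diskReflect : closedBall (0 : ℂ) 1 ≃ₜ closedBall (0 : ℂ) 1 :=
  have h : ∀ v : closedBall (0 : ℂ) 1, -(starRingEnd ℂ) (v : ℂ) ∈ closedBall (0 : ℂ) 1 := fun v => by
    rw [mem_closedBall_zero_iff, norm_neg, RCLike.norm_conj, ← mem_closedBall_zero_iff]
    exact v.2
  { toFun := fun v => ⟨_, h v⟩
    invFun := fun v => ⟨_, h v⟩
    left_inv := fun v => Subtype.ext (by simp)
    right_inv := fun v => Subtype.ext (by simp)
    continuous_toFun := by fun_prop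
    continuous_invFun := by fun_prop }

lemma coe_diskReflect (v : closedBall (0 : ℂ) 1) :
    (diskReflect v : ℂ) = -(starRingEnd ℂ) (v : ℂ) := rfl

lemma compactSpace_diskLab (hℓ : ContinuousOn ℓ (closedBall 0 1)) : CompactSpace (DiskLab ℓ) :=
  compactSpace_lab (isCompact_closedBall _ _) hℓ continuousOn_diskSize

/-- Cutting a labelled space over the disk along a diameter with regular end points. -/
lemma isEquivariantConnectedSum_diameter (hℓ : ContinuousOn ℓ (closedBall 0 1)) {δ : ℝ} (hδ : 0 < δ)
    (h : ∀ v : ℂ, ‖v‖ = 1 → |v.re| < δ → ℓ v ≤ 0) :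
    IsEquivariantConnectedSum (DiskLab fun v => min (ℓ v) v.re) (DiskLab fun v => min (ℓ v) (-v.re))
      (DiskLab fun v => min (ℓ v) |v.re|) := by
  -- The first summand has all labels on the left half circle cut down to nonpositive values, so
  -- that the left half disk carries a ball; the second is treated symmetrically. The chart exceeds
  -- the half disk by less than `δ`, where boundary labels are nonpositive by assumption.
  obtain ⟨ψ, hψ, hψ1, hψδ, hψlt, hψeq, hψs⟩ := exists_halfDisk_chart hδ
  have hℓ₁ : ContinuousOn (fun v : ℂ => min (ℓ v) v.re) (closedBall 0 1) := by fun_prop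
  have hℓ₂ : ContinuousOn (fun v : ℂ => min (ℓ v) (-v.re)) (closedBall 0 1) := by fun_prop
  have hsize : ∀ b, 1 - ‖(ψ b : ℂ)‖ = 0 ↔ (b : ℂ).im = 0 := fun b => by
    rw [← hψ1, sub_eq_zero, eq_comm]
  have hlab : ∀ b : UpperHalf, (b : ℂ).im = 0 → ℓ (ψ b) ≤ 0 ∨ (ψ b : ℂ).re ≤ 0 := by
    intro b hb
    rcases le_or_gt (ψ b : ℂ).re 0 with h0 | h0
    · exact Or.inr h0
    · exact Or.inl (h _ ((hψ1 b).2 hb) (by rw [abs_of_pos h0]; exact hψδ b))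
  obtain ⟨e₁, he₁, hr₁, hp₁⟩ := exists_ball_chart hℓ₁ continuousOn_diskSize hψ hsize
    (fun b : UpperHalf => fun hb => by rw [min_le_iff]; exact hlab b hb)
  have hψ' := diskReflect.isOpenEmbedding.comp hψ
  have hre' : ∀ b, ((diskReflect ∘ ψ) b : ℂ).re = -(ψ b : ℂ).re := fun b => by
    simp [coe_diskReflect]
  have hnorm' : ∀ b, ‖((diskReflect ∘ ψ) b : ℂ)‖ = ‖(ψ b : ℂ)‖ := fun b => by
    simp [coe_diskReflect]
  obtain ⟨e₂, he₂, hr₂, hp₂⟩ := exists_ball_chart hℓ₂ continuousOn_diskSize hψ'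
    (fun b : UpperHalf => by rw [hnorm']; exact hsize b) (fun (b : UpperHalf) hb => by
      rw [min_le_iff, hre', neg_neg]
      rcases le_or_gt (ψ b : ℂ).re 0 with h0 | h0
      · exact Or.inr h0
      · left
        refine h _ ?_ ?_
        · rw [hnorm']; exact (hψ1 b).2 hb
        · rw [hre', abs_neg, abs_of_pos h0]; exact hψδ b)
  have hball₁ : ∀ x, x ∈ e₁ '' openBall3 ↔ x.1.1.re < 0 := by
    intro x
    rw [mem_image_openBall_iff hp₁]
    constructor
    · rintro ⟨b, hb, hx⟩
      rw [← hx]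
      exact (hψlt b).2 hb
    · intro hx
      obtain ⟨b, hb⟩ := hψs ⟨x.1.1, x.2.1⟩ hx.le
      have hb' : (ψ b : ℂ) = x.1.1 := congrArg Subtype.val hb
      exact ⟨b, (hψlt b).1 (by rw [hb']; exact hx), hb'⟩
  have hball₂ : ∀ x, x ∈ e₂ '' openBall3 ↔ 0 < x.1.1.re := by
    intro x
    rw [mem_image_openBall_iff hp₂]
    constructor
    · rintro ⟨b, hb, hx⟩
      rw [← hx, hre', neg_pos]
      exact (hψlt b).2 hb
    · intro hx
      have hre : (diskReflect ⟨x.1.1, x.2.1⟩ : ℂ).re = -x.1.1.re := by simp [coe_diskReflect]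
      obtain ⟨b, hb⟩ := hψs (diskReflect ⟨x.1.1, x.2.1⟩) (by rw [hre]; linarith)
      have hb' : ((diskReflect ∘ ψ) b : ℂ) = x.1.1 := by
        show (diskReflect (ψ b) : ℂ) = _
        rw [hb]
        simp [coe_diskReflect]
      refine ⟨b, (hψlt b).1 ?_, hb'⟩
      rw [hb, hre]
      linarith
  -- On the right half disk `v.re = |v.re|`, so this piece and the sum have the same ambient
  -- coordinates, and the inclusion is the identity on them.
  have hm₁ : ∀ x : {x : DiskLab fun v => min (ℓ v) v.re // x ∉ e₁ '' openBall3},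
      x.1.1 ∈ DiskLab fun v => min (ℓ v) |v.re| := by
    rintro ⟨x, hx⟩
    rw [hball₁, not_lt] at hx
    obtain ⟨z, hz⟩ := x.2.2
    exact ⟨x.2.1, z, by simp only; rw [abs_of_nonneg hx, hz]⟩
  have hm₂ : ∀ x : {x : DiskLab fun v => min (ℓ v) (-v.re) // x ∉ e₂ '' openBall3},
      x.1.1 ∈ DiskLab fun v => min (ℓ v) |v.re| := by
    rintro ⟨x, hx⟩
    rw [hball₂, not_lt] at hx
    obtain ⟨z, hz⟩ := x.2.2
    exact ⟨x.2.1, z, by simp only; rw [abs_of_nonpos hx, hz]⟩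
  have hcomp₁ : CompactSpace {x : DiskLab fun v => min (ℓ v) v.re // x ∉ e₁ '' openBall3} := by
    have := compactSpace_diskLab hℓ₁
    have hcl : IsClosed {x : DiskLab fun v => min (ℓ v) v.re | x ∉ e₁ '' openBall3} := by
      simp only [hball₁, not_lt]
      exact isClosed_le continuous_const (by fun_prop)
    exact isCompact_iff_compactSpace.1 hcl.isCompact
  have hcomp₂ : CompactSpace {x : DiskLab fun v => min (ℓ v) (-v.re) // x ∉ e₂ '' openBall3} := by
    have := compactSpace_diskLab hℓ₂
    have hcl : IsClosed {x : DiskLab fun v => min (ℓ v) (-v.re) | x ∉ e₂ '' openBall3} := by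
      simp only [hball₂, not_lt]
      exact isClosed_le (by fun_prop) continuous_const
    exact isCompact_iff_compactSpace.1 hcl.isCompact
  refine ⟨e₁, e₂, fun x => ⟨x.1.1, hm₁ x⟩, fun x => ⟨x.1.1, hm₂ x⟩,
    ⟨he₁, he₂, ?_, ?_, ?_, ?_⟩, hr₁, hr₂, ?_, ?_⟩
  · refine isClosedEmbedding_of_injective (by fun_prop) fun x y hxy => ?_
    exact Subtype.ext (Subtype.ext (Subtype.mk.inj hxy))
  · refine isClosedEmbedding_of_injective (by fun_prop) fun x y hxy => ?_
    exact Subtype.ext (Subtype.ext (Subtype.mk.inj hxy))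
  · refine eq_univ_of_forall fun x => ?_
    obtain ⟨z, hz⟩ := x.2.2
    rcases le_total 0 x.1.1.re with h0 | h0
    · left
      refine ⟨⟨⟨x.1, x.2.1, z, ?_⟩, ?_⟩, rfl⟩
      · simp only [abs_of_nonneg h0] at hz
        exact hz
      · rw [hball₁, not_lt]
        exact h0
    · right
      refine ⟨⟨⟨x.1, x.2.1, z, ?_⟩, ?_⟩, rfl⟩
      · simp only [abs_of_nonpos h0] at hz
        exact hz
      · rw [hball₂, not_lt]
        exact h0
  · rintro ⟨a, ha⟩ ⟨b, hb⟩
    simp only [Subtype.mk.injEq]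
    have hraw : ∀ (c : UpperHalf) (z : Circle), ‖(c : ℂ)‖ = 1 →
        (e₁ ((c : ℂ).im * z, (c : ℂ).re)).1 = (e₂ ((c : ℂ).im * z, (c : ℂ).re)).1 := by
      intro c z hc
      have h0 := (hψeq c).2 hc
      have h1 : ((diskReflect ∘ ψ) c : ℂ) = ψ c := by
        show (diskReflect (ψ c) : ℂ) = _
        rw [coe_diskReflect]
        apply Complex.ext
        · simp [h0]
        · simp
      rw [hp₁, hp₂]
      simp only [labMk, h1, h0, neg_zero]
    constructor
    · intro hab
      rw [hball₁, not_lt] at ha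
      rw [hball₂, not_lt] at hb
      have h0 : a.1.1.re = 0 := le_antisymm (by rw [hab]; exact hb) ha
      obtain ⟨⟨v, z⟩, rfl⟩ := labMk_surjective a
      obtain ⟨c, rfl⟩ := hψs v (le_of_eq h0)
      have hc := (hψeq c).1 h0
      refine ⟨((c : ℂ).im * z, (c : ℂ).re), (polar_mem_sphere2_iff c z).2 hc, hp₁ c z, ?_⟩
      apply Subtype.ext
      rw [← hraw c z hc, hp₁]
      exact hab
    · rintro ⟨p, hp, rfl, rfl⟩
      obtain ⟨c, z, rfl, -⟩ := exists_polar p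
      exact hraw c z ((polar_mem_sphere2_iff c z).1 hp)
  · rintro z ⟨a, ha⟩ ⟨b, hb⟩ hab
    simp only at hab
    subst hab
    rfl
  · rintro z ⟨a, ha⟩ ⟨b, hb⟩ hab
    simp only at hab
    subst hab
    rfl

/-- Equivariant connected sums are invariant under equivariant homeomorphisms. -/
lemma IsEquivariantConnectedSum.congr {X₁ X₂ Z X₁' X₂' Z' : Type} [TopologicalSpace X₁]
    [TopologicalSpace X₂] [TopologicalSpace Z] [MulAction Circle X₁] [MulAction Circle X₂]
    [MulAction Circle Z] [TopologicalSpace X₁'] [TopologicalSpace X₂'] [TopologicalSpace Z']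
    [MulAction Circle X₁'] [MulAction Circle X₂'] [MulAction Circle Z']
    (h : IsEquivariantConnectedSum X₁ X₂ Z)
    (h₁ : ∃ f : X₁ ≃ₜ X₁', ∀ (z : Circle) x, f (z • x) = z • f x)
    (h₂ : ∃ f : X₂ ≃ₜ X₂', ∀ (z : Circle) x, f (z • x) = z • f x)
    (h₃ : ∃ f : Z ≃ₜ Z', ∀ (z : Circle) x, f (z • x) = z • f x) :
    IsEquivariantConnectedSum X₁' X₂' Z' := by
  obtain ⟨e₁, e₂, i₁, i₂, ⟨ho₁, ho₂, hc₁, hc₂, hcov, hglue⟩, hr₁, hr₂, hs₁, hs₂⟩ := h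
  obtain ⟨f₁, hf₁⟩ := h₁
  obtain ⟨f₂, hf₂⟩ := h₂
  obtain ⟨f₃, hf₃⟩ := h₃
  let g₁ : {x : X₁' // x ∉ (f₁ ∘ e₁) '' openBall3} ≃ₜ {x : X₁ // x ∉ e₁ '' openBall3} :=
    f₁.symm.subtype fun x => by
      rw [image_comp, ← f₁.injective.mem_set_image (s := e₁ '' openBall3), f₁.apply_symm_apply]
  let g₂ : {x : X₂' // x ∉ (f₂ ∘ e₂) '' openBall3} ≃ₜ {x : X₂ // x ∉ e₂ '' openBall3} :=
    f₂.symm.subtype fun x => by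
      rw [image_comp, ← f₂.injective.mem_set_image (s := e₂ '' openBall3), f₂.apply_symm_apply]
  have hg₁ : ∀ x, ((g₁ x : {x : X₁ // x ∉ e₁ '' openBall3}) : X₁) = f₁.symm x := fun _ => rfl
  have hg₂ : ∀ x, ((g₂ x : {x : X₂ // x ∉ e₂ '' openBall3}) : X₂) = f₂.symm x := fun _ => rfl
  refine ⟨f₁ ∘ e₁, f₂ ∘ e₂, f₃ ∘ i₁ ∘ g₁, f₃ ∘ i₂ ∘ g₂,
    ⟨f₁.isOpenEmbedding.comp ho₁, f₂.isOpenEmbedding.comp ho₂,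
      f₃.isClosedEmbedding.comp (hc₁.comp g₁.isClosedEmbedding),
      f₃.isClosedEmbedding.comp (hc₂.comp g₂.isClosedEmbedding), ?_, ?_⟩, ?_, ?_, ?_, ?_⟩
  · rw [range_comp, range_comp f₃ (i₂ ∘ g₂), g₁.surjective.range_comp, g₂.surjective.range_comp,
      ← image_union, hcov, image_univ, f₃.surjective.range_eq]
  · intro a b
    simp only [Function.comp_apply, f₃.injective.eq_iff, hglue, hg₁, hg₂, Homeomorph.eq_symm_apply]
  · intro z p
    simp only [Function.comp_apply, hr₁, hf₁]
  · intro z p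
    simp only [Function.comp_apply, hr₂, hf₂]
  · intro z a b hab
    simp only [Function.comp_apply]
    rw [hs₁ z (g₁ a) (g₁ b), hf₃]
    rw [hg₁, hg₁, hab, f₁.symm_apply_eq, hf₁, f₁.apply_symm_apply]
  · intro z a b hab
    simp only [Function.comp_apply]
    rw [hs₂ z (g₂ a) (g₂ b), hf₃]
    rw [hg₂, hg₂, hab, f₂.symm_apply_eq, hf₂, f₂.apply_symm_apply]

end ConnectedSums

/-! ### Disks with several exceptional arcs are sums of suspensions. -/

section SuspensionSums

open Set Metric

lemma cos_sub_cos_arc (α β θ : ℝ) : Real.cos (θ - (α + β) / 2) - Real.cos ((β - α) / 2) =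
    2 * Real.sin ((θ - α) / 2) * Real.sin ((β - θ) / 2) := by
  rw [Real.cos_sub_cos, show (θ - (α + β) / 2 + (β - α) / 2) / 2 = (θ - α) / 2 by ring,
    show (θ - (α + β) / 2 - (β - α) / 2) / 2 = -((β - θ) / 2) by ring, Real.sin_neg]
  ring

/-- An arc of the circle is cut out by a half plane. -/
lemma mem_arc_iff {α β θ : ℝ} (h0 : 0 ≤ α) (hαβ : α < β) (hβ : β ≤ 2 * Real.pi)
    (hθ : θ ∈ Ico 0 (2 * Real.pi)) :
    Real.cos ((β - α) / 2) < Real.cos (θ - (α + β) / 2) ↔ α < θ ∧ θ < β := by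
  obtain ⟨hθ0, hθ1⟩ := hθ
  rw [← sub_pos, cos_sub_cos_arc]
  constructor
  · intro h
    by_contra hc
    rw [not_and_or, not_lt, not_lt] at hc
    rcases hc with hc | hc
    · have h1 : Real.sin ((θ - α) / 2) ≤ 0 :=
        Real.sin_nonpos_of_nonpos_of_neg_pi_le (by linarith) (by linarith)
      have h2 : 0 ≤ Real.sin ((β - θ) / 2) :=
        Real.sin_nonneg_of_nonneg_of_le_pi (by linarith) (by linarith)
      nlinarith
    · have h1 : 0 ≤ Real.sin ((θ - α) / 2) :=
        Real.sin_nonneg_of_nonneg_of_le_pi (by linarith) (by linarith)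
      have h2 : Real.sin ((β - θ) / 2) ≤ 0 :=
        Real.sin_nonpos_of_nonpos_of_neg_pi_le (by linarith) (by linarith)
      nlinarith
  · rintro ⟨h1, h2⟩
    have h3 : 0 < Real.sin ((θ - α) / 2) := Real.sin_pos_of_pos_of_lt_pi (by linarith) (by linarith)
    have h4 : 0 < Real.sin ((β - θ) / 2) := Real.sin_pos_of_pos_of_lt_pi (by linarith) (by linarith)
    positivity

lemma re_exp_mul_exp (c θ : ℝ) :
    ((Circle.exp (-c) : ℂ) * (Circle.exp θ : ℂ)).re = Real.cos (θ - c) := by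
  rw [← Circle.coe_mul, ← Circle.exp_add, Circle.coe_exp, Complex.exp_ofReal_mul_I_re]
  congr 1
  ring

lemma exists_angle {w : ℂ} (hw : ‖w‖ = 1) :
    ∃ θ ∈ Ico 0 (2 * Real.pi), (Circle.exp θ : ℂ) = w := by
  obtain ⟨t, ht⟩ := Circle.exp_surjective ⟨w, mem_sphere_zero_iff_norm.2 hw⟩
  have h1 := toIcoMod_mem_Ico Real.two_pi_pos 0 t
  rw [zero_add] at h1
  refine ⟨_, h1, ?_⟩
  have h2 := exp_two_pi_int (-(toIcoDiv Real.two_pi_pos 0 t)) t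
  have h3 : t + ((-(toIcoDiv Real.two_pi_pos 0 t) : ℤ) : ℝ) * (2 * Real.pi) =
      toIcoMod Real.two_pi_pos 0 t := by
    rw [toIcoMod, zsmul_eq_mul]
    push_cast
    ring
  rw [h3, ht] at h2
  rw [h2]

lemma abs_cos_lt_one {x : ℝ} (h0 : 0 < x) (h1 : x < Real.pi) : |Real.cos x| < 1 := by
  rw [← sq_lt_one_iff_abs_lt_one, Real.cos_sq']
  have := Real.sin_pos_of_pos_of_lt_pi h0 h1
  have := sq_pos_of_pos this
  linarith

variable {ℓ : ℂ → ℝ}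

/-- One exceptional arc gives the suspension of the projective plane. -/
lemma exists_diskLab_susp_of_arc (hℓ : ContinuousOn ℓ (closedBall 0 1)) {α β : ℝ} (h0 : 0 < α)
    (hαβ : α < β) (hβ : β < 2 * Real.pi)
    (h : ∀ θ ∈ Ico 0 (2 * Real.pi), 0 < ℓ (Circle.exp θ) ↔ α < θ ∧ θ < β) :
    ∃ e : DiskLab ℓ ≃ₜ Susp RP2, ∀ (z : Circle) p, e (z • p) = z • e p := by
  obtain ⟨φ, hφ1, hφ2, -⟩ := exists_disk_normalization (Circle.exp (-((α + β) / 2)))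
    (abs_cos_lt_one (x := (β - α) / 2) (by linarith) (by linarith))
  obtain ⟨e, he⟩ := exists_diskLab_homeomorph hℓ Complex.continuous_re.continuousOn φ hφ1 (by
    intro v hv
    obtain ⟨θ, hθ, hθv⟩ := exists_angle hv
    rw [← not_lt, ← not_lt, hφ2, ← hθv, h θ hθ, re_exp_mul_exp, mem_arc_iff h0.le hαβ hβ.le hθ])
  obtain ⟨e', he'⟩ := exists_diskLab_susp
  exact ⟨e.trans e', fun z p => by simp [he, he']⟩

/-- Labels are functions on the whole plane of which only the values on the disk matter; this turns
a label transported by a homeomorphism of the disk into such a function. -/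
lemma exists_continuousOn_extension {X : Type*} [TopologicalSpace X] {S : Set X} {F : S → ℝ}
    (hF : Continuous F) : ∃ f : X → ℝ, ContinuousOn f S ∧ ∀ v : S, f v = F v := by
  have h : ∀ v : S, Function.extend Subtype.val F 0 v = F v :=
    fun v => Subtype.val_injective.extend_apply F 0 v
  refine ⟨Function.extend Subtype.val F 0, ?_, h⟩
  rw [continuousOn_iff_continuous_domRestrict]
  exact hF.congr fun v => (h v).symm

/-- A labelled space over the disk with `k + 1` exceptional arcs is an equivariant connected sum of
suspensions of the projective plane. -/
lemma isSuspSum_diskLab (k : ℕ) {a b : ℕ → ℝ} (h0 : 0 < a 0) (hab : ∀ i, a i < b i)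
    (hba : ∀ i, b i < a (i + 1)) (hb : b k < 2 * Real.pi) (hℓ : ContinuousOn ℓ (closedBall 0 1))
    (h : ∀ θ ∈ Ico 0 (2 * Real.pi), 0 < ℓ (Circle.exp θ) ↔ ∃ i ≤ k, a i < θ ∧ θ < b i) :
    IsSuspSum (k + 1) (DiskLab ℓ) := by
  have ha : StrictMono a := strictMono_nat_of_lt_succ fun i => (hab i).trans (hba i)
  have hbm : StrictMono b := strictMono_nat_of_lt_succ fun i => (hba i).trans (hab (i + 1))
  induction k generalizing ℓ with
  | zero =>
    exact exists_diskLab_susp_of_arc hℓ h0 (hab 0) hb fun θ hθ => by rw [h θ hθ]; simp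
  | succ k ih =>
    -- The cut is the chord from angle `0` to an angle `m` in the gap before the last arc. It has
    -- direction `m / 2` and distance `cos (m / 2)`, and separates the last arc from all others.
    set m := (b k + a (k + 1)) / 2 with hm
    have hm1 : b k < m := by have := hba k; rw [hm]; linarith
    have hm2 : m < a (k + 1) := by have := hba k; rw [hm]; linarith
    have ha0 : ∀ i, 0 < a i := fun i => h0.trans_le (ha.monotone (Nat.zero_le i))
    have hm0 : 0 < m := ((ha0 k).trans (hab k)).trans hm1
    have hm3 : m < 2 * Real.pi := by linarith [hab (k + 1)]
    set γ := Real.cos (m / 2) with hγ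
    set d := Circle.exp (-(m / 2)) with hd
    obtain ⟨φ, hφ1, hφ2, hφ3⟩ := exists_disk_normalization (γ := γ) d
      (abs_cos_lt_one (by linarith) (by linarith))
    have harc : ∀ θ ∈ Ico 0 (2 * Real.pi),
        γ < ((d : ℂ) * (Circle.exp θ : ℂ)).re ↔ 0 < θ ∧ θ < m := by
      intro θ hθ
      have := mem_arc_iff le_rfl hm0 hm3.le hθ
      rw [zero_add, sub_zero] at this
      rw [hd, re_exp_mul_exp, this]
    have harc' : ∀ θ ∈ Ico 0 (2 * Real.pi),
        ((d : ℂ) * (Circle.exp θ : ℂ)).re < γ ↔ m < θ := by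
      intro θ hθ
      have := mem_arc_iff hm0.le hm3 le_rfl hθ
      rw [show θ - (m + 2 * Real.pi) / 2 = (θ - m / 2) - Real.pi by ring,
        show (2 * Real.pi - m) / 2 = Real.pi - m / 2 by ring, Real.cos_pi_sub, Real.cos_sub_pi,
        neg_lt_neg_iff] at this
      rw [hd, re_exp_mul_exp, this]
      exact and_iff_left hθ.2
    -- The label is transported to the disk in which the chord is the vertical diameter.
    obtain ⟨lam, hlam, hlamφ⟩ := exists_continuousOn_extension (F := fun v => ℓ (φ.symm v))
      ((continuousOn_iff_continuous_domRestrict.1 hℓ).comp φ.symm.continuous)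
    have hcirc : ∀ θ : ℝ, (Circle.exp θ : ℂ) ∈ closedBall (0 : ℂ) 1 := fun θ => by
      rw [mem_closedBall_zero_iff, Circle.norm_coe]
    -- the end points of the cut are regular
    obtain ⟨δ, hδ, hδ'⟩ : ∃ δ > 0, ∀ θ ∈ Ico 0 (2 * Real.pi), 0 < ℓ (Circle.exp θ) →
        δ ≤ |(φ ⟨_, hcirc θ⟩ : ℂ).re| := by
      have hK : IsCompact (⋃ i ∈ Iic (k + 1), Icc (a i) (b i)) :=
        (finite_Iic (k + 1)).isCompact_biUnion fun i _ => isCompact_Icc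
      have hcont : Continuous fun θ : ℝ => |(φ ⟨_, hcirc θ⟩ : ℂ).re| := by
        have : Continuous fun θ : ℝ => (⟨_, hcirc θ⟩ : closedBall (0 : ℂ) 1) := by fun_prop
        exact (Complex.continuous_re.comp (continuous_subtype_val.comp
          (φ.continuous.comp this))).abs
      obtain ⟨δ, hδ, h1⟩ := hK.exists_forall_le' hcont.continuousOn (a := 0) (by
        intro θ hθ
        simp only [mem_iUnion] at hθ
        obtain ⟨i, hi, hθ1, hθ2⟩ := hθ
        have hi' : i ≤ k + 1 := hi
        have hmem : θ ∈ Ico 0 (2 * Real.pi) :=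
          ⟨(ha0 i).le.trans hθ1, hθ2.trans_lt ((hbm.monotone hi').trans_lt hb)⟩
        rw [abs_pos]
        rcases Nat.lt_or_ge k i with hki | hki
        · have h2 : m < θ := hm2.trans_le ((ha.monotone hki).trans hθ1)
          exact ((hφ3 ⟨_, hcirc θ⟩).2 ((harc' θ hmem).2 h2)).ne
        · have h2 : θ < m := (hθ2.trans (hbm.monotone hki)).trans_lt hm1
          exact ((hφ2 ⟨_, hcirc θ⟩).2 ((harc θ hmem).2 ⟨(ha0 i).trans_le hθ1, h2⟩)).ne')
      refine ⟨δ, hδ, fun θ hθ hpos => h1 θ ?_⟩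
      obtain ⟨i, hi, hθ1, hθ2⟩ := (h θ hθ).1 hpos
      simp only [mem_iUnion]
      exact ⟨i, hi, hθ1.le, hθ2.le⟩
    have hreg : ∀ v : closedBall (0 : ℂ) 1, ‖(v : ℂ)‖ = 1 → 0 < ℓ v → δ ≤ |(φ v : ℂ).re| := by
      rintro ⟨v, hv⟩ hv1 hpos
      obtain ⟨θ, hθ, rfl⟩ := exists_angle hv1
      exact hδ' θ hθ hpos
    have hsymm : ∀ v, ‖(φ.symm v : ℂ)‖ = 1 ↔ ‖(v : ℂ)‖ = 1 := fun v => by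
      rw [← hφ1, φ.apply_symm_apply]
    have hsum := isEquivariantConnectedSum_diameter hlam hδ (by
      intro v hv hre
      by_contra hpos
      rw [not_le] at hpos
      have hv' : v ∈ closedBall (0 : ℂ) 1 := by rw [mem_closedBall_zero_iff, hv]
      have h1 := hlamφ ⟨v, hv'⟩
      simp only at h1
      rw [h1] at hpos
      have h2 := hreg _ ((hsymm ⟨v, hv'⟩).2 hv) hpos
      rw [φ.apply_symm_apply] at h2
      exact absurd hre (not_lt.2 h2))
    have hℓ₁ : ContinuousOn (fun v : ℂ => min (ℓ v) (((d : ℂ) * v).re - γ)) (closedBall 0 1) := by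
      fun_prop
    have hℓ₂ : ContinuousOn (fun v : ℂ => min (ℓ v) (γ - ((d : ℂ) * v).re)) (closedBall 0 1) := by
      fun_prop
    have hl1 : ContinuousOn (fun v : ℂ => min (lam v) v.re) (closedBall 0 1) := by fun_prop
    have hl2 : ContinuousOn (fun v : ℂ => min (lam v) (-v.re)) (closedBall 0 1) := by fun_prop
    have hl3 : ContinuousOn (fun v : ℂ => min (lam v) |v.re|) (closedBall 0 1) := by fun_prop
    refine ⟨DiskLab fun v => min (ℓ v) (((d : ℂ) * v).re - γ), inferInstance, inferInstance,
      ?_, hsum.congr ?_ ?_ ?_⟩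
    · refine ih (by linarith [hba k, hab (k + 1)]) hℓ₁ fun θ hθ => ?_
      rw [lt_min_iff, sub_pos, h θ hθ, harc θ hθ]
      constructor
      · rintro ⟨⟨i, hi, h1, h2⟩, h3, h4⟩
        refine ⟨i, ?_, h1, h2⟩
        by_contra hki
        have : a (k + 1) ≤ a i := ha.monotone (by omega)
        linarith
      · rintro ⟨i, hi, h1, h2⟩
        exact ⟨⟨i, by omega, h1, h2⟩, (ha0 i).trans h1, (h2.trans_le (hbm.monotone hi)).trans hm1⟩
    · refine exists_diskLab_homeomorph hl1 hℓ₁ φ.symm hsymm fun v hv => ?_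
      have h1 := hφ2 (φ.symm v)
      rw [φ.apply_symm_apply] at h1
      simp only [hlamφ]
      rw [min_le_iff, min_le_iff, sub_nonpos, ← not_lt, ← not_lt (a := γ), ← h1, ← not_lt (b := v.1.re)]
    · obtain ⟨e, he⟩ := exists_diskLab_homeomorph hl2 hℓ₂ φ.symm hsymm fun v hv => by
        have h1 := hφ3 (φ.symm v)
        rw [φ.apply_symm_apply] at h1
        simp only [hlamφ]
        rw [min_le_iff, min_le_iff, sub_nonpos, neg_nonpos, ← not_lt, ← not_lt (b := γ), ← h1,
          ← not_lt (a := v.1.re)]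
      obtain ⟨e', he'⟩ := exists_diskLab_susp_of_arc hℓ₂ (ha0 (k + 1)) (hab (k + 1)) hb (by
        intro θ hθ
        rw [lt_min_iff, sub_pos, h θ hθ, harc' θ hθ]
        constructor
        · rintro ⟨⟨i, hi, h1, h2⟩, h3⟩
          have : i = k + 1 := by
            by_contra hne
            have : b i ≤ b k := hbm.monotone (by omega)
            linarith
          subst this
          exact ⟨h1, h2⟩
        · rintro ⟨h1, h2⟩
          exact ⟨⟨k + 1, le_rfl, h1, h2⟩, hm2.trans h1⟩)
      exact ⟨e.trans e', fun z p => by simp [he, he']⟩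
    · refine exists_diskLab_homeomorph hl3 hℓ φ.symm hsymm fun v hv => ?_
      have h1 := hreg (φ.symm v) ((hsymm v).2 hv)
      rw [φ.apply_symm_apply] at h1
      simp only [hlamφ]
      rw [min_le_iff]
      constructor
      · rintro (h2 | h2)
        · exact h2
        · by_contra h3
          linarith [h1 (not_le.1 h3)]
      · exact Or.inl

end SuspensionSums

/-! ### Orbits and parameters of the wave spaces. -/

section WaveFibers

open Set

variable {N : ℕ} {b : Bool}

/-- The base point of an orbit: its coordinate along the core and its size. -/
def waveBase : WaveSpace b N → Circle × ℝ :=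
  Quotient.lift (fun p => (Circle.exp (2 * Real.pi * p.1.1.1), p.1.1.2)) (by
    rintro p _ ⟨n, rfl⟩
    simp only [waveShift]
    rw [show 2 * Real.pi * (p.1.1.1 + n) = 2 * Real.pi * p.1.1.1 + n * (2 * Real.pi) by ring,
      exp_two_pi_int])

lemma waveBase_mk (p : WaveCover N) :
    waveBase (waveMk b N p) = (Circle.exp (2 * Real.pi * p.1.1.1), p.1.1.2) := rfl

/-- The decomposition of the labelled space over the annulus into orbits. -/
def waveFiber (b : Bool) (N : ℕ) : Setoid (WaveSpace b N) := Setoid.ker waveBase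

lemma waveFiber_iff {y y' : WaveSpace b N} : waveFiber b N y y' ↔ waveBase y = waveBase y' :=
  Iff.rfl

lemma exp_two_pi_eq_iff {x y : ℝ} :
    Circle.exp (2 * Real.pi * x) = Circle.exp (2 * Real.pi * y) ↔ ∃ n : ℤ, y = x + n := by
  have hpi := Real.pi_pos
  constructor
  · intro h
    obtain ⟨n, hn⟩ := exp_eq_exp_iff.1 h.symm
    refine ⟨n, ?_⟩
    have : 2 * Real.pi * (y - (x + n)) = 0 := by linear_combination hn
    have := (mul_eq_zero.1 this).resolve_left (by positivity)
    linarith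
  · rintro ⟨n, rfl⟩
    rw [show 2 * Real.pi * (x + n) = 2 * Real.pi * x + n * (2 * Real.pi) by ring, exp_two_pi_int]

lemma waveBase_mk_eq_iff {p q : WaveCover N} : waveBase (waveMk b N p) = waveBase (waveMk b N q) ↔
    ∃ n : ℤ, q.1.1.1 = p.1.1.1 + n ∧ q.1.1.2 = p.1.1.2 := by
  rw [waveBase_mk, waveBase_mk, Prod.mk.injEq, exp_two_pi_eq_iff]
  constructor
  · rintro ⟨⟨n, hn⟩, h⟩
    exact ⟨n, hn, h.symm⟩
  · rintro ⟨n, hn, h⟩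
    exact ⟨⟨n, hn⟩, h.symm⟩

/-- Each fiber is the image of one orbit of the cover: a representative can be translated back over
the same base point. There the orbit makes sense, although in the twisted case the rotation is not
globally defined on the quotient. -/
lemma waveFiber_mk_iff {p : WaveCover N} {y : WaveSpace b N} :
    waveFiber b N (waveMk b N p) y ↔ ∃ z : Circle, y = waveMk b N (z • p) := by
  rw [waveFiber_iff]
  constructor
  · intro h
    obtain ⟨q, rfl⟩ := waveMk_surjective y
    obtain ⟨n, h1, h2⟩ := waveBase_mk_eq_iff.1 h
    have h3 : waveMk b N q = waveMk b N (waveShift b (-n) q) := waveMk_eq_iff.2 ⟨-n, rfl⟩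
    have h4 : waveShift b (-n) q ∈ MulAction.orbit Circle p := by
      rw [mem_orbit_lab_iff]
      refine Prod.ext ?_ h2.symm
      simp only [waveShift]
      push_cast
      linarith
    obtain ⟨z, hz⟩ := h4
    exact ⟨z, by rw [h3, ← hz]⟩
  · rintro ⟨z, rfl⟩
    rfl

/-- Parametrization of the labelled space over the annulus by base point and phase. -/
def waveParam (b : Bool) (N : ℕ) (p : unitStrip ℝ × Circle) : WaveSpace b N :=
  waveMk b N (labMk _ _ _ p)

lemma continuous_waveParam : Continuous (waveParam b N) :=
  continuous_waveMk.comp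
    (continuous_labMk (continuous_waveLabel N).continuousOn continuous_snd.continuousOn)

lemma waveShift_labMk (n : ℤ) (p : unitStrip ℝ × Circle) :
    waveShift b n (labMk (unitStrip ℝ) (waveLabel N) Prod.snd p) =
      labMk _ _ _ (⟨(p.1.1.1 + n, p.1.1.2), p.1.2⟩, flipIf (twist b n) p.2) := by
  apply Subtype.ext
  simp only [waveShift, labMk, lab_flipIf]
  rw [waveLabel_add_int N p.1.1.1 p.1.1.2 p.1.1.2 n]

lemma waveParam_eq_iff {p q : unitStrip ℝ × Circle} : waveParam b N p = waveParam b N q ↔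
    ∃ n : ℤ, (q.1.1.1 = p.1.1.1 + n ∧ q.1.1.2 = p.1.1.2) ∧ (q.2 = flipIf (twist b n) p.2 ∨
      (p.1.1.2 = 0 ∧ (waveLabel N p.1 ≤ 0 ∨ q.2 = -flipIf (twist b n) p.2))) := by
  rw [waveParam, waveParam, waveMk_eq_iff]
  refine exists_congr fun n => ?_
  rw [waveShift_labMk, eq_comm, labMk_eq_iff]
  simp only [Subtype.ext_iff, Prod.ext_iff]
  rw [waveLabel_add_int N p.1.1.1 p.1.1.2 p.1.1.2 n, eq_comm (b := q.1.1.1), eq_comm (b := q.1.1.2),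
    eq_comm (b := q.2)]

lemma waveBase_param_eq_iff {p q : unitStrip ℝ × Circle} :
    waveBase (waveParam b N p) = waveBase (waveParam b N q) ↔
      ∃ n : ℤ, q.1.1.1 = p.1.1.1 + n ∧ q.1.1.2 = p.1.1.2 := waveBase_mk_eq_iff

lemma exists_waveParam (y : WaveSpace b N) :
    ∃ p : unitStrip ℝ × Circle, p.1.1.1 ∈ Ico (0 : ℝ) 1 ∧ waveParam b N p = y := by
  obtain ⟨p, rfl⟩ := waveMk_surjective y
  obtain ⟨p, rfl⟩ := labMk_surjective p
  refine ⟨(⟨(p.1.1.1 + (-⌊p.1.1.1⌋ : ℤ), p.1.1.2), p.1.2⟩, flipIf (twist b (-⌊p.1.1.1⌋)) p.2), ?_, ?_⟩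
  · have h1 := Int.fract_nonneg p.1.1.1
    have h2 := Int.fract_lt_one p.1.1.1
    rw [Int.fract] at h1 h2
    simp only
    push_cast
    exact ⟨by linarith, by linarith⟩
  · refine Eq.symm ?_
    show waveParam b N p = waveParam b N _
    exact waveParam_eq_iff.2 ⟨-⌊p.1.1.1⌋, ⟨rfl, rfl⟩, Or.inl rfl⟩

lemma isCompact_waveParam_domain :
    IsCompact {p : unitStrip ℝ × Circle | p.1.1.1 ∈ Icc (0 : ℝ) 1} := by
  let f : (Icc (0 : ℝ) 1 × Icc (0 : ℝ) 1) × Circle → unitStrip ℝ × Circle :=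
    fun a => (⟨(a.1.1, a.1.2), a.1.2.2⟩, a.2)
  have hf : Continuous f := by fun_prop
  convert isCompact_range hf
  ext p
  constructor
  · intro hp
    exact ⟨((⟨p.1.1.1, hp⟩, ⟨p.1.1.2, p.1.2⟩), p.2), rfl⟩
  · rintro ⟨a, rfl⟩
    exact a.1.1.2

lemma waveParam_false_eq_iff {p q : unitStrip ℝ × Circle} :
    waveParam false N p = waveParam false N q ↔
      waveBase (waveParam false N p) = waveBase (waveParam false N q) ∧
        (p.2 = q.2 ∨ (p.1.1.2 = 0 ∧ (waveLabel N p.1 ≤ 0 ∨ q.2 = -p.2))) := by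
  rw [waveParam_eq_iff, waveBase_param_eq_iff, exists_and_right]
  simp only [twist, Bool.false_and, flipIf, Bool.false_eq_true, if_false, exists_and_right,
    eq_comm (a := q.2) (b := p.2)]

/-- Sets of positive labels. -/
lemma waveLabel_pos_iff (hN : 0 < N) {x : ℝ} (hx : x ∈ Icc (0 : ℝ) 1) (s : ℝ) :
    0 < waveLabel N (x, s) ↔ ∃ i < N, (i : ℝ) + 1 / 4 < N * x ∧ N * x < i + 3 / 4 := by
  have hpi := Real.pi_pos
  have hN' : (0 : ℝ) < N := by positivity
  have h0 : 0 ≤ N * x := mul_nonneg hN'.le hx.1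
  have h1 : N * x ≤ N := mul_le_of_le_one_right hN'.le hx.2
  have hlab : ∀ i : ℕ, waveLabel N (x, s) = -Real.cos (2 * Real.pi * (N * x - i)) := by
    intro i
    rw [show 2 * Real.pi * (N * x - i) = 2 * Real.pi * (N * x) - i * (2 * Real.pi) by ring,
      Real.cos_sub_nat_mul_two_pi, waveLabel, mul_assoc]
  constructor
  · intro h
    have h2 := Nat.floor_le h0
    have h3 := Nat.lt_floor_add_one (N * x)
    set i := ⌊N * x⌋₊
    rw [hlab i, neg_pos] at h
    have h4 : (i : ℝ) + 1 / 4 < N * x := by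
      by_contra hc
      rw [not_lt] at hc
      have := Real.cos_nonneg_of_neg_pi_div_two_le_of_le (x := 2 * Real.pi * (N * x - i))
        (by nlinarith) (by nlinarith)
      linarith
    refine ⟨i, ?_, h4, ?_⟩
    · have : (i : ℝ) < N := by linarith
      exact_mod_cast this
    · by_contra hc
      rw [not_lt] at hc
      have := Real.cos_nonneg_of_neg_pi_div_two_le_of_le (x := 2 * Real.pi * (N * x - i) - 2 * Real.pi)
        (by nlinarith) (by nlinarith)
      rw [Real.cos_sub_two_pi] at this
      linarith
  · rintro ⟨i, -, h2, h3⟩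
    rw [hlab i, neg_pos]
    exact Real.cos_neg_of_pi_div_two_lt_of_lt (by nlinarith) (by nlinarith)

end WaveFibers

/-! ### The untwisted wave space is a simple block. -/

section SimpleBlock

open Set Metric

/-- A continuous map defined on a quotient of a compact space with the same kernel is a closed
embedding. -/
lemma exists_isClosedEmbedding_of_compact {A X Z : Type*} [TopologicalSpace A] [TopologicalSpace X]
    [TopologicalSpace Z] [CompactSpace A] [T2Space X] [T2Space Z] {q₀ : A → X} {q' : A → Z}
    (h : Continuous q₀) (hs : Function.Surjective q₀) (h' : Continuous q')
    (hk : ∀ a b, q₀ a = q₀ b ↔ q' a = q' b) :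
    ∃ i : X → Z, IsClosedEmbedding i ∧ ∀ a, i (q₀ a) = q' a := by
  have : CompactSpace X := hs.compactSpace h
  choose s hs' using id hs
  have hf : ∀ a, q' (s (q₀ a)) = q' (id a) := fun a => (hk _ _).1 (hs' _)
  refine ⟨fun x => q' (s x), isClosedEmbedding_of_injective
    (continuous_of_quotient (isQuotientMap_of_compact h hs) h' continuous_id hf)
    (injective_of_quotient hs hf fun a a' => (hk a a').2), hf⟩

/-- The plane as the open unit disk. -/
def diskPlane (d : ℂ) : closedBall (0 : ℂ) 1 := ⟨(((1 + ‖d‖)⁻¹ : ℝ) : ℂ) * d, by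
  have := norm_nonneg d
  rw [mem_closedBall_zero_iff, norm_mul, Complex.norm_real, Real.norm_of_nonneg (by positivity),
    inv_mul_le_iff₀ (by positivity)]
  linarith⟩

lemma norm_diskPlane (d : ℂ) : ‖(diskPlane d : ℂ)‖ = (1 + ‖d‖)⁻¹ * ‖d‖ := by
  have := norm_nonneg d
  rw [diskPlane, norm_mul, Complex.norm_real, Real.norm_of_nonneg (by positivity)]

lemma norm_diskPlane_lt_one (d : ℂ) : ‖(diskPlane d : ℂ)‖ < 1 := by
  have := norm_nonneg d
  rw [norm_diskPlane, inv_mul_lt_iff₀ (by positivity)]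
  linarith

lemma norm_diskPlane_lt_half_iff (d : ℂ) : ‖(diskPlane d : ℂ)‖ < 1 / 2 ↔ ‖d‖ < 1 := by
  have := norm_nonneg d
  rw [norm_diskPlane, inv_mul_lt_iff₀ (by positivity)]
  constructor <;> intro h <;> linarith

lemma diskPlane_inverse {v : ℂ} (hv : ‖v‖ < 1) :
    (diskPlane (((1 - ‖v‖)⁻¹ : ℝ) * v) : ℂ) = v := by
  have h1 : 0 < 1 - ‖v‖ := by linarith
  rw [diskPlane]
  simp only
  rw [norm_mul, Complex.norm_real, Real.norm_of_nonneg (by positivity), ← mul_assoc,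
    ← Complex.ofReal_mul]
  have : (1 + (1 - ‖v‖)⁻¹ * ‖v‖)⁻¹ * (1 - ‖v‖)⁻¹ = 1 := by
    field_simp
    ring
  rw [this]
  simp

lemma isOpenEmbedding_diskPlane : IsOpenEmbedding diskPlane := by
  refine isOpenEmbedding_of_inverse (V := {v | ‖(v : ℂ)‖ < 1})
    (g := fun v => (((1 - ‖(v : ℂ)‖)⁻¹ : ℝ) : ℂ) * v) ?_
    (isOpen_lt (by fun_prop) continuous_const) norm_diskPlane_lt_one ?_ ?_
    (fun v hv => Subtype.ext (diskPlane_inverse hv))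
  · unfold diskPlane
    refine Continuous.subtype_mk ((Complex.continuous_ofReal.comp ?_).mul continuous_id) _
    exact Continuous.inv₀ (by fun_prop) fun d => by positivity
  · refine ContinuousOn.mul (Complex.continuous_ofReal.comp_continuousOn ?_) (by fun_prop)
    refine ContinuousOn.inv₀ (by fun_prop) fun v hv => ?_
    have : ‖(v : ℂ)‖ < 1 := hv
    linarith
  · intro d
    have h := norm_nonneg d
    rw [norm_diskPlane, diskPlane]
    simp only
    rw [← mul_assoc, ← Complex.ofReal_mul]
    have : (1 - (1 + ‖d‖)⁻¹ * ‖d‖)⁻¹ * (1 + ‖d‖)⁻¹ = 1 := by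
      field_simp
      ring
    rw [this]
    simp

/-- At the boundary point with angle `2πx` this label is the wave label at `x`, whose positive
intervals are `(i + 1/4, i + 3/4) / (k + 1)`. -/
lemma isSuspSum_pow (k : ℕ) : IsSuspSum (k + 1) (DiskLab fun v => -(v ^ (k + 1)).re) := by
  have hpi := Real.pi_pos
  have hN : (0 : ℝ) < (k + 1 : ℕ) := by positivity
  refine isSuspSum_diskLab k (a := fun i => 2 * Real.pi * ((i + 1 / 4) / (k + 1 : ℕ)))
    (b := fun i => 2 * Real.pi * ((i + 3 / 4) / (k + 1 : ℕ))) (by positivity) ?_ ?_ ?_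
    (by fun_prop) ?_
  · intro i
    gcongr
    norm_num
  · intro i
    push_cast
    gcongr 2 * Real.pi * (?_ / _)
    linarith
  · rw [mul_lt_iff_lt_one_right (by positivity), div_lt_one hN]
    push_cast
    linarith
  · intro θ hθ
    have hx : θ / (2 * Real.pi) ∈ Icc (0 : ℝ) 1 :=
      ⟨div_nonneg hθ.1 (by positivity), (div_le_one (by positivity)).2 hθ.2.le⟩
    have h1 := waveLabel_pos_iff (N := k + 1) k.succ_pos hx 0
    have h2 : waveLabel (k + 1) (θ / (2 * Real.pi), 0) =
        -((Circle.exp θ : ℂ) ^ (k + 1)).re := by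
      rw [Circle.coe_exp, ← Complex.exp_nat_mul, waveLabel, ← mul_assoc]
      rw [← Complex.ofReal_natCast, ← Complex.ofReal_mul, Complex.exp_ofReal_mul_I_re]
      congr 2
      simp only
      field_simp
    rw [← h2, h1]
    refine exists_congr fun i => ?_
    rw [Nat.lt_succ_iff]
    refine and_congr_right fun _ => ?_
    have h3 : ∀ c : ℝ, 2 * Real.pi * (c / (k + 1 : ℕ)) - θ =
        (c - (k + 1 : ℕ) * (θ / (2 * Real.pi))) * (2 * Real.pi / (k + 1 : ℕ)) := by
      intro c
      field_simp
    have h4 : 0 < 2 * Real.pi / (k + 1 : ℕ) := by positivity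
    have h5 : ∀ c : ℝ, θ - 2 * Real.pi * (c / (k + 1 : ℕ)) =
        ((k + 1 : ℕ) * (θ / (2 * Real.pi)) - c) * (2 * Real.pi / (k + 1 : ℕ)) := by
      intro c
      linear_combination -h3 c
    rw [← sub_pos (b := 2 * Real.pi * _), h5, ← sub_pos (a := 2 * Real.pi * _), h3,
      mul_pos_iff_of_pos_right h4, mul_pos_iff_of_pos_right h4, sub_pos, sub_pos]

/-- The labelled space over the annulus with untwisted orbits is a simple block. -/
lemma isSimpleSFBlock_wave {N : ℕ} (hN : 0 < N) :
    IsSimpleSFBlock N (WaveSpace false N) (waveFiber false N) := by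
  obtain ⟨k, rfl⟩ := Nat.exists_eq_add_one.2 hN
  set N := k + 1 with hNk
  set ℓ : ℂ → ℝ := fun v => -(v ^ N).re with hℓdef
  have hℓ : ContinuousOn ℓ (closedBall 0 1) := by fun_prop
  let e : ℂ × Circle → DiskLab ℓ := fun a => labMk _ _ _ (diskPlane a.1, a.2)
  have he : IsOpenEmbedding e := by
    refine isOpenEmbedding_of_quotient (q₀ := id) (ι := fun a => (diskPlane a.1, a.2))
      IsQuotientMap.id (isQuotientMap_labMk hℓ continuousOn_diskSize)
      (isOpenEmbedding_diskPlane.prodMap IsOpenEmbedding.id) (fun _ => rfl) ?_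
    rintro ⟨d, z⟩ ⟨v, z'⟩ h
    obtain ⟨h1, h2⟩ := labMk_eq_iff.1 h
    have h3 := norm_diskPlane_lt_one d
    have h4 : z = z' := h2.resolve_right fun h5 => by
      have := h5.1
      simp only at this
      linarith
    exact ⟨(d, z), Prod.ext h1 h4, rfl⟩
  have hmem : ∀ x, x ∈ e '' {p | ‖p.1‖ < 1} ↔ ‖x.1.1‖ < 1 / 2 := by
    intro x
    constructor
    · rintro ⟨⟨d, z⟩, hd, rfl⟩
      exact (norm_diskPlane_lt_half_iff d).2 hd
    · intro hx
      obtain ⟨⟨v, z⟩, rfl⟩ := labMk_surjective x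
      have hx' : ‖(v : ℂ)‖ < 1 / 2 := hx
      have h1 := diskPlane_inverse (v := v) (by linarith)
      refine ⟨(((1 - ‖(v : ℂ)‖)⁻¹ : ℝ) * v, z), ?_, ?_⟩
      · refine (norm_diskPlane_lt_half_iff _).1 ?_
        rw [h1]
        exact hx'
      · show labMk _ _ _ (_, z) = _
        rw [Subtype.ext h1]
  let A := {p : unitStrip ℝ × Circle | p.1.1.1 ∈ Icc (0 : ℝ) 1}
  -- Size `0` goes to the boundary circle of the disk, size `1` to the circle of radius `1/2`
  -- bounding the base of the removed solid torus. Labels matter only at size zero, where they agree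
  -- by `hlab`.
  let pt : A → ℂ := fun p => ((1 - p.1.1.1.2 / 2 : ℝ) : ℂ) * Circle.exp (2 * Real.pi * p.1.1.1.1)
  have hu : ∀ p : A, 0 < 1 - p.1.1.1.2 / 2 := fun p => by
    have := p.1.1.2.2
    linarith
  have hpt : ∀ p, ‖pt p‖ = 1 - p.1.1.1.2 / 2 := fun p => by
    simp only [pt]
    rw [norm_mul, Circle.norm_coe, mul_one, Complex.norm_real, Real.norm_of_nonneg (hu p).le]
  have hptm : ∀ p, pt p ∈ closedBall (0 : ℂ) 1 := fun p => by
    have := p.1.1.2.1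
    rw [mem_closedBall_zero_iff, hpt]
    linarith
  let q : A → {x : DiskLab ℓ // x ∉ e '' {p | ‖p.1‖ < 1}} := fun p =>
    ⟨labMk _ _ _ (⟨pt p, hptm p⟩, p.1.2), by
      have := p.1.1.2.2
      rw [hmem, not_lt]
      show _ ≤ ‖pt p‖
      rw [hpt]
      linarith⟩
  have hA : CompactSpace A := isCompact_iff_compactSpace.1 isCompact_waveParam_domain
  have hptc : Continuous pt := by fun_prop
  have hqc : Continuous q := by
    refine Continuous.subtype_mk ((continuous_labMk hℓ continuousOn_diskSize).comp ?_) _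
    fun_prop
  have hpteq : ∀ p p' : A, pt p = pt p' ↔
      waveBase (waveParam false N p) = waveBase (waveParam false N p') := by
    intro p p'
    show _ ↔ ((_, _) : Circle × ℝ) = (_, _)
    rw [Prod.mk.injEq]
    constructor
    · intro h
      have h1 := congrArg norm h
      rw [hpt, hpt] at h1
      have h2 : p.1.1.1.2 = p'.1.1.1.2 := by linarith
      refine ⟨Circle.ext ?_, h2⟩
      simp only [pt, h2] at h
      exact mul_left_cancel₀ (Complex.ofReal_ne_zero.2 (hu p').ne') h
    · rintro ⟨h1, h2⟩
      have h1' : Circle.exp (2 * Real.pi * p.1.1.1.1) = Circle.exp (2 * Real.pi * p'.1.1.1.1) := h1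
      have h2' : p.1.1.1.2 = p'.1.1.1.2 := h2
      simp only [pt, h1', h2']
  have hlab : ∀ p : A, p.1.1.1.2 = 0 → ℓ (pt p) = waveLabel N p.1.1.1 := by
    intro p hp
    simp only [hℓdef, pt, hp, waveLabel]
    rw [zero_div, sub_zero, Complex.ofReal_one, one_mul, Circle.coe_exp, ← Complex.exp_nat_mul,
      ← mul_assoc, ← Complex.ofReal_natCast, ← Complex.ofReal_mul, Complex.exp_ofReal_mul_I_re]
    congr 2
    ring
  have hsurj : Function.Surjective fun p : A => waveParam false N p := fun y => by
    obtain ⟨p, hp, h⟩ := exists_waveParam y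
    exact ⟨⟨p, Ico_subset_Icc_self hp⟩, h⟩
  have hqs : Function.Surjective q := by
    rintro ⟨x, hx⟩
    obtain ⟨⟨⟨v, hv⟩, z⟩, rfl⟩ := labMk_surjective x
    rw [hmem, not_lt] at hx
    have hx' : 1 / 2 ≤ ‖v‖ := hx
    rw [mem_closedBall_zero_iff] at hv
    have hv0 : (‖v‖ : ℂ) ≠ 0 := Complex.ofReal_ne_zero.2 (by linarith)
    obtain ⟨θ, hθ, hθv⟩ := exists_angle (w := v / ‖v‖) (by
      rw [norm_div, Complex.norm_real, norm_norm, div_self (by linarith)])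
    have hpi := Real.pi_pos
    refine ⟨⟨(⟨(θ / (2 * Real.pi), 2 - 2 * ‖v‖), by linarith, by linarith⟩, z),
      div_nonneg hθ.1 (by positivity), (div_le_one (by positivity)).2 hθ.2.le⟩, ?_⟩
    apply Subtype.ext
    refine congrArg (fun w => labMk (closedBall (0 : ℂ) 1) ℓ (fun v => 1 - ‖v‖) (w, z))
      (Subtype.ext ?_)
    simp only [pt]
    rw [mul_div_cancel₀ _ (by positivity), hθv, show 1 - (2 - 2 * ‖v‖) / 2 = ‖v‖ by ring,
      mul_div_cancel₀ _ hv0]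
  obtain ⟨h, hh⟩ := exists_homeomorph_of_quotient
    (isQuotientMap_of_compact (continuous_waveParam.comp continuous_subtype_val) hsurj)
    (isQuotientMap_of_compact hqc hqs) (by
      intro p p'
      show waveParam false N p = waveParam false N p' ↔ _
      rw [waveParam_false_eq_iff, ← hpteq, Subtype.ext_iff, labMk_eq_iff, Subtype.mk.injEq]
      refine and_congr_right fun _ => or_congr_right ?_
      have h1 : 1 - ‖pt p‖ = 0 ↔ p.1.1.1.2 = 0 := by
        rw [hpt]
        constructor <;> intro h <;> linarith
      simp only [h1]
      refine and_congr_right fun h2 => ?_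
      rw [hlab p h2])
  refine ⟨DiskLab ℓ, inferInstance, inferInstance, e, isSuspSum_pow k, he, fun z u d => ?_, h, ?_⟩
  · simp only [e, smul_labMk]
  · intro x y
    obtain ⟨p, rfl⟩ := hsurj x
    obtain ⟨p', rfl⟩ := hsurj y
    have hh' : ∀ a : A, h (waveParam false N a) = q a := hh
    rw [hh', hh']
    show _ ↔ MulAction.orbitRel Circle (DiskLab ℓ) (q p) (q p')
    rw [MulAction.orbitRel_apply, mem_orbit_lab_iff, eq_comm]
    exact (hpteq p p').symm

end SimpleBlock

/-! ### The solid Klein bottle as a wave space. -/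

section SolidKlein

open Set Metric

lemma coe_diskConj_zpow (n : ℤ) (w : Disk) :
    (((diskConj ^ n) w : Disk) : ℂ) = conjIf (twist true n) w := by
  have h1 : ∀ w : Disk, ((diskConj w : Disk) : ℂ) = conjIf (twist true 1) w := fun w => by
    simp [twist, conjIf, diskConj]
  have h2 : diskConj⁻¹ = diskConj := rfl
  induction n using Int.induction_on generalizing w with
  | zero => simp [twist, conjIf]
  | succ i ih => rw [zpow_add, zpow_one, Homeomorph.mul_apply, ih, h1, ← conjIf_twist_add]
  | pred i ih =>
    rw [zpow_sub, zpow_one, h2, Homeomorph.mul_apply, ih, h1, sub_eq_add_neg, conjIf_twist_add]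
    simp [twist]

/-- The universal cover of the solid Klein bottle as a labelled space without exceptional orbits. -/
def waveCoverZero : WaveCover 0 ≃ₜ Disk × ℝ where
  toFun p := (⟨p.1.2.1, by
    obtain ⟨⟨b, z⟩, rfl⟩ := labMk_surjective p
    rw [mem_closedBall_zero_iff]
    exact (norm_lab_fst (ℓ := waveLabel 0 b) b.2.1 z).trans_le b.2.2⟩, p.1.1.1)
  invFun a := ⟨((a.2, ‖(a.1 : ℂ)‖), a.1, 0), ⟨norm_nonneg _, mem_closedBall_zero_iff.1 a.1.2⟩,
    Circle.exp (Complex.arg a.1), by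
      simp only [lab, waveLabel]
      rw [Circle.coe_exp, Complex.norm_mul_exp_arg_mul_I]
      simp⟩
  left_inv p := by
    obtain ⟨⟨b, z⟩, rfl⟩ := labMk_surjective p
    apply Subtype.ext
    refine Prod.ext (Prod.ext rfl (norm_lab_fst (ℓ := waveLabel 0 b) b.2.1 z)) (Prod.ext rfl ?_)
    simp [labMk, lab, waveLabel]
  right_inv a := rfl
  continuous_toFun := by fun_prop
  continuous_invFun := by fun_prop

/-- For `N = 0` the label is constantly `-1`, so size and phase are polar coordinates of a disk, the
twist is complex conjugation, and orbits are concentric circles. -/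
lemma exists_solidKlein_homeomorph : ∃ h : WaveSpace true 0 ≃ₜ SolidKleinBottle,
    ∀ y y', twistedFBlock (h y) (h y') ↔ waveBase y = waveBase y' := by
  let π : Disk × ℝ → SolidKleinBottle := Quotient.mk (mappingTorusSetoid diskConj)
  have hπ : IsQuotientMap π := isQuotientMap_quotient_mk'
  obtain ⟨h, hh⟩ := exists_homeomorph_of_quotient (isQuotientMap_waveMk (b := true) (N := 0))
    (hπ.comp waveCoverZero.isQuotientMap) (by
      intro p q
      rw [waveMk_eq_iff]
      refine Iff.trans ?_ (Quotient.eq (r := mappingTorusSetoid diskConj)).symm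
      refine exists_congr fun n => ?_
      rw [← waveCoverZero.injective.eq_iff]
      refine Eq.congr rfl ?_
      refine Prod.ext (Subtype.ext ?_) rfl
      rw [coe_diskConj_zpow]
      rfl)
  have hh' : ∀ p, h (waveMk true 0 p) = π (waveCoverZero p) := hh
  have hnorm : ∀ p : WaveCover 0, ‖((waveCoverZero p).1 : ℂ)‖ = p.1.1.2 := fun p => by
    obtain ⟨⟨b, z⟩, rfl⟩ := labMk_surjective p
    exact norm_lab_fst (ℓ := waveLabel 0 b) b.2.1 z
  refine ⟨h, fun y y' => ?_⟩
  constructor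
  · rintro ⟨v, w, t, hvw, hv, hw⟩
    obtain ⟨p, hp⟩ := waveCoverZero.surjective (v, t)
    obtain ⟨q, hq⟩ := waveCoverZero.surjective (w, t)
    have hv' : h (waveMk true 0 p) = h y := by rw [hh', hp]; exact hv
    have hw' : h (waveMk true 0 q) = h y' := by rw [hh', hq]; exact hw
    rw [← h.injective hv', ← h.injective hw', waveBase_mk, waveBase_mk, ← hnorm, ← hnorm, hp, hq]
    have h1 : p.1.1.1 = t := congrArg Prod.snd hp
    have h2 : q.1.1.1 = t := congrArg Prod.snd hq
    rw [h1, h2]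
    exact Prod.ext rfl hvw
  · intro hb
    obtain ⟨p, rfl⟩ := waveMk_surjective y
    obtain ⟨z, rfl⟩ := waveFiber_mk_iff.1 (waveFiber_iff.2 hb)
    refine ⟨(waveCoverZero p).1, (waveCoverZero (z • p)).1, p.1.1.1, ?_, ?_, ?_⟩
    · rw [hnorm, hnorm]
      rfl
    · rw [hh']
      rfl
    · rw [hh']
      rfl

end SolidKlein

/-! ### A disk carrying the exceptional arcs of the annulus on half of its boundary. -/

section TwistedGeometry

open Set Metric

/-- A function on the disk which is a coordinate of its boundary on both half circles. -/
def circleCoord (v : ℂ) : ℝ := -v.im / (1 + |v.re|)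

lemma continuous_circleCoord : Continuous circleCoord := by
  unfold circleCoord
  exact Continuous.div (by fun_prop) (by fun_prop) fun v => by positivity

lemma im_cayley_ofReal (t : ℝ) : (cayley t).im = -2 * t / (t ^ 2 + 1) := by
  rw [cayley, Complex.div_im]
  simp [Complex.normSq_apply]
  ring

lemma re_cayley_ofReal (t : ℝ) : (cayley t).re = (t ^ 2 - 1) / (t ^ 2 + 1) := by
  rw [cayley, Complex.div_re]
  simp [Complex.normSq_apply]
  ring

lemma circleCoord_cayley_of_le {t : ℝ} (ht : |t| ≤ 1) : circleCoord (cayley t) = t := by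
  have h1 : t ^ 2 ≤ 1 := (sq_le_one_iff_abs_le_one t).2 ht
  have h2 : (t ^ 2 - 1) / (t ^ 2 + 1) ≤ 0 :=
    div_nonpos_of_nonpos_of_nonneg (by linarith) (by positivity)
  rw [circleCoord, im_cayley_ofReal, re_cayley_ofReal, abs_of_nonpos h2]
  have h3 : 1 + -((t ^ 2 - 1) / (t ^ 2 + 1)) = 2 / (t ^ 2 + 1) := by
    field_simp
    ring
  rw [h3]
  field_simp

lemma circleCoord_cayley_of_ge {t : ℝ} (ht : 1 ≤ |t|) : circleCoord (cayley t) = t⁻¹ := by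
  have h1 : 1 ≤ t ^ 2 := (one_le_sq_iff_one_le_abs t).2 ht
  have h2 : 0 ≤ (t ^ 2 - 1) / (t ^ 2 + 1) := div_nonneg (by linarith) (by positivity)
  have h0 : t ≠ 0 := by
    rintro rfl
    norm_num at h1
  rw [circleCoord, im_cayley_ofReal, re_cayley_ofReal, abs_of_nonneg h2]
  have h3 : 1 + (t ^ 2 - 1) / (t ^ 2 + 1) = 2 * t ^ 2 / (t ^ 2 + 1) := by
    field_simp
    ring
  rw [h3]
  field_simp

/-- This relates the coordinate `t = tan φ` on the boundary line of the half plane to the angle used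
in `isSuspSum_diskLab`. -/
lemma cayley_tan {φ : ℝ} (h : Real.cos φ ≠ 0) :
    cayley (Real.tan φ) = (Circle.exp (Real.pi + 2 * φ) : ℂ) := by
  have h0 : Real.cos φ ^ 2 + Real.sin φ ^ 2 = 1 := Real.cos_sq_add_sin_sq φ
  have h1 : (Circle.exp (Real.pi + 2 * φ) : ℂ) =
      ⟨-Real.cos (2 * φ), -Real.sin (2 * φ)⟩ := by
    apply Complex.ext
    · rw [Circle.coe_exp, Complex.exp_ofReal_mul_I_re, add_comm, Real.cos_add_pi]
    · rw [Circle.coe_exp, Complex.exp_ofReal_mul_I_im, add_comm, Real.sin_add_pi]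
  have h2 : Real.tan φ ^ 2 + 1 = 1 / Real.cos φ ^ 2 := by
    rw [Real.tan_eq_sin_div_cos]
    field_simp
    linarith
  rw [h1]
  apply Complex.ext
  · rw [re_cayley_ofReal, h2, Real.tan_eq_sin_div_cos, Real.cos_two_mul']
    field_simp
    ring
  · rw [im_cayley_ofReal, h2, Real.tan_eq_sin_div_cos, Real.sin_two_mul]
    field_simp

variable {N : ℕ}

/-- The half width of the interval which contains all exceptional orbits. -/
def waveRadius (N : ℕ) : ℝ := 1 / 2 - 1 / (8 * N)

lemma waveRadius_pos (hN : 0 < N) : 0 < waveRadius N := by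
  have h1 : (1 : ℝ) ≤ N := by exact_mod_cast hN
  have : 1 / (8 * (N : ℝ)) ≤ 1 / 8 := by
    apply one_div_le_one_div_of_le <;> linarith
  rw [waveRadius]
  linarith

/-- Exceptional orbits occur within `1/2 - 1/(4N)` of the middle of the period. The chosen half
width `1/2 - 1/(8N)` exceeds this, and even after enlargement by the factor `1 + 1/(8N)` of the
charts it stays inside one period. -/
lemma waveRadius_mul_lt (hN : 0 < N) : waveRadius N * (1 + 1 / (8 * N)) < 1 / 2 := by
  have h : 0 < 1 / (8 * (N : ℝ)) := by positivity
  rw [waveRadius]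
  nlinarith

/-- The label of the disk with the exceptional arcs of the labelled annulus. -/
def waveDiskLabel (N : ℕ) (v : ℂ) : ℝ :=
  min (-v.re) (waveLabel N (1 / 2 + waveRadius N * circleCoord v, 0))

lemma continuous_waveDiskLabel : Continuous (waveDiskLabel N) := by
  have h1 := continuous_circleCoord
  have h2 := continuous_waveLabel N
  unfold waveDiskLabel
  fun_prop

/-- Labels are positive only away from the ends of the period. -/
lemma waveLabel_nonpos (hN : 0 < N) {t : ℝ} (h1 : |waveRadius N * t| ≤ 1 / 2)
    (h2 : 1 / (1 + 1 / (8 * (N : ℝ))) ≤ |t|) (s : ℝ) :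
    waveLabel N (1 / 2 + waveRadius N * t, s) ≤ 0 := by
  by_contra hc
  rw [not_le] at hc
  have h1' := abs_le.1 h1
  have hN' : (0 : ℝ) < N := by positivity
  obtain ⟨i, hi, h3, h4⟩ := (waveLabel_pos_iff hN ⟨by linarith, by linarith⟩ s).1 hc
  have hi' : (i : ℝ) + 1 ≤ N := by exact_mod_cast hi
  have hi0 : (0 : ℝ) ≤ i := Nat.cast_nonneg i
  have hc0 := waveRadius_pos hN
  have h5 : N * (waveRadius N * |t|) < N / 2 - 1 / 4 := by
    rcases abs_cases t with ⟨h, -⟩ | ⟨h, -⟩ <;> rw [h] <;> nlinarith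
  have h6 : N * (waveRadius N * (1 / (1 + 1 / (8 * (N : ℝ))))) ≤ N * (waveRadius N * |t|) := by
    gcongr
  -- Even after division by the enlargement factor the half width is at least `1/2 - 1/(4N)`, beyond
  -- which no label is positive.
  have h7 : (N : ℝ) / 2 - 1 / 4 ≤ N * (waveRadius N * (1 / (1 + 1 / (8 * (N : ℝ))))) := by
    have h8 : N * waveRadius N = N / 2 - 1 / 8 := by
      rw [waveRadius]
      field_simp
    rw [← mul_assoc, h8, mul_one_div, le_div_iff₀ (by positivity)]
    have : (N : ℝ) * (1 / (8 * N)) = 1 / 8 := by field_simp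
    have h9 : 0 < 1 / (8 * (N : ℝ)) := by positivity
    nlinarith
  linarith

/-- The term `-v.re` in the label confines the positive arcs to the left half circle. There
`circleCoord` inverts the Cayley transform, so the arcs are the positive intervals of the wave
label, rewritten through `x = 1/2 + waveRadius * t` and `θ = π + 2 arctan t`. -/
lemma isSuspSum_waveDisk (k : ℕ) : IsSuspSum (k + 1) (DiskLab (waveDiskLabel (k + 1))) := by
  have hpi := Real.pi_pos
  have hc := waveRadius_pos k.succ_pos
  have hN : (0 : ℝ) < (k + 1 : ℕ) := by positivity
  have htan := Real.arctan_strictMono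
  refine isSuspSum_diskLab k
    (a := fun i => Real.pi + 2 * Real.arctan (((i + 1 / 4) / (k + 1 : ℕ) - 1 / 2) / waveRadius (k + 1)))
    (b := fun i => Real.pi + 2 * Real.arctan (((i + 3 / 4) / (k + 1 : ℕ) - 1 / 2) / waveRadius (k + 1)))
    ?_ ?_ ?_ ?_ continuous_waveDiskLabel.continuousOn ?_
  · linarith [Real.neg_pi_div_two_lt_arctan
      ((((0 : ℕ) + 1 / 4) / (k + 1 : ℕ) - 1 / 2) / waveRadius (k + 1))]
  · intro i
    have : (((i : ℝ) + 1 / 4) / (k + 1 : ℕ) - 1 / 2) / waveRadius (k + 1) <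
      ((i + 3 / 4) / (k + 1 : ℕ) - 1 / 2) / waveRadius (k + 1) := by gcongr; norm_num
    linarith [htan this]
  · intro i
    have : (((i : ℝ) + 3 / 4) / (k + 1 : ℕ) - 1 / 2) / waveRadius (k + 1) <
        (((i + 1 : ℕ) + 1 / 4) / (k + 1 : ℕ) - 1 / 2) / waveRadius (k + 1) := by
      refine div_lt_div_of_pos_right (sub_lt_sub_right (div_lt_div_of_pos_right ?_ hN) _) hc
      push_cast
      linarith
    linarith [htan this]
  · linarith [Real.arctan_lt_pi_div_two ((((k : ℕ) + 3 / 4) / (k + 1 : ℕ) - 1 / 2) / waveRadius (k + 1))]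
  · intro θ hθ
    -- The angle `0` is the point at infinity of the Cayley coordinate and is treated separately.
    rcases hθ.1.eq_or_lt with rfl | h0
    · refine iff_of_false ?_ ?_
      · rw [waveDiskLabel, lt_min_iff]
        simp
      · rintro ⟨i, -, h1, -⟩
        linarith [Real.neg_pi_div_two_lt_arctan
          (((i + 1 / 4) / (k + 1 : ℕ) - 1 / 2) / waveRadius (k + 1))]
    obtain ⟨φ, rfl⟩ : ∃ φ, θ = Real.pi + 2 * φ := ⟨(θ - Real.pi) / 2, by ring⟩
    have hφ1 : -(Real.pi / 2) < φ := by linarith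
    have hφ2 : φ < Real.pi / 2 := by linarith [hθ.2]
    have hcos := Real.cos_pos_of_mem_Ioo ⟨hφ1, hφ2⟩
    rw [← cayley_tan hcos.ne']
    have harc := Real.arctan_tan hφ1 hφ2
    set t := Real.tan φ
    have hlt : ∀ s, Real.pi + 2 * Real.arctan s < Real.pi + 2 * φ ↔ s < t := fun s => by
      rw [← harc, add_lt_add_iff_left, mul_lt_mul_iff_right₀ two_pos, htan.lt_iff_lt]
    have hgt : ∀ s, Real.pi + 2 * φ < Real.pi + 2 * Real.arctan s ↔ t < s := fun s => by
      rw [← harc, add_lt_add_iff_left, mul_lt_mul_iff_right₀ two_pos, htan.lt_iff_lt]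
    simp only [hlt, hgt, div_lt_iff₀ hc, lt_div_iff₀ hc, sub_lt_iff_lt_add, lt_sub_iff_add_lt,
      div_lt_iff₀ hN, lt_div_iff₀ hN]
    have hre : 0 < -(cayley t).re ↔ |t| < 1 := by
      rw [re_cayley_ofReal, ← neg_div, lt_div_iff₀ (by positivity), zero_mul, neg_pos, sub_neg,
        sq_lt_one_iff_abs_lt_one]
    have hNc : (k + 1 : ℕ) * waveRadius (k + 1) = (k + 1 : ℕ) / 2 - 1 / 8 := by
      rw [waveRadius]
      field_simp
    rw [waveDiskLabel, lt_min_iff, hre]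
    constructor
    · rintro ⟨h1, h2⟩
      rw [circleCoord_cayley_of_le h1.le] at h2
      have h1' := abs_lt.1 h1
      have hc2 : waveRadius (k + 1) ≤ 1 / 2 := by
        rw [waveRadius]
        have : 0 < 1 / (8 * ((k + 1 : ℕ) : ℝ)) := by positivity
        linarith
      obtain ⟨i, hi, h3, h4⟩ := (waveLabel_pos_iff k.succ_pos ⟨by nlinarith, by nlinarith⟩ 0).1 h2
      exact ⟨i, Nat.lt_succ_iff.1 hi, by linarith, by linarith⟩
    · rintro ⟨i, hi, h3, h4⟩
      have hi' : (i : ℝ) + 1 ≤ (k + 1 : ℕ) := by exact_mod_cast Nat.succ_le_succ hi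
      have hi0 : (0 : ℝ) ≤ i := Nat.cast_nonneg i
      have h5 : |t| < 1 := by
        have h6 : |(k + 1 : ℕ) * waveRadius (k + 1) * t| < (k + 1 : ℕ) * waveRadius (k + 1) := by
          rw [hNc, abs_lt]
          constructor <;> nlinarith
        rw [abs_mul, abs_of_pos (by positivity)] at h6
        exact (mul_lt_iff_lt_one_right (by positivity)).1 h6
      refine ⟨h5, ?_⟩
      rw [circleCoord_cayley_of_le h5.le]
      have h5' := abs_lt.1 h5
      have hc2 : waveRadius (k + 1) ≤ 1 / 2 := by
        rw [waveRadius]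
        have : 0 < 1 / (8 * ((k + 1 : ℕ) : ℝ)) := by positivity
        linarith
      exact (waveLabel_pos_iff k.succ_pos ⟨by nlinarith, by nlinarith⟩ 0).2
        ⟨i, Nat.lt_succ_iff.2 hi, by linarith, by linarith⟩

end TwistedGeometry

/-! ### Half plane coordinates on the strip and the two charts of the removed balls. -/

section StripCoordinates

open Set Metric

variable {N : ℕ}

/-- The point of the strip with given coordinate in the half plane. -/
def stripPoint (N : ℕ) (b : ℂ) : ℝ × ℝ := (1 / 2 + waveRadius N * b.re, b.im / 2)

/-- The coordinate in the half plane of a point in the strip. -/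
def stripCoord (N : ℕ) (p : ℝ × ℝ) : ℂ :=
  (((p.1 - 1 / 2) / waveRadius N : ℝ) : ℂ) + ((2 * p.2 : ℝ) : ℂ) * Complex.I

lemma stripCoord_re (p : ℝ × ℝ) : (stripCoord N p).re = (p.1 - 1 / 2) / waveRadius N := by
  simp [stripCoord]

lemma stripCoord_im (p : ℝ × ℝ) : (stripCoord N p).im = 2 * p.2 := by
  simp [stripCoord]

lemma stripCoord_stripPoint (hN : 0 < N) (b : ℂ) : stripCoord N (stripPoint N b) = b := by
  have := waveRadius_pos hN
  apply Complex.ext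
  · rw [stripCoord_re, stripPoint]
    field_simp
    ring
  · rw [stripCoord_im, stripPoint]
    ring

lemma stripPoint_stripCoord (hN : 0 < N) (p : ℝ × ℝ) : stripPoint N (stripCoord N p) = p := by
  have := waveRadius_pos hN
  rw [stripPoint, stripCoord_re, stripCoord_im]
  refine Prod.ext ?_ ?_
  · simp only
    field_simp
    ring
  · simp only
    ring

lemma stripPoint_mem {b : ℂ} (hb : b ∈ UpperHalf) (hb' : ‖b‖ ≤ 2) : stripPoint N b ∈ unitStrip ℝ := by
  have h1 : 0 ≤ b.im := hb
  have h2 := (le_abs_self _).trans ((Complex.abs_im_le_norm b).trans hb')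
  exact ⟨by simp only [stripPoint]; linarith, by simp only [stripPoint]; linarith⟩

lemma stripCoord_mem {p : ℝ × ℝ} (hp : p ∈ unitStrip ℝ) : stripCoord N p ∈ UpperHalf := by
  show 0 ≤ (stripCoord N p).im
  rw [stripCoord_im]
  linarith [hp.1]

lemma continuous_stripPoint : Continuous (stripPoint N) := by
  unfold stripPoint
  fun_prop

lemma continuous_stripCoord : Continuous (stripCoord N) := by
  unfold stripCoord
  fun_prop

lemma abs_stripPoint_sub_lt (hN : 0 < N) {b : ℂ} (hb : ‖b‖ < 1 + 1 / (8 * (N : ℝ))) :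
    |(stripPoint N b).1 - 1 / 2| < 1 / 2 := by
  have hc := waveRadius_pos hN
  have h1 := (Complex.abs_re_le_norm b).trans_lt hb
  rw [stripPoint]
  simp only [add_sub_cancel_left]
  rw [abs_mul, abs_of_pos hc]
  have h2 := waveRadius_mul_lt hN
  nlinarith

/-- The chart of the strip around the exceptional points. -/
def stripChart (hN : 0 < N) (b : UpperHalf) : unitStrip ℝ :=
  ⟨stripPoint N (squeeze (1 / (8 * N)) b),
    stripPoint_mem (squeeze_mem (by positivity) b.2) (by
      have h1 := norm_squeeze_lt (δ := 1 / (8 * (N : ℝ))) (by positivity) b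
      have h2 : (1 : ℝ) ≤ N := by exact_mod_cast hN
      have h3 : 1 / (8 * (N : ℝ)) ≤ 1 / 1 := one_div_le_one_div_of_le one_pos (by linarith)
      linarith)⟩

lemma stripCoord_stripChart (hN : 0 < N) (b : UpperHalf) :
    stripCoord N (stripChart hN b) = squeeze (1 / (8 * N)) b :=
  stripCoord_stripPoint hN _

lemma isOpenEmbedding_stripChart (hN : 0 < N) : IsOpenEmbedding (stripChart hN) := by
  have hδ : 0 < 1 / (8 * (N : ℝ)) := by positivity
  refine isOpenEmbedding_of_inverse
    (V := {p | ‖stripCoord N p‖ < 1 + 1 / (8 * (N : ℝ))})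
    (g := fun p => ⟨unsqueeze (1 / (8 * N)) (stripCoord N p), unsqueeze_mem hδ (stripCoord_mem p.2)⟩)
    ?_ ?_ ?_ ?_ ?_ ?_
  · exact ((continuous_stripPoint.comp (continuous_squeeze hδ)).comp
      continuous_subtype_val).subtype_mk _
  · exact isOpen_lt ((continuous_stripCoord.comp continuous_subtype_val).norm) continuous_const
  · intro b
    show ‖stripCoord N (stripChart hN b)‖ < _
    rw [stripCoord_stripChart]
    exact norm_squeeze_lt hδ _
  · rw [Topology.IsInducing.subtypeVal.continuousOn_iff]
    exact continuousOn_unsqueeze.comp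
      (continuous_stripCoord.comp continuous_subtype_val).continuousOn fun p hp => hp
  · intro b
    apply Subtype.ext
    simp only
    rw [stripCoord_stripChart, unsqueeze_squeeze hδ]
  · intro p hp
    apply Subtype.ext
    simp only [stripChart]
    rw [squeeze_unsqueeze hδ hp, stripPoint_stripCoord hN]

lemma exists_stripChart (hN : 0 < N) (p : unitStrip ℝ) (hp : ‖stripCoord N p‖ < 1) :
    ∃ b : UpperHalf, ‖(b : ℂ)‖ < 1 ∧ stripChart hN b = p := by
  have hδ : 0 < 1 / (8 * (N : ℝ)) := by positivity
  have h1 := squeeze_unsqueeze hδ (b := stripCoord N p) (by linarith)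
  refine ⟨⟨unsqueeze (1 / (8 * N)) (stripCoord N p), unsqueeze_mem hδ (stripCoord_mem p.2)⟩, ?_, ?_⟩
  · rw [← norm_squeeze_lt_one_iff hδ, h1]
    exact hp
  · apply Subtype.ext
    simp only [stripChart]
    rw [h1, stripPoint_stripCoord hN]

lemma eq_zero_of_shift {x y : ℝ} {n : ℤ} (hx : |x - 1 / 2| < 1 / 2) (hy : y ∈ Icc (0 : ℝ) 1)
    (h : y = x + n) : n = 0 := by
  have h1 := abs_lt.1 hx
  have h3 : (n : ℝ) < 1 := by linarith [hy.2]
  have h4 : (-1 : ℝ) < n := by linarith [hy.1]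
  have h6 : n < 1 := by exact_mod_cast h3
  have h7 : -1 < n := by exact_mod_cast h4
  omega

lemma re_cayley_lt_iff {b : ℂ} (hb : b ∈ UpperHalf) : (cayley b).re < 0 ↔ ‖b‖ < 1 := by
  rw [re_cayley, div_lt_iff₀ (cayley_den_pos hb), zero_mul, sub_neg, sq_lt_one_iff₀ (norm_nonneg _)]

lemma re_cayley_le_iff {b : ℂ} (hb : b ∈ UpperHalf) : (cayley b).re ≤ 0 ↔ ‖b‖ ≤ 1 := by
  rw [re_cayley, div_le_iff₀ (cayley_den_pos hb), zero_mul, sub_nonpos,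
    sq_le_one_iff₀ (norm_nonneg _)]

/-- Outside the unit half disk the orbits of size zero in the strip are fixed points. -/
lemma waveLabel_nonpos_of_coord (hN : 0 < N) {p : ℝ × ℝ} (hp : p.1 ∈ Icc (0 : ℝ) 1) (h0 : p.2 = 0)
    (h : 1 ≤ ‖stripCoord N p‖) : waveLabel N p ≤ 0 := by
  have hc := waveRadius_pos hN
  have h1 : stripCoord N p = (((p.1 - 1 / 2) / waveRadius N : ℝ) : ℂ) := by
    simp [stripCoord, h0]
  rw [h1, Complex.norm_real, Real.norm_eq_abs] at h
  have h2 := waveLabel_nonpos hN (t := (p.1 - 1 / 2) / waveRadius N) (by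
    rw [mul_div_cancel₀ _ hc.ne', abs_le]
    constructor <;> linarith [hp.1, hp.2]) (le_trans (by
    rw [div_le_one (by positivity)]
    have : 0 < 1 / (8 * (N : ℝ)) := by positivity
    linarith) h) p.2
  rwa [mul_div_cancel₀ _ hc.ne', add_sub_cancel] at h2

/-- The labels of the disk and of the strip agree. -/
lemma waveDiskLabel_cayley_iff (hN : 0 < N) {b : ℂ} (h0 : b.im = 0) (hb : ‖b‖ ≤ 1) :
    waveDiskLabel N (cayley b) ≤ 0 ↔ waveLabel N (stripPoint N b) ≤ 0 := by
  have hbr : b = (b.re : ℂ) := Complex.ext rfl (by simp [h0])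
  have hb1 : |b.re| ≤ 1 := by rwa [hbr, Complex.norm_real] at hb
  have hbu : b ∈ UpperHalf := h0.ge
  have h1 : circleCoord (cayley b) = b.re := by
    rw [hbr]
    exact circleCoord_cayley_of_le hb1
  have h2 : waveLabel N (1 / 2 + waveRadius N * b.re, 0) = waveLabel N (stripPoint N b) := rfl
  rw [waveDiskLabel, min_le_iff, h1, h2, neg_nonpos]
  refine ⟨fun h => h.elim (fun h3 => ?_) id, Or.inr⟩
  have hb' : 1 ≤ ‖b‖ := by
    rw [← not_lt, ← re_cayley_lt_iff hbu, not_lt]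
    exact h3
  refine waveLabel_nonpos_of_coord hN ?_ (by simp [stripPoint, h0]) ?_
  · have := abs_lt.1 (abs_stripPoint_sub_lt hN (b := b) (hb.trans_lt (by
      have : 0 < 1 / (8 * (N : ℝ)) := by positivity
      linarith)))
    exact ⟨by linarith, by linarith⟩
  · rwa [stripCoord_stripPoint hN]

/-- The chart of the disk opposite to `stripChart`. -/
def reflectChart (hN : 0 < N) (b : UpperHalf) : closedBall (0 : ℂ) 1 :=
  diskReflect ⟨cayley (squeeze (1 / (8 * N)) b), cayley_mem (squeeze_mem (by positivity) b.2)⟩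

lemma isOpenEmbedding_reflectChart (hN : 0 < N) : IsOpenEmbedding (reflectChart hN) :=
  diskReflect.isOpenEmbedding.comp
    (isOpenEmbedding_cayley.comp (isOpenEmbedding_squeeze (by positivity)))

lemma norm_reflectChart_iff (hN : 0 < N) (b : UpperHalf) :
    ‖(reflectChart hN b : ℂ)‖ = 1 ↔ (b : ℂ).im = 0 := by
  have hδ : 0 < 1 / (8 * (N : ℝ)) := by positivity
  rw [reflectChart, coe_diskReflect, norm_neg, RCLike.norm_conj]
  rw [norm_cayley_eq_one_iff (squeeze_mem hδ b.2), im_squeeze_eq, mul_eq_zero, or_iff_right]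
  positivity

lemma reflectChart_re (hN : 0 < N) (b : UpperHalf) :
    (reflectChart hN b : ℂ).re = -(cayley (squeeze (1 / (8 * N)) b)).re := by
  simp [reflectChart, coe_diskReflect]

lemma reflectChart_im (hN : 0 < N) (b : UpperHalf) :
    (reflectChart hN b : ℂ).im = (cayley (squeeze (1 / (8 * N)) b)).im := by
  simp [reflectChart, coe_diskReflect]

lemma reflectChart_pos_iff (hN : 0 < N) (b : UpperHalf) :
    0 < (reflectChart hN b : ℂ).re ↔ ‖(b : ℂ)‖ < 1 := by
  have hδ : 0 < 1 / (8 * (N : ℝ)) := by positivity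
  rw [reflectChart_re, neg_pos, re_cayley_lt_iff (squeeze_mem hδ b.2), norm_squeeze_lt_one_iff hδ]

/-- The contraction fixes the unit circle, which the Cayley transform maps to the imaginary axis,
and this is fixed by the reflection. So the two charts match along the gluing sphere. -/
lemma reflectChart_of_norm_eq_one (hN : 0 < N) {b : UpperHalf} (hb : ‖(b : ℂ)‖ = 1) :
    (reflectChart hN b : ℂ) = cayley b := by
  have h1 : (cayley b).re = 0 := by
    rw [re_cayley, hb]
    simp
  have h2 : (reflectChart hN b : ℂ) = -(starRingEnd ℂ) (cayley (squeeze (1 / (8 * N)) b)) := rfl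
  rw [h2, squeeze_eq_self (by positivity) hb]
  apply Complex.ext
  · simp [h1]
  · simp

lemma exists_reflectChart (hN : 0 < N) (v : closedBall (0 : ℂ) 1) (hv : 0 < (v : ℂ).re) :
    ∃ b : UpperHalf, ‖(b : ℂ)‖ < 1 ∧ reflectChart hN b = v := by
  have hδ : 0 < 1 / (8 * (N : ℝ)) := by positivity
  have hre : (diskReflect v : ℂ).re = -(v : ℂ).re := by simp [coe_diskReflect]
  have hne : (diskReflect v : ℂ) ≠ 1 := by
    intro h
    rw [h, Complex.one_re] at hre
    linarith
  have hm := cayleyInv_mem (diskReflect v).2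
  have h1 : ‖cayleyInv (diskReflect v)‖ < 1 := by
    rw [← re_cayley_lt_iff hm, cayley_cayleyInv hne, hre]
    linarith
  have h2 := squeeze_unsqueeze hδ (b := cayleyInv (diskReflect v)) (by linarith)
  have h3 : reflectChart hN ⟨unsqueeze (1 / (8 * N)) (cayleyInv (diskReflect v)),
      unsqueeze_mem hδ hm⟩ = v := by
    rw [reflectChart]
    simp only [h2, cayley_cayleyInv hne]
    apply Subtype.ext
    simp [coe_diskReflect]
  exact ⟨_, (reflectChart_pos_iff hN _).1 (by rw [h3]; exact hv), h3⟩

/-- The unit half disk lands on the right, where `-v.re` is negative. The excess of the chart has a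
contracted coordinate `s` with `1 ≤ |s| < 1 + 1/(8N)`; reflection turns it into `s⁻¹`, which is
still past the last exceptional arcs. -/
lemma waveDiskLabel_reflectChart (hN : 0 < N) {b : UpperHalf} (hb : (b : ℂ).im = 0) :
    waveDiskLabel N (reflectChart hN b) ≤ 0 := by
  have hδ : 0 < 1 / (8 * (N : ℝ)) := by positivity
  rw [waveDiskLabel, min_le_iff]
  rcases lt_or_ge ‖(b : ℂ)‖ 1 with h | h
  · left
    linarith [(reflectChart_pos_iff hN b).2 h]
  right
  set s := squeeze (1 / (8 * N)) (b : ℂ) with hs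
  have hs0 : s.im = 0 := by rw [hs, im_squeeze_eq, hb, mul_zero]
  have hsr : s = (s.re : ℂ) := Complex.ext rfl (by simp [hs0])
  have hs1 : 1 ≤ |s.re| := by
    have : ¬ ‖s‖ < 1 := by rw [hs, norm_squeeze_lt_one_iff hδ]; exact not_lt.2 h
    rw [hsr, Complex.norm_real] at this
    exact not_lt.1 this
  have hs2 : |s.re| < 1 + 1 / (8 * (N : ℝ)) :=
    (Complex.abs_re_le_norm s).trans_lt (norm_squeeze_lt hδ _)
  have h1 : circleCoord (reflectChart hN b) = s.re⁻¹ := by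
    rw [← circleCoord_cayley_of_ge hs1, ← hsr, circleCoord, circleCoord, reflectChart_re,
      reflectChart_im, abs_neg]
  have hpos : 0 < |s.re| := by linarith
  have hc := waveRadius_pos hN
  rw [h1]
  refine waveLabel_nonpos hN ?_ ?_ 0
  · rw [abs_mul, abs_of_pos hc, abs_inv]
    have h2 : |s.re|⁻¹ ≤ 1 := inv_le_one_of_one_le₀ hs1
    have h3 := waveRadius_mul_lt hN
    nlinarith
  · rw [abs_inv, one_div]
    exact inv_anti₀ hpos hs2.le

end StripCoordinates

/-! ### The twisted wave space is a twisted block. -/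

section TwistedBlock

open Set Metric

variable {N : ℕ}

/-- The parameters of the orbits of the annulus outside the unit half disk. -/
def outerParam (N : ℕ) : Set (unitStrip ℝ × Circle) :=
  {p | p.1.1.1 ∈ Icc (0 : ℝ) 1} ∩ {p | 1 ≤ ‖stripCoord N p.1‖}

lemma isCompact_outerParam : IsCompact (outerParam N) := by
  refine isCompact_waveParam_domain.inter_right ?_
  have := continuous_stripCoord (N := N)
  exact isClosed_le continuous_const (by fun_prop)

/-- The unit half disk. -/
def halfDisk : Set ℂ := closedBall 0 1 ∩ UpperHalf

lemma isCompact_halfDisk : IsCompact halfDisk :=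
  (isCompact_closedBall _ _).inter_right (isClosed_le continuous_const Complex.continuous_im)

lemma norm_le_of_mem_halfDisk {b : ℂ} (hb : b ∈ halfDisk) : ‖b‖ ≤ 1 :=
  mem_closedBall_zero_iff.1 hb.1

/-- The parameters of the orbits of the annulus inside the unit half disk. -/
def innerParam (N : ℕ) (a : halfDisk × Circle) : unitStrip ℝ × Circle :=
  (⟨stripPoint N a.1, stripPoint_mem a.1.2.2
    ((norm_le_of_mem_halfDisk a.1.2).trans one_le_two)⟩, a.2)

lemma continuous_innerParam : Continuous (innerParam N) := by
  have := continuous_stripPoint (N := N)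
  unfold innerParam
  fun_prop

lemma innerParam_mem (hN : 0 < N) (a : halfDisk × Circle) :
    |(innerParam N a).1.1.1 - 1 / 2| < 1 / 2 := by
  refine abs_stripPoint_sub_lt hN ((norm_le_of_mem_halfDisk a.1.2).trans_lt ?_)
  have : 0 < 1 / (8 * (N : ℝ)) := by positivity
  linarith

lemma mem_Icc_of_abs_sub_lt {x : ℝ} (h : |x - 1 / 2| < 1 / 2) : x ∈ Icc (0 : ℝ) 1 := by
  have := abs_lt.1 h
  exact ⟨by linarith, by linarith⟩

/-- Near the middle of the period the quotient map is injective on parameters. -/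
lemma waveParam_eq_iff_of_mem {b : Bool} {p q : unitStrip ℝ × Circle}
    (hp : |p.1.1.1 - 1 / 2| < 1 / 2) (hq : q.1.1.1 ∈ Icc (0 : ℝ) 1) :
    waveParam b N p = waveParam b N q ↔ p.1 = q.1 ∧ (p.2 = q.2 ∨
      (p.1.1.2 = 0 ∧ (waveLabel N p.1 ≤ 0 ∨ q.2 = -p.2))) := by
  have h0 : ∀ z, flipIf (twist b 0) z = z := fun z => by simp [twist, flipIf]
  rw [waveParam_eq_iff]
  constructor
  · rintro ⟨n, ⟨h1, h2⟩, h3⟩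
    have hn := eq_zero_of_shift hp hq h1
    subst hn
    rw [h0] at h3
    exact ⟨Subtype.ext (Prod.ext (by simpa using h1.symm) h2.symm), h3.imp Eq.symm id⟩
  · rintro ⟨h1, h2⟩
    refine ⟨0, ⟨by simp [h1], by rw [h1]⟩, ?_⟩
    rw [h0]
    exact h2.imp Eq.symm id

lemma waveBase_param_eq_iff_of_mem {b : Bool} {p q : unitStrip ℝ × Circle}
    (hp : |p.1.1.1 - 1 / 2| < 1 / 2) (hq : q.1.1.1 ∈ Icc (0 : ℝ) 1) :
    waveBase (waveParam b N p) = waveBase (waveParam b N q) ↔ p.1 = q.1 := by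
  rw [waveBase_param_eq_iff]
  constructor
  · rintro ⟨n, h1, h2⟩
    have hn := eq_zero_of_shift hp hq h1
    subst hn
    exact Subtype.ext (Prod.ext (by simpa using h1.symm) h2.symm)
  · intro h
    exact ⟨0, by simp [h], by rw [h]⟩

/-- Outside the half disk neither label is positive at size zero, so the spaces with `0` and with
`N` exceptional intervals have the same identifications. This embeds the punctured solid Klein
bottle. -/
lemma waveParam_eq_iff_of_outer (hN : 0 < N) {b : Bool} (p q : outerParam N) :
    waveParam b 0 p = waveParam b 0 q ↔ waveParam b N p = waveParam b N q := by
  rw [waveParam_eq_iff, waveParam_eq_iff]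
  refine exists_congr fun n => and_congr_right fun _ => or_congr_right (and_congr_right fun h => ?_)
  have h1 : waveLabel 0 p.1.1 ≤ 0 := by simp [waveLabel]
  have h2 := waveLabel_nonpos_of_coord hN p.2.1 h p.2.2
  simp only [h1, h2, true_or]

lemma mem_image_ball_solidKlein (hN : 0 < N) {E : ℂ × ℝ → WaveCover 0}
    (hE : ∀ (b : UpperHalf) (z : Circle),
      E ((b : ℂ).im * z, (b : ℂ).re) = labMk _ _ _ (stripChart hN b, z))
    {p : unitStrip ℝ × Circle} (hp : p.1.1.1 ∈ Icc (0 : ℝ) 1) :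
    waveParam true 0 p ∈ (fun x => waveMk true 0 (E x)) '' openBall3 ↔ ‖stripCoord N p.1‖ < 1 := by
  have hδ : 0 < 1 / (8 * (N : ℝ)) := by positivity
  constructor
  · rintro ⟨x, hx, hxp⟩
    obtain ⟨b, z, rfl, hb⟩ := exists_polar x
    have h1 : ‖(((b : ℂ).im * z : ℂ), (b : ℂ).re).1‖ ^ 2 +
      (((b : ℂ).im * z : ℂ), (b : ℂ).re).2 ^ 2 < 1 := hx
    rw [← hb] at h1
    simp only [hE] at hxp
    have h2 := congrArg waveBase hxp
    have h3 := (waveBase_param_eq_iff_of_mem (p := (stripChart hN b, z))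
      (abs_stripPoint_sub_lt hN (norm_squeeze_lt hδ _)) hp).1 h2
    rw [← h3]
    simp only
    rw [stripCoord_stripChart, norm_squeeze_lt_one_iff hδ]
    exact (sq_lt_one_iff₀ (norm_nonneg _)).1 h1
  · intro h
    obtain ⟨b, hb, hbp⟩ := exists_stripChart hN p.1 h
    refine ⟨((b : ℂ).im * p.2, (b : ℂ).re), ?_, ?_⟩
    · show ‖(((b : ℂ).im * p.2 : ℂ), (b : ℂ).re).1‖ ^ 2 +
        (((b : ℂ).im * p.2 : ℂ), (b : ℂ).re).2 ^ 2 < 1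
      rw [norm_polar]
      exact (sq_lt_one_iff₀ (norm_nonneg _)).2 hb
    · simp only [hE, hbp]
      rfl

/-- The labelled space over the annulus with twisted orbits is a twisted block. -/
lemma isTwistedSFBlock_wave (hN : 0 < N) :
    IsTwistedSFBlock N (WaveSpace true N) (waveFiber true N) := by
  have hδ : 0 < 1 / (8 * (N : ℝ)) := by positivity
  have hℓ : ContinuousOn (waveDiskLabel N) (closedBall 0 1) := continuous_waveDiskLabel.continuousOn
  have hsum : IsSuspSum N (DiskLab (waveDiskLabel N)) := by
    obtain ⟨k, rfl⟩ := Nat.exists_eq_add_one.2 hN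
    exact isSuspSum_waveDisk k
  obtain ⟨h, hh⟩ := exists_solidKlein_homeomorph
  have hT2 : T2Space SolidKleinBottle := h.symm.isEmbedding.t2Space
  -- the ball in the solid Klein bottle
  obtain ⟨E, hE, hEr, hEp⟩ := exists_ball_chart (continuous_waveLabel 0).continuousOn
    continuous_snd.continuousOn (isOpenEmbedding_stripChart hN)
    (fun b : UpperHalf => by
      show (squeeze (1 / (8 * N)) (b : ℂ)).im / 2 = 0 ↔ _
      rw [div_eq_zero_iff, or_iff_left two_ne_zero, im_squeeze_eq, mul_eq_zero, or_iff_right]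
      positivity)
    (fun b _ => by simp [waveLabel])
  let e₁ : ℂ × ℝ → SolidKleinBottle := fun x => h (waveMk true 0 (E x))
  have hEmem : ∀ x, E x ∈ waveChart 0 (1 / 2) := by
    intro x
    obtain ⟨b, z, rfl, -⟩ := exists_polar x
    rw [hEp]
    exact abs_stripPoint_sub_lt hN (norm_squeeze_lt hδ _)
  have he₁ : IsOpenEmbedding e₁ := by
    refine h.isOpenEmbedding.comp (IsOpenEmbedding.of_continuous_injective_isOpenMap
      (continuous_waveMk.comp hE.continuous) ?_ (isOpenMap_waveMk.comp hE.isOpenMap))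
    intro x x' hx
    have h1 := (isOpenEmbedding_waveMk (b := true) (N := 0) (1 / 2)).injective
      (a₁ := ⟨E x, hEmem x⟩) (a₂ := ⟨E x', hEmem x'⟩) hx
    exact hE.injective (congrArg Subtype.val h1)
  have hball₁ : ∀ p : unitStrip ℝ × Circle, p.1.1.1 ∈ Icc (0 : ℝ) 1 →
      (h (waveParam true 0 p) ∈ e₁ '' openBall3 ↔ ‖stripCoord N p.1‖ < 1) := by
    intro p hp
    rw [← mem_image_ball_solidKlein hN hEp hp, ← h.injective.mem_set_image, image_image]
  -- the ball in the connected sum of suspensions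
  obtain ⟨e₂, he₂, hr₂, hp₂⟩ := exists_ball_chart hℓ continuousOn_diskSize
    (isOpenEmbedding_reflectChart hN)
    (fun b : UpperHalf => by rw [← norm_reflectChart_iff hN, sub_eq_zero, eq_comm])
    (fun b : UpperHalf => waveDiskLabel_reflectChart hN)
  have hball₂ : ∀ x, x ∈ e₂ '' openBall3 ↔ 0 < x.1.1.re := by
    intro x
    rw [mem_image_openBall_iff hp₂]
    constructor
    · rintro ⟨b, hb, hx⟩
      rw [← hx]
      exact (reflectChart_pos_iff hN b).2 hb
    · intro hx
      obtain ⟨b, hb, hbx⟩ := exists_reflectChart hN ⟨x.1.1, x.2.1⟩ hx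
      exact ⟨b, hb, congrArg Subtype.val hbx⟩
  -- the first inclusion
  have hK₁ : CompactSpace (outerParam N) := isCompact_iff_compactSpace.1 isCompact_outerParam
  let q₁ : outerParam N → {x : SolidKleinBottle // x ∉ e₁ '' openBall3} := fun p =>
    ⟨h (waveParam true 0 p), by rw [hball₁ _ p.2.1, not_lt]; exact p.2.2⟩
  have hq₁ : Function.Surjective q₁ := by
    rintro ⟨x, hx⟩
    obtain ⟨y, rfl⟩ := h.surjective x
    obtain ⟨p, hp, rfl⟩ := exists_waveParam y
    have hp' := Ico_subset_Icc_self hp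
    rw [hball₁ _ hp', not_lt] at hx
    exact ⟨⟨p, hp', hx⟩, rfl⟩
  obtain ⟨i₁, hi₁, hiq₁⟩ := exists_isClosedEmbedding_of_compact (q₀ := q₁)
    (q' := fun p : outerParam N => waveParam true N p)
    ((h.continuous.comp (continuous_waveParam.comp continuous_subtype_val)).subtype_mk _) hq₁
    (continuous_waveParam.comp continuous_subtype_val) (fun p q => by
      rw [Subtype.mk.injEq, h.injective.eq_iff]
      exact waveParam_eq_iff_of_outer hN p q)
  -- the second inclusion
  have hK₂ : CompactSpace halfDisk := isCompact_iff_compactSpace.1 isCompact_halfDisk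
  let P : halfDisk → closedBall (0 : ℂ) 1 := fun b => ⟨cayley b, cayley_mem b.2.2⟩
  have hP : Continuous P :=
    isOpenEmbedding_cayley.continuous.comp
      (f := fun b : halfDisk => (⟨b, b.2.2⟩ : UpperHalf)) (by fun_prop)
  have hPinj : Function.Injective P := fun b b' hb => by
    have h1 : cayley b = cayley b' := congrArg Subtype.val hb
    exact Subtype.ext (by rw [← cayleyInv_cayley b.2.2, h1, cayleyInv_cayley b'.2.2])
  let q₂ : halfDisk × Circle → {x : DiskLab (waveDiskLabel N) // x ∉ e₂ '' openBall3} := fun a =>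
    ⟨labMk _ _ _ (P a.1, a.2), by
      rw [hball₂, not_lt]
      exact (re_cayley_le_iff a.1.2.2).2 (norm_le_of_mem_halfDisk a.1.2)⟩
  have hq₂ : Function.Surjective q₂ := by
    rintro ⟨x, hx⟩
    obtain ⟨⟨v, z⟩, rfl⟩ := labMk_surjective x
    rw [hball₂, not_lt] at hx
    have hx' : (v : ℂ).re ≤ 0 := hx
    have hv1 : (v : ℂ) ≠ 1 := by
      intro h1
      rw [h1, Complex.one_re] at hx'
      linarith
    have h1 := cayley_cayleyInv hv1
    have h2 := cayleyInv_mem v.2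
    have h3 : cayleyInv v ∈ halfDisk :=
      ⟨mem_closedBall_zero_iff.2 ((re_cayley_le_iff h2).1 (by rw [h1]; exact hx')), h2⟩
    refine ⟨(⟨_, h3⟩, z), Subtype.ext ?_⟩
    exact congrArg (fun w => labMk (closedBall (0 : ℂ) 1) (waveDiskLabel N) (fun v => 1 - ‖v‖) (w, z))
      (Subtype.ext h1)
  have hbase₂ : ∀ a a' : halfDisk × Circle, (innerParam N a).1 = (innerParam N a').1 ↔
      a.1 = a'.1 := by
    intro a a'
    constructor
    · intro h1
      have h2 : stripPoint N a.1 = stripPoint N a'.1 := congrArg Subtype.val h1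
      exact Subtype.ext (by rw [← stripCoord_stripPoint hN a.1, h2, stripCoord_stripPoint hN])
    · intro h1
      simp only [innerParam, h1]
  obtain ⟨i₂, hi₂, hiq₂⟩ := exists_isClosedEmbedding_of_compact (q₀ := q₂)
    (q' := fun a : halfDisk × Circle => waveParam true N (innerParam N a))
    (((continuous_labMk hℓ continuousOn_diskSize).comp (by fun_prop)).subtype_mk _) hq₂
    (continuous_waveParam.comp continuous_innerParam) (fun a a' => by
      rw [waveParam_eq_iff_of_mem (innerParam_mem hN a)
        (mem_Icc_of_abs_sub_lt (innerParam_mem hN a')), hbase₂, Subtype.mk.injEq, labMk_eq_iff,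
        hPinj.eq_iff]
      refine and_congr_right fun _ => or_congr_right ?_
      have h1 : 1 - ‖(P a.1 : ℂ)‖ = 0 ↔ (innerParam N a).1.1.2 = 0 := by
        rw [sub_eq_zero, eq_comm]
        show ‖cayley a.1‖ = 1 ↔ (a.1 : ℂ).im / 2 = 0
        rw [norm_cayley_eq_one_iff a.1.2.2, div_eq_zero_iff, or_iff_left two_ne_zero]
      rw [h1]
      refine and_congr_right fun h2 => or_congr_left ?_
      refine waveDiskLabel_cayley_iff hN ?_ (norm_le_of_mem_halfDisk a.1.2)
      have h3 : (a.1 : ℂ).im / 2 = 0 := h2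
      linarith)
  -- common points of both pieces
  have hcommon : ∀ (p : outerParam N) (a : halfDisk × Circle),
      waveBase (waveParam true N p) = waveBase (waveParam true N (innerParam N a)) →
        p.1.1 = (innerParam N a).1 ∧ ‖(a.1 : ℂ)‖ = 1 := by
    intro p a hpa
    have h1 := (waveBase_param_eq_iff_of_mem (innerParam_mem hN a) p.2.1).1 hpa.symm
    refine ⟨h1.symm, le_antisymm (norm_le_of_mem_halfDisk a.1.2) ?_⟩
    have h2 : 1 ≤ ‖stripCoord N p.1.1‖ := p.2.2
    rw [← h1] at h2
    have h3 : stripCoord N (innerParam N a).1 = a.1 := stripCoord_stripPoint hN _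
    rwa [h3] at h2
  -- Over the unit half circle the contraction is the identity, so both ball charts take the
  -- parameter `a` of a point of the sphere to the points represented by `a`.
  have hsph : ∀ (a : halfDisk × Circle) (ha : ‖(a.1 : ℂ)‖ = 1),
      e₂ ((a.1 : ℂ).im * a.2, (a.1 : ℂ).re) = q₂ a ∧
        e₁ ((a.1 : ℂ).im * a.2, (a.1 : ℂ).re) = h (waveParam true 0 (innerParam N a)) := by
    rintro ⟨⟨b, hb⟩, z⟩ ha
    have h1 := hp₂ ⟨b, hb.2⟩ z
    have h2 := hEp ⟨b, hb.2⟩ z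
    constructor
    · refine h1.trans ?_
      exact congrArg (fun w => labMk (closedBall (0 : ℂ) 1) (waveDiskLabel N)
        (fun v => 1 - ‖v‖) (w, z)) (Subtype.ext (reflectChart_of_norm_eq_one hN ha))
    · show h (waveMk true 0 (E _)) = _
      refine congrArg (fun w => h (waveMk true 0 w)) (h2.trans ?_)
      refine congrArg (fun w => labMk (unitStrip ℝ) (waveLabel 0) Prod.snd (w, z)) (Subtype.ext ?_)
      show stripPoint N (squeeze _ b) = stripPoint N b
      rw [squeeze_eq_self hδ ha]
  have houter : ∀ a : halfDisk × Circle, ‖(a.1 : ℂ)‖ = 1 → innerParam N a ∈ outerParam N := by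
    intro a ha
    refine ⟨mem_Icc_of_abs_sub_lt (innerParam_mem hN a), ?_⟩
    have h3 : stripCoord N (innerParam N a).1 = a.1 := stripCoord_stripPoint hN _
    show 1 ≤ ‖stripCoord N (innerParam N a).1‖
    rw [h3, ha]
  refine ⟨DiskLab (waveDiskLabel N), inferInstance, inferInstance, e₁, e₂, i₁, i₂, hsum,
    ⟨he₁, he₂, hi₁, hi₂, ?_, ?_⟩, ?_, hr₂, ?_, ?_, ?_⟩
  · rw [eq_univ_iff_forall]
    intro y
    obtain ⟨p, hp, rfl⟩ := exists_waveParam y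
    have hp' := Ico_subset_Icc_self hp
    rcases le_or_gt 1 ‖stripCoord N p.1‖ with h1 | h1
    · exact Or.inl ⟨q₁ ⟨p, hp', h1⟩, hiq₁ _⟩
    · refine Or.inr ⟨q₂ (⟨stripCoord N p.1, mem_closedBall_zero_iff.2 h1.le, stripCoord_mem p.1.2⟩,
        p.2), (hiq₂ _).trans ?_⟩
      refine congrArg (waveParam true N) (Prod.ext (Subtype.ext ?_) rfl)
      exact stripPoint_stripCoord hN _
  · intro x x'
    obtain ⟨p, rfl⟩ := hq₁ x
    obtain ⟨a, rfl⟩ := hq₂ x'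
    rw [hiq₁, hiq₂]
    constructor
    · intro hpa
      obtain ⟨h1, h2⟩ := hcommon p a (congrArg waveBase hpa)
      refine ⟨_, (polar_mem_sphere2_iff ⟨a.1, a.1.2.2⟩ a.2).2 h2, ?_, (hsph a h2).1⟩
      rw [(hsph a h2).2]
      have h3 := (waveParam_eq_iff_of_outer hN p ⟨_, houter a h2⟩ (b := true)).2 hpa
      exact congrArg h h3.symm
    · rintro ⟨y, hy, hy1, hy2⟩
      obtain ⟨b, z, rfl, -⟩ := exists_polar y
      have hb := (polar_mem_sphere2_iff b z).1 hy
      let a' : halfDisk × Circle := (⟨b, mem_closedBall_zero_iff.2 hb.le, b.2⟩, z)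
      have h1 := (hsph a' hb).1.symm.trans hy2
      have h2 : q₂ a' = q₂ a := Subtype.ext h1
      have h3 := (hsph a' hb).2.symm.trans hy1
      have h4 := (waveParam_eq_iff_of_outer hN ⟨_, houter a' hb⟩ p (b := true)).1 (h.injective h3)
      rw [← hiq₂ a, ← h2, hiq₂]
      exact h4.symm
  · intro x y
    obtain ⟨y, rfl⟩ := h.surjective y
    rw [hh, ← waveFiber_iff, waveFiber_mk_iff]
    refine exists_congr fun z => ?_
    simp only [e₁, hEr, h.injective.eq_iff]
  · intro x x'
    obtain ⟨p, rfl⟩ := hq₁ x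
    obtain ⟨p', rfl⟩ := hq₁ x'
    rw [hiq₁, hiq₁, hh]
    rfl
  · intro x x'
    obtain ⟨a, rfl⟩ := hq₂ x
    obtain ⟨a', rfl⟩ := hq₂ x'
    rw [hiq₂, hiq₂, MulAction.orbitRel_apply, mem_orbit_lab_iff, waveFiber_iff,
      waveBase_param_eq_iff_of_mem (innerParam_mem hN a)
        (mem_Icc_of_abs_sub_lt (innerParam_mem hN a')), hbase₂, ← hPinj.eq_iff, eq_comm]
    exact Subtype.ext_iff
  · intro x x'
    obtain ⟨p, rfl⟩ := hq₁ x
    obtain ⟨a, rfl⟩ := hq₂ x'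
    rw [hiq₁, hiq₂]
    constructor
    · intro hpa
      obtain ⟨h1, h2⟩ := hcommon p a hpa
      refine ⟨q₁ ⟨_, houter a h2⟩, ?_, hiq₁ _⟩
      exact (hh _ _).2 hpa
    · rintro ⟨c, hc, hc'⟩
      obtain ⟨p', rfl⟩ := hq₁ c
      rw [← hc', hiq₁]
      exact (hh _ _).1 hc

end TwistedBlock

/-! ### Local circle actions from charts. -/

section LocalActions

open Set

/-- A decomposition which is given near each point by the orbits of a circle action on the domain of
an open embedding is a local circle action. -/
lemma isLocalCircleAction_of_charts {X : Type*} [TopologicalSpace X] {r : Setoid X}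
    (h : ∀ x : X, ∃ (W : Type) (_ : TopologicalSpace W) (_ : MulAction Circle W) (j : W → X),
      ContinuousSMul Circle W ∧ FaithfulSMul Circle W ∧ ConnectedSpace W ∧ IsOpenEmbedding j ∧
      x ∈ range j ∧ ∀ w y, r (j w) y ↔ ∃ z : Circle, y = j (z • w)) :
    IsLocalCircleAction r := by
  intro x
  obtain ⟨W, _, _, j, hc, hf, hconn, hj, hx, hr⟩ := h x
  let e : range j ≃ₜ W := hj.isEmbedding.toHomeomorph.symm
  have he : ∀ w, e ⟨j w, w, rfl⟩ = w := fun w => hj.isEmbedding.toHomeomorph.symm_apply_apply w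
  have hje : ∀ w, (e.symm w : X) = j w := fun _ => rfl
  refine ⟨range j, hx, hj.isOpen_range, isConnected_range hj.continuous, ?_,
    e.toEquiv.mulAction Circle, ?_, ?_, ?_⟩
  · rintro _ ⟨w, rfl⟩ y hy
    obtain ⟨z, rfl⟩ := (hr w y).1 hy
    exact ⟨_, rfl⟩
  · let := e.toEquiv.mulAction Circle
    exact ⟨e.symm.continuous.comp (hc.continuous_smul.comp
      (continuous_fst.prodMk (e.continuous.comp continuous_snd)))⟩
  · let := e.toEquiv.mulAction Circle
    refine ⟨fun {z z'} hz => hf.eq_of_smul_eq_smul fun w => ?_⟩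
    have h1 : e.symm (z • e (e.symm w)) = e.symm (z' • e (e.symm w)) := hz (e.symm w)
    rw [e.apply_symm_apply] at h1
    exact e.symm.injective h1
  · rintro ⟨_, w, rfl⟩ ⟨y, hy⟩
    rw [hr]
    refine exists_congr fun z => ?_
    have h1 : ∀ z : Circle, e.symm (z • e ⟨j w, w, rfl⟩) = ⟨y, hy⟩ ↔ y = j (z • w) := fun z => by
      rw [he, Subtype.ext_iff, hje, eq_comm]
    exact (h1 z).symm

/-- The orbits of a circle action form a local circle action. -/
lemma isLocalCircleAction_comap_orbitRel {Y : Type*} [TopologicalSpace Y] {W : Type}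
    [TopologicalSpace W] [MulAction Circle W] [ContinuousSMul Circle W] [FaithfulSMul Circle W]
    [ConnectedSpace W] (h : Y ≃ₜ W) :
    IsLocalCircleAction ((MulAction.orbitRel Circle W).comap h) := by
  refine isLocalCircleAction_of_charts fun x => ⟨W, inferInstance, inferInstance, h.symm,
    inferInstance, inferInstance, inferInstance, h.symm.isOpenEmbedding, ⟨h x, h.symm_apply_apply x⟩,
    fun w y => ?_⟩
  rw [Setoid.comap_rel, h.apply_symm_apply, MulAction.orbitRel_apply, MulAction.mem_orbit_symm]
  refine exists_congr fun z => ?_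
  rw [h.eq_symm_apply, eq_comm]

/-- The orbits of the labelled space over the annulus form a local circle action. -/
lemma isLocalCircleAction_comap_waveFiber {Y : Type*} [TopologicalSpace Y] {b : Bool} {N : ℕ}
    (h : Y ≃ₜ WaveSpace b N) : IsLocalCircleAction ((waveFiber b N).comap h) := by
  refine isLocalCircleAction_of_charts fun y => ?_
  obtain ⟨p, hp⟩ := waveMk_surjective (h y)
  set x := p.1.1.1 with hx
  let S : Set (ℝ × ℝ) := {a | |a.1 - x| < 1 / 2} ∩ unitStrip ℝ
  let g : Lab S (waveLabel N) Prod.snd → waveChart N x := fun w => ⟨⟨w.1, w.2.1.2, w.2.2⟩, w.2.1.1⟩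
  let G : Lab S (waveLabel N) Prod.snd ≃ₜ waveChart N x :=
    { toFun := g
      invFun := fun w => ⟨w.1.1, ⟨w.2, w.1.2.1⟩, w.1.2.2⟩
      left_inv := fun _ => rfl
      right_inv := fun _ => rfl
      continuous_toFun := by fun_prop
      continuous_invFun := by fun_prop }
  have hconv : Convex ℝ S := by
    refine Convex.inter ?_ ?_
    · have : {a : ℝ × ℝ | |a.1 - x| < 1 / 2} = Metric.ball x (1 / 2) ×ˢ univ := by
        ext a
        simp [Real.dist_eq]
      rw [this]
      exact (convex_ball _ _).prod convex_univ
    · have : unitStrip ℝ = univ ×ˢ Icc (0 : ℝ) 1 := by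
        ext a
        simp [unitStrip]
      rw [this]
      exact convex_univ.prod (convex_Icc _ _)
  -- The orbit of size one over the center of the window is free, which makes the action on the
  -- chart effective.
  have h1 : (x, (1 : ℝ)) ∈ S := ⟨by simp, by simp [unitStrip]⟩
  have hS : ConnectedSpace S := isConnected_iff_connectedSpace.1 (hconv.isConnected ⟨_, h1⟩)
  have hconn : ConnectedSpace (Lab S (waveLabel N) Prod.snd) :=
    labMk_surjective.connectedSpace
      (continuous_labMk (continuous_waveLabel N).continuousOn continuous_snd.continuousOn)
  refine ⟨Lab S (waveLabel N) Prod.snd, inferInstance, inferInstance,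
    fun w => h.symm (waveMk b N (g w)), inferInstance, faithfulSMul_lab h1 one_ne_zero, hconn,
    h.symm.isOpenEmbedding.comp ((isOpenEmbedding_waveMk x).comp G.isOpenEmbedding),
    ⟨G.symm ⟨p, by simp [waveChart, hx]⟩, ?_⟩, fun w y' => ?_⟩
  · show h.symm (waveMk b N p) = y
    rw [hp, h.symm_apply_apply]
  · rw [Setoid.comap_rel, h.apply_symm_apply, waveFiber_mk_iff]
    refine exists_congr fun z => ?_
    rw [h.eq_symm_apply]
    rfl

end LocalActions

/-! ### Circle actions on the spaces of type zero. -/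

section ProductActions

/-- Translation of the second factor. -/
abbrev prodCircleAction (X : Type) : MulAction Circle (X × Circle) where
  smul z a := (a.1, z * a.2)
  one_smul _ := Prod.ext rfl (one_mul _)
  mul_smul _ _ _ := Prod.ext rfl (mul_assoc _ _ _)

lemma exists_isLocalCircleAction_prod {Y : Type*} [TopologicalSpace Y] {X : Type}
    [TopologicalSpace X] [ConnectedSpace X] (h : Y ≃ₜ X × Circle) :
    ∃ r : Setoid Y, IsLocalCircleAction r := by
  let := prodCircleAction X
  have h1 : ∀ (z : Circle) (a : X × Circle), z • a = (a.1, z * a.2) := fun _ _ => rfl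
  have hc : ContinuousSMul Circle (X × Circle) := ⟨by
    simp only [h1]
    fun_prop⟩
  have hf : FaithfulSMul Circle (X × Circle) := ⟨fun {z w} hzw => by
    obtain ⟨x⟩ := (inferInstance : Nonempty X)
    have h2 := congrArg Prod.snd (hzw (x, 1))
    simpa [h1] using h2⟩
  exact ⟨_, isLocalCircleAction_comap_orbitRel h⟩

variable {X : Type} [TopologicalSpace X] {f : X ≃ₜ X}

/-- The projection to a mapping torus. -/
def torusMk (f : X ≃ₜ X) (p : X × ℝ) : MappingTorus f := Quotient.mk (mappingTorusSetoid f) p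

lemma torusMk_surjective (f : X ≃ₜ X) : Function.Surjective (torusMk f) := Quotient.mk_surjective

lemma isOpenQuotientMap_torusMk (f : X ≃ₜ X) :
    IsOpenQuotientMap (torusMk f) := by
  refine ⟨torusMk_surjective f, continuous_quotient_mk', fun U hU => ?_⟩
  have h1 : torusMk f ⁻¹' (torusMk f '' U) =
      ⋃ n : ℤ, (fun p : X × ℝ => ((f ^ n) p.1, p.2 + n)) ⁻¹' U := by
    ext p
    simp only [Set.mem_preimage, Set.mem_image, Set.mem_iUnion]
    constructor
    · rintro ⟨q, hq, h⟩
      obtain ⟨n, rfl⟩ := Quotient.exact h.symm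
      exact ⟨n, hq⟩
    · rintro ⟨n, hn⟩
      have : mappingTorusSetoid f p ((f ^ n) p.1, p.2 + n) := ⟨n, rfl⟩
      exact ⟨_, hn, (Quotient.sound this).symm⟩
  have h2 : IsOpen (torusMk f ⁻¹'
      (torusMk f '' U)) := by
    rw [h1]
    exact isOpen_iUnion fun n => hU.preimage (by fun_prop)
  exact h2

/-- The flow of a mapping torus. -/
def torusFlow (f : X ≃ₜ X) (s : ℝ) : MappingTorus f → MappingTorus f :=
  Quotient.map (fun p => (p.1, p.2 + s)) (by
    rintro p _ ⟨n, rfl⟩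
    exact ⟨n, Prod.ext rfl (by simp only; ring)⟩)

lemma torusFlow_mk (s : ℝ) (p : X × ℝ) : torusFlow f s (torusMk f p) =
    torusMk f (p.1, p.2 + s) := rfl

/-- For an involution the flow has period two. Time is therefore the angle divided by `π` in the
circle action below. -/
lemma torusFlow_eq (hf : f ^ 2 = 1) {s s' : ℝ} (n : ℤ) (h : s' = s + 2 * n) (y : MappingTorus f) :
    torusFlow f s' y = torusFlow f s y := by
  obtain ⟨p, rfl⟩ := torusMk_surjective f y
  rw [torusFlow_mk, torusFlow_mk]
  have h1 : mappingTorusSetoid f (p.1, p.2 + s) (p.1, p.2 + s') := ⟨2 * n, by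
    have : f ^ (2 * n) = 1 := by
      rw [zpow_mul]
      have : f ^ (2 : ℤ) = 1 := by exact_mod_cast hf
      rw [this, one_zpow]
    rw [this, h]
    refine Prod.ext rfl ?_
    push_cast
    ring⟩
  exact (Quotient.sound h1).symm

/-- The circle action on the mapping torus of an involution. -/
abbrev torusAction (hf : f ^ 2 = 1) : MulAction Circle (MappingTorus f) where
  smul z := torusFlow f (Complex.arg z / Real.pi)
  one_smul y := by
    show torusFlow f (Complex.arg (1 : Circle) / Real.pi) y = y
    obtain ⟨p, rfl⟩ := torusMk_surjective f y
    rw [torusFlow_mk]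
    simp
  mul_smul z w y := by
    have hpi := Real.pi_pos
    show torusFlow f (Complex.arg (z * w : Circle) / Real.pi) y =
      torusFlow f (Complex.arg z / Real.pi) (torusFlow f (Complex.arg w / Real.pi) y)
    have h1 : Circle.exp (Complex.arg (z * w : Circle)) =
        Circle.exp (Complex.arg w + Complex.arg z) := by
      rw [Circle.exp_add, Circle.exp_arg, Circle.exp_arg, Circle.exp_arg, mul_comm]
    obtain ⟨n, hn⟩ := exp_eq_exp_iff.1 h1
    rw [torusFlow_eq hf (s := Complex.arg w / Real.pi + Complex.arg z / Real.pi) n (by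
      rw [hn]
      field_simp)]
    obtain ⟨p, rfl⟩ := torusMk_surjective f y
    rw [torusFlow_mk, torusFlow_mk, torusFlow_mk, add_assoc]

/-- If two elements act alike on the point over `x₀`, their flow times differ by an integer `n` such
that `f ^ n` fixes `x₀`. Since `f` moves `x₀`, the integer is even and the elements coincide; this
gives effectiveness. -/
lemma exists_isLocalCircleAction_mappingTorus {Y : Type*} [TopologicalSpace Y] [ConnectedSpace X]
    (hf : f ^ 2 = 1) {x₀ : X} (hx₀ : f x₀ ≠ x₀) (h : Y ≃ₜ MappingTorus f) :
    ∃ r : Setoid Y, IsLocalCircleAction r := by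
  have hpi := Real.pi_pos
  let := torusAction hf
  have hexp : ∀ (θ : ℝ) (y : MappingTorus f), Circle.exp θ • y = torusFlow f (θ / Real.pi) y := by
    intro θ y
    show torusFlow f (Complex.arg (Circle.exp θ) / Real.pi) y = _
    obtain ⟨n, hn⟩ := exp_eq_exp_iff.1 (Circle.exp_arg (Circle.exp θ))
    refine torusFlow_eq hf n ?_ y
    rw [hn]
    field_simp
  have hq := isOpenQuotientMap_torusMk f
  have hc : ContinuousSMul Circle (MappingTorus f) := by
    have he : IsOpenQuotientMap Circle.exp :=
      ⟨Circle.exp_surjective, Circle.exp.continuous, isLocalHomeomorph_circleExp.isOpenMap⟩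
    refine ⟨(he.prodMap hq).isQuotientMap.continuous_iff.2 ?_⟩
    have h1 : ((fun p : Circle × MappingTorus f => p.1 • p.2) ∘
        Prod.map Circle.exp (torusMk f)) =
        fun p => torusMk f (p.2.1, p.2.2 + p.1 / Real.pi) := by
      funext p
      exact hexp _ _
    rw [h1]
    exact hq.continuous.comp (by fun_prop)
  have hfaith : FaithfulSMul Circle (MappingTorus f) := by
    refine ⟨fun {z w} hzw => ?_⟩
    obtain ⟨θ, rfl⟩ := Circle.exp_surjective z
    obtain ⟨θ', rfl⟩ := Circle.exp_surjective w
    have h1 := hzw (torusMk f (x₀, 0))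
    rw [hexp, hexp, torusFlow_mk, torusFlow_mk] at h1
    obtain ⟨n, hn⟩ := Quotient.exact h1
    obtain ⟨h2, h3⟩ := Prod.ext_iff.1 hn
    simp only at h2 h3
    rcases Int.even_or_odd' n with ⟨m, rfl | rfl⟩
    · refine (exp_eq_exp_iff.2 ⟨m, ?_⟩).symm
      push_cast at h3
      field_simp at h3
      linarith
    · exfalso
      apply hx₀
      have h4 : f ^ (2 : ℤ) = 1 := by exact_mod_cast hf
      rw [zpow_add, zpow_mul, h4, one_zpow, one_mul, zpow_one] at h2
      exact h2.symm
  have hconn : ConnectedSpace (MappingTorus f) := hq.surjective.connectedSpace hq.continuous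
  exact ⟨_, isLocalCircleAction_comap_orbitRel h⟩

instance : ConnectedSpace Disk :=
  isConnected_iff_connectedSpace.1
    ((convex_closedBall (0 : ℂ) 1).isConnected ⟨0, Metric.mem_closedBall_self zero_le_one⟩)

instance : ConnectedSpace Moebius := by
  have : ConnectedSpace (Set.Icc (-1 : ℝ) 1) :=
    isConnected_iff_connectedSpace.1 (isConnected_Icc (by norm_num))
  exact (Quotient.mk_surjective (s := moebiusSetoid)).connectedSpace continuous_quotient_mk'

lemma diskConj_sq : diskConj ^ 2 = 1 := by
  ext w
  simp [pow_two, Homeomorph.mul_apply, diskConj]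

lemma moebiusConj_sq : moebiusConj ^ 2 = 1 := by
  ext x
  rw [pow_two, Homeomorph.mul_apply]
  exact moebiusFlip_flip x

lemma exists_diskConj_ne : ∃ x, diskConj x ≠ x := by
  refine ⟨⟨Complex.I, by simp⟩, fun h => ?_⟩
  have h1 := congrArg (fun w : Disk => (w : ℂ).im) h
  simp [diskConj] at h1
  norm_num at h1

lemma exists_moebiusConj_ne : ∃ x, moebiusConj x ≠ x := by
  refine ⟨Quotient.mk moebiusSetoid (⟨1, by norm_num, le_rfl⟩, Circle.exp (Real.pi / 2)), fun h => ?_⟩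
  rcases Quotient.exact h with h1 | ⟨h1, -⟩
  · have h2 := congrArg (fun a => ((a.2 : Circle) : ℂ).im) h1
    simp only [Circle.coe_inv_eq_conj, Circle.coe_exp, Complex.conj_im,
      Complex.exp_ofReal_mul_I_im, Real.sin_pi_div_two] at h2
    norm_num at h2
  · norm_num at h1

/-- Type zero spaces carry local circle actions. -/
lemma exists_isLocalCircleAction_zero {Y : Type*} [TopologicalSpace Y]
    (hY : IsGeneralizedSolidTorus 0 Y ∨ IsGeneralizedSolidKleinBottle 0 Y) :
    ∃ r : Setoid Y, IsLocalCircleAction r := by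
  rcases hY with (⟨-, ⟨⟨h⟩⟩ | ⟨⟨h⟩⟩⟩ | ⟨h, -⟩) | (⟨-, ⟨⟨h⟩⟩ | ⟨⟨h⟩⟩⟩ | ⟨h, -⟩)
  · exact exists_isLocalCircleAction_prod h
  · exact exists_isLocalCircleAction_prod h
  · exact absurd h (lt_irrefl 0)
  · obtain ⟨x, hx⟩ := exists_diskConj_ne
    exact exists_isLocalCircleAction_mappingTorus diskConj_sq hx h
  · obtain ⟨x, hx⟩ := exists_moebiusConj_ne
    exact exists_isLocalCircleAction_mappingTorus moebiusConj_sq hx h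
  · exact absurd h (lt_irrefl 0)

end ProductActions

end

theorem lemma6p1 {Y : Type*} [TopologicalSpace Y] (N : ℕ)
    (hY : IsGeneralizedSolidTorus N Y ∨ IsGeneralizedSolidKleinBottle N Y) :
    ∃ r : Setoid Y, IsLocalCircleAction r ∧
      (IsGeneralizedSolidTorus N Y → 0 < N →
        ∃ (Z : Type) (_ : TopologicalSpace Z) (s : Setoid Z),
          IsSimpleSFBlock N Z s ∧ FiberEquivalent r s) ∧
      (IsGeneralizedSolidKleinBottle N Y → 0 < N →
        ∃ (Z : Type) (_ : TopologicalSpace Z) (s : Setoid Z),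
          IsTwistedSFBlock N Z s ∧ FiberEquivalent r s) := by
  rcases Nat.eq_zero_or_pos N with rfl | hN
  · obtain ⟨r, hr⟩ := exists_isLocalCircleAction_zero hY
    exact ⟨r, hr, fun _ h => absurd h (lt_irrefl 0), fun _ h => absurd h (lt_irrefl 0)⟩
  obtain ⟨ht, hk⟩ := exists_wave_homeomorph hN (Y := Y)
  rcases hY with hY | hY
  · obtain ⟨h⟩ := ht hY
    refine ⟨(waveFiber false N).comap h, isLocalCircleAction_comap_waveFiber h, fun _ _ =>
      ⟨_, _, _, isSimpleSFBlock_wave hN, h, fun _ _ => Iff.rfl⟩, fun hY' _ => ?_⟩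
    -- The same decomposition has to serve both claims; a space of both kinds would make the two
    -- wave spaces homeomorphic, against the invariance of the twist.
    obtain ⟨h'⟩ := hk hY'
    exact Bool.noConfusion (wave_twist_eq_of_homeomorph hN (h.symm.trans h'))
  · obtain ⟨h⟩ := hk hY
    refine ⟨(waveFiber true N).comap h, isLocalCircleAction_comap_waveFiber h, fun hY' _ => ?_,
      fun _ _ => ⟨_, _, _, isTwistedSFBlock_wave hN, h, fun _ _ => Iff.rfl⟩⟩
    obtain ⟨h'⟩ := ht hY'
    exact Bool.noConfusion (wave_twist_eq_of_homeomorph hN (h.symm.trans h'))
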